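/- Let $d=n-1\ge 2$, $\Lambda\in\mathbb R$, $k\in\mathbb N\cup\{\infty\}$, let $S$ be a smooth $d$-dimensional manifold (without boundary), $I\subset\mathbb R$ an interval with non-empty interior, and $N=I\times S$. Identify $N$ with the null hypersurface $\{u=0\}$ of an $(n+1)$-dimensional Lorentzian metric in Isenberg–Moncrief (Gaussian null) form $$2\left(-du+u\,\alpha\,dr+u\,\beta_A\,dx^A\right)dr+g_{AB}\,dx^A dx^B ,$$ where $r\in I$, the $x^A$ are coordinates on $S$, and $g_{AB}$ is Riemannian on $N$. Let $\mathbf S=\{u=0,\ r=\sigma(x)\}$ be a cross-section of $N$, with $\sigma:S\to I$ smooth. All fields are smooth on $N$, respectively on $\mathbf S$. *Data of order $k$ on $N$* are the fields $\partial_u^j g_{AB}|_N$, $\partial_u^j\alpha|_N$ with $0\le j\le k$ and, if $k\ge1$, also $\partial_u^j\beta_A|_N$ with $0\le j\le k$. They are *vacuum* if they are the part of order $k$ of a family of fields $(\partial_u^j g_{AB},\partial_u^j\alpha,\partial_u^j\beta_A)_{j\ge0}$ on $N$ which satisfies on $N$ the Einstein equations $R_{\mu\nu}=\frac{2\Lambda}{n-1}\,\mathbf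 g_{\mu\nu}$ and all their $u$-derivatives. *Isenberg–Moncrief data of order $k$* are fields $\partial_u^jg_{AB}$, $0\le j\le k$, on $\mathbf S$ and, if $k\ge 1$, fields $\alpha,\beta_A$ on $\mathbf S$, together with fields $(g_{AB},\alpha)$ on $N$, with $g_{AB}$ Riemannian, which agree on $\mathbf S$ with the given $g_{AB}$ and (if $k\ge1$) $\alpha$, and which satisfy on $N$ the Raychaudhuri equation $$-\tfrac12 g^{AB}\partial_r^2g_{AB}+\tfrac14 g^{CA}g^{BD}(\partial_rg_{AB})\,\partial_rg_{CD}+\tfrac12\,\alpha\, g^{AB}\partial_rg_{AB}=0 .$$ By the *hierarchy of order $k$* we mean the equation $R_{rA}|_N=0$ (if $k\ge1$) together with $\partial_u^i\big(R_{\mu\nu}-\frac{2\Lambda}{n-1}\mathbf g_{\mu\nu}\big)|_N=0$ for $0\le i<k$ and $(\mu\nu)=(AB),(ur),(uA)$. By the *transverse constraint of order $k$* we mean the equations $\partial_u^iR_{uu}|_{\mathbf S}=0$ for $0\le i\le k-2$, where $R_{uu}=-\frac12g^{AB}\partial_u^2g_{AB}+\frac14g^{CA}g^{BD}(\partial_ug_{AB})\,\partial_ug_{CD}$;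 it only involves the fields $\partial_u^jg_{AB}|_{\mathbf S}$ with $j\le k$, and is void if $k\le1$. Then: 1. In these coordinates $\partial_u^i\Gamma^r_{rr}|_N=(i+1)\,\partial_u^i\alpha|_N$ for all $i\ge 0$; in particular $\kappa=\Gamma^r_{rr}|_N=\alpha|_N$. 2. Vacuum data of order $k$ on $N$ induce, by restriction, Isenberg–Moncrief data of order $k$ which satisfy the transverse constraint of order $k$; moreover, vacuum data of order $k$ satisfy the hierarchy of order $k$. 3. Two sets of data of order $k$ on $N$ (vacuum or not) which satisfy the hierarchy of order $k$ and induce the same Isenberg–Moncrief data of order $k$ coincide. 4. All Isenberg–Moncrief data of order $k$ are induced by (by point 3, unique) data of order $k$ on $N$ satisfying the hierarchy of order $k$, and these are vacuum if and only if the Isenberg–Moncrief data satisfy the transverse constraint of order $k$. Thus vacuum data of order $k$ on $N$ are equivalent to Isenberg–Moncrief data of order $k$ satisfying the transverse constraint. 5. The hierarchy consists of linear transport equations along the generators and of linear algebraic equations: with $X_A{}^B=g^{BC}\partial_rg_{CA}$, on $N$ it holds that $$R_{rA}=\tfrac12\partial_r\beta_A+\tfrac14X_C{}^C\beta_A+F_A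 ,$$ where $F_A$ is determined by $(g_{AB},\alpha)|_N$; and, for all $i\ge0$, with $h_{AB}=\partial_u^{i+1}g_{AB}|_N$, $$\partial_u^i\big(R_{AB}-\tfrac{2\Lambda}{n-1}\mathbf g_{AB}\big)=\partial_rh_{AB}+(i+1)\,\alpha\, h_{AB}-\tfrac12\big(h_{AC}X_B{}^C+h_{BC}X_A{}^C\big)+\tfrac14\big(X_C{}^C\,h_{AB}+g^{CD}h_{CD}\,\partial_rg_{AB}\big)+F^{(i)}_{AB},$$ $$\partial_u^i\big(R_{ur}-\tfrac{2\Lambda}{n-1}\mathbf g_{ur}\big)=-(i+2)\,\partial_u^{i+1}\alpha+F^{(i)},\qquad \partial_u^i\big(R_{uA}-\tfrac{2\Lambda}{n-1}\mathbf g_{uA}\big)=-\tfrac{i+2}2\,\partial_u^{i+1}\beta_A+F^{(i)}_A ,$$ where $F^{(i)}_{AB}$ is determined by the fields $\partial_u^jg_{AB},\partial_u^j\alpha,\partial_u^j\beta_A$ on $N$ with $j\le i$, and $F^{(i)},F^{(i)}_A$ by these fields together with $\partial_u^{i+1}g_{AB}|_N$. -/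

import Mathlib

open scoped Manifold ContDiff Matrix

noncomputable section

namespace IsenbergMoncrief

/-! ### Curvature of a metric in coordinates -/

section Curvature

variable {ι : Type*} [Fintype ι] [DecidableEq ι]

/-- The partial derivative `∂f/∂xⁱ` on a coordinate domain `Ω` (one-sided at points of `Ω` lying on
a boundary of `Ω`). -/
def partialDeriv (Ω : Set (ι → ℝ)) (i : ι) (f : (ι → ℝ) → ℝ) (p : ι → ℝ) : ℝ :=
  fderivWithin ℝ f Ω p (Pi.single i 1)

/-- The Christoffel symbol `Γᵏ_{ij}` of the metric with components `g`. -/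
def christoffel (Ω : Set (ι → ℝ)) (g : (ι → ℝ) → Matrix ι ι ℝ) (k i j : ι) (p : ι → ℝ) : ℝ :=
  (1 / 2) * ∑ l, (g p)⁻¹ k l *
    (partialDeriv Ω i (fun q => g q j l) p + partialDeriv Ω j (fun q => g q i l) p
      - partialDeriv Ω l (fun q => g q i j) p)

/-- The Ricci tensor `R_{ij} = ∂ₖΓᵏ_{ij} - ∂ⱼΓᵏ_{ik} + Γᵏ_{kl}Γˡ_{ij} - Γᵏ_{jl}Γˡ_{ik}`
(positive on round spheres). -/
def ricci (Ω : Set (ι → ℝ)) (g : (ι → ℝ) → Matrix ι ι ℝ) (i j : ι) (p : ι → ℝ) : ℝ :=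
  (∑ k, (partialDeriv Ω k (christoffel Ω g k i j) p
      - partialDeriv Ω j (christoffel Ω g k i k) p))
    + ∑ k, ∑ l, (christoffel Ω g k k l p * christoffel Ω g l i j p
      - christoffel Ω g k j l p * christoffel Ω g l i k p)

end Curvature

/-! ### Isenberg–Moncrief metrics in a coordinate patch -/

/-- Euclidean space, the model of the cross-section; its dimension is `d = n - 1`. -/
abbrev Vec (d : ℕ) : Type := EuclideanSpace ℝ (Fin d)

/-- Indices of the coordinates `(u, r, x¹, …, x^d)`. -/
abbrev Idx (d : ℕ) : Type := Fin 2 ⊕ Fin d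

/-- The index of the transverse coordinate `u`. -/
abbrev iu {d : ℕ} : Idx d := Sum.inl 0

/-- The index of the coordinate `r` along the generators. -/
abbrev ir {d : ℕ} : Idx d := Sum.inl 1

/-- The index of the coordinate `x^A`. -/
abbrev ix {d : ℕ} (A : Fin d) : Idx d := Sum.inr A

/-- The point with coordinates `(u, r, y)`. -/
def pt {d : ℕ} (u r : ℝ) (y : Vec d) : Idx d → ℝ := Sum.elim ![u, r] (fun A => y A)

/-- The `x^A`-coordinates of a point. -/
def xPart {d : ℕ} (p : Idx d → ℝ) : Vec d := WithLp.toLp 2 (fun A => p (ix A))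

/-- The coordinate domain `{(u, r, x) : r ∈ I, x ∈ U}`. -/
def domain {d : ℕ} (I : Set ℝ) (U : Set (Vec d)) : Set (Idx d → ℝ) :=
  {p | p ir ∈ I ∧ xPart p ∈ U}

/-- Components, in coordinates `(r, x^A)` on `N = {u = 0}`, of the transverse derivatives
`∂_u^j g_{AB}`, `∂_u^j α`, `∂_u^j β_A` at `u = 0`. -/
structure CoordJet (d : ℕ) where
  g : ℕ → ℝ → Vec d → Matrix (Fin d) (Fin d) ℝ
  α : ℕ → ℝ → Vec d → ℝ
  β : ℕ → ℝ → Vec d → Fin d → ℝ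

/-- The Taylor polynomial `∑_{j ≤ m} uʲ fⱼ / j!`. -/
def taylorSum (m : ℕ) (f : ℕ → ℝ) (u : ℝ) : ℝ :=
  ∑ j ∈ Finset.range (m + 1), u ^ j / (j.factorial : ℝ) * f j

/-- The metric `2 (-du + u α dr + u β_A dx^A) dr + g_{AB} dx^A dx^B`, where `g_{AB}`, `α`, `β_A` are
the Taylor polynomials in `u`, of order `m`, with the given transverse derivatives. -/
def CoordJet.metric {d : ℕ} (J : CoordJet d) (m : ℕ) (p : Idx d → ℝ) :
    Matrix (Idx d) (Idx d) ℝ :=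
  let u := p iu
  let r := p ir
  let y := xPart p
  let a : ℝ := taylorSum m (fun j => J.α j r y) u
  let b : Fin d → ℝ := fun A => taylorSum m (fun j => J.β j r y A) u
  let h : Matrix (Fin d) (Fin d) ℝ :=
    Matrix.of fun A B => taylorSum m (fun j => J.g j r y A B) u
  let ub : Matrix (Fin 2) (Fin d) ℝ := Matrix.of ![fun _ => 0, fun A => u * b A]
  Matrix.fromBlocks !![0, -1; -1, 2 * u * a] ub ubᵀ h

/-- The `i`-th transverse derivative at `u = 0` of the vacuum Einstein expression
`R_{μν} - (2 Λ / (n - 1)) g_{μν}`, with `n - 1 = d`, as a function of the transverse derivatives of the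
metric.  It contains no transverse derivatives of the metric of order higher than `i + 2`, so that it
can be evaluated on the Taylor polynomials of order `i + 2`. -/
def CoordJet.einstein {d : ℕ} (I : Set ℝ) (U : Set (Vec d)) (Λ : ℝ) (J : CoordJet d) (i : ℕ)
    (μ ν : Idx d) (r : ℝ) (y : Vec d) : ℝ :=
  iteratedDeriv i (fun u => ricci (domain I U) (J.metric (i + 2)) μ ν (pt u r y)
    - 2 * Λ / (d : ℝ) * J.metric (i + 2) (pt u r y) μ ν) 0

/-- The `i`-th transverse derivative at `u = 0` of `Γ^r_{rr}`.  For `i = 0` this is the connection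
coefficient `κ` of the null hypersurface `N`. -/
def CoordJet.kappa {d : ℕ} (I : Set ℝ) (U : Set (Vec d)) (J : CoordJet d) (i : ℕ)
    (r : ℝ) (y : Vec d) : ℝ :=
  iteratedDeriv i (fun u => christoffel (domain I U) (J.metric (i + 2)) ir ir ir (pt u r y)) 0

/-! ### The Raychaudhuri expression -/

section Raychaudhuri

variable {d : ℕ}

/-- Entrywise derivative of a matrix-valued function on `s ⊆ ℝ`. -/
def entryDeriv (s : Set ℝ) (M : ℝ → Matrix (Fin d) (Fin d) ℝ) (t : ℝ) :
    Matrix (Fin d) (Fin d) ℝ :=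
  Matrix.of fun A B => derivWithin (fun t' => M t' A B) s t

/-- The expression
`-½ g^{AB} ∂²g_{AB} + ¼ g^{CA} g^{BD} (∂g_{AB}) ∂g_{CD} + ½ a g^{AB} ∂g_{AB}`
for a one-parameter family `M` of symmetric matrices `(g_{AB})`.  It does not depend upon the basis in
which the matrices are calculated. -/
def raychaudhuri (s : Set ℝ) (M : ℝ → Matrix (Fin d) (Fin d) ℝ) (a : ℝ) (t : ℝ) : ℝ :=
  -(1 / 2) * ((M t)⁻¹ * entryDeriv s (entryDeriv s M) t).trace
    + (1 / 4) * ((M t)⁻¹ * entryDeriv s M t * ((M t)⁻¹ * entryDeriv s M t)).trace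
    + (1 / 2) * a * ((M t)⁻¹ * entryDeriv s M t).trace

end Raychaudhuri

/-! ### Fields on `N = I × S` and on the cross-section -/

section Fields

variable {d : ℕ} {S : Type*} [TopologicalSpace S] [ChartedSpace (Vec d) S]

/-- Bilinear forms on the tangent space `T_x S`. -/
abbrev Bilin (d : ℕ) {S : Type*} [TopologicalSpace S] [ChartedSpace (Vec d) S] (x : S) : Type :=
  TangentSpace 𝓘(ℝ, Vec d) x →L[ℝ] TangentSpace 𝓘(ℝ, Vec d) x →L[ℝ] ℝ

/-- Covectors on `S` at `x`. -/
abbrev Covec (d : ℕ) {S : Type*} [TopologicalSpace S] [ChartedSpace (Vec d) S] (x : S) : Type :=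
  TangentSpace 𝓘(ℝ, Vec d) x →L[ℝ] ℝ

/-- The coordinate vector `∂_A` of the chart `e`, at the point with coordinates `y`. -/
def coordVec (e : OpenPartialHomeomorph S (Vec d)) (y : Vec d) (A : Fin d) :
    TangentSpace 𝓘(ℝ, Vec d) (e.symm y) :=
  mfderiv 𝓘(ℝ, Vec d) 𝓘(ℝ, Vec d) e.symm y (EuclideanSpace.single A (1 : ℝ) : Vec d)

/-- The matrix of a bilinear form on `T_x S` in the standard basis of `T_x S ≅ ℝ^d`. -/
def gram {x : S} (b : Bilin d x) : Matrix (Fin d) (Fin d) ℝ :=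
  Matrix.of fun A B => b (EuclideanSpace.single A (1 : ℝ) : Vec d)
    (EuclideanSpace.single B (1 : ℝ) : Vec d)

/-- Smoothness on `I × S` of a family of functions on `S`. -/
def SmoothFun (I : Set ℝ) (f : ℝ → S → ℝ) : Prop :=
  ∀ e ∈ atlas (Vec d) S,
    ContDiffOn ℝ ∞ (fun p : ℝ × Vec d => f p.1 (e.symm p.2)) (I ×ˢ e.target)

/-- Smoothness on `I × S` of a family of covector fields on `S`. -/
def SmoothCovec (I : Set ℝ) (f : ℝ → (x : S) → Covec d x) : Prop :=
  ∀ e ∈ atlas (Vec d) S, ∀ A,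
    ContDiffOn ℝ ∞ (fun p : ℝ × Vec d => f p.1 (e.symm p.2) (coordVec e p.2 A)) (I ×ˢ e.target)

/-- Smoothness on `I × S` of a family of bilinear forms on `S`. -/
def SmoothBilin (I : Set ℝ) (f : ℝ → (x : S) → Bilin d x) : Prop :=
  ∀ e ∈ atlas (Vec d) S, ∀ A B,
    ContDiffOn ℝ ∞
      (fun p : ℝ × Vec d => f p.1 (e.symm p.2) (coordVec e p.2 A) (coordVec e p.2 B))
      (I ×ˢ e.target)

variable (d S) in
/-- The fields `∂_u^j g_{AB}`, `∂_u^j α`, `∂_u^j β_A`, `j = 0, 1, 2, …`, on `N = I × S = {u = 0}`, at the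
point with `r`-coordinate `r` and projection `x ∈ S`.  For data of finite order `k` only the fields with
`j ≤ k` matter, those with larger `j` are irrelevant and arbitrary. -/
structure IMJet where
  g : ℕ → ℝ → (x : S) → Bilin d x
  α : ℕ → ℝ → S → ℝ
  β : ℕ → ℝ → (x : S) → Covec d x

/-- The components of the fields in the coordinates `(r, x^A)` given by a chart of `S`. -/
def IMJet.inChart (J : IMJet d S) (e : OpenPartialHomeomorph S (Vec d)) : CoordJet d where
  g j r y := Matrix.of fun A B => J.g j r (e.symm y) (coordVec e y A) (coordVec e y B)
  α j r y := J.α j r (e.symm y)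
  β j r y A := J.β j r (e.symm y) (coordVec e y A)

/-- The fields are smooth on `I × S`, the tensors `∂_u^j g` are symmetric, and `g|_N` is Riemannian on
the sections `r = const`; that is, they are the transverse derivatives on `N` of a smooth Lorentzian
metric of Isenberg–Moncrief form. -/
structure IsJet (I : Set ℝ) (J : IMJet d S) : Prop where
  smooth_g : ∀ j, SmoothBilin I (J.g j)
  smooth_α : ∀ j, SmoothFun (d := d) I (J.α j)
  smooth_β : ∀ j, SmoothCovec I (J.β j)
  symm : ∀ j, ∀ r ∈ I, ∀ (x : S) (v w : TangentSpace 𝓘(ℝ, Vec d) x), J.g j r x v w = J.g j r x w v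
  pos : ∀ r ∈ I, ∀ (x : S) (v : TangentSpace 𝓘(ℝ, Vec d) x), v ≠ 0 → 0 < J.g 0 r x v v

/-- Two collections of fields agree on `N` up to and including transverse order `i`. -/
def AgreeUpTo (I : Set ℝ) (i : ℕ) (J J' : IMJet d S) : Prop :=
  ∀ j ≤ i, ∀ r ∈ I, ∀ x, J.g j r x = J'.g j r x ∧ J.α j r x = J'.α j r x ∧ J.β j r x = J'.β j r x

/-- Equality of data of order `k` on `N`: the fields `∂_u^j g_{AB}` and `∂_u^j α` with `j ≤ k` and, if
`k ≥ 1`, also `∂_u^j β_A` with `j ≤ k`. -/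
def SameData (I : Set ℝ) (k : ℕ∞) (J J' : IMJet d S) : Prop :=
  ∀ j : ℕ, (j : ℕ∞) ≤ k → ∀ r ∈ I, ∀ x,
    J.g j r x = J'.g j r x ∧ J.α j r x = J'.α j r x ∧ (1 ≤ k → J.β j r x = J'.β j r x)

/-- All the vacuum Einstein equations and all their transverse derivatives hold on `N`. -/
def IsFormalVacuum (I : Set ℝ) (Λ : ℝ) (J : IMJet d S) : Prop :=
  IsJet I J ∧ ∀ e ∈ atlas (Vec d) S, ∀ i μ ν, ∀ r ∈ I, ∀ y ∈ e.target,
    (J.inChart e).einstein I e.target Λ i μ ν r y = 0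

/-- Vacuum characteristic data of order `k` on `N`: data of order `k` satisfying the restrictions
arising from the vacuum Einstein equations and their transverse derivatives, i.e., the data are the
part of order `k` of a solution of all these equations on `N`. -/
def IsVacuumData (I : Set ℝ) (Λ : ℝ) (k : ℕ∞) (J : IMJet d S) : Prop :=
  IsJet I J ∧ ∃ J', IsFormalVacuum I Λ J' ∧ SameData I k J J'

/-- The transport and algebraic equations of order `k`: `R_{rA} = 0` on `N` (if `k ≥ 1`) and, for
`0 ≤ i < k`, the `i`-th transverse derivatives on `N` of the `AB`, `ur` and `uA` components of the
vacuum Einstein equations. -/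
def SolvesHierarchy (I : Set ℝ) (Λ : ℝ) (k : ℕ∞) (J : IMJet d S) : Prop :=
  ∀ e ∈ atlas (Vec d) S, ∀ r ∈ I, ∀ y ∈ e.target,
    (1 ≤ k → ∀ A, (J.inChart e).einstein I e.target Λ 0 ir (ix A) r y = 0) ∧
    ∀ i : ℕ, ((i + 1 : ℕ) : ℕ∞) ≤ k →
      (∀ A B, (J.inChart e).einstein I e.target Λ i (ix A) (ix B) r y = 0) ∧
      (J.inChart e).einstein I e.target Λ i iu ir r y = 0 ∧
      ∀ A, (J.inChart e).einstein I e.target Λ i iu (ix A) r y = 0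

variable (d S) in
/-- Collections of fields `∂_u^j g_{AB}`, `α`, `β_A` on a cross-section, together with
`(g_{AB}, α)` on `N`.  For data of order `k` only the fields `∂_u^j g_{AB}` with `j ≤ k` matter, and
`α`, `β_A` on the cross-section only if `k ≥ 1`. -/
structure IMData where
  gS : ℕ → (x : S) → Bilin d x
  αS : S → ℝ
  βS : (x : S) → Covec d x
  gN : ℝ → (x : S) → Bilin d x
  αN : ℝ → S → ℝ

/-- The fields on the cross-section `{r = σ(x)}` and on `N` induced by fields on `N`. -/
def IMJet.restrict (σ : S → ℝ) (J : IMJet d S) : IMData d S where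
  gS j x := J.g j (σ x) x
  αS x := J.α 0 (σ x) x
  βS x := J.β 0 (σ x) x
  gN r x := J.g 0 r x
  αN r x := J.α 0 r x

/-- Equality of collections of fields of order `k`. -/
def SameIMData (I : Set ℝ) (k : ℕ∞) (D D' : IMData d S) : Prop :=
  (∀ j : ℕ, (j : ℕ∞) ≤ k → ∀ x, D.gS j x = D'.gS j x) ∧
  (1 ≤ k → ∀ x, D.αS x = D'.αS x ∧ D.βS x = D'.βS x) ∧
  ∀ r ∈ I, ∀ x, D.gN r x = D'.gN r x ∧ D.αN r x = D'.αN r x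

/-- Isenberg–Moncrief vacuum characteristic data of order `k`: smooth fields, consistent at the
cross-section `{r = σ(x)}`, with `(g_{AB}, α)` on `N` satisfying the Raychaudhuri equation. -/
structure IsIMData (I : Set ℝ) (σ : S → ℝ) (k : ℕ∞) (D : IMData d S) : Prop where
  smooth_gN : SmoothBilin I D.gN
  smooth_αN : SmoothFun (d := d) I D.αN
  symm_gN : ∀ r ∈ I, ∀ (x : S) (v w : TangentSpace 𝓘(ℝ, Vec d) x), D.gN r x v w = D.gN r x w v
  pos_gN : ∀ r ∈ I, ∀ (x : S) (v : TangentSpace 𝓘(ℝ, Vec d) x), v ≠ 0 → 0 < D.gN r x v v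
  smooth_gS : ∀ j : ℕ, (j : ℕ∞) ≤ k → SmoothBilin Set.univ (fun _ => D.gS j)
  symm_gS : ∀ j : ℕ, (j : ℕ∞) ≤ k → ∀ (x : S) (v w : TangentSpace 𝓘(ℝ, Vec d) x),
    D.gS j x v w = D.gS j x w v
  smooth_βS : 1 ≤ k → SmoothCovec Set.univ (fun _ => D.βS)
  gS_zero : ∀ x, D.gS 0 x = D.gN (σ x) x
  αS_eq : 1 ≤ k → ∀ x, D.αS x = D.αN (σ x) x
  raychaudhuri_eq : ∀ r ∈ I, ∀ x,
    raychaudhuri I (fun r' => gram (D.gN r' x)) (D.αN r x) r = 0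

/-- The equation `R_{uu} = -½ g^{AB} ∂_u² g_{AB} + ¼ g^{CA} g^{BD} (∂_u g_{AB}) ∂_u g_{CD} = 0` (the
Raychaudhuri equation in the transverse null direction) and its transverse derivatives, at the
cross-section, as far as they only involve `∂_u^j g_{AB}` with `j ≤ k`.  Nothing is required if
`k ≤ 1`. -/
def TransverseConstraint (k : ℕ∞) (D : IMData d S) : Prop :=
  ∀ i : ℕ, ((i + 2 : ℕ) : ℕ∞) ≤ k → ∀ x : S,
    iteratedDeriv i
      (raychaudhuri Set.univ
        (fun u => Matrix.of fun A B => taylorSum (i + 2) (fun j => gram (D.gS j x) A B) u) 0) 0 = 0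

end Fields

end IsenbergMoncrief

end

/-! Everything is done with formal power series in `u`. In a coordinate patch of `N`, a jet of
fields is a metric whose entries are power series in `u` with coefficients in the ring of smooth
functions of `(r, x)`. On these series `∂_u` acts as `d/dX` and `∂_r`, `∂_A` act coefficientwise.
The Levi-Civita connection, the Ricci tensor, the Bianchi identities and covariance are proved for
an abstract commutative ring with commuting derivations, and `HasTaylor` together with
`IsSmooth.einstein_eq` identifies the formal Ricci tensor with the analytic one, to all orders at `u
= 0`.

Structure of the equations. One compares two metrics whose coefficients agree up to a given order
and records the first difference (`Eqv`, `Lin`). Since `φ = u α`, `b_A = u β_A` and hence `g^{uu}`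
and `b^A` vanish at `u = 0`, most terms gain an order. What survives in the `i`-th coefficient of
`R_AB`, `R_ur`, `R_uA` is linear in `∂_u^{i+1}` of `g`, `α`, `β` respectively (`lin_ric_xx`,
`lin_ric_ur`, `lin_ric_ux`), while `R_rA` on `N` is a transport operator applied to `β_A` plus a
source (`ric_rx`). Thus `β` solves a linear ODE along the generators, then, order by order,
`∂_u^{i+1} g` solves one, and `∂_u^{i+1} α`, `∂_u^{i+1} β` are obtained by division by `i + 2`.

Uniqueness is uniqueness for linear ODEs (`Solves.unique`). Existence in a patch needs solutions
which are smooth jointly in `r` and `x`, up to the ends of `I`: the ODE is rewritten as a Volterra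
equation on the unit interval, where `1 - V` is invertible and inversion is a smooth operation
(`exists_transport`). Solutions in different charts agree on overlaps because the Ricci tensor is
covariant and the solution is unique, hence they glue to global fields (`exists_jet`).

Vacuum. If the `AB`, `ur`, `uA` equations hold to all orders, the contracted Bianchi identity
becomes triangular (`bianchi_im`). Its `u` component gives, at each order in `u`, a homogeneous
linear ODE in `r` for the coefficient of `R_uu`, so that `R_uu` vanishes if it does on the
cross-section. After that `R_rA`, and then the `rr` equation, satisfy homogeneous linear equations
in `u`; they vanish because they vanish on `N`, the latter by Raychaudhuri.

Finite order. Data of order `k` satisfying the transverse constraint extend to data of infinite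
order which satisfy it to all orders: `∂_u^{i+2} g` enters `∂_u^i R_uu` only through its `g`-trace,
which can be adjusted by a multiple of `g` (`IsIMData.exists_extension`). Since the hierarchy of
order `k` involves only fields of order at most `k`, the case of infinite order then yields all the
others. -/

noncomputable section

namespace IsenbergMoncrief

/-! ### Connections and curvature over a ring with commuting derivations -/

section Algebra

variable {ι : Type*} [Fintype ι] [DecidableEq ι] {R : Type*} [CommRing R] [Algebra ℝ R]

/-- Entrywise derivative of a matrix. -/
def dMat (δ : Derivation ℝ R R) (M : Matrix ι ι R) : Matrix ι ι R := M.map δ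

@[simp] lemma dMat_apply (δ : Derivation ℝ R R) (M : Matrix ι ι R) (i j : ι) :
    dMat δ M i j = δ (M i j) := rfl

lemma dMat_mul (δ : Derivation ℝ R R) (M N : Matrix ι ι R) :
    dMat δ (M * N) = dMat δ M * N + M * dMat δ N := by
  ext i j
  simp only [dMat_apply, Matrix.mul_apply, Matrix.add_apply, map_sum, Derivation.leibniz,
    smul_eq_mul, Finset.sum_add_distrib]
  rw [add_comm]
  congr 1
  exact Finset.sum_congr rfl fun k _ => mul_comm _ _

lemma dMat_add (δ : Derivation ℝ R R) (M N : Matrix ι ι R) :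
    dMat δ (M + N) = dMat δ M + dMat δ N := by
  ext; simp

lemma dMat_sub (δ : Derivation ℝ R R) (M N : Matrix ι ι R) :
    dMat δ (M - N) = dMat δ M - dMat δ N := by
  ext; simp

lemma dMat_transpose (δ : Derivation ℝ R R) (M : Matrix ι ι R) :
    dMat δ Mᵀ = (dMat δ M)ᵀ := rfl

lemma dMat_one (δ : Derivation ℝ R R) : dMat δ (1 : Matrix ι ι R) = 0 := by
  ext i j
  by_cases h : i = j <;> simp [h]

lemma dMat_comm {δ ε : Derivation ℝ R R} (h : ∀ a, δ (ε a) = ε (δ a)) (M : Matrix ι ι R) :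
    dMat δ (dMat ε M) = dMat ε (dMat δ M) := by
  ext; simp [h]

/-- The derivative of an inverse matrix. -/
lemma dMat_inv (δ : Derivation ℝ R R) {g gi : Matrix ι ι R} (h : gi * g = 1) :
    dMat δ gi = -(gi * dMat δ g * gi) := by
  have h1 : dMat δ gi * g + gi * dMat δ g = 0 := by rw [← dMat_mul, h, dMat_one]
  have h2 : g * gi = 1 := mul_eq_one_comm.mp h
  have h3 : dMat δ gi = (dMat δ gi * g) * gi := by rw [Matrix.mul_assoc, h2, Matrix.mul_one]
  rw [h3, eq_neg_of_add_eq_zero_left h1]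
  simp

variable (R) in
/-- The element `1 / 2` of an `ℝ`-algebra. -/
def half : R := algebraMap ℝ R (1 / 2)

@[simp] lemma derivation_half (δ : Derivation ℝ R R) : δ (half R) = 0 :=
  δ.map_algebraMap _

@[simp] lemma derivation_two (δ : Derivation ℝ R R) : δ (2 : R) = 0 := by
  simpa using δ.map_natCast 2

lemma half_add_half : half R + half R = 1 := by
  rw [half, ← map_add]
  norm_num

/-- The Christoffel symbols `Γᵏ_{ij}`, the entry `(k, j)` of the matrix with index `i`. -/
def leviCivita (D : ι → Derivation ℝ R R) (g gi : Matrix ι ι R) (i : ι) : Matrix ι ι R :=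
  Matrix.of fun k j => half R *
    ∑ l, gi k l * (D i (g j l) + D j (g i l) - D l (g i j))

/-- The Ricci tensor of a torsion-free connection. -/
def ricciOf (D : ι → Derivation ℝ R R) (Γ : ι → Matrix ι ι R) (i j : ι) : R :=
  (∑ k, (D k (Γ i k j) - D j (Γ i k k)))
    + ∑ k, ∑ l, (Γ k k l * Γ i l j - Γ j k l * Γ i l k)

/-- The curvature matrices of a connection. -/
def curvature (D : ι → Derivation ℝ R R) (Γ : ι → Matrix ι ι R) (i j : ι) : Matrix ι ι R :=
  dMat (D i) (Γ j) - dMat (D j) (Γ i) + (Γ i * Γ j - Γ j * Γ i)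

/-- A torsion-free connection compatible with the metric `g`. -/
structure IsLeviCivita (D : ι → Derivation ℝ R R) (g : Matrix ι ι R) (Γ : ι → Matrix ι ι R) :
    Prop where
  torsion : ∀ i k j, Γ i k j = Γ j k i
  compat : ∀ i, dMat (D i) g = (Γ i)ᵀ * g + g * Γ i

lemma two_mul_half (x : R) : half R * x + half R * x = x := by
  rw [← add_mul, half_add_half, one_mul]

lemma eq_of_two_mul_eq {x y : R} (h : x + x = y + y) : x = y := by
  rw [← two_mul_half x, ← two_mul_half y, ← mul_add, ← mul_add, h]

/-- Lowering the first index removes the inverse metric, so that symmetry and compatibility can be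
checked on Christoffel symbols of the first kind. -/
lemma g_mul_leviCivita (D : ι → Derivation ℝ R R) {g gi : Matrix ι ι R} (h : g * gi = 1)
    (i l j : ι) : (g * leviCivita D g gi i) l j =
      half R * (D i (g j l) + D j (g i l) - D l (g i j)) := by
  have : leviCivita D g gi i = gi * Matrix.of fun l j => half R *
      (D i (g j l) + D j (g i l) - D l (g i j)) := by
    ext k j
    simp only [leviCivita, Matrix.of_apply, Matrix.mul_apply, Finset.mul_sum]
    exact Finset.sum_congr rfl fun l _ => by ring
  rw [this, ← Matrix.mul_assoc, h, Matrix.one_mul, Matrix.of_apply]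

/-- Bridge from the explicit formula to its two characteristic properties. The Bianchi identities
and covariance below use only the latter. -/
lemma isLeviCivita_leviCivita (D : ι → Derivation ℝ R R) {g gi : Matrix ι ι R} (h : g * gi = 1)
    (hg : gᵀ = g) : IsLeviCivita D g (leviCivita D g gi) := by
  have hs : ∀ i j, g i j = g j i := fun i j => by rw [← Matrix.transpose_apply g, hg]
  refine ⟨fun i k j => ?_, fun i => ?_⟩
  · simp only [leviCivita, Matrix.of_apply]
    congr 1
    refine Finset.sum_congr rfl fun l _ => ?_
    rw [hs i j]; ring
  · ext j l
    have h1 : ((leviCivita D g gi i)ᵀ * g) j l = (g * leviCivita D g gi i) l j := by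
      rw [← Matrix.transpose_apply (g * leviCivita D g gi i), Matrix.transpose_mul, hg]
    rw [Matrix.add_apply, h1, g_mul_leviCivita D h, g_mul_leviCivita D h, dMat_apply, hs l j,
      hs i l, hs i j]
    linear_combination (D i (g j l)) * (-half_add_half (R := R))

/-- The compatible torsion-free connection is unique. -/
lemma IsLeviCivita.unique {D : ι → Derivation ℝ R R} {g gi : Matrix ι ι R} (h : gi * g = 1)
    (hg : gᵀ = g) {Γ Γ' : ι → Matrix ι ι R} (hΓ : IsLeviCivita D g Γ)
    (hΓ' : IsLeviCivita D g Γ') : Γ = Γ' := by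
  have hs : ∀ i j, g i j = g j i := fun i j => by rw [← Matrix.transpose_apply g, hg]
  -- Koszul's formula: torsion-freeness and compatibility determine `2 g Γ_i`.
  have key : ∀ {Γ : ι → Matrix ι ι R}, IsLeviCivita D g Γ → ∀ i l j,
      (g * Γ i) l j + (g * Γ i) l j = D i (g j l) + D j (g i l) - D l (g i j) := by
    intro Γ hΓ i l j
    have tr : ∀ i j l, ((Γ i)ᵀ * g) j l = (g * Γ i) l j := fun i j l => by
      rw [← Matrix.transpose_apply (g * Γ i), Matrix.transpose_mul, hg]
    have c : ∀ i j l, D i (g j l) = (g * Γ i) l j + (g * Γ i) j l := fun i j l => by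
      have := congrFun (congrFun (hΓ.compat i) j) l
      rwa [Matrix.add_apply, tr, dMat_apply] at this
    have t : ∀ i j l, (g * Γ i) l j = (g * Γ j) l i := fun i j l => by
      simp only [Matrix.mul_apply]
      exact Finset.sum_congr rfl fun k _ => by rw [hΓ.torsion]
    rw [c, c, c, t j i l, t l i j, t l j i]; ring
  funext i
  have e : g * Γ i = g * Γ' i := by
    ext l j
    exact eq_of_two_mul_eq (by rw [key hΓ, key hΓ'])
  rw [← Matrix.one_mul (Γ i), ← h, Matrix.mul_assoc, e, ← Matrix.mul_assoc, h, Matrix.one_mul]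

/-- The Ricci tensor is a trace of the curvature. -/
lemma ricciOf_eq_curvature (D : ι → Derivation ℝ R R) {Γ : ι → Matrix ι ι R}
    (ht : ∀ i k j, Γ i k j = Γ j k i) (l j : ι) :
    ricciOf D Γ l j = ∑ k, curvature D Γ k j k l := by
  simp only [ricciOf, curvature, Matrix.add_apply, Matrix.sub_apply, dMat_apply, Matrix.mul_apply,
    Finset.sum_add_distrib, Finset.sum_sub_distrib]
  congr 1
  · congr 1
    · exact Finset.sum_congr rfl fun k _ => by rw [ht]
    · exact Finset.sum_congr rfl fun k _ => by rw [ht]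
  · congr 1
    · exact Finset.sum_congr rfl fun k _ => Finset.sum_congr rfl fun m _ => by rw [ht l]
    · exact Finset.sum_congr rfl fun k _ => Finset.sum_congr rfl fun m _ => by rw [ht l]

/-- Traces of a metric connection. -/
lemma IsLeviCivita.trace {D : ι → Derivation ℝ R R} {g gi : Matrix ι ι R} (h : gi * g = 1)
    {Γ : ι → Matrix ι ι R} (hΓ : IsLeviCivita D g Γ) (i : ι) :
    (Γ i).trace + (Γ i).trace = (gi * dMat (D i) g).trace := by
  have h2 : g * gi = 1 := mul_eq_one_comm.mp h
  rw [hΓ.compat, Matrix.mul_add, Matrix.trace_add, ← Matrix.mul_assoc gi g, h, Matrix.one_mul,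
    Matrix.trace_mul_comm, Matrix.mul_assoc, h2, Matrix.mul_one, Matrix.trace_transpose]

/-- The trace is formally `½ ∂_i log |det g|`, a gradient. Without a logarithm in the ring, one
differentiates `tr (g⁻¹ ∂_i g)` and uses cyclicity of the trace. This is the only non-obvious
ingredient in the symmetry of the Ricci tensor. -/
lemma IsLeviCivita.trace_comm {D : ι → Derivation ℝ R R}
    (hD : ∀ i j a, D i (D j a) = D j (D i a)) {g gi : Matrix ι ι R} (h : gi * g = 1)
    {Γ : ι → Matrix ι ι R} (hΓ : IsLeviCivita D g Γ) (i j : ι) :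
    D j (Γ i).trace = D i (Γ j).trace := by
  have hd : ∀ (δ : Derivation ℝ R R) (M : Matrix ι ι R), δ M.trace = (dMat δ M).trace :=
    fun δ M => by simp [Matrix.trace, map_sum]
  apply eq_of_two_mul_eq
  rw [← map_add, ← map_add, hΓ.trace h, hΓ.trace h, hd, hd, dMat_mul, dMat_mul, dMat_inv _ h,
    dMat_inv _ h, dMat_comm (hD j i), Matrix.trace_add, Matrix.trace_add]
  congr 1
  rw [Matrix.neg_mul, Matrix.neg_mul, Matrix.trace_neg, Matrix.trace_neg, Matrix.mul_assoc,
    Matrix.trace_mul_comm, ← Matrix.mul_assoc]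

/-- The Ricci tensor is symmetric. -/
lemma IsLeviCivita.ricciOf_comm {D : ι → Derivation ℝ R R}
    (hD : ∀ i j a, D i (D j a) = D j (D i a)) {g gi : Matrix ι ι R} (h : gi * g = 1)
    {Γ : ι → Matrix ι ι R} (hΓ : IsLeviCivita D g Γ) (i j : ι) :
    ricciOf D Γ i j = ricciOf D Γ j i := by
  have h1 : ∑ k, D j (Γ i k k) = ∑ k, D i (Γ j k k) := by
    have := hΓ.trace_comm hD h i j
    simpa [Matrix.trace, map_sum] using this
  simp only [ricciOf, Finset.sum_sub_distrib, h1]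
  congr 1
  · congr 1
    exact Finset.sum_congr rfl fun k _ => by rw [hΓ.torsion]
  · congr 1
    · exact Finset.sum_congr rfl fun k _ => Finset.sum_congr rfl fun m _ => by rw [hΓ.torsion i]
    · rw [Finset.sum_comm]
      exact Finset.sum_congr rfl fun k _ => Finset.sum_congr rfl fun m _ => mul_comm _ _

/-- The second Bianchi identity. -/
lemma bianchi_second {D : ι → Derivation ℝ R R} (hD : ∀ i j a, D i (D j a) = D j (D i a))
    (Γ : ι → Matrix ι ι R) (a i j : ι) :
    (dMat (D a) (curvature D Γ i j) + (Γ a * curvature D Γ i j - curvature D Γ i j * Γ a))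
    + (dMat (D i) (curvature D Γ j a) + (Γ i * curvature D Γ j a - curvature D Γ j a * Γ i))
    + (dMat (D j) (curvature D Γ a i) + (Γ j * curvature D Γ a i - curvature D Γ a i * Γ j)) = 0 := by
  simp only [curvature, dMat_add, dMat_sub, dMat_mul]
  rw [dMat_comm (hD a i), dMat_comm (hD a j), dMat_comm (hD i j)]
  noncomm_ring

/-- Apply the commutator of two derivations to `g`: it vanishes, and compatibility expresses it
through the curvature. -/
lemma IsLeviCivita.curvature_antisymm {D : ι → Derivation ℝ R R}
    (hD : ∀ i j a, D i (D j a) = D j (D i a)) {g : Matrix ι ι R}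
    {Γ : ι → Matrix ι ι R} (hΓ : IsLeviCivita D g Γ) (i j : ι) :
    (curvature D Γ i j)ᵀ * g + g * curvature D Γ i j = 0 := by
  have key : dMat (D i) (dMat (D j) g) - dMat (D j) (dMat (D i) g) = 0 := by
    rw [dMat_comm (hD i j), sub_self]
  rw [hΓ.compat j, hΓ.compat i, dMat_add, dMat_add, dMat_mul, dMat_mul, dMat_mul, dMat_mul,
    hΓ.compat i, hΓ.compat j, dMat_transpose, dMat_transpose] at key
  rw [← key]
  simp only [curvature, Matrix.transpose_add, Matrix.transpose_sub, Matrix.transpose_mul]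
  noncomm_ring

/-- The curvature with the second index raised. -/
def curvatureUp (D : ι → Derivation ℝ R R) (Γ : ι → Matrix ι ι R) (gi : Matrix ι ι R) (i j : ι) :
    Matrix ι ι R := curvature D Γ i j * gi

lemma IsLeviCivita.curvatureUp_antisymm {D : ι → Derivation ℝ R R}
    (hD : ∀ i j a, D i (D j a) = D j (D i a)) {g gi : Matrix ι ι R} (h : gi * g = 1)
    (hgi : giᵀ = gi) {Γ : ι → Matrix ι ι R} (hΓ : IsLeviCivita D g Γ) (i j k l : ι) :
    curvatureUp D Γ gi i j k l = - curvatureUp D Γ gi i j l k := by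
  have h2 : g * gi = 1 := mul_eq_one_comm.mp h
  have e : curvatureUp D Γ gi i j + (curvatureUp D Γ gi i j)ᵀ = 0 := by
    have := congrArg (fun M => gi * M * gi) (hΓ.curvature_antisymm hD i j)
    simp only [Matrix.mul_add, Matrix.add_mul, Matrix.mul_zero, Matrix.zero_mul] at this
    rw [← Matrix.mul_assoc gi g, h, Matrix.one_mul, Matrix.mul_assoc, Matrix.mul_assoc, h2,
      Matrix.mul_one] at this
    rw [curvatureUp, Matrix.transpose_mul, hgi, add_comm, this]
  have := congrFun (congrFun e k) l
  simp only [Matrix.add_apply, Matrix.transpose_apply, Matrix.zero_apply] at this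
  linear_combination this

lemma IsLeviCivita.dMat_inv {D : ι → Derivation ℝ R R} {g gi : Matrix ι ι R} (h : gi * g = 1)
    {Γ : ι → Matrix ι ι R} (hΓ : IsLeviCivita D g Γ) (i : ι) :
    dMat (D i) gi = -(Γ i * gi + gi * (Γ i)ᵀ) := by
  have h2 : g * gi = 1 := mul_eq_one_comm.mp h
  rw [IsenbergMoncrief.dMat_inv _ h, hΓ.compat, Matrix.mul_add, Matrix.add_mul,
    ← Matrix.mul_assoc gi g, h, Matrix.one_mul, Matrix.mul_assoc gi, Matrix.mul_assoc _ g, h2,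
    Matrix.mul_one, add_comm]

/-- The inverse metric is parallel, so the second Bianchi identity survives multiplication by `gi`;
the commutator with `Γ` becomes its action on both upper indices. -/
lemma IsLeviCivita.bianchi_up {D : ι → Derivation ℝ R R}
    (hD : ∀ i j a, D i (D j a) = D j (D i a)) {g gi : Matrix ι ι R} (h : gi * g = 1)
    {Γ : ι → Matrix ι ι R} (hΓ : IsLeviCivita D g Γ) (a i j : ι) :
    let U := curvatureUp D Γ gi
    (dMat (D a) (U i j) + Γ a * U i j + U i j * (Γ a)ᵀ)
    + (dMat (D i) (U j a) + Γ i * U j a + U j a * (Γ i)ᵀ)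
    + (dMat (D j) (U a i) + Γ j * U a i + U a i * (Γ j)ᵀ) = 0 := by
  intro U
  have e : ∀ a i j, dMat (D a) (U i j) + Γ a * U i j + U i j * (Γ a)ᵀ =
      (dMat (D a) (curvature D Γ i j)
        + (Γ a * curvature D Γ i j - curvature D Γ i j * Γ a)) * gi := by
    intro a i j
    simp only [U, curvatureUp]
    rw [dMat_mul, hΓ.dMat_inv h]
    noncomm_ring
  rw [e, e, e, ← Matrix.add_mul, ← Matrix.add_mul, bianchi_second hD, Matrix.zero_mul]

/-- The contracted Bianchi identity in mixed components. -/
lemma IsLeviCivita.bianchi_contracted {D : ι → Derivation ℝ R R}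
    (hD : ∀ i j a, D i (D j a) = D j (D i a)) {g gi : Matrix ι ι R} (h : gi * g = 1)
    (hgi : giᵀ = gi) {Γ : ι → Matrix ι ι R} (hΓ : IsLeviCivita D g Γ) (i : ι)
    (Q : Matrix ι ι R) (hQ : Q = gi * Matrix.of (ricciOf D Γ)) :
    2 * (∑ a, D a (Q a i) + ∑ a, (Γ a).trace * Q a i - ∑ a, ∑ b, Γ i b a * Q a b)
      = D i Q.trace := by
  set U := curvatureUp D Γ gi with hU
  have anti : ∀ i j k l, U i j k l = - U i j l k := hΓ.curvatureUp_antisymm hD h hgi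
  have anti' : ∀ i j k l, U i j k l = - U j i k l := by
    intro i j k l
    have : curvature D Γ i j = - curvature D Γ j i := by simp only [curvature]; abel
    simp only [hU, curvatureUp, this, Matrix.neg_mul, Matrix.neg_apply]
  have hQU : ∀ l j, ∑ k, U k j k l = Q l j := by
    intro l j
    simp only [hU, hQ, curvatureUp, Matrix.mul_apply, Matrix.of_apply]
    rw [Finset.sum_comm]
    refine Finset.sum_congr rfl fun m _ => ?_
    rw [ricciOf_eq_curvature D hΓ.torsion, Finset.mul_sum]
    have : gi m l = gi l m := by rw [← Matrix.transpose_apply gi, hgi]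
    exact Finset.sum_congr rfl fun k _ => by rw [this, mul_comm]
  -- Double contraction: the upper indices are set equal to the derivative index `a` and to `j`, and
  -- summed. Of the nine resulting terms, `t3` and `t8` pair a symmetric `Γ` with an antisymmetric
  -- `U` and vanish; `t4` is the derivative of the scalar curvature; the other six form the
  -- divergence of `Q` twice.
  have B := fun a j => congrFun (congrFun (hΓ.bianchi_up hD h a i j) a) j
  simp only [← hU, Matrix.add_apply, Matrix.zero_apply, dMat_apply, Matrix.mul_apply,
    Matrix.transpose_apply] at B
  have S : ∑ a, ∑ j, _ = ∑ a : ι, ∑ j : ι, (0 : R) :=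
    Finset.sum_congr rfl fun a _ => Finset.sum_congr rfl fun j _ => B a j
  simp only [Finset.sum_add_distrib, Finset.sum_const_zero] at S
  have antisum : ∀ (f : ι → ι → R) (V : ι → ι → R), (∀ a b, f a b = f b a) →
      (∀ a b, V a b = - V b a) → ∑ a, ∑ b, f a b * V a b = 0 := by
    intro f V hf hV
    have : ∑ a, ∑ b, f a b * V a b = - ∑ a, ∑ b, f a b * V a b := by
      conv_lhs => rw [Finset.sum_comm]
      rw [← Finset.sum_neg_distrib]
      refine Finset.sum_congr rfl fun a _ => ?_
      rw [← Finset.sum_neg_distrib]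
      exact Finset.sum_congr rfl fun b _ => by rw [hf b a, hV b a]; ring
    apply eq_of_two_mul_eq
    rw [add_zero]
    linear_combination this
  have t1 : ∑ a, ∑ j, D a (U i j a j) = ∑ a, D a (Q a i) := by
    refine Finset.sum_congr rfl fun a _ => ?_
    rw [← map_sum, ← hQU]
    congr 1
    exact Finset.sum_congr rfl fun j _ => by rw [anti, anti', neg_neg]
  have t2 : ∑ a, ∑ j, ∑ m, Γ a a m * U i j m j = ∑ a, (Γ a).trace * Q a i := by
    calc ∑ a, ∑ j, ∑ m, Γ a a m * U i j m j = ∑ a, ∑ m, Γ a a m * Q m i := by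
          refine Finset.sum_congr rfl fun a _ => ?_
          rw [Finset.sum_comm]
          refine Finset.sum_congr rfl fun m _ => ?_
          rw [← Finset.mul_sum, ← hQU]
          congr 1
          exact Finset.sum_congr rfl fun j _ => by rw [anti, anti', neg_neg]
      _ = ∑ a, (Γ a).trace * Q a i := by
          rw [Finset.sum_comm]
          refine Finset.sum_congr rfl fun m _ => ?_
          rw [← Finset.sum_mul]
          congr 1
          exact Finset.sum_congr rfl fun a _ => hΓ.torsion _ _ _
  have t3 : ∑ a, ∑ j, ∑ m, U i j a m * Γ a j m = 0 := by
    rw [Finset.sum_comm]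
    refine Finset.sum_eq_zero fun j _ => ?_
    rw [← antisum (fun a m => Γ a j m) (fun a m => U i j a m) (fun a b => hΓ.torsion _ _ _)
      (anti i j)]
    exact Finset.sum_congr rfl fun a _ => Finset.sum_congr rfl fun m _ => mul_comm _ _
  have t4 : ∑ a, ∑ j, D i (U j a a j) = - D i Q.trace := by
    rw [Matrix.trace, map_sum, Finset.sum_comm, ← Finset.sum_neg_distrib]
    refine Finset.sum_congr rfl fun j _ => ?_
    rw [Matrix.diag_apply, ← map_sum, ← map_neg, ← hQU, ← Finset.sum_neg_distrib]
    congr 1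
    exact Finset.sum_congr rfl fun a _ => anti' _ _ _ _
  have t5 : ∑ a, ∑ j, ∑ m, Γ i a m * U j a m j = - ∑ a, ∑ b, Γ i b a * Q a b := by
    rw [← Finset.sum_neg_distrib]
    calc ∑ a, ∑ j, ∑ m, Γ i a m * U j a m j = ∑ a, ∑ m, -(Γ i a m * Q m a) := by
          refine Finset.sum_congr rfl fun a _ => ?_
          rw [Finset.sum_comm]
          refine Finset.sum_congr rfl fun m _ => ?_
          rw [← Finset.mul_sum, ← hQU, ← mul_neg, ← Finset.sum_neg_distrib]
          congr 1
          exact Finset.sum_congr rfl fun j _ => anti _ _ _ _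
      _ = _ := by
          rw [Finset.sum_comm]
          exact Finset.sum_congr rfl fun m _ => by rw [Finset.sum_neg_distrib]
  have t6 : ∑ a, ∑ j, ∑ m, U j a a m * Γ i j m = - ∑ a, ∑ b, Γ i b a * Q a b := by
    rw [Finset.sum_comm, ← Finset.sum_neg_distrib]
    calc ∑ j, ∑ a, ∑ m, U j a a m * Γ i j m = ∑ j, ∑ m, -(Γ i j m * Q m j) := by
          refine Finset.sum_congr rfl fun j _ => ?_
          rw [Finset.sum_comm]
          refine Finset.sum_congr rfl fun m _ => ?_
          rw [← Finset.sum_mul, ← hQU, mul_comm, ← mul_neg, ← Finset.sum_neg_distrib]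
          congr 1
          exact Finset.sum_congr rfl fun a _ => anti' _ _ _ _
      _ = _ := by
          rw [Finset.sum_comm]
          exact Finset.sum_congr rfl fun m _ => by rw [Finset.sum_neg_distrib]
  have t7 : ∑ a, ∑ j, D j (U a i a j) = ∑ a, D a (Q a i) := by
    rw [Finset.sum_comm]
    exact Finset.sum_congr rfl fun j _ => by rw [← map_sum, hQU]
  have t8 : ∑ a, ∑ j, ∑ m, Γ j a m * U a i m j = 0 := by
    refine Finset.sum_eq_zero fun a _ => ?_
    exact antisum (fun j m => Γ j a m) (fun j m => U a i m j) (fun _ _ => hΓ.torsion _ _ _)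
      (fun _ _ => anti _ _ _ _)
  have t9 : ∑ a, ∑ j, ∑ m, U a i a m * Γ j j m = ∑ a, (Γ a).trace * Q a i := by
    calc ∑ a, ∑ j, ∑ m, U a i a m * Γ j j m = ∑ j, ∑ m, Γ j j m * Q m i := by
          rw [Finset.sum_comm]
          refine Finset.sum_congr rfl fun j _ => ?_
          rw [Finset.sum_comm]
          refine Finset.sum_congr rfl fun m _ => ?_
          rw [← Finset.sum_mul, hQU, mul_comm]
      _ = ∑ a, (Γ a).trace * Q a i := by
          rw [Finset.sum_comm]
          refine Finset.sum_congr rfl fun m _ => ?_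
          rw [← Finset.sum_mul]
          congr 1
          exact Finset.sum_congr rfl fun a _ => hΓ.torsion _ _ _
  rw [t1, t2, t3, t4, t5, t6, t7, t8, t9] at S
  linear_combination S

/-! ### Change of coordinates -/

section Covariance

variable {R' : Type*} [CommRing R'] [Algebra ℝ R']

/-- The change of variables for connections: `P` times the transformed connection. -/
lemma IsLeviCivita.pullback {D : ι → Derivation ℝ R R} {D' : ι → Derivation ℝ R' R'}
    (φ : R' →+* R) (P Q : Matrix ι ι R) (hQ : Q * P = 1)
    (hφ : ∀ i a, D i (φ a) = ∑ b, P b i * φ (D' b a))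
    (hP : ∀ i j a, D j (P a i) = D i (P a j)) {g' : Matrix ι ι R'}
    {Γ' : ι → Matrix ι ι R'} (hΓ' : IsLeviCivita D' g' Γ') :
    IsLeviCivita D (Pᵀ * g'.map φ * P)
      (fun i => Q * ((∑ a, P a i • (Γ' a).map φ) * P + dMat (D i) P)) := by
  have hPQ : P * Q = 1 := mul_eq_one_comm.mp hQ
  refine ⟨fun i k j => ?_, fun i => ?_⟩
  · simp only [Matrix.mul_apply (M := Q)]
    refine Finset.sum_congr rfl fun c _ => ?_
    congr 1
    simp only [Matrix.add_apply, dMat_apply, hP i j, Matrix.mul_apply, Matrix.sum_apply,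
      Matrix.smul_apply, Matrix.map_apply, smul_eq_mul, Finset.sum_mul]
    congr 1
    rw [Finset.sum_comm]
    exact Finset.sum_congr rfl fun a _ => Finset.sum_congr rfl fun b _ => by
      rw [hΓ'.torsion]; ring
  · set A : Matrix ι ι R := ∑ a, P a i • (Γ' a).map φ
    have h1 : dMat (D i) (g'.map φ) = Aᵀ * g'.map φ + g'.map φ * A := by
      have : dMat (D i) (g'.map φ) = ∑ a, P a i • (dMat (D' a) g').map φ := by
        ext j l
        simp [hφ, Matrix.sum_apply]
      rw [this]
      simp only [hΓ'.compat, A, Matrix.transpose_sum, Finset.sum_mul, Finset.mul_sum,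
        ← Finset.sum_add_distrib]
      refine Finset.sum_congr rfl fun a _ => ?_
      rw [Matrix.map_add φ (map_add φ), Matrix.map_mul, Matrix.map_mul, Matrix.transpose_smul,
        Matrix.smul_mul, Matrix.mul_smul, smul_add, Matrix.transpose_map]
    have h2 : P * (Q * (A * P + dMat (D i) P)) = A * P + dMat (D i) P := by
      rw [← Matrix.mul_assoc, hPQ, Matrix.one_mul]
    rw [Matrix.mul_assoc (Pᵀ * g'.map φ), h2, ← Matrix.mul_assoc _ (Pᵀ * g'.map φ),
      ← Matrix.mul_assoc _ Pᵀ, ← Matrix.transpose_mul, h2, dMat_mul, dMat_mul, h1, dMat_transpose,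
      Matrix.transpose_add, Matrix.transpose_mul]
    noncomm_ring

/-- The curvature of the transformed connection. -/
lemma curvature_pullback {D : ι → Derivation ℝ R R} (hD : ∀ i j a, D i (D j a) = D j (D i a))
    {D' : ι → Derivation ℝ R' R'}
    (φ : R' →+* R) (P : Matrix ι ι R)
    (hφ : ∀ i a, D i (φ a) = ∑ b, P b i * φ (D' b a))
    (hP : ∀ i j a, D j (P a i) = D i (P a j))
    (Γ' : ι → Matrix ι ι R') (Γ : ι → Matrix ι ι R)
    (hΓ : ∀ i, P * Γ i = (∑ a, P a i • (Γ' a).map φ) * P + dMat (D i) P) (i j : ι) :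
    P * curvature D Γ i j =
      (∑ a, ∑ b, (P a i * P b j) • (curvature D' Γ' a b).map φ) * P := by
  -- `A i` is the pulled-back connection form, so that `hΓ` is the gauge transformation law with
  -- gauge matrix `P`; the claim is the corresponding law for the curvature of `A`.
  set A : ι → Matrix ι ι R := fun i => ∑ a, P a i • (Γ' a).map φ with hA
  have hdA : ∀ i j, dMat (D i) (A j) = (∑ a, D i (P a j) • (Γ' a).map φ)
      + ∑ a, ∑ b, (P b i * P a j) • (dMat (D' b) (Γ' a)).map φ := by
    intro i j
    ext k l
    simp only [hA, dMat_apply, Matrix.sum_apply, Matrix.smul_apply, Matrix.map_apply, map_sum,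
      Derivation.leibniz, smul_eq_mul, hφ, Matrix.add_apply, Finset.sum_add_distrib,
      Finset.mul_sum]
    rw [add_comm]
    congr 1
    · exact Finset.sum_congr rfl fun a _ => mul_comm _ _
    · exact Finset.sum_congr rfl fun a _ => Finset.sum_congr rfl fun b _ => by ring
  have hcA : (∑ a, ∑ b, (P a i * P b j) • (curvature D' Γ' a b).map φ)
      = dMat (D i) (A j) - dMat (D j) (A i) + (A i * A j - A j * A i) := by
    have h1 : ∑ a, D i (P a j) • (Γ' a).map φ = ∑ a, D j (P a i) • (Γ' a).map φ :=
      Finset.sum_congr rfl fun a _ => by rw [hP]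
    have hAA : ∀ i j, A i * A j = ∑ a, ∑ b, (P a i * P b j) • (Γ' a * Γ' b).map φ := by
      intro i j
      simp only [hA, Finset.sum_mul, Finset.mul_sum]
      rw [Finset.sum_comm]
      refine Finset.sum_congr rfl fun a _ => Finset.sum_congr rfl fun b _ => ?_
      rw [Matrix.smul_mul, Matrix.mul_smul, smul_smul, Matrix.map_mul]
    have sw : ∀ (f : ι → ι → Matrix ι ι R), ∑ a, ∑ b, (P a j * P b i) • f a b
        = ∑ a, ∑ b, (P a i * P b j) • f b a := by
      intro f
      rw [Finset.sum_comm]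
      exact Finset.sum_congr rfl fun a _ => Finset.sum_congr rfl fun b _ => by rw [mul_comm]
    have sw' : ∀ (f : ι → ι → Matrix ι ι R), ∑ a, ∑ b, (P b i * P a j) • f b a
        = ∑ a, ∑ b, (P a i * P b j) • f a b := by
      intro f
      rw [Finset.sum_comm]
    rw [hdA, hdA, h1, hAA, hAA, sw (fun a b => (Γ' a * Γ' b).map φ),
      sw' (fun a b => (dMat (D' a) (Γ' b)).map φ)]
    have sw2 : ∑ a, ∑ b, (P b j * P a i) • (dMat (D' b) (Γ' a)).map φ
        = ∑ a, ∑ b, (P a i * P b j) • (dMat (D' b) (Γ' a)).map φ :=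
      Finset.sum_congr rfl fun a _ => Finset.sum_congr rfl fun b _ => by rw [mul_comm]
    rw [sw2, add_sub_add_left_eq_sub, ← Finset.sum_sub_distrib, ← Finset.sum_sub_distrib,
      ← Finset.sum_add_distrib]
    refine Finset.sum_congr rfl fun a _ => ?_
    rw [← Finset.sum_sub_distrib, ← Finset.sum_sub_distrib, ← Finset.sum_add_distrib]
    refine Finset.sum_congr rfl fun b _ => ?_
    rw [← smul_sub, ← smul_sub, ← smul_add]
    congr 1
    ext k l
    simp [curvature, -Matrix.map_mul]
  have hdP : ∀ i j, P * dMat (D i) (Γ j) =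
      dMat (D i) (A j * P + dMat (D j) P) - dMat (D i) P * Γ j := by
    intro i j
    rw [← hΓ j, dMat_mul]
    abel
  have hPP : ∀ i j, P * (Γ i * Γ j) = A i * (A j * P + dMat (D j) P) + dMat (D i) P * Γ j := by
    intro i j
    rw [← Matrix.mul_assoc, hΓ i, Matrix.add_mul, Matrix.mul_assoc, hΓ j]
  rw [hcA, curvature, Matrix.mul_add, Matrix.mul_sub, Matrix.mul_sub, hdP, hdP, hPP, hPP, dMat_add,
    dMat_add, dMat_mul, dMat_mul, dMat_comm (hD i j)]
  noncomm_ring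

/-- The Ricci tensor is covariant under changes of coordinates. -/
lemma IsLeviCivita.ricciOf_pullback {D : ι → Derivation ℝ R R}
    (hD : ∀ i j a, D i (D j a) = D j (D i a)) {D' : ι → Derivation ℝ R' R'}
    (φ : R' →+* R) (P Q : Matrix ι ι R) (hQ : Q * P = 1)
    (hφ : ∀ i a, D i (φ a) = ∑ b, P b i * φ (D' b a))
    (hP : ∀ i j a, D j (P a i) = D i (P a j)) {g gi : Matrix ι ι R} {g' : Matrix ι ι R'}
    (hg : g = Pᵀ * g'.map φ * P) (hgs : gᵀ = g) (hgi : gi * g = 1)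
    {Γ : ι → Matrix ι ι R} (hΓ : IsLeviCivita D g Γ)
    {Γ' : ι → Matrix ι ι R'} (hΓ' : IsLeviCivita D' g' Γ') :
    Matrix.of (ricciOf D Γ) = Pᵀ * (Matrix.of (ricciOf D' Γ')).map φ * P := by
  have hPQ : P * Q = 1 := mul_eq_one_comm.mp hQ
  -- The transformed connection is torsion-free and compatible with `g`, hence equal to `Γ` by
  -- uniqueness. The transformation law of the curvature then gives that of its trace, the factors
  -- `P` and `Q` cancelling in the contracted index.
  have h1 := IsLeviCivita.pullback φ P Q hQ hφ hP hΓ'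
  rw [← hg] at h1
  have h2 := hΓ.unique hgi hgs h1
  have h3 := curvature_pullback hD φ P hφ hP Γ' Γ (fun i => by
    rw [h2, ← Matrix.mul_assoc, hPQ, Matrix.one_mul])
  have h4 : ∀ i j, curvature D Γ i j =
      Q * ((∑ a, ∑ b, (P a i * P b j) • (curvature D' Γ' a b).map φ) * P) := fun i j => by
    rw [← h3, ← Matrix.mul_assoc, hQ, Matrix.one_mul]
  ext l j
  have hPQ' : ∀ a c, ∑ k, P a k * Q k c = if a = c then 1 else 0 := fun a c => by
    rw [← Matrix.mul_apply, hPQ, Matrix.one_apply]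
  rw [Matrix.of_apply, ricciOf_eq_curvature D hΓ.torsion]
  calc ∑ k, curvature D Γ k j k l
      = ∑ k, ∑ c, ∑ e, ∑ a, ∑ b, (P a k * Q k c) *
          (P b j * φ (curvature D' Γ' a b c e) * P e l) := by
        refine Finset.sum_congr rfl fun k _ => ?_
        rw [h4, Matrix.mul_apply]
        refine Finset.sum_congr rfl fun c _ => ?_
        rw [Matrix.mul_apply, Finset.mul_sum]
        refine Finset.sum_congr rfl fun e _ => ?_
        simp only [Matrix.sum_apply, Finset.sum_mul, Finset.mul_sum, Matrix.smul_apply,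
          Matrix.map_apply, smul_eq_mul]
        exact Finset.sum_congr rfl fun a _ => Finset.sum_congr rfl fun b _ => by ring
    _ = ∑ c, ∑ e, ∑ a, ∑ b, (∑ k, P a k * Q k c) *
          (P b j * φ (curvature D' Γ' a b c e) * P e l) := by
        rw [Finset.sum_comm]
        refine Finset.sum_congr rfl fun c _ => ?_
        rw [Finset.sum_comm]
        refine Finset.sum_congr rfl fun e _ => ?_
        rw [Finset.sum_comm]
        refine Finset.sum_congr rfl fun a _ => ?_
        rw [Finset.sum_comm]
        exact Finset.sum_congr rfl fun b _ => by rw [Finset.sum_mul]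
    _ = ∑ c, ∑ e, ∑ b, P b j * φ (curvature D' Γ' c b c e) * P e l := by
        simp only [hPQ']
        refine Finset.sum_congr rfl fun c _ => Finset.sum_congr rfl fun e _ => ?_
        rw [Finset.sum_comm]
        refine Finset.sum_congr rfl fun b _ => ?_
        simp
    _ = _ := by
        have sw : ∀ F : ι → ι → ι → R, ∑ c, ∑ e, ∑ b, F c e b = ∑ b, ∑ e, ∑ c, F c e b := by
          intro F
          rw [Finset.sum_congr rfl fun c _ => Finset.sum_comm, Finset.sum_comm,
            Finset.sum_congr rfl fun b _ => Finset.sum_comm]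
        rw [sw]
        simp only [Matrix.mul_apply, Matrix.transpose_apply, Matrix.map_apply, Matrix.of_apply,
          ricciOf_eq_curvature D' hΓ'.torsion, map_sum, Finset.mul_sum, Finset.sum_mul]
        exact Finset.sum_congr rfl fun b _ => Finset.sum_congr rfl fun e _ =>
          Finset.sum_congr rfl fun c _ => by ring

end Covariance

end Algebra

/-! ### Algebra of Isenberg–Moncrief metrics -/

section IMAlgebra

variable {d : ℕ} {R : Type*} [CommRing R] [Algebra ℝ R]

/-- The metric `2 (-du + φ dr + b_A dx^A) dr + h_{AB} dx^A dx^B`. -/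
def imMetric (φ : R) (b : Fin d → R) (h : Matrix (Fin d) (Fin d) R) : Matrix (Idx d) (Idx d) R :=
  Matrix.fromBlocks !![0, -1; -1, 2 * φ] (Matrix.of ![fun _ => 0, b]) (Matrix.of ![fun _ => 0, b])ᵀ h

/-- `b^A = h^{AB} b_B`. -/
def raise (hi : Matrix (Fin d) (Fin d) R) (b : Fin d → R) (A : Fin d) : R := ∑ B, hi A B * b B

/-- The component `g^{uu}` of the inverse metric. -/
def invUU (φ : R) (b : Fin d → R) (hi : Matrix (Fin d) (Fin d) R) : R :=
  ∑ A, raise hi b A * b A - 2 * φ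

/-- The inverse of `imMetric`. -/
def imInv (φ : R) (b : Fin d → R) (hi : Matrix (Fin d) (Fin d) R) : Matrix (Idx d) (Idx d) R :=
  Matrix.fromBlocks !![invUU φ b hi, -1; -1, 0] (Matrix.of ![raise hi b, fun _ => 0])
    (Matrix.of ![raise hi b, fun _ => 0])ᵀ hi

variable (φ : R) (b : Fin d → R) (h hi : Matrix (Fin d) (Fin d) R)

@[simp] lemma imMetric_uu : imMetric φ b h iu iu = 0 := rfl
@[simp] lemma imMetric_ur : imMetric φ b h iu ir = -1 := rfl
@[simp] lemma imMetric_ru : imMetric φ b h ir iu = -1 := rfl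
@[simp] lemma imMetric_rr : imMetric φ b h ir ir = 2 * φ := rfl
@[simp] lemma imMetric_ux (A : Fin d) : imMetric φ b h iu (ix A) = 0 := rfl
@[simp] lemma imMetric_xu (A : Fin d) : imMetric φ b h (ix A) iu = 0 := rfl
@[simp] lemma imMetric_rx (A : Fin d) : imMetric φ b h ir (ix A) = b A := rfl
@[simp] lemma imMetric_xr (A : Fin d) : imMetric φ b h (ix A) ir = b A := rfl
@[simp] lemma imMetric_xx (A B : Fin d) : imMetric φ b h (ix A) (ix B) = h A B := rfl
@[simp] lemma imInv_uu : imInv φ b hi iu iu = invUU φ b hi := rfl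
@[simp] lemma imInv_ur : imInv φ b hi iu ir = -1 := rfl
@[simp] lemma imInv_ru : imInv φ b hi ir iu = -1 := rfl
@[simp] lemma imInv_rr : imInv φ b hi ir ir = 0 := rfl
@[simp] lemma imInv_ux (A : Fin d) : imInv φ b hi iu (ix A) = raise hi b A := rfl
@[simp] lemma imInv_xu (A : Fin d) : imInv φ b hi (ix A) iu = raise hi b A := rfl
@[simp] lemma imInv_rx (A : Fin d) : imInv φ b hi ir (ix A) = 0 := rfl
@[simp] lemma imInv_xr (A : Fin d) : imInv φ b hi (ix A) ir = 0 := rfl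
@[simp] lemma imInv_xx (A B : Fin d) : imInv φ b hi (ix A) (ix B) = hi A B := rfl

lemma sum_idx {M : Type*} [AddCommMonoid M] (f : Idx d → M) :
    ∑ k, f k = f iu + f ir + ∑ A, f (ix A) := by
  rw [Fintype.sum_sum_type, Fin.sum_univ_two]

lemma forall_idx {p : Idx d → Prop} : (∀ k, p k) ↔ p iu ∧ p ir ∧ ∀ A, p (ix A) := by
  rw [Sum.forall, Fin.forall_fin_two, and_assoc]

variable {φ b h hi}

lemma imMetric_transpose (hs : hᵀ = h) : (imMetric φ b h)ᵀ = imMetric φ b h := by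
  have hs' : ∀ A B, h B A = h A B := fun A B => by rw [← Matrix.transpose_apply h, hs]
  ext i j
  revert i j
  simp [forall_idx, hs']

lemma imInv_transpose (hs : hiᵀ = hi) : (imInv φ b hi)ᵀ = imInv φ b hi := by
  have hs' : ∀ A B, hi B A = hi A B := fun A B => by rw [← Matrix.transpose_apply hi, hs]
  ext i j
  revert i j
  simp [forall_idx, hs']

lemma inv_transpose (hs : hᵀ = h) (hinv : hi * h = 1) : hiᵀ = hi := by
  have h2 : h * hi = 1 := mul_eq_one_comm.mp hinv
  have h3 : h * hiᵀ = 1 := by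
    have := congrArg Matrix.transpose hinv
    rwa [Matrix.transpose_mul, hs, Matrix.transpose_one] at this
  rw [← Matrix.one_mul hiᵀ, ← hinv, Matrix.mul_assoc, h3, Matrix.mul_one]

lemma imInv_mul_imMetric (hs : hᵀ = h) (hinv : hi * h = 1) :
    imInv φ b hi * imMetric φ b h = 1 := by
  have h2 : h * hi = 1 := mul_eq_one_comm.mp hinv
  have his := inv_transpose hs hinv
  have his' : ∀ A B, hi B A = hi A B := fun A B => by rw [← Matrix.transpose_apply hi, his]
  have e1 : ∀ A B, ∑ C, hi A C * h C B = if A = B then 1 else 0 := fun A B => by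
    rw [← Matrix.mul_apply, hinv, Matrix.one_apply]
  have e2 : ∀ B, ∑ C, raise hi b C * h C B = b B := by
    intro B
    simp only [raise, Finset.sum_mul]
    rw [Finset.sum_comm]
    calc ∑ E, ∑ C, hi C E * b E * h C B = ∑ E, b E * ∑ C, hi E C * h C B := by
          refine Finset.sum_congr rfl fun E _ => ?_
          rw [Finset.mul_sum]
          exact Finset.sum_congr rfl fun C _ => by rw [his']; ring
      _ = b B := by simp [e1]
  ext i j
  revert i j
  simp only [forall_idx, Matrix.mul_apply, sum_idx]
  simp [e1, e2, Matrix.one_apply, invUU]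
  exact ⟨by ring, fun A => by simp [raise]⟩

variable (D : Idx d → Derivation ℝ R R) (φ b h hi)

local notation "Γ" => leviCivita D (imMetric φ b h) (imInv φ b hi)

/-- The components `g_{uk}` are constants, so the lines of constant `(r, x)` are affinely
parametrised null geodesics. -/
lemma chr_u_k_u (k : Idx d) : Γ iu k iu = 0 := by
  simp [leviCivita, sum_idx]

/-- The only nonzero `g^{rk}` is `g^{ru} = -1`, hence `Γ^r_{ij} = ½ ∂_u g_{ij}`, which vanishes for
`i = u`. For `i = j = r` the same formula gives `Γ^r_{rr} = ∂_u φ`. -/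
lemma chr_u_r (j : Idx d) : Γ iu ir j = 0 := by
  revert j
  simp [forall_idx, leviCivita, sum_idx]

lemma chr_u_u_r : Γ iu iu ir = -D iu φ + half R * ∑ A, raise hi b A * D iu (b A) := by
  simp only [leviCivita, Matrix.of_apply, sum_idx]
  simp
  linear_combination (-D iu φ) * (half_add_half (R := R))

lemma chr_u_x_r (A : Fin d) : Γ iu (ix A) ir = half R * ∑ B, hi A B * D iu (b B) := by
  simp [leviCivita, sum_idx]

lemma chr_u_u_x (A : Fin d) :
    Γ iu iu (ix A) = -(half R * D iu (b A)) + half R * ∑ C, raise hi b C * D iu (h A C) := by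
  simp [leviCivita, sum_idx, mul_add]

lemma chr_u_x_x (A B : Fin d) : Γ iu (ix A) (ix B) = half R * ∑ C, hi A C * D iu (h B C) := by
  simp [leviCivita, sum_idx]

lemma chr_r_r_r : Γ ir ir ir = D iu φ := by
  simp [leviCivita, sum_idx]
  linear_combination (D iu φ) * (half_add_half (R := R))

lemma chr_r_r_x (A : Fin d) : Γ ir ir (ix A) = half R * D iu (b A) := by
  simp [leviCivita, sum_idx]

lemma chr_x_r_x (A B : Fin d) : Γ (ix A) ir (ix B) = half R * D iu (h A B) := by
  simp [leviCivita, sum_idx]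

lemma chr_r_u_r : Γ ir iu ir = -(invUU φ b hi * D iu φ) - D ir φ
    + ∑ A, raise hi b A * (D ir (b A) - D (ix A) φ) := by
  simp [leviCivita, sum_idx]
  have : ∀ A, raise hi b A * (D ir (b A) + D ir (b A) - 2 * D (ix A) φ)
      = 2 * (raise hi b A * (D ir (b A) - D (ix A) φ)) := fun A => by ring
  simp only [this, ← Finset.mul_sum]
  linear_combination (-(invUU φ b hi * D iu φ) - D ir φ
    + ∑ A, raise hi b A * (D ir (b A) - D (ix A) φ)) * (half_add_half (R := R))

lemma chr_r_x_r (A : Fin d) : Γ ir (ix A) ir = -(raise hi b A * D iu φ)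
    + ∑ B, hi A B * (D ir (b B) - D (ix B) φ) := by
  simp [leviCivita, sum_idx]
  have : ∀ B, hi A B * (D ir (b B) + D ir (b B) - 2 * D (ix B) φ)
      = 2 * (hi A B * (D ir (b B) - D (ix B) φ)) := fun A => by ring
  simp only [this, ← Finset.mul_sum]
  linear_combination (-(raise hi b A * D iu φ)
    + ∑ B, hi A B * (D ir (b B) - D (ix B) φ)) * (half_add_half (R := R))

lemma chr_r_u_x (A : Fin d) : Γ ir iu (ix A) = -(half R * (invUU φ b hi * D iu (b A))) - D (ix A) φ
    + half R * ∑ C, raise hi b C * (D ir (h A C) + D (ix A) (b C) - D (ix C) (b A)) := by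
  simp [leviCivita, sum_idx]
  linear_combination (- D (ix A) φ) * (half_add_half (R := R))

lemma chr_r_x_x (A B : Fin d) : Γ ir (ix B) (ix A) = -(half R * (raise hi b B * D iu (b A)))
    + half R * ∑ C, hi B C * (D ir (h A C) + D (ix A) (b C) - D (ix C) (b A)) := by
  simp [leviCivita, sum_idx]
  ring

lemma chr_x_u_x (A B : Fin d) : Γ (ix A) iu (ix B) = -(half R * (invUU φ b hi * D iu (h A B)))
    - half R * (D (ix A) (b B) + D (ix B) (b A) - D ir (h A B))
    + half R * ∑ C, raise hi b C * (D (ix A) (h B C) + D (ix B) (h A C) - D (ix C) (h A B)) := by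
  simp [leviCivita, sum_idx]
  ring

lemma chr_x_x_x (A B C : Fin d) : Γ (ix A) (ix C) (ix B) = -(half R * (raise hi b C * D iu (h A B)))
    + half R * ∑ E, hi C E * (D (ix A) (h B E) + D (ix B) (h A E) - D (ix E) (h A B)) := by
  simp [leviCivita, sum_idx]
  ring

variable {φ b h hi D}

lemma isLeviCivita_im (hs : hᵀ = h) (hinv : hi * h = 1) :
    IsLeviCivita D (imMetric φ b h) Γ :=
  isLeviCivita_leviCivita D (mul_eq_one_comm.mp (imInv_mul_imMetric hs hinv)) (imMetric_transpose hs)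

/-- Only the block `h` contributes to `tr (g⁻¹ ∂ g)`: the entries of the metric involving `u` are
constant, and `g^{rr}` and `g^{rA}` vanish. -/
lemma chr_trace (hs : hᵀ = h) (hinv : hi * h = 1) (i : Idx d) :
    (Γ i).trace = half R * ∑ A, ∑ B, hi A B * D i (h A B) := by
  have hs' : ∀ A B, h B A = h A B := fun A B => by rw [← Matrix.transpose_apply h, hs]
  have e := (isLeviCivita_im (D := D) (φ := φ) (b := b) hs hinv).trace
    (imInv_mul_imMetric hs hinv) i
  apply eq_of_two_mul_eq
  rw [e, two_mul_half]
  simp only [Matrix.trace, Matrix.diag_apply, Matrix.mul_apply, dMat_apply, sum_idx]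
  simp
  exact Finset.sum_congr rfl fun A _ => Finset.sum_congr rfl fun B _ => by rw [hs']

/-- The Ricci tensor, with the sums over all indices split. -/
lemma ricciOf_split (G : Idx d → Matrix (Idx d) (Idx d) R) (ht : ∀ i k j, G i k j = G j k i)
    (i j : Idx d) : ricciOf D G i j =
    D iu (G i iu j) + D ir (G i ir j) + ∑ C, D (ix C) (G i (ix C) j) - D j (G i).trace
    + ((G iu).trace * G i iu j + (G ir).trace * G i ir j + ∑ C, (G (ix C)).trace * G i (ix C) j)
    - (G j iu iu * G i iu iu + G j iu ir * G i ir iu + ∑ C, G j iu (ix C) * G i (ix C) iu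
      + (G j ir iu * G i iu ir + G j ir ir * G i ir ir + ∑ C, G j ir (ix C) * G i (ix C) ir)
      + ∑ C, (G j (ix C) iu * G i iu (ix C) + G j (ix C) ir * G i ir (ix C)
        + ∑ E, G j (ix C) (ix E) * G i (ix E) (ix C))) := by
  have h1 : ∑ k, ∑ l, G k k l * G i l j = ∑ l, (G l).trace * G i l j := by
    rw [Finset.sum_comm]
    refine Finset.sum_congr rfl fun l _ => ?_
    rw [← Finset.sum_mul]
    congr 1
    exact Finset.sum_congr rfl fun k _ => ht _ _ _
  have h2 : ∑ k, D j (G i k k) = D j (G i).trace := by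
    rw [← map_sum]; rfl
  simp only [ricciOf, Finset.sum_sub_distrib, h1, h2]
  simp only [sum_idx]
  ring

/-- The component `R_{uu}`. -/
lemma ricciOf_uu (hs : hᵀ = h) (hinv : hi * h = 1) :
    ricciOf D Γ iu iu = -(D iu (half R * ∑ A, ∑ B, hi A B * D iu (h A B)))
      - ∑ C, ∑ E, (half R * ∑ B, hi C B * D iu (h E B)) * (half R * ∑ B, hi E B * D iu (h C B)) := by
  rw [ricciOf_split _ (isLeviCivita_im hs hinv).torsion, chr_trace hs hinv]
  simp [chr_u_k_u, chr_u_r, chr_u_x_x]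

/-- The contracted Bianchi identity for `R_{ij} - λ g_{ij}`. -/
lemma IsLeviCivita.bianchi_einstein {ι : Type*} [Fintype ι] [DecidableEq ι]
    {D : ι → Derivation ℝ R R}
    (hD : ∀ i j a, D i (D j a) = D j (D i a)) {g gi : Matrix ι ι R} (h : gi * g = 1)
    (hgi : giᵀ = gi) {G : ι → Matrix ι ι R} (hG : IsLeviCivita D g G) (l : ℝ) (i : ι)
    (M : Matrix ι ι R) (hM : M = gi * (Matrix.of (ricciOf D G) - algebraMap ℝ R l • g)) :
    2 * (∑ a, D a (M a i) + ∑ a, (G a).trace * M a i - ∑ a, ∑ b, G i b a * M a b)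
      = D i M.trace := by
  have B := hG.bianchi_contracted hD h hgi i _ rfl
  have hQ : gi * Matrix.of (ricciOf D G) = M + algebraMap ℝ R l • (1 : Matrix ι ι R) := by
    rw [hM, Matrix.mul_sub, Matrix.mul_smul, h, sub_add_cancel]
  rw [hQ] at B
  have c0 : ∀ a j, D a (algebraMap ℝ R l * (1 : Matrix ι ι R) j i) = 0 := fun a j => by
    rw [Matrix.one_apply]
    split_ifs <;> simp
  have c1 : D i ((algebraMap ℝ R l • (1 : Matrix ι ι R)).trace) = 0 := by
    simp
  -- The cosmological term is `l` times the identity in mixed components. Its derivatives vanish,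
  -- and its two connection terms, `c2` and `c3`, are equal and cancel.
  have c2 : ∑ a, (G a).trace * (algebraMap ℝ R l * (1 : Matrix ι ι R) a i)
      = algebraMap ℝ R l * (G i).trace := by
    simp [Matrix.one_apply, mul_comm]
  have c3 : ∑ a, ∑ b, G i b a * (algebraMap ℝ R l * (1 : Matrix ι ι R) a b)
      = algebraMap ℝ R l * (G i).trace := by
    simp [Matrix.one_apply, Matrix.trace, Finset.sum_mul, mul_comm]
  simp only [Matrix.add_apply, Matrix.smul_apply, smul_eq_mul, map_add, c0, add_zero, mul_add,
    Finset.sum_add_distrib, Matrix.trace_add, c1, c2, c3] at B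
  linear_combination B

/-- The consequences of the Bianchi identity for an Isenberg–Moncrief metric solving the `AB`, `ur`
and `uA` components of the Einstein equations. -/
lemma bianchi_im (hD : ∀ i j a, D i (D j a) = D j (D i a)) (hs : hᵀ = h) (hinv : hi * h = 1)
    (l : ℝ) (E : Idx d → Idx d → R)
    (hE : ∀ i j, E i j = ricciOf D Γ i j - algebraMap ℝ R l * imMetric φ b h i j)
    (hxx : ∀ A B, E (ix A) (ix B) = 0) (hur : E iu ir = 0) (hux : ∀ A, E iu (ix A) = 0) :
    (2 * (D iu (invUU φ b hi * E iu iu) - D ir (E iu iu) + ∑ A, D (ix A) (raise hi b A * E iu iu)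
        + ((Γ iu).trace * invUU φ b hi - (Γ ir).trace + ∑ A, (Γ (ix A)).trace * raise hi b A
          + Γ iu iu ir - ∑ A, Γ iu iu (ix A) * raise hi b A) * E iu iu)
      = D iu (invUU φ b hi * E iu iu)) ∧
    (E iu iu = 0 → (∀ A, D iu (E ir (ix A)) = -((Γ iu).trace * E ir (ix A))
        - ∑ C, Γ (ix A) ir (ix C) * ∑ B, hi C B * E ir (ix B)
        + ∑ B, Γ (ix A) (ix B) iu * E ir (ix B)) ∧
      ((∀ A, E ir (ix A) = 0) → D iu (E ir ir) = -((Γ iu).trace * E ir ir))) := by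
  have LC := isLeviCivita_im (D := D) (φ := φ) (b := b) hs hinv
  have I1 := imInv_mul_imMetric (φ := φ) (b := b) hs hinv
  have hEs : ∀ i j, E i j = E j i := fun i j => by
    have : imMetric φ b h i j = imMetric φ b h j i := by
      rw [← Matrix.transpose_apply (imMetric φ b h), imMetric_transpose hs]
    rw [hE, hE, LC.ricciOf_comm hD I1, this]
  have B := fun i => LC.bianchi_einstein hD I1 (imInv_transpose (inv_transpose hs hinv)) l i
    (imInv φ b hi * Matrix.of E) (by
      congr 1; ext i j; exact hE i j)
  have hru : E ir iu = 0 := by rw [hEs, hur]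
  have hxu : ∀ A, E (ix A) iu = 0 := fun A => by rw [hEs, hux]
  have hxr : ∀ A, E (ix A) ir = E ir (ix A) := fun A => hEs _ _
  -- With the `AB`, `ur` and `uA` components zero, the mixed tensor is triangular: the column `u`
  -- contains only `E_uu`, the columns `A` only `E_rA`, and the trace only `E_uu`. Hence the Bianchi
  -- identities for the indices `u`, `A`, `r` can be used successively for `E_uu`, `E_rA`, `E_rr`.
  set M := imInv φ b hi * Matrix.of E with hM
  have Muu : M iu iu = invUU φ b hi * E iu iu := by simp [hM, Matrix.mul_apply, sum_idx, hru, hxu]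
  have Mru : M ir iu = - E iu iu := by simp [hM, Matrix.mul_apply, sum_idx]
  have Mxu : ∀ A, M (ix A) iu = raise hi b A * E iu iu := fun A => by
    simp [hM, Matrix.mul_apply, sum_idx, hxu]
  have Mur : M iu ir = - E ir ir + ∑ B, raise hi b B * E ir (ix B) := by
    simp [hM, Matrix.mul_apply, sum_idx, hur, hxr]
  have Mrr : M ir ir = 0 := by simp [hM, Matrix.mul_apply, sum_idx, hur]
  have Mxr : ∀ A, M (ix A) ir = ∑ B, hi A B * E ir (ix B) := fun A => by
    simp [hM, Matrix.mul_apply, sum_idx, hur, hxr]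
  have Mux : ∀ A, M iu (ix A) = - E ir (ix A) := fun A => by
    simp [hM, Matrix.mul_apply, sum_idx, hux, hxx]
  have Mrx : ∀ A, M ir (ix A) = 0 := fun A => by simp [hM, Matrix.mul_apply, sum_idx, hux]
  have Mxx : ∀ A B, M (ix A) (ix B) = 0 := fun A B => by
    simp [hM, Matrix.mul_apply, sum_idx, hux, hxx]
  have tr : M.trace = invUU φ b hi * E iu iu := by
    simp [Matrix.trace, sum_idx, Muu, Mrr, Mxx]
  rw [tr] at B
  refine ⟨?_, fun h0 => ⟨fun A => ?_, fun h1 => ?_⟩⟩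
  · have := B iu
    simp only [sum_idx, Muu, Mru, Mxu, Mur, Mrr, Mxr, Mux, Mrx, Mxx, chr_u_k_u, chr_u_r] at this
    simp only [map_neg, mul_zero, zero_mul, Finset.sum_const_zero, add_zero, zero_add,
      ← mul_assoc, ← Finset.sum_mul] at this
    linear_combination this
  · have := B (ix A)
    have t : Γ (ix A) ir iu = 0 := by rw [LC.torsion, chr_u_r]
    simp only [sum_idx, Muu, Mru, Mxu, Mur, Mrr, Mxr, Mux, Mrx, Mxx, h0, t] at this
    simp only [map_neg, mul_zero, zero_mul, Finset.sum_const_zero, add_zero, zero_add, map_zero,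
      neg_zero, mul_neg, Finset.sum_neg_distrib] at this
    have e : ∀ x : R, 2 * x = 0 → x = 0 := fun x hx => eq_of_two_mul_eq (by
      rw [← two_mul, hx, add_zero])
    have := e _ this
    linear_combination -this
  · have := B ir
    have t : Γ ir ir iu = 0 := by rw [LC.torsion, chr_u_r]
    simp only [sum_idx, Muu, Mru, Mxu, Mur, Mrr, Mxr, Mux, Mrx, Mxx, h0, h1, t] at this
    simp only [map_neg, mul_zero, zero_mul, Finset.sum_const_zero, add_zero, zero_add, map_zero,
      neg_zero, mul_neg, Finset.sum_neg_distrib] at this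
    have e : ∀ x : R, 2 * x = 0 → x = 0 := fun x hx => eq_of_two_mul_eq (by
      rw [← two_mul, hx, add_zero])
    have := e _ this
    linear_combination -this

end IMAlgebra

/-! ### Rings of smooth functions -/

section SmoothRing

/-- A set on which the calculus of smooth functions behaves as on open sets. -/
structure SmoothDomain (E : Type*) [NormedAddCommGroup E] [NormedSpace ℝ E] where
  carrier : Set E
  uniqueDiffOn : UniqueDiffOn ℝ carrier
  subset_closure : carrier ⊆ closure (interior carrier)

variable {E : Type*} [NormedAddCommGroup E] [NormedSpace ℝ E] (K : SmoothDomain E)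

open Classical in
/-- Extension of a function by zero. -/
def extendZero {E : Type*} {s : Set E} (f : s → ℝ) (p : E) : ℝ := if h : p ∈ s then f ⟨p, h⟩ else 0

/-- The algebra of smooth functions on a domain. -/
def smoothAlgebra : Subalgebra ℝ (K.carrier → ℝ) where
  carrier := {f | ContDiffOn ℝ ∞ (extendZero f) K.carrier}
  mul_mem' {f g} hf hg := by
    refine (ContDiffOn.mul hf hg).congr fun p hp => ?_
    simp [extendZero, hp]
  add_mem' {f g} hf hg := by
    refine (ContDiffOn.add hf hg).congr fun p hp => ?_
    simp [extendZero, hp]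
  algebraMap_mem' c := by
    refine (contDiffOn_const (c := c)).congr fun p hp => ?_
    simp [extendZero, hp]

/-- The ring of smooth functions on a domain. -/
def SmoothDomain.Ring : Type _ := smoothAlgebra K

instance : CommRing K.Ring := inferInstanceAs (CommRing (smoothAlgebra K))

instance : Algebra ℝ K.Ring := inferInstanceAs (Algebra ℝ (smoothAlgebra K))

variable {K}

/-- The values of a smooth function. -/
def ev (f : K.Ring) (p : E) : ℝ := extendZero f.1 p

lemma contDiffOn_ev (f : K.Ring) : ContDiffOn ℝ ∞ (ev f) K.carrier := f.2

variable (K) in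
open Classical in
/-- The element of the ring given by a function; zero if it is not smooth. -/
def SmoothDomain.mk' (f : E → ℝ) : K.Ring :=
  if h : ContDiffOn ℝ ∞ f K.carrier then
    ⟨fun p => f p, h.congr fun p hp => by simp [extendZero, hp]⟩ else 0

lemma ev_mk {f : E → ℝ} (h : ContDiffOn ℝ ∞ f K.carrier) {p : E} (hp : p ∈ K.carrier) :
    ev (K.mk' f) p = f p := by
  simp [SmoothDomain.mk', h, ev, extendZero, hp]

lemma ev_of_mem (f : K.Ring) {p : E} (hp : p ∈ K.carrier) : ev f p = f.1 ⟨p, hp⟩ := by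
  simp [ev, extendZero, hp]

lemma ev_of_notMem (f : K.Ring) {p : E} (hp : p ∉ K.carrier) : ev f p = 0 := by
  simp [ev, extendZero, hp]

lemma ev_ext {f g : K.Ring} (h : ∀ p ∈ K.carrier, ev f p = ev g p) : f = g := by
  refine Subtype.ext (funext fun ⟨p, hp⟩ => ?_)
  rw [← ev_of_mem f hp, ← ev_of_mem g hp, h p hp]

lemma ev_add (f g : K.Ring) (p : E) : ev (f + g) p = ev f p + ev g p := by
  by_cases hp : p ∈ K.carrier
  · rw [ev_of_mem _ hp, ev_of_mem _ hp, ev_of_mem _ hp]; rfl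
  · simp [ev_of_notMem _ hp]

lemma ev_neg (f : K.Ring) (p : E) : ev (-f) p = -ev f p := by
  by_cases hp : p ∈ K.carrier
  · rw [ev_of_mem _ hp, ev_of_mem _ hp]; rfl
  · simp [ev_of_notMem _ hp]

lemma ev_sub (f g : K.Ring) (p : E) : ev (f - g) p = ev f p - ev g p := by
  rw [sub_eq_add_neg, ev_add, ev_neg, sub_eq_add_neg]

lemma ev_zero (p : E) : ev (0 : K.Ring) p = 0 := by
  by_cases hp : p ∈ K.carrier
  · rw [ev_of_mem _ hp]; rfl
  · simp [ev_of_notMem _ hp]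

lemma ev_mul (f g : K.Ring) (p : E) : ev (f * g) p = ev f p * ev g p := by
  by_cases hp : p ∈ K.carrier
  · rw [ev_of_mem _ hp, ev_of_mem _ hp, ev_of_mem _ hp]; rfl
  · simp [ev_of_notMem _ hp]

lemma ev_smul (c : ℝ) (f : K.Ring) (p : E) : ev (c • f) p = c * ev f p := by
  by_cases hp : p ∈ K.carrier
  · rw [ev_of_mem _ hp, ev_of_mem _ hp]; rfl
  · simp [ev_of_notMem _ hp]

lemma ev_algebraMap (c : ℝ) {p : E} (hp : p ∈ K.carrier) : ev (algebraMap ℝ K.Ring c) p = c := by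
  rw [ev_of_mem _ hp]; rfl

lemma ev_one {p : E} (hp : p ∈ K.carrier) : ev (1 : K.Ring) p = 1 := by
  rw [ev_of_mem _ hp]; rfl

/-- Evaluation at a point of the domain, as a ring homomorphism. -/
def evHom {p : E} (hp : p ∈ K.carrier) : K.Ring →+* ℝ where
  toFun f := ev f p
  map_one' := ev_one hp
  map_zero' := ev_zero p
  map_mul' f g := ev_mul f g p
  map_add' f g := ev_add f g p

@[simp] lemma evHom_apply {p : E} (hp : p ∈ K.carrier) (f : K.Ring) : evHom hp f = ev f p := rfl

lemma ev_sum {ι : Type*} (s : Finset ι) (f : ι → K.Ring) {p : E} (hp : p ∈ K.carrier) :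
    ev (∑ i ∈ s, f i) p = ∑ i ∈ s, ev (f i) p := map_sum (evHom hp) f s

lemma differentiableWithinAt_ev (f : K.Ring) {p : E} (hp : p ∈ K.carrier) :
    DifferentiableWithinAt ℝ (ev f) K.carrier p :=
  (contDiffOn_ev f p hp).differentiableWithinAt (by simp)

lemma contDiffOn_fderivWithin_apply {s : Set E} (hs : UniqueDiffOn ℝ s) {f : E → ℝ}
    (hf : ContDiffOn ℝ ∞ f s) (v : E) : ContDiffOn ℝ ∞ (fun p => fderivWithin ℝ f s p v) s :=
  (hf.fderivWithin hs (m := ∞) (by simp)).clm_apply contDiffOn_const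

/-- The directional derivative on the ring of smooth functions. -/
def dirDeriv (v : E) : Derivation ℝ K.Ring K.Ring :=
  Derivation.mk'
    { toFun := fun f => K.mk' fun p => fderivWithin ℝ (ev f) K.carrier p v
      map_add' := fun f g => ev_ext fun p hp => by
        have hu := K.uniqueDiffOn p hp
        rw [ev_add, ev_mk (contDiffOn_fderivWithin_apply K.uniqueDiffOn (contDiffOn_ev _) v) hp,
          ev_mk (contDiffOn_fderivWithin_apply K.uniqueDiffOn (contDiffOn_ev _) v) hp,
          ev_mk (contDiffOn_fderivWithin_apply K.uniqueDiffOn (contDiffOn_ev _) v) hp]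
        have : ev (f + g) = ev f + ev g := funext fun p => ev_add f g p
        rw [this, fderivWithin_add hu (differentiableWithinAt_ev f hp)
          (differentiableWithinAt_ev g hp)]
        rfl
      map_smul' := fun c f => ev_ext fun p hp => by
        have hu := K.uniqueDiffOn p hp
        rw [RingHom.id_apply, ev_smul,
          ev_mk (contDiffOn_fderivWithin_apply K.uniqueDiffOn (contDiffOn_ev _) v) hp,
          ev_mk (contDiffOn_fderivWithin_apply K.uniqueDiffOn (contDiffOn_ev _) v) hp]
        have : ev (c • f) = c • ev f := funext fun p => ev_smul c f p
        rw [this, fderivWithin_const_smul hu (differentiableWithinAt_ev f hp)]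
        rfl }
    fun f g => ev_ext fun p hp => by
      have hu := K.uniqueDiffOn p hp
      simp only [smul_eq_mul, LinearMap.coe_mk, AddHom.coe_mk]
      rw [ev_add, ev_mul, ev_mul,
        ev_mk (contDiffOn_fderivWithin_apply K.uniqueDiffOn (contDiffOn_ev _) v) hp,
        ev_mk (contDiffOn_fderivWithin_apply K.uniqueDiffOn (contDiffOn_ev _) v) hp,
        ev_mk (contDiffOn_fderivWithin_apply K.uniqueDiffOn (contDiffOn_ev _) v) hp]
      have : ev (f * g) = fun p => ev f p * ev g p := funext fun p => ev_mul f g p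
      rw [this, fderivWithin_fun_mul hu (differentiableWithinAt_ev f hp)
        (differentiableWithinAt_ev g hp)]
      rfl

lemma ev_dirDeriv (v : E) (f : K.Ring) {p : E} (hp : p ∈ K.carrier) :
    ev (dirDeriv v f) p = fderivWithin ℝ (ev f) K.carrier p v :=
  ev_mk (contDiffOn_fderivWithin_apply K.uniqueDiffOn (contDiffOn_ev f) v) hp

lemma two_le_infty : (2 : WithTop ℕ∞) ≤ ∞ := by
  have : ((2 : ℕ∞) : WithTop ℕ∞) ≤ ((⊤ : ℕ∞) : WithTop ℕ∞) := WithTop.coe_le_coe.mpr le_top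
  exact this

/-- Directional derivatives of smooth functions commute. -/
lemma fderivWithin_comm {s : Set E} (hs : UniqueDiffOn ℝ s) {f : E → ℝ} {p : E}
    (hf : ContDiffWithinAt ℝ 2 f s p) (hp : p ∈ s) (hp' : p ∈ closure (interior s)) (v w : E) :
    fderivWithin ℝ (fun q => fderivWithin ℝ f s q v) s p w
      = fderivWithin ℝ (fun q => fderivWithin ℝ f s q w) s p v := by
  have hd : DifferentiableWithinAt ℝ (fderivWithin ℝ f s) s p :=
    (hf.fderivWithin_right hs (m := 1) (by norm_num) hp).differentiableWithinAt (by simp)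
  have e : ∀ v w, fderivWithin ℝ (fun q => fderivWithin ℝ f s q v) s p w
      = fderivWithin ℝ (fderivWithin ℝ f s) s p w v := by
    intro v w
    rw [fderivWithin_clm_apply (hs p hp) hd (differentiableWithinAt_const v)]
    simp
  rw [e, e]
  exact (hf.isSymmSndFDerivWithinAt (by simp) hs hp' hp) w v

lemma dirDeriv_comm (v w : E) (f : K.Ring) :
    dirDeriv v (dirDeriv w f) = dirDeriv w (dirDeriv v f) := by
  refine ev_ext fun p hp => ?_
  rw [ev_dirDeriv _ _ hp, ev_dirDeriv _ _ hp,
    fderivWithin_congr (fun q hq => ev_dirDeriv w f hq) (ev_dirDeriv w f hp),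
    fderivWithin_congr (fun q hq => ev_dirDeriv v f hq) (ev_dirDeriv v f hp)]
  exact fderivWithin_comm K.uniqueDiffOn ((contDiffOn_ev f p hp).of_le two_le_infty) hp (K.subset_closure hp) w v

/-- A smooth function without zeros is a unit. -/
lemma exists_mul_eq_one (f : K.Ring) (hf : ∀ p ∈ K.carrier, ev f p ≠ 0) : ∃ g : K.Ring, g * f = 1 := by
  refine ⟨K.mk' fun p => (ev f p)⁻¹, ev_ext fun p hp => ?_⟩
  rw [ev_mul, ev_mk (f := fun p => (ev f p)⁻¹) ((contDiffOn_ev f).inv hf) hp, ev_one hp, inv_mul_cancel₀ (hf p hp)]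

end SmoothRing

/-! ### Power series over a ring with derivations -/

section PowerSeries

open PowerSeries

variable {C : Type*} [CommRing C] [Algebra ℝ C]

/-- The coefficientwise extension of a derivation to power series. -/
def mapDer (δ : Derivation ℝ C C) : Derivation ℝ C⟦X⟧ C⟦X⟧ :=
  Derivation.mk'
    { toFun := fun f => PowerSeries.mk fun n => δ (coeff n f)
      map_add' := fun f g => by ext n; simp
      map_smul' := fun c f => by
        ext n
        simp [coeff_mk] }
    fun f g => by
      ext n
      simp only [LinearMap.coe_mk, AddHom.coe_mk, coeff_mk, coeff_mul, map_sum, Derivation.leibniz,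
        smul_eq_mul, map_add, Finset.sum_add_distrib]
      congr 1
      rw [← Finset.Nat.sum_antidiagonal_swap]
      rfl

@[simp] lemma coeff_mapDer (δ : Derivation ℝ C C) (n : ℕ) (f : C⟦X⟧) :
    coeff n (mapDer δ f) = δ (coeff n f) := by
  simp [mapDer]

variable (C) in
/-- The derivation `d/dX`, over `ℝ`. -/
def dX : Derivation ℝ C⟦X⟧ C⟦X⟧ := (PowerSeries.derivative C).restrictScalars ℝ

@[simp] lemma coeff_dX (n : ℕ) (f : C⟦X⟧) : coeff n (dX C f) = coeff (n + 1) f * (n + 1) :=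
  coeff_derivative f n

end PowerSeries

/-! ### Taylor expansions at the null hypersurface -/

section Taylor

open PowerSeries Filter Topology

/-- The coordinate range of a null hypersurface: an interval times an open set. -/
structure Patch (d : ℕ) where
  I : Set ℝ
  U : Set (Vec d)
  ord : I.OrdConnected
  nontrivial : I.Nontrivial
  isOpen : IsOpen U

variable {d : ℕ}

/-- The coordinates `(u, (r, y))`. -/
def coordEquiv (d : ℕ) : (Idx d → ℝ) ≃L[ℝ] ℝ × (ℝ × Vec d) :=
  LinearEquiv.toContinuousLinearEquiv
    { toFun := fun p => (p iu, p ir, xPart p)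
      invFun := fun q => pt q.1 q.2.1 q.2.2
      map_add' := fun _ _ => rfl
      map_smul' := fun _ _ => rfl
      left_inv := fun p => by
        ext k
        rcases k with k | A
        · fin_cases k <;> rfl
        · rfl
      right_inv := fun _ => rfl }

lemma coordEquiv_apply (p : Idx d → ℝ) : coordEquiv d p = (p iu, p ir, xPart p) := rfl

lemma _root_.Set.OrdConnected.uniqueDiffOn_real {I : Set ℝ} (h : I.OrdConnected)
    (h' : I.Nontrivial) : UniqueDiffOn ℝ I :=
  uniqueDiffOn_convex h.convex (h.convex.nontrivial_iff_nonempty_interior.mp h')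

namespace Patch

variable (P : Patch d)

/-- The null hypersurface in coordinates `(r, y)`. -/
def K : SmoothDomain (ℝ × Vec d) where
  carrier := P.I ×ˢ P.U
  uniqueDiffOn := (P.ord.uniqueDiffOn_real P.nontrivial).prod P.isOpen.uniqueDiffOn
  subset_closure := by
    have hc : Convex ℝ P.I := P.ord.convex
    rw [interior_prod_eq, closure_prod_eq, P.isOpen.interior_eq,
      hc.closure_interior_eq_closure_of_nonempty_interior
        (hc.nontrivial_iff_nonempty_interior.mp P.nontrivial)]
    exact Set.prod_mono subset_closure subset_closure

lemma domain_eq : domain P.I P.U = coordEquiv d ⁻¹' (Set.univ ×ˢ P.K.carrier) := by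
  ext p
  simp [domain, coordEquiv_apply, K]

/-- The spacetime coordinate domain. -/
def Ω : SmoothDomain (Idx d → ℝ) where
  carrier := domain P.I P.U
  uniqueDiffOn := by
    rw [domain_eq, (coordEquiv d).uniqueDiffOn_preimage_iff]
    exact uniqueDiffOn_univ.prod P.K.uniqueDiffOn
  subset_closure := by
    rw [domain_eq]
    change (coordEquiv d).toHomeomorph ⁻¹' _ ⊆
      closure (interior ((coordEquiv d).toHomeomorph ⁻¹' _))
    rw [← Homeomorph.preimage_interior, ← Homeomorph.preimage_closure, interior_prod_eq,
      closure_prod_eq, interior_univ, closure_univ]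
    exact Set.preimage_mono (Set.prod_mono le_rfl P.K.subset_closure)

lemma uniqueDiffOn_domain : UniqueDiffOn ℝ (domain P.I P.U) := P.Ω.uniqueDiffOn

/-- The embedding of the null hypersurface `{u = 0}`. -/
def emb (d : ℕ) : (ℝ × Vec d) →L[ℝ] (Idx d → ℝ) :=
  ((coordEquiv d).symm : _ →L[ℝ] _).comp (ContinuousLinearMap.inr ℝ ℝ (ℝ × Vec d))

/-- The projection along the lines of constant `(r, y)`. -/
def proj (d : ℕ) : (Idx d → ℝ) →L[ℝ] (ℝ × Vec d) :=
  (ContinuousLinearMap.snd ℝ ℝ (ℝ × Vec d)).comp (coordEquiv d : _ →L[ℝ] _)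

lemma emb_apply (z : ℝ × Vec d) : emb d z = pt 0 z.1 z.2 := rfl

lemma proj_apply (p : Idx d → ℝ) : proj d p = (p ir, xPart p) := rfl

lemma pt_mem {z : ℝ × Vec d} (hz : z ∈ P.K.carrier) (u : ℝ) : pt u z.1 z.2 ∈ P.Ω.carrier := hz

lemma emb_mem_domain {z : ℝ × Vec d} (hz : z ∈ P.K.carrier) : emb d z ∈ domain P.I P.U := hz

lemma emb_r : emb d ((1 : ℝ), (0 : Vec d)) = Pi.single ir 1 := by
  ext k
  rcases k with k | A
  · fin_cases k <;> simp [emb_apply, pt]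
  · simp [emb_apply, pt]

lemma emb_x (A : Fin d) :
    emb d ((0 : ℝ), (EuclideanSpace.single A (1 : ℝ) : Vec d)) = Pi.single (ix A) 1 := by
  ext k
  rcases k with k | B
  · fin_cases k <;> simp [emb_apply, pt]
  · simp [emb_apply, pt, Pi.single_apply]

/-- The coordinate derivatives on the ring of formal expansions. -/
def frame : Idx d → Derivation ℝ P.K.Ring⟦X⟧ P.K.Ring⟦X⟧ :=
  Sum.elim ![dX P.K.Ring, mapDer (dirDeriv ((1 : ℝ), (0 : Vec d)))]
    fun A => mapDer (dirDeriv ((0 : ℝ), (EuclideanSpace.single A (1 : ℝ) : Vec d)))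

lemma frame_u : P.frame iu = dX P.K.Ring := rfl
lemma frame_r : P.frame ir = mapDer (dirDeriv ((1 : ℝ), (0 : Vec d))) := rfl
lemma frame_x (A : Fin d) : P.frame (ix A) =
  mapDer (dirDeriv ((0 : ℝ), (EuclideanSpace.single A (1 : ℝ) : Vec d))) := rfl

lemma mapDer_dX_comm (δ : Derivation ℝ P.K.Ring P.K.Ring) (a : P.K.Ring⟦X⟧) :
    dX P.K.Ring (mapDer δ a) = mapDer δ (dX P.K.Ring a) := by
  ext1 n
  have : δ ((n : P.K.Ring) + 1) = 0 := by simp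
  simp only [coeff_dX, coeff_mapDer, Derivation.leibniz, smul_eq_mul, this]
  ring

lemma mapDer_comm {δ ε : Derivation ℝ P.K.Ring P.K.Ring} (h : ∀ a, δ (ε a) = ε (δ a))
    (a : P.K.Ring⟦X⟧) : mapDer δ (mapDer ε a) = mapDer ε (mapDer δ a) := by
  ext1 n
  simp [h]

lemma frame_comm (i j : Idx d) (a : P.K.Ring⟦X⟧) :
    P.frame i (P.frame j a) = P.frame j (P.frame i a) := by
  revert i j
  simp only [forall_idx, frame_u, frame_r, frame_x, mapDer_dX_comm, true_and, implies_true,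
    and_true]
  exact ⟨fun A => mapDer_comm P (dirDeriv_comm _ _) a, fun A =>
    ⟨mapDer_comm P (dirDeriv_comm _ _) a, fun B => mapDer_comm P (dirDeriv_comm _ _) a⟩⟩

local notation "∂" => partialDeriv (domain P.I P.U)

/-- Functions smooth at the null hypersurface. -/
def Good (F : (Idx d → ℝ) → ℝ) : Prop :=
  ∀ z ∈ P.K.carrier, ContDiffWithinAt ℝ ∞ F (domain P.I P.U) (emb d z)

/-- Equality near the null hypersurface. -/
def GermEq (F G : (Idx d → ℝ) → ℝ) : Prop :=
  ∀ z ∈ P.K.carrier, F =ᶠ[𝓝[domain P.I P.U] (emb d z)] G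

/-- `a` is the Taylor expansion of `F` at the null hypersurface. -/
structure HasTaylor (F : (Idx d → ℝ) → ℝ) (a : P.K.Ring⟦X⟧) : Prop where
  good : P.Good F
  coeff_eq : ∀ j, ∀ z ∈ P.K.carrier, (∂ iu)^[j] F (emb d z) = j.factorial * ev (coeff j a) z

variable {P} {F G : (Idx d → ℝ) → ℝ} {a b : P.K.Ring⟦X⟧}

/-- Derivatives within the domain depend only on germs. This allows one to differentiate identities
known merely near `u = 0`, such as those for the inverse of a metric which may degenerate elsewhere.
-/
lemma GermEq.partialDeriv (h : P.GermEq F G) (i : Idx d) : P.GermEq (∂ i F) (∂ i G) := by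
  intro z hz
  filter_upwards [(h z hz).fderivWithin (𝕜 := ℝ)] with q hq
  simp only [IsenbergMoncrief.partialDeriv, hq]

lemma GermEq.iterate (h : P.GermEq F G) (j : ℕ) : P.GermEq ((∂ iu)^[j] F) ((∂ iu)^[j] G) := by
  induction j generalizing F G with
  | zero => exact h
  | succ j ih => exact ih (h.partialDeriv iu)

lemma GermEq.eval (h : P.GermEq F G) {z : ℝ × Vec d} (hz : z ∈ P.K.carrier) :
    F (emb d z) = G (emb d z) := (h z hz).self_of_nhdsWithin (P.emb_mem_domain hz)

lemma Good.congr (hF : P.Good F) (h : P.GermEq G F) : P.Good G :=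
  fun z hz => (hF z hz).congr_of_eventuallyEq (h z hz) (h.eval hz)

lemma Good.partialDeriv (hF : P.Good F) (i : Idx d) : P.Good (∂ i F) := by
  intro z hz
  exact ((hF z hz).fderivWithin_right P.uniqueDiffOn_domain (m := ∞) (by simp)
    (P.emb_mem_domain hz)).clm_apply contDiffWithinAt_const

lemma Good.iterate (hF : P.Good F) (j : ℕ) : P.Good ((∂ iu)^[j] F) := by
  induction j generalizing F with
  | zero => exact hF
  | succ j ih => exact ih (hF.partialDeriv iu)

lemma Good.eventually (hF : P.Good F) {z : ℝ × Vec d} (hz : z ∈ P.K.carrier) :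
    ∀ᶠ q in 𝓝[domain P.I P.U] (emb d z), q ∈ domain P.I P.U ∧
      ContDiffWithinAt ℝ 2 F (domain P.I P.U) q := by
  have := ((hF z hz).of_le two_le_infty).eventually (by decide)
  rw [Set.insert_eq_of_mem (P.emb_mem_domain hz)] at this
  exact eventually_mem_nhdsWithin.and this

lemma Good.eventually_diff (hF : P.Good F) {z : ℝ × Vec d} (hz : z ∈ P.K.carrier) :
    ∀ᶠ q in 𝓝[domain P.I P.U] (emb d z), q ∈ domain P.I P.U ∧
      DifferentiableWithinAt ℝ F (domain P.I P.U) q := by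
  filter_upwards [hF.eventually hz] with q hq
  exact ⟨hq.1, hq.2.differentiableWithinAt (by simp)⟩

lemma Good.add (hF : P.Good F) (hG : P.Good G) : P.Good (fun p => F p + G p) :=
  fun z hz => (hF z hz).add (hG z hz)

lemma Good.mul (hF : P.Good F) (hG : P.Good G) : P.Good (fun p => F p * G p) :=
  fun z hz => (hF z hz).mul (hG z hz)

lemma Good.partialDeriv_add (hF : P.Good F) (hG : P.Good G) (i : Idx d) :
    P.GermEq (∂ i (fun p => F p + G p)) (fun p => ∂ i F p + ∂ i G p) := by
  intro z hz
  filter_upwards [hF.eventually_diff hz, hG.eventually_diff hz] with q h1 h2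
  simp only [IsenbergMoncrief.partialDeriv]
  rw [fderivWithin_fun_add (P.uniqueDiffOn_domain q h1.1) h1.2 h2.2]
  rfl

lemma Good.partialDeriv_mul (hF : P.Good F) (hG : P.Good G) (i : Idx d) :
    P.GermEq (∂ i (fun p => F p * G p)) (fun p => F p * ∂ i G p + G p * ∂ i F p) := by
  intro z hz
  filter_upwards [hF.eventually_diff hz, hG.eventually_diff hz] with q h1 h2
  simp only [IsenbergMoncrief.partialDeriv]
  rw [fderivWithin_fun_mul (P.uniqueDiffOn_domain q h1.1) h1.2 h2.2]
  rfl

lemma Good.partialDeriv_comm (hF : P.Good F) (i j : Idx d) :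
    P.GermEq (∂ i (∂ j F)) (∂ j (∂ i F)) := by
  intro z hz
  have := ((hF z hz).of_le two_le_infty).eventually (by decide)
  rw [Set.insert_eq_of_mem (P.emb_mem_domain hz)] at this
  filter_upwards [hF.eventually hz] with q h1
  exact fderivWithin_comm P.uniqueDiffOn_domain h1.2 h1.1 (P.Ω.subset_closure h1.1) _ _

lemma Good.iterate_partialDeriv (hF : P.Good F) (i : Idx d) (j : ℕ) :
    P.GermEq ((∂ iu)^[j] (∂ i F)) (∂ i ((∂ iu)^[j] F)) := by
  induction j generalizing F with
  | zero => exact fun z _ => EventuallyEq.rfl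
  | succ j ih =>
    intro z hz
    have h1 := ((hF.partialDeriv_comm iu i).iterate j) z hz
    exact h1.trans (ih (hF.partialDeriv iu) z hz)

lemma Good.contDiffOn (hF : P.Good F) :
    ContDiffOn ℝ ∞ (fun z => F (emb d z)) P.K.carrier := by
  intro z hz
  exact (hF z hz).comp z ((emb d).contDiff.contDiffWithinAt) (fun w hw => P.emb_mem_domain hw)

lemma Good.fderivWithin_emb (hF : P.Good F) {z : ℝ × Vec d} (hz : z ∈ P.K.carrier)
    (v : ℝ × Vec d) : fderivWithin ℝ (fun w => F (emb d w)) P.K.carrier z v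
      = fderivWithin ℝ F (domain P.I P.U) (emb d z) (emb d v) := by
  have := fderivWithin_comp z (g := F) (f := emb d) (t := domain P.I P.U) (s := P.K.carrier)
    ((hF z hz).differentiableWithinAt (by simp)) (emb d).differentiableWithinAt
    (fun w hw => P.emb_mem_domain hw) (P.K.uniqueDiffOn z hz)
  rw [(emb d).fderivWithin (P.K.uniqueDiffOn z hz)] at this
  exact congrArg (fun T => T v) this

/-- No convergence is involved: the derivatives on the hypersurface define the series. It serves for
functions which are known to be smooth, but whose coefficients are only determined by an algebraic
relation, in particular entries of an inverse matrix. -/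
lemma Good.exists_hasTaylor (hF : P.Good F) : ∃ a, P.HasTaylor F a := by
  refine ⟨PowerSeries.mk fun j =>
    (1 / (j.factorial : ℝ)) • P.K.mk' fun z => (∂ iu)^[j] F (emb d z), hF, fun j z hz => ?_⟩
  rw [coeff_mk, ev_smul, ev_mk (hF.iterate j).contDiffOn hz]
  field_simp

lemma HasTaylor.unique (ha : P.HasTaylor F a) (hb : P.HasTaylor F b) : a = b := by
  ext1 j
  refine ev_ext fun z hz => ?_
  have h1 := ha.coeff_eq j z hz
  rw [hb.coeff_eq j z hz] at h1
  exact (mul_left_cancel₀ (by positivity) h1).symm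

lemma HasTaylor.congr (ha : P.HasTaylor F a) (h : P.GermEq G F) : P.HasTaylor G a :=
  ⟨ha.good.congr h, fun j z hz => by rw [(h.iterate j).eval hz, ha.coeff_eq j z hz]⟩

lemma iterate_add (j : ℕ) : ∀ {F G : (Idx d → ℝ) → ℝ}, P.Good F → P.Good G →
    P.GermEq ((∂ iu)^[j] fun p => F p + G p) (fun p => (∂ iu)^[j] F p + (∂ iu)^[j] G p) := by
  induction j with
  | zero => exact fun _ _ z _ => EventuallyEq.rfl
  | succ j ih =>
    intro F G hF hG z hz
    exact (((hF.partialDeriv_add hG iu).iterate j) z hz).trans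
      (ih (hF.partialDeriv iu) (hG.partialDeriv iu) z hz)

lemma HasTaylor.add (ha : P.HasTaylor F a) (hb : P.HasTaylor G b) :
    P.HasTaylor (fun p => F p + G p) (a + b) := by
  refine ⟨ha.good.add hb.good, fun j z hz => ?_⟩
  rw [(iterate_add j ha.good hb.good).eval hz, ha.coeff_eq j z hz, hb.coeff_eq j z hz, map_add,
    ev_add, mul_add]

lemma HasTaylor.partialDeriv_u (ha : P.HasTaylor F a) :
    P.HasTaylor (∂ iu F) (dX P.K.Ring a) := by
  refine ⟨ha.good.partialDeriv iu, fun j z hz => ?_⟩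
  have h1 := ha.coeff_eq (j + 1) z hz
  rw [Function.iterate_succ_apply] at h1
  have h2 : ev ((j : P.K.Ring) + 1) z = j + 1 := by
    have : ((j : P.K.Ring) + 1) = algebraMap ℝ _ ((j : ℝ) + 1) := by simp
    rw [this, ev_algebraMap _ hz]
  rw [h1, coeff_dX, ev_mul, h2, Nat.factorial_succ]
  push_cast
  ring

/-- Directions tangent to `{u = 0}`: their derivatives commute with `∂_u` and with restriction to
the hypersurface, hence act on each coefficient separately. -/
lemma HasTaylor.partialDeriv_dir (ha : P.HasTaylor F a) {i : Idx d} {v : ℝ × Vec d}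
    (hv : emb d v = Pi.single i 1) : P.HasTaylor (∂ i F) (mapDer (dirDeriv v) a) := by
  refine ⟨ha.good.partialDeriv i, fun j z hz => ?_⟩
  rw [(ha.good.iterate_partialDeriv i j).eval hz, coeff_mapDer, ev_dirDeriv _ _ hz]
  have e : ∀ w ∈ P.K.carrier, ev (coeff j a) w = (1 / (j.factorial : ℝ)) *
      (∂ iu)^[j] F (emb d w) := by
    intro w hw
    rw [ha.coeff_eq j w hw]
    field_simp
  rw [fderivWithin_congr e (e z hz)]
  have := (ha.good.iterate j).fderivWithin_emb hz v
  rw [hv] at this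
  rw [fderivWithin_const_mul (P.K.uniqueDiffOn z hz)
    (((ha.good.iterate j).contDiffOn z hz).differentiableWithinAt (by simp))]
  simp only [IsenbergMoncrief.partialDeriv, ← this]
  simp
  field_simp

lemma HasTaylor.partialDeriv (ha : P.HasTaylor F a) (i : Idx d) :
    P.HasTaylor (∂ i F) (P.frame i a) := by
  revert i
  rw [forall_idx]
  exact ⟨ha.partialDeriv_u, ha.partialDeriv_dir emb_r, fun A => ha.partialDeriv_dir (emb_x A)⟩

/-- Induction on the order through one application of the Leibniz rule on each side, which avoids
the binomial formula for iterated derivatives. -/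
lemma HasTaylor.mul (ha : P.HasTaylor F a) (hb : P.HasTaylor G b) :
    P.HasTaylor (fun p => F p * G p) (a * b) := by
  refine ⟨ha.good.mul hb.good, fun j => ?_⟩
  induction j generalizing F G a b with
  | zero =>
    intro z hz
    have h1 := ha.coeff_eq 0 z hz
    have h2 := hb.coeff_eq 0 z hz
    simp only [Function.iterate_zero, id_eq, Nat.factorial_zero, Nat.cast_one, one_mul,
      coeff_mul, Finset.Nat.antidiagonal_zero, Finset.sum_singleton] at h1 h2 ⊢
    rw [h1, h2, ev_mul]
  | succ j ih =>
    intro z hz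
    rw [Function.iterate_succ_apply, ((ha.good.partialDeriv_mul hb.good iu).iterate j).eval hz,
      (iterate_add j (ha.good.mul (hb.good.partialDeriv iu))
        (hb.good.mul (ha.good.partialDeriv iu))).eval hz, ih ha hb.partialDeriv_u z hz,
      ih hb ha.partialDeriv_u z hz, ← mul_add, ← ev_add, ← map_add]
    have : a * dX P.K.Ring b + b * dX P.K.Ring a = dX P.K.Ring (a * b) := by
      rw [Derivation.leibniz]; rfl
    have h2 : ev ((j : P.K.Ring) + 1) z = j + 1 := by
      have : ((j : P.K.Ring) + 1) = algebraMap ℝ _ ((j : ℝ) + 1) := by simp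
      rw [this, ev_algebraMap _ hz]
    rw [this, coeff_dX, ev_mul, h2, Nat.factorial_succ]
    push_cast
    ring

lemma ev_coeff_algebraMap (c : ℝ) (j : ℕ) {z : ℝ × Vec d} (hz : z ∈ P.K.carrier) :
    ev (coeff j (algebraMap ℝ P.K.Ring⟦X⟧ c)) z = if j = 0 then c else 0 := by
  have : algebraMap ℝ P.K.Ring⟦X⟧ c = C (algebraMap ℝ P.K.Ring c) :=
    PowerSeries.algebraMap_apply
  rw [this, coeff_C]
  split_ifs
  · exact ev_algebraMap c hz
  · exact ev_zero z

lemma hasTaylor_const (c : ℝ) : P.HasTaylor (fun _ => c) (algebraMap ℝ _ c) := by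
  refine ⟨fun z hz => contDiffWithinAt_const, fun j z hz => ?_⟩
  rw [ev_coeff_algebraMap c j hz]
  rcases j with _ | j
  · simp
  · have h0 : ∀ c : ℝ, ∂ iu (fun _ => c) = fun _ => 0 := fun c => by
      funext p; simp [IsenbergMoncrief.partialDeriv]
    have : ∀ j, (∂ iu)^[j] (fun _ => (0 : ℝ)) = fun _ => 0 := by
      intro j
      induction j with
      | zero => rfl
      | succ j ih => rw [Function.iterate_succ_apply, h0, ih]
    rw [Function.iterate_succ_apply, h0, this]
    simp

lemma HasTaylor.neg (ha : P.HasTaylor F a) : P.HasTaylor (fun p => -F p) (-a) := by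
  have := (hasTaylor_const (P := P) (-1)).mul ha
  simpa using this

lemma HasTaylor.sub (ha : P.HasTaylor F a) (hb : P.HasTaylor G b) :
    P.HasTaylor (fun p => F p - G p) (a - b) := by
  simpa [sub_eq_add_neg] using ha.add hb.neg

lemma HasTaylor.sum {κ : Type*} (s : Finset κ) {F : κ → (Idx d → ℝ) → ℝ} {a : κ → P.K.Ring⟦X⟧}
    (h : ∀ k ∈ s, P.HasTaylor (F k) (a k)) :
    P.HasTaylor (fun p => ∑ k ∈ s, F k p) (∑ k ∈ s, a k) := by
  classical
  induction s using Finset.induction_on with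
  | empty => simpa using hasTaylor_const (P := P) 0
  | insert k s hk ih =>
    simp only [Finset.sum_insert hk]
    exact (h k (Finset.mem_insert_self k s)).add
      (ih fun l hl => h l (Finset.mem_insert_of_mem hl))

lemma HasTaylor.prod {κ : Type*} (s : Finset κ) {F : κ → (Idx d → ℝ) → ℝ} {a : κ → P.K.Ring⟦X⟧}
    (h : ∀ k ∈ s, P.HasTaylor (F k) (a k)) :
    P.HasTaylor (fun p => ∏ k ∈ s, F k p) (∏ k ∈ s, a k) := by
  classical
  induction s using Finset.induction_on with
  | empty => simpa using hasTaylor_const (P := P) 1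
  | insert k s hk ih =>
    simp only [Finset.prod_insert hk]
    exact (h k (Finset.mem_insert_self k s)).mul
      (ih fun l hl => h l (Finset.mem_insert_of_mem hl))

/-- The expansion of a field on the null hypersurface. -/
lemma hasTaylor_proj {f : ℝ × Vec d → ℝ} (hf : ContDiffOn ℝ ∞ f P.K.carrier) :
    P.HasTaylor (fun p => f (proj d p)) (C (P.K.mk' f)) := by
  have hg : P.Good (fun p => f (proj d p)) := fun z hz =>
    (hf _ hz).comp (emb d z) (proj d).contDiff.contDiffWithinAt (fun w hw => hw)
  refine ⟨hg, fun j z hz => ?_⟩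
  rw [coeff_C]
  rcases j with _ | j
  · simp only [Function.iterate_zero, id_eq, if_true, Nat.factorial_zero, Nat.cast_one, one_mul]
    exact (ev_mk hf hz).symm
  · have h0 : P.GermEq (∂ iu (fun p => f (proj d p))) (fun _ => 0) := by
      intro z hz
      filter_upwards [self_mem_nhdsWithin] with q hq
      have h1 : HasFDerivWithinAt (fun p => f (proj d p))
          ((fderivWithin ℝ f P.K.carrier (proj d q)).comp (proj d)) (domain P.I P.U) q :=
        HasFDerivWithinAt.comp q
          (((hf _ hq).differentiableWithinAt (by simp)).hasFDerivWithinAt)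
          (proj d).hasFDerivWithinAt (fun w hw => hw)
      rw [IsenbergMoncrief.partialDeriv, h1.fderivWithin (P.uniqueDiffOn_domain q hq)]
      have : proj d (Pi.single iu 1) = 0 := by
        rw [proj_apply]
        ext <;> simp [xPart]
      simp [this]
    rw [Function.iterate_succ_apply, (h0.iterate j).eval hz]
    have := (hasTaylor_const (P := P) 0).coeff_eq j z hz
    rw [this, map_zero]
    simp [ev_zero]

/-- The expansion of the coordinate `u`. -/
lemma hasTaylor_u : P.HasTaylor (fun p => p iu) X := by
  have hd : ∀ i, ∀ q ∈ domain P.I P.U, ∂ i (fun p => p iu) q = (Pi.single i 1 : Idx d → ℝ) iu := by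
    intro i q hq
    have : HasFDerivWithinAt (fun p : Idx d → ℝ => p iu)
      (ContinuousLinearMap.proj (R := ℝ) (φ := fun _ : Idx d => ℝ) iu) (domain P.I P.U) q :=
      (ContinuousLinearMap.proj (R := ℝ) (φ := fun _ : Idx d => ℝ) iu).hasFDerivWithinAt
    rw [IsenbergMoncrief.partialDeriv, this.fderivWithin (P.uniqueDiffOn_domain q hq)]
    rfl
  refine ⟨fun z hz => (contDiff_apply ℝ ℝ iu).contDiffWithinAt, fun j z hz => ?_⟩
  rw [coeff_X]
  rcases j with _ | j
  · simp [ev_zero, emb_apply, pt]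
  · have h0 : P.GermEq (∂ iu (fun p => p iu)) (fun _ => 1) := by
      intro z hz
      filter_upwards [self_mem_nhdsWithin] with q hq
      rw [hd iu q hq]
      simp
    rw [Function.iterate_succ_apply, (h0.iterate j).eval hz,
      (hasTaylor_const (P := P) 1).coeff_eq j z hz, map_one, coeff_one]
    rcases j with _ | j
    · simp
    · simp [ev_zero]

lemma HasTaylor.pow (ha : P.HasTaylor F a) (n : ℕ) : P.HasTaylor (fun p => F p ^ n) (a ^ n) := by
  simpa using HasTaylor.prod (Finset.range n) (fun _ _ => ha)

/-- Iterated derivatives in `u` at `u = 0` are the coefficients of the expansion. -/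
lemma HasTaylor.iteratedDeriv_eq (ha : P.HasTaylor F a) (j : ℕ) {z : ℝ × Vec d}
    (hz : z ∈ P.K.carrier) :
    iteratedDeriv j (fun u => F (pt u z.1 z.2)) 0 = j.factorial * ev (coeff j a) z := by
  rw [← ha.coeff_eq j z hz]
  have hg := ha.good
  clear ha
  induction j generalizing F with
  | zero => simp [emb_apply]
  | succ j ih =>
    rw [iteratedDeriv_succ', Function.iterate_succ_apply, ← ih (hg.partialDeriv iu)]
    have hline : ∀ u, HasDerivAt (fun u => pt u z.1 z.2) (Pi.single iu 1 : Idx d → ℝ) u := by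
      intro u
      rw [hasDerivAt_pi]
      intro k
      rcases k with k | A
      · fin_cases k
        · exact hasDerivAt_id' u
        · simpa [pt] using hasDerivAt_const u z.1
      · simpa [pt] using hasDerivAt_const u (z.2 A)
    -- The partial derivative is known to be the derivative along the line only near `u = 0`. This
    -- suffices for iterated derivatives at `0`.
    have ht : Tendsto (fun u => pt u z.1 z.2) (𝓝 0) (𝓝[domain P.I P.U] (emb d z)) := by
      refine tendsto_nhdsWithin_iff.mpr ⟨(hline 0).continuousAt.tendsto, ?_⟩
      exact Eventually.of_forall fun u => P.pt_mem hz u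
    apply Filter.EventuallyEq.iteratedDeriv_eq
    filter_upwards [ht.eventually (hg.eventually_diff hz)] with u hu
    have h1 := hu.2.hasFDerivWithinAt.comp_hasDerivWithinAt u (s := Set.univ)
      (hline u).hasDerivWithinAt (fun w _ => P.pt_mem hz w)
    rw [hasDerivWithinAt_univ] at h1
    exact h1.deriv

end Patch

end Taylor

/-! ### Comparison of power series up to a given order -/

section Compare

open PowerSeries

variable {C : Type*} [CommRing C] [Algebra ℝ C]

/-- `a` and `a'` agree below order `i`, and their coefficients of order `i` differ by `q`. -/
def Lin (i : ℕ) (q : C) (a a' : C⟦X⟧) : Prop := ∃ e, a = a' + X ^ i * e ∧ coeff 0 e = q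

/-- `a` and `a'` agree below order `n`. -/
def Eqv (n : ℕ) (a a' : C⟦X⟧) : Prop := ∃ e, a = a' + X ^ n * e

variable {i n : ℕ} {q s : C} {a a' b b' : C⟦X⟧}

lemma Lin.coeff_eq (h : Lin i q a a') : coeff i a = coeff i a' + q := by
  obtain ⟨e, rfl, rfl⟩ := h
  have := coeff_X_pow_mul e i 0
  rw [map_add]
  simpa using this

lemma Lin.congr (h : Lin i q a a') (hq : q = s) : Lin i s a a' := hq ▸ h

lemma eqv_iff : Eqv n a a' ↔ ∀ j < n, coeff j a = coeff j a' := by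
  have h1 : Eqv n a a' ↔ X ^ n ∣ a - a' := by
    constructor
    · rintro ⟨e, rfl⟩
      exact ⟨e, by ring⟩
    · rintro ⟨e, he⟩
      exact ⟨e, by rw [← he]; ring⟩
  rw [h1, X_pow_dvd_iff]
  simp [sub_eq_zero]

lemma Lin.eqv (h : Lin i q a a') : Eqv i a a' := ⟨h.choose, h.choose_spec.1⟩

lemma Eqv.lin (h : Eqv i a a') (hq : coeff i a = coeff i a' + q) : Lin i q a a' := by
  obtain ⟨e, rfl⟩ := h
  refine ⟨e, rfl, ?_⟩
  have := coeff_X_pow_mul e i 0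
  rw [map_add] at hq
  simp only [zero_add] at this
  rw [this] at hq
  exact add_left_cancel hq

lemma Eqv.mono {m : ℕ} (h : Eqv n a a') (hm : m ≤ n) : Eqv m a a' :=
  eqv_iff.mpr fun j hj => eqv_iff.mp h j (by omega)

lemma Eqv.lin_zero (h : Eqv (i + 1) a a') : Lin i 0 a a' :=
  (h.mono (Nat.le_succ i)).lin (by rw [eqv_iff.mp h i (Nat.lt_succ_self i), add_zero])

lemma Eqv.refl (n : ℕ) (a : C⟦X⟧) : Eqv n a a := ⟨0, by simp⟩

lemma Eqv.add (h : Eqv n a a') (h' : Eqv n b b') : Eqv n (a + b) (a' + b') := by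
  obtain ⟨e, rfl⟩ := h
  obtain ⟨f, rfl⟩ := h'
  exact ⟨e + f, by ring⟩

lemma Eqv.neg (h : Eqv n a a') : Eqv n (-a) (-a') := by
  obtain ⟨e, rfl⟩ := h
  exact ⟨-e, by ring⟩

lemma Eqv.sub (h : Eqv n a a') (h' : Eqv n b b') : Eqv n (a - b) (a' - b') := by
  obtain ⟨e, rfl⟩ := h
  obtain ⟨f, rfl⟩ := h'
  exact ⟨e - f, by ring⟩

lemma Eqv.mul (h : Eqv n a a') (h' : Eqv n b b') : Eqv n (a * b) (a' * b') := by
  obtain ⟨e, rfl⟩ := h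
  obtain ⟨f, rfl⟩ := h'
  exact ⟨e * b' + a' * f + X ^ n * e * f, by ring⟩

lemma Eqv.sum {κ : Type*} {t : Finset κ} {f f' : κ → C⟦X⟧} (h : ∀ k ∈ t, Eqv n (f k) (f' k)) :
    Eqv n (∑ k ∈ t, f k) (∑ k ∈ t, f' k) := by
  refine eqv_iff.mpr fun j hj => ?_
  rw [map_sum, map_sum]
  exact Finset.sum_congr rfl fun k hk => eqv_iff.mp (h k hk) j hj

lemma Eqv.mapDer (h : Eqv n a a') (δ : Derivation ℝ C C) : Eqv n (mapDer δ a) (mapDer δ a') :=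
  eqv_iff.mpr fun j hj => by rw [coeff_mapDer, coeff_mapDer, eqv_iff.mp h j hj]

lemma Eqv.dX (h : Eqv (n + 1) a a') : Eqv n (dX C a) (dX C a') :=
  eqv_iff.mpr fun j hj => by rw [coeff_dX, coeff_dX, eqv_iff.mp h (j + 1) (by omega)]

lemma Lin.add (h : Lin i q a a') (h' : Lin i s b b') : Lin i (q + s) (a + b) (a' + b') := by
  obtain ⟨e, rfl, rfl⟩ := h
  obtain ⟨f, rfl, rfl⟩ := h'
  exact ⟨e + f, by ring, map_add _ _ _⟩

lemma Lin.neg (h : Lin i q a a') : Lin i (-q) (-a) (-a') := by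
  obtain ⟨e, rfl, rfl⟩ := h
  exact ⟨-e, by ring, map_neg _ _⟩

lemma Lin.sub (h : Lin i q a a') (h' : Lin i s b b') : Lin i (q - s) (a - b) (a' - b') := by
  obtain ⟨e, rfl, rfl⟩ := h
  obtain ⟨f, rfl, rfl⟩ := h'
  exact ⟨e - f, by ring, map_sub _ _ _⟩

lemma Lin.sum {κ : Type*} {t : Finset κ} {f f' : κ → C⟦X⟧} {q : κ → C}
    (h : ∀ k ∈ t, Lin i (q k) (f k) (f' k)) :
    Lin i (∑ k ∈ t, q k) (∑ k ∈ t, f k) (∑ k ∈ t, f' k) :=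
  (Eqv.sum fun k hk => (h k hk).eqv).lin (by
    rw [map_sum, map_sum, ← Finset.sum_add_distrib]
    exact Finset.sum_congr rfl fun k hk => (h k hk).coeff_eq)

lemma coeff_zero_mul' (a b : C⟦X⟧) : coeff 0 (a * b) = coeff 0 a * coeff 0 b := by
  simp [coeff_mul]

/-- First-order variation of a product. The second factor is allowed to change from order `i + 1`
on, where it no longer affects the coefficient of order `i`. -/
lemma Lin.mul_right (h : Lin i q a a') (h' : Eqv (i + 1) b b') :
    Lin i (q * coeff 0 b) (a * b) (a' * b') := by
  obtain ⟨e, rfl, rfl⟩ := h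
  obtain ⟨f, rfl⟩ := h'
  refine ⟨e * (b' + X ^ (i + 1) * f) + X * (a' * f), by ring, ?_⟩
  rw [map_add, coeff_zero_mul', coeff_zero_X_mul, add_zero]

lemma Lin.mul_left (h' : Eqv (i + 1) b b') (h : Lin i q a a') :
    Lin i (coeff 0 b * q) (b * a) (b' * a') := by
  rw [mul_comm b, mul_comm b', mul_comm _ q]
  exact h.mul_right h'

lemma Lin.const_mul (c : C⟦X⟧) (h : Lin i q a a') : Lin i (coeff 0 c * q) (c * a) (c * a') :=
  Lin.mul_left (Eqv.refl _ _) h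

lemma Eqv.const_mul (c : C⟦X⟧) (h : Eqv n a a') : Eqv n (c * a) (c * a') := (Eqv.refl _ _).mul h

lemma exists_eq_X_mul (h : coeff 0 a = 0) : ∃ c, a = X * c := by
  have : X ∣ a := X_dvd_iff.mpr (by rwa [coeff_zero_eq_constantCoeff_apply] at h)
  exact this

/-- Multiplication by a series without constant term gains one order. -/
lemma Eqv.mul_gain (h0 : coeff 0 b = 0) (hb : Eqv (n + 1) b b') (h : Eqv n a a') :
    Eqv (n + 1) (b * a) (b' * a') := by
  obtain ⟨c, hc⟩ := exists_eq_X_mul h0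
  obtain ⟨e, rfl⟩ := h
  obtain ⟨f, hf⟩ := hb
  have : b' = X * c - X ^ (n + 1) * f := by rw [← hc, hf]; ring
  exact ⟨c * e + a' * f, by rw [hc, this]; ring⟩

/-- A factor starting with `coeff 1 b * u` moves the first difference one order up. This is how
`g^{uu} = -2 u α + ⋯` turns `∂_u g_{AB}` into the zero-order term of the transport equation. -/
lemma Lin.mul_gain (h0 : coeff 0 b = 0) (hb : Eqv (i + 2) b b') (h : Lin i q a a') :
    Lin (i + 1) (coeff 1 b * q) (b * a) (b' * a') := by
  obtain ⟨c, hc⟩ := exists_eq_X_mul h0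
  obtain ⟨e, rfl, rfl⟩ := h
  obtain ⟨f, hf⟩ := hb
  have : b' = X * c - X ^ (i + 2) * f := by rw [← hc, hf]; ring
  refine ⟨c * e + X * (a' * f), by rw [hc, this]; ring, ?_⟩
  rw [map_add, coeff_zero_mul', coeff_zero_X_mul, add_zero, hc]
  congr 1
  exact (coeff_succ_X_mul 0 c).symm

lemma Lin.mapDer (h : Lin i q a a') (δ : Derivation ℝ C C) :
    Lin i (δ q) (mapDer δ a) (mapDer δ a') :=
  (h.eqv.mapDer δ).lin (by rw [coeff_mapDer, coeff_mapDer, h.coeff_eq, map_add])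

lemma Lin.dX (h : Lin (i + 1) q a a') : Lin i (q * (i + 1)) (dX C a) (dX C a') :=
  h.eqv.dX.lin (by rw [coeff_dX, coeff_dX, h.coeff_eq, add_mul])

lemma coeff_zero_half : coeff 0 (half C⟦X⟧) = half C := by
  rw [half, PowerSeries.algebraMap_apply, coeff_zero_C, half]

/-- Inverse matrices of matrices agreeing below order `n` agree below order `n`. -/
lemma eqv_inv {κ : Type*} [Fintype κ] [DecidableEq κ] {h h' k k' : Matrix κ κ C⟦X⟧}
    (hk : k * h = 1) (hk' : k' * h' = 1) (H : ∀ A B, Eqv n (h A B) (h' A B)) (A B : κ) :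
    Eqv n (k A B) (k' A B) := by
  have h2 : h' * k' = 1 := mul_eq_one_comm.mp hk'
  choose E hE using H
  have e1 : h = h' + (X ^ n : C⟦X⟧) • Matrix.of E := by
    ext1 A B
    simp [hE]
  have e2 : k = k' + (X ^ n : C⟦X⟧) • (-(k * Matrix.of E * k')) := by
    calc k = k * (h - (X ^ n : C⟦X⟧) • Matrix.of E) * k' := by
            rw [e1, add_sub_cancel_right, Matrix.mul_assoc, h2, Matrix.mul_one]
      _ = _ := by
            rw [Matrix.mul_sub, hk, Matrix.mul_smul, Matrix.sub_mul, Matrix.one_mul,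
              Matrix.smul_mul, smul_neg, sub_eq_add_neg]
  exact ⟨(-(k * Matrix.of E * k')) A B, congrFun (congrFun e2 A) B⟩

end Compare

/-! ### The Ricci tensor of a formal Isenberg–Moncrief metric -/

section FormalRicci

open PowerSeries

variable {d : ℕ} {P : Patch d}

lemma Eqv.frame_r {n : ℕ} {a a' : P.K.Ring⟦X⟧} (h : Eqv n a a') :
    Eqv n (P.frame ir a) (P.frame ir a') := h.mapDer _

lemma Eqv.frame_x {n : ℕ} {a a' : P.K.Ring⟦X⟧} (h : Eqv n a a') (A : Fin d) :
    Eqv n (P.frame (ix A) a) (P.frame (ix A) a') := h.mapDer _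

lemma Eqv.frame_u {n : ℕ} {a a' : P.K.Ring⟦X⟧} (h : Eqv (n + 1) a a') :
    Eqv n (P.frame iu a) (P.frame iu a') := h.dX

lemma Eqv.frame {n : ℕ} {a a' : P.K.Ring⟦X⟧} (h : Eqv (n + 1) a a') (i : Idx d) :
    Eqv n (P.frame i a) (P.frame i a') := by
  revert i
  rw [forall_idx]
  exact ⟨h.frame_u, (h.mono (Nat.le_succ n)).frame_r, (h.mono (Nat.le_succ n)).frame_x⟩

variable (P) in
/-- The coefficients of a formal Isenberg–Moncrief metric, with `φ = u α` and `b_A = u β_A`. -/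
structure FormalMetric where
  φ : P.K.Ring⟦X⟧
  b : Fin d → P.K.Ring⟦X⟧
  h : Matrix (Fin d) (Fin d) P.K.Ring⟦X⟧
  hi : Matrix (Fin d) (Fin d) P.K.Ring⟦X⟧
  φ_zero : coeff 0 φ = 0
  b_zero : ∀ A, coeff 0 (b A) = 0
  symm : hᵀ = h
  inv : hi * h = 1

namespace FormalMetric

variable (M M' : FormalMetric P)

/-- The metric. -/
def g : Matrix (Idx d) (Idx d) P.K.Ring⟦X⟧ := imMetric M.φ M.b M.h

/-- The inverse metric. -/
def gi : Matrix (Idx d) (Idx d) P.K.Ring⟦X⟧ := imInv M.φ M.b M.hi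

/-- The Christoffel symbols. -/
def Γ : Idx d → Matrix (Idx d) (Idx d) P.K.Ring⟦X⟧ := leviCivita P.frame M.g M.gi

/-- The Ricci tensor. -/
def ric : Idx d → Idx d → P.K.Ring⟦X⟧ := ricciOf P.frame M.Γ

lemma gi_mul_g : M.gi * M.g = 1 := imInv_mul_imMetric M.symm M.inv

lemma isLeviCivita : IsLeviCivita P.frame M.g M.Γ := isLeviCivita_im M.symm M.inv

lemma ric_comm (i j : Idx d) : M.ric i j = M.ric j i :=
  M.isLeviCivita.ricciOf_comm P.frame_comm M.gi_mul_g i j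

lemma trace_Γ (i : Idx d) :
    (M.Γ i).trace = half _ * ∑ A, ∑ B, M.hi A B * P.frame i (M.h A B) :=
  chr_trace M.symm M.inv i

lemma raise_zero (A : Fin d) : coeff 0 (raise M.hi M.b A) = 0 := by
  simp only [raise, map_sum]
  exact Finset.sum_eq_zero fun B _ => by rw [coeff_zero_mul', M.b_zero, mul_zero]

lemma invUU_zero : coeff 0 (invUU M.φ M.b M.hi) = 0 := by
  rw [invUU, map_sub, map_sum, coeff_zero_mul', M.φ_zero, mul_zero, sub_zero]
  exact Finset.sum_eq_zero fun B _ => by rw [coeff_zero_mul', M.b_zero, mul_zero]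

/-- The term quadratic in `b` is of second order in `u`. -/
lemma invUU_one : coeff 1 (invUU M.φ M.b M.hi) = -(2 * coeff 1 M.φ) := by
  have h1 : ∀ A, coeff 1 (raise M.hi M.b A * M.b A) = 0 := by
    intro A
    obtain ⟨c, hc⟩ := exists_eq_X_mul (M.raise_zero A)
    rw [hc, mul_assoc, coeff_succ_X_mul 0, coeff_zero_mul', M.b_zero, mul_zero]
  rw [invUU, map_sub, map_sum, Finset.sum_eq_zero fun A _ => h1 A, zero_sub]
  congr 1
  rw [two_mul, two_mul, map_add]

variable {M M'}

section

variable {n : ℕ} (hφ : Eqv (n + 1) M.φ M'.φ) (hb : ∀ A, Eqv (n + 1) (M.b A) (M'.b A))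
  (hh : ∀ A B, Eqv n (M.h A B) (M'.h A B))

include hh in
lemma eqv_hi (A B : Fin d) : Eqv n (M.hi A B) (M'.hi A B) := eqv_inv M.inv M'.inv hh A B

-- Since `b` vanishes at `u = 0`, agreement of `h` to one order less than that of `b` is enough.
include hb hh in
lemma eqv_raise (A : Fin d) : Eqv (n + 1) (raise M.hi M.b A) (raise M'.hi M'.b A) :=
  Eqv.sum fun B _ => by
    rw [mul_comm (M.hi A B), mul_comm (M'.hi A B)]
    exact Eqv.mul_gain (M.b_zero B) (hb B) (eqv_hi hh A B)

include hφ hb hh in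
lemma eqv_invUU : Eqv (n + 1) (invUU M.φ M.b M.hi) (invUU M'.φ M'.b M'.hi) :=
  (Eqv.sum fun A _ => (eqv_raise hb hh A).mul (hb A)).sub (hφ.const_mul _)

end

/-- The `AB` components of the Ricci tensor: dependence upon the coefficients of `g_{AB}`. -/
lemma lin_ric_xx {i : ℕ} {q : Fin d → Fin d → P.K.Ring}
    (hφ : Eqv (i + 2) M.φ M'.φ) (hb : ∀ A, Eqv (i + 2) (M.b A) (M'.b A))
    (hh : ∀ A B, Lin (i + 1) (q A B) (M.h A B) (M'.h A B)) (A B : Fin d) :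
    let δ := dirDeriv (K := P.K) ((1 : ℝ), (0 : Vec d))
    let c := half P.K.Ring
    let p : Fin d → Fin d → P.K.Ring := fun A B => q A B * (i + 1)
    let k : Fin d → Fin d → P.K.Ring := fun A B => coeff 0 (M.hi A B)
    let g' : Fin d → Fin d → P.K.Ring := fun A B => δ (coeff 0 (M.h A B))
    coeff i (M.ric (ix A) (ix B)) = coeff i (M'.ric (ix A) (ix B))
      + ((-(c * (-(2 * coeff 1 M.φ) * p A B)) + c * δ (q A B)) * (i + 1) + δ (c * p A B)
        + (c * ∑ C, ∑ E, k C E * p C E) * (c * g' A B) + (c * ∑ C, ∑ E, k C E * g' C E) * (c * p A B)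
        - (∑ C, (c * g' B C) * (c * ∑ E, k C E * p A E)
          + ∑ C, (c * p B C) * (c * ∑ E, k C E * g' A E)
          + ∑ C, ((c * ∑ E, k C E * p B E) * (c * g' A C)
            + (c * ∑ E, k C E * g' B E) * (c * p A C)))) := by
  intro δ c p k g'
  have hh1 : ∀ A B, Eqv (i + 1) (M.h A B) (M'.h A B) := fun A B => (hh A B).eqv
  have hi1 := eqv_hi hh1
  have hφ1 := hφ.mono (Nat.le_succ (i + 1))
  have hb1 := fun A => (hb A).mono (Nat.le_succ (i + 1))
  have hr := eqv_raise hb hh1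
  have hr1 := fun A => (hr A).mono (Nat.le_succ (i + 1))
  have hψ := eqv_invUU hφ hb hh1
  have hψ1 := hψ.mono (Nat.le_succ (i + 1))
  have hp : ∀ A B, Lin i (p A B) (P.frame iu (M.h A B)) (P.frame iu (M'.h A B)) :=
    fun A B => (hh A B).dX
  have hbu := fun A => (hb A).frame_u
  have hφu := hφ.frame_u
  -- Christoffel symbols
  have Γuux : ∀ A, Eqv (i + 1) (M.Γ iu iu (ix A)) (M'.Γ iu iu (ix A)) := fun A => by
    simp only [Γ, g, gi, chr_u_u_x]
    exact ((hbu A).const_mul _).neg.add (Eqv.const_mul _ (Eqv.sum fun C _ =>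
      Eqv.mul_gain (M.raise_zero C) (hr1 C) (hp A C).eqv))
  have Γuxx : ∀ A B, Lin i (c * ∑ C, k A C * p B C) (M.Γ iu (ix A) (ix B))
      (M'.Γ iu (ix A) (ix B)) := fun A B => by
    simp only [Γ, g, gi, chr_u_x_x]
    have := Lin.const_mul (half P.K.Ring⟦X⟧)
      (Lin.sum (t := Finset.univ) fun C _ => Lin.mul_left (hi1 A C) (hp B C))
    rwa [coeff_zero_half] at this
  have Γrrx : ∀ A, Eqv (i + 1) (M.Γ ir ir (ix A)) (M'.Γ ir ir (ix A)) := fun A => by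
    simp only [Γ, g, gi, chr_r_r_x]
    exact (hbu A).const_mul _
  have Γxrx : ∀ A B, Lin i (c * p A B) (M.Γ (ix A) ir (ix B)) (M'.Γ (ix A) ir (ix B)) :=
    fun A B => by
      simp only [Γ, g, gi, chr_x_r_x]
      have := Lin.const_mul (half P.K.Ring⟦X⟧) (hp A B)
      rwa [coeff_zero_half] at this
  have Γrxx : ∀ A B, Eqv (i + 1) (M.Γ ir (ix B) (ix A)) (M'.Γ ir (ix B) (ix A)) := fun A B => by
    simp only [Γ, g, gi, chr_r_x_x]
    exact (((hr1 B).mul (hbu A)).const_mul _).neg.add (Eqv.const_mul _ (Eqv.sum fun C _ =>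
      (hi1 B C).mul (((hh1 A C).frame_r.add ((hb1 C).frame_x A)).sub ((hb1 A).frame_x C))))
  -- `R_AB` contains `∂_u Γ^u_{AB}`, so this symbol is needed to order `i + 1`. Two terms contribute
  -- there: `g^{uu} ∂_u h`, by gain of one order, giving the term with `α`; and `½ ∂_r h`.
  have Γxux : ∀ A B, Lin (i + 1) (-(c * (-(2 * coeff 1 M.φ) * p A B)) + c * δ (q A B))
      (M.Γ (ix A) iu (ix B)) (M'.Γ (ix A) iu (ix B)) := fun A B => by
    simp only [Γ, g, gi, chr_x_u_x]
    have h1 := Lin.const_mul (half P.K.Ring⟦X⟧) (Lin.mul_gain M.invUU_zero hψ (hp A B))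
    have h2 := Lin.const_mul (half P.K.Ring⟦X⟧)
      (Lin.sub (((hb B).frame_x A).add ((hb A).frame_x B)).lin_zero ((hh A B).mapDer δ))
    have h3 := (Eqv.const_mul (half P.K.Ring⟦X⟧)
      (Eqv.sum (t := Finset.univ) fun C _ => Eqv.mul_gain (M.raise_zero C) (hr C)
      ((((hh1 B C).frame_x A).add ((hh1 A C).frame_x B)).sub ((hh1 A B).frame_x C)))).lin_zero
    rw [coeff_zero_half] at h1 h2
    rw [M.invUU_one] at h1
    exact ((h1.neg.sub h2).add h3).congr (by ring)
  have Γxxx : ∀ A B C, Eqv (i + 1) (M.Γ (ix A) (ix C) (ix B)) (M'.Γ (ix A) (ix C) (ix B)) :=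
    fun A B C => by
      simp only [Γ, g, gi, chr_x_x_x]
      exact (Eqv.const_mul _ (Eqv.mul_gain (M.raise_zero C) (hr1 C) (hp A B).eqv)).neg.add
        (Eqv.const_mul _ (Eqv.sum fun E _ => (hi1 C E).mul
          ((((hh1 B E).frame_x A).add ((hh1 A E).frame_x B)).sub ((hh1 A B).frame_x E))))
  have τu : Lin i (c * ∑ C, ∑ E, k C E * p C E) (M.Γ iu).trace (M'.Γ iu).trace := by
    simp only [trace_Γ]
    have := Lin.const_mul (half P.K.Ring⟦X⟧) (Lin.sum (t := Finset.univ) fun C _ =>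
      (Lin.sum (t := Finset.univ) fun E _ => Lin.mul_left (hi1 C E) (hp C E)))
    rwa [coeff_zero_half] at this
  have τr : Eqv (i + 1) (M.Γ ir).trace (M'.Γ ir).trace := by
    simp only [trace_Γ]
    exact Eqv.const_mul _ (Eqv.sum fun C _ => Eqv.sum fun E _ => (hi1 C E).mul (hh1 C E).frame_r)
  have τx : ∀ A, Eqv (i + 1) (M.Γ (ix A)).trace (M'.Γ (ix A)).trace := fun A => by
    simp only [trace_Γ]
    exact Eqv.const_mul _ (Eqv.sum fun C _ => Eqv.sum fun E _ =>
      (hi1 C E).mul ((hh1 C E).frame_x A))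
  have ts := M.isLeviCivita.torsion
  have ts' := M'.isLeviCivita.torsion
  have zr : ∀ A, Eqv (i + 1) (M.Γ (ix A) ir iu) (M'.Γ (ix A) ir iu) := fun A => by
    rw [ts, ts', Γ, Γ, g, g, gi, gi, chr_u_r, chr_u_r]; exact Eqv.refl _ _
  have Γxuu : ∀ A, Eqv (i + 1) (M.Γ (ix A) iu iu) (M'.Γ (ix A) iu iu) := fun A => by
    rw [ts, ts']; exact Γuux A
  have Γxxu : ∀ A B, Lin i (c * ∑ C, k A C * p B C) (M.Γ (ix B) (ix A) iu)
      (M'.Γ (ix B) (ix A) iu) := fun A B => by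
    rw [ts, ts']; exact Γuxx A B
  have Γxrr : ∀ A, Eqv (i + 1) (M.Γ (ix A) ir ir) (M'.Γ (ix A) ir ir) := fun A => by
    rw [ts, ts']; exact Γrrx A
  have Γxxr : ∀ A B, Eqv (i + 1) (M.Γ (ix A) (ix B) ir) (M'.Γ (ix A) (ix B) ir) := fun A B => by
    rw [ts, ts']; exact Γrxx A B
  have Γxur : ∀ A, Eqv (i + 1) (M.Γ (ix A) iu ir) (M'.Γ (ix A) iu ir) := fun A => by
    rw [ts, ts']
    simp only [Γ, g, gi, chr_r_u_x]
    exact ((((hψ1.mul (hbu A)).const_mul _).neg).sub (hφ1.frame_x A)).add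
      (Eqv.const_mul _ (Eqv.sum fun C _ => (hr1 C).mul
        (((hh1 A C).frame_r.add ((hb1 C).frame_x A)).sub ((hb1 A).frame_x C))))
  have Γxux' := fun A B => (Γxux A B).eqv
  -- values on the hypersurface
  have v1 : ∀ A B, coeff 0 (M.Γ (ix A) iu (ix B)) = c * g' A B := fun A B => by
    simp only [Γ, g, gi, chr_x_u_x, map_add, map_sub, map_neg, coeff_zero_mul', M.invUU_zero,
      map_sum, M.raise_zero, Patch.frame_r, Patch.frame_x, coeff_mapDer, M.b_zero, map_zero,
      coeff_zero_half]
    simp [c, g', δ]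
  have v2 : ∀ A B, coeff 0 (M.Γ (ix A) (ix B) ir) = c * ∑ E, k B E * g' A E := fun A B => by
    rw [ts]
    simp only [Γ, g, gi, chr_r_x_x, map_add, map_sub, map_neg, coeff_zero_mul',
      map_sum, M.raise_zero, Patch.frame_r, Patch.frame_x, coeff_mapDer, M.b_zero, map_zero,
      coeff_zero_half]
    simp [c, g', δ, k]
  have v3 : coeff 0 (M.Γ ir).trace = c * ∑ C, ∑ E, k C E * g' C E := by
    simp only [trace_Γ, coeff_zero_mul', map_sum, coeff_zero_half, Patch.frame_r, coeff_mapDer]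
    rfl
  apply Lin.coeff_eq
  simp only [ric]
  rw [ricciOf_split _ ts, ricciOf_split _ ts']
  -- Term by term along `ricciOf_split`. At order `i` only `∂_u Γ^u_{AB}`, `∂_r Γ^r_{AB}` and
  -- products with one factor `Γ^r_{AB}`, `Γ^A_{uB}` or the trace of `Γ_u` change; all other terms
  -- agree to order `i + 1`.
  have H := (((((Γxux A B).dX).add ((Γxrx A B).mapDer δ)).add
      (Eqv.sum (t := Finset.univ) fun C _ => (Γxxx A B C).frame_x C).lin_zero).sub
      ((τx A).frame_x B).lin_zero).add
      (((τu.mul_right (Γxux' A B)).add (Lin.mul_left τr (Γxrx A B))).add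
        (Eqv.sum (t := Finset.univ) fun C _ => (τx C).mul (Γxxx A B C)).lin_zero) |>.sub
      ((((((Γxuu B).mul (Γxuu A)).lin_zero).add ((Γxur B).mul (zr A)).lin_zero).add
          (Lin.sum (t := Finset.univ) fun C _ => Lin.mul_left (Γxux' B C) (Γxxu C A))).add
        ((((zr B).mul (Γxur A)).lin_zero.add ((Γxrr B).mul (Γxrr A)).lin_zero).add
          (Lin.sum (t := Finset.univ) fun C _ => (Γxrx B C).mul_right (Γxxr A C))) |>.add
        (Lin.sum (t := Finset.univ) fun C _ =>
          (((Γxxu C B).mul_right (Γxux' A C)).add (Lin.mul_left (Γxxr B C) (Γxrx A C))).add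
            (Eqv.sum (t := Finset.univ) fun E _ => (Γxxx B E C).mul (Γxxx A C E)).lin_zero))
  simp only [v1, v2, v3, add_zero, zero_add, sub_zero] at H
  exact H.congr (by ring)

/-- One derivative costs one order. The inverse metric enters undifferentiated and is only needed to
order `n`. -/
lemma eqv_Γ {n : ℕ} (hφ : Eqv (n + 1) M.φ M'.φ) (hb : ∀ A, Eqv (n + 1) (M.b A) (M'.b A))
    (hh : ∀ A B, Eqv (n + 1) (M.h A B) (M'.h A B)) (i k j : Idx d) :
    Eqv n (M.Γ i k j) (M'.Γ i k j) := by
  have hφ0 := hφ.mono (Nat.le_succ n)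
  have hb0 := fun A => (hb A).mono (Nat.le_succ n)
  have hh0 := fun A B => (hh A B).mono (Nat.le_succ n)
  have hg : ∀ i j, Eqv (n + 1) (M.g i j) (M'.g i j) := by
    simp only [forall_idx, g, imMetric_uu, imMetric_ur, imMetric_ru, imMetric_rr, imMetric_ux,
      imMetric_xu, imMetric_rx, imMetric_xr, imMetric_xx]
    exact ⟨⟨Eqv.refl _ _, Eqv.refl _ _, fun _ => Eqv.refl _ _⟩,
      ⟨Eqv.refl _ _, hφ.const_mul _, hb⟩, fun A => ⟨Eqv.refl _ _, hb A, hh A⟩⟩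
  have hgi : ∀ i j, Eqv n (M.gi i j) (M'.gi i j) := by
    have hr := fun A => (eqv_raise hb hh0 A).mono (Nat.le_succ n)
    have hψ := (eqv_invUU hφ hb hh0).mono (Nat.le_succ n)
    simp only [forall_idx, gi, imInv_uu, imInv_ur, imInv_ru, imInv_rr, imInv_ux,
      imInv_xu, imInv_rx, imInv_xr, imInv_xx]
    exact ⟨⟨hψ, Eqv.refl _ _, hr⟩, ⟨Eqv.refl _ _, Eqv.refl _ _, fun _ => Eqv.refl _ _⟩,
      fun A => ⟨hr A, Eqv.refl _ _, eqv_hi hh0 A⟩⟩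
  exact Eqv.const_mul _ (Eqv.sum fun l _ => (hgi k l).mul
      (((hg _ _).frame _).add ((hg _ _).frame _) |>.sub ((hg _ _).frame _)))

lemma eqv_trace_Γ {n : ℕ} (hφ : Eqv (n + 1) M.φ M'.φ) (hb : ∀ A, Eqv (n + 1) (M.b A) (M'.b A))
    (hh : ∀ A B, Eqv (n + 1) (M.h A B) (M'.h A B)) (i : Idx d) :
    Eqv n (M.Γ i).trace (M'.Γ i).trace :=
  Eqv.sum fun k _ => eqv_Γ hφ hb hh i k k

/-- The `u j` components of the Ricci tensor, up to terms containing fewer derivatives. -/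
lemma lin_ric_u {i : ℕ} {q : P.K.Ring} (hφ : Eqv (i + 2) M.φ M'.φ)
    (hb : ∀ A, Eqv (i + 2) (M.b A) (M'.b A))
    (hh : ∀ A B, Eqv (i + 2) (M.h A B) (M'.h A B)) (j : Idx d) (hj : j ≠ iu)
    (hq : Lin (i + 1) q (M.Γ iu iu j) (M'.Γ iu iu j)) :
    coeff i (M.ric iu j) = coeff i (M'.ric iu j) + q * (i + 1) := by
  have hΓ := eqv_Γ hφ hb hh
  have hτ := eqv_trace_Γ hφ hb hh
  have ts := M.isLeviCivita.torsion
  have ts' := M'.isLeviCivita.torsion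
  apply Lin.coeff_eq
  simp only [ric]
  rw [ricciOf_split _ ts, ricciOf_split _ ts']
  -- Here `j ≠ iu` is essential: the derivative of the trace is then tangential and loses no order,
  -- so that the trace of `Γ_u`, which contains `∂_u h`, does not contribute.
  have hjd : Eqv (i + 1) (P.frame j (M.Γ iu).trace) (P.frame j (M'.Γ iu).trace) := by
    revert hj
    revert j
    rw [forall_idx]
    exact ⟨fun _ h => absurd rfl h, fun _ _ => (hτ iu).frame_r, fun A _ _ => (hτ iu).frame_x A⟩
  have H := ((((hq.dX).add ((hΓ iu ir j).frame_r).lin_zero).add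
      (Eqv.sum (t := Finset.univ) fun C _ => (hΓ iu (ix C) j).frame_x C).lin_zero).sub
      hjd.lin_zero).add
      (((((hτ iu).mul (hΓ iu iu j)).add ((hτ ir).mul (hΓ iu ir j))).add
        (Eqv.sum (t := Finset.univ) fun C _ => (hτ (ix C)).mul (hΓ iu (ix C) j))).lin_zero) |>.sub
      ((((((hΓ j iu iu).mul (hΓ iu iu iu)).add ((hΓ j iu ir).mul (hΓ iu ir iu))).add
          (Eqv.sum (t := Finset.univ) fun C _ => (hΓ j iu (ix C)).mul (hΓ iu (ix C) iu))).add
        ((((hΓ j ir iu).mul (hΓ iu iu ir)).add ((hΓ j ir ir).mul (hΓ iu ir ir))).add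
          (Eqv.sum (t := Finset.univ) fun C _ => (hΓ j ir (ix C)).mul (hΓ iu (ix C) ir)))).add
        (Eqv.sum (t := Finset.univ) fun C _ =>
          (((hΓ j (ix C) iu).mul (hΓ iu iu (ix C))).add
            ((hΓ j (ix C) ir).mul (hΓ iu ir (ix C)))).add
            (Eqv.sum (t := Finset.univ) fun E _ =>
              (hΓ j (ix C) (ix E)).mul (hΓ iu (ix E) (ix C))))).lin_zero
  exact H.congr (by ring)

/-- The `ur` component of the Ricci tensor: dependence upon the coefficients of `φ`. -/
lemma lin_ric_ur {i : ℕ} {q : P.K.Ring} (hφ : Lin (i + 2) q M.φ M'.φ)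
    (hb : ∀ A, Eqv (i + 2) (M.b A) (M'.b A)) (hh : ∀ A B, Eqv (i + 2) (M.h A B) (M'.h A B)) :
    coeff i (M.ric iu ir) = coeff i (M'.ric iu ir) - q * ((i + 2) * (i + 1)) := by
  -- Only `-∂_u φ` in `Γ^u_{ur}` sees the coefficient of order `i + 2`, which yields the factor `i +
  -- 2`; the sum with `b^A` gains an order. The outer `∂_u` in `R_ur` contributes the factor `i +
  -- 1`.
  have hq : Lin (i + 1) (-(q * (i + 2))) (M.Γ iu iu ir) (M'.Γ iu iu ir) := by
    have hr := eqv_raise (n := i + 1) hb (fun A B => (hh A B).mono (Nat.le_succ _))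
    simp only [Γ, g, gi, chr_u_u_r]
    have h1 := (hφ.dX.neg).add (Eqv.const_mul (half P.K.Ring⟦X⟧)
      (Eqv.sum (t := Finset.univ) fun C _ => Eqv.mul_gain (M.raise_zero C) (hr C)
        (hb C).frame_u)).lin_zero
    exact h1.congr (by push_cast; ring)
  rw [lin_ric_u hφ.eqv hb hh ir (by simp) hq]
  ring

/-- The `uA` component of the Ricci tensor: dependence upon the coefficients of `b_A`. -/
lemma lin_ric_ux {i : ℕ} {q : Fin d → P.K.Ring} (hφ : Eqv (i + 2) M.φ M'.φ)
    (hb : ∀ A, Lin (i + 2) (q A) (M.b A) (M'.b A)) (hh : ∀ A B, Eqv (i + 2) (M.h A B) (M'.h A B))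
    (A : Fin d) :
    coeff i (M.ric iu (ix A)) = coeff i (M'.ric iu (ix A))
      - half P.K.Ring * q A * ((i + 2) * (i + 1)) := by
  have hq : Lin (i + 1) (-(half P.K.Ring * q A * (i + 2))) (M.Γ iu iu (ix A))
      (M'.Γ iu iu (ix A)) := by
    have hr := eqv_raise (n := i + 1) (fun A => (hb A).eqv)
      (fun A B => (hh A B).mono (Nat.le_succ _))
    simp only [Γ, g, gi, chr_u_u_x]
    have h1 := ((hb A).dX.const_mul (half P.K.Ring⟦X⟧)).neg.add
      (Eqv.const_mul (half P.K.Ring⟦X⟧)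
      (Eqv.sum (t := Finset.univ) fun C _ => Eqv.mul_gain (M.raise_zero C) (hr C)
        (hh A C).frame_u)).lin_zero
    refine h1.congr ?_
    rw [coeff_zero_half]
    push_cast
    ring
  rw [lin_ric_u hφ (fun A => (hb A).eqv) hh (ix A) (by simp) hq]
  ring

/-! #### Components tangential to the null hypersurface -/

section Tangential

variable (M)

local notation "δ" => dirDeriv (K := P.K) ((1 : ℝ), (0 : Vec d))
local notation "ε" A => dirDeriv (K := P.K) ((0 : ℝ), (EuclideanSpace.single A (1 : ℝ) : Vec d))
local notation "𝔥" => half P.K.Ring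

lemma coeff_zero_frame_u (a : P.K.Ring⟦X⟧) : coeff 0 (P.frame iu a) = coeff 1 a := by
  rw [Patch.frame_u, coeff_dX]
  simp

lemma coeff_zero_frame_r (a : P.K.Ring⟦X⟧) : coeff 0 (P.frame ir a) = δ (coeff 0 a) := by
  rw [Patch.frame_r, coeff_mapDer]

lemma coeff_zero_frame_x (a : P.K.Ring⟦X⟧) (A : Fin d) :
    coeff 0 (P.frame (ix A) a) = (ε A) (coeff 0 a) := by
  rw [Patch.frame_x, coeff_mapDer]

lemma coeff_one_mul (a b : P.K.Ring⟦X⟧) :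
    coeff 1 (a * b) = coeff 0 a * coeff 1 b + coeff 1 a * coeff 0 b := by
  rw [coeff_mul, Finset.Nat.sum_antidiagonal_eq_sum_range_succ_mk]
  simp [Finset.sum_range_succ]

lemma coeff_one_half : coeff 1 (half P.K.Ring⟦X⟧) = 0 := by
  rw [half, PowerSeries.algebraMap_apply, coeff_C]
  simp

lemma coeff_one_frame_r (a : P.K.Ring⟦X⟧) : coeff 1 (P.frame ir a) = δ (coeff 1 a) := by
  rw [Patch.frame_r, coeff_mapDer]

lemma coeff_one_frame_x (a : P.K.Ring⟦X⟧) (A : Fin d) :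
    coeff 1 (P.frame (ix A) a) = (ε A) (coeff 1 a) := by
  rw [Patch.frame_x, coeff_mapDer]

lemma raise_one (A : Fin d) :
    coeff 1 (raise M.hi M.b A) = ∑ B, coeff 0 (M.hi A B) * coeff 1 (M.b B) := by
  simp only [raise, map_sum, coeff_one_mul, M.b_zero, mul_zero, add_zero]

lemma hi_symm (A B : Fin d) : M.hi A B = M.hi B A := by
  conv_lhs => rw [← inv_transpose M.symm M.inv]
  rfl

lemma coeff_zero_Γ_uur : coeff 0 (M.Γ iu iu ir) = -coeff 1 M.φ := by
  simp [Γ, g, gi, chr_u_u_r, coeff_zero_frame_u, coeff_zero_mul', map_sum, M.raise_zero,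
    -coeff_zero_eq_constantCoeff]

lemma coeff_zero_Γ_uxr (A : Fin d) : coeff 0 (M.Γ iu (ix A) ir)
    = 𝔥 * ∑ B, coeff 0 (M.hi A B) * coeff 1 (M.b B) := by
  simp [Γ, g, gi, chr_u_x_r, coeff_zero_frame_u, coeff_zero_mul', map_sum, coeff_zero_half,
    -coeff_zero_eq_constantCoeff]

lemma coeff_zero_Γ_uux (A : Fin d) : coeff 0 (M.Γ iu iu (ix A)) = -(𝔥 * coeff 1 (M.b A)) := by
  simp [Γ, g, gi, chr_u_u_x, coeff_zero_frame_u, coeff_zero_mul', map_sum, coeff_zero_half,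
    M.raise_zero, -coeff_zero_eq_constantCoeff]

lemma coeff_zero_Γ_rrr : coeff 0 (M.Γ ir ir ir) = coeff 1 M.φ := by
  simp [Γ, g, gi, chr_r_r_r, coeff_zero_frame_u, -coeff_zero_eq_constantCoeff]

lemma coeff_zero_Γ_rrx (A : Fin d) : coeff 0 (M.Γ ir ir (ix A)) = 𝔥 * coeff 1 (M.b A) := by
  simp [Γ, g, gi, chr_r_r_x, coeff_zero_frame_u, coeff_zero_mul', coeff_zero_half,
    -coeff_zero_eq_constantCoeff]

lemma coeff_zero_Γ_rur : coeff 0 (M.Γ ir iu ir) = 0 := by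
  simp [Γ, g, gi, chr_r_u_r, coeff_zero_mul', M.invUU_zero, coeff_zero_frame_r, M.φ_zero,
    map_sum, M.raise_zero, -coeff_zero_eq_constantCoeff]

lemma coeff_one_Γ_rur : coeff 1 (M.Γ ir iu ir)
    = 2 * coeff 1 M.φ * coeff 1 M.φ - δ (coeff 1 M.φ) := by
  simp [Γ, g, gi, chr_r_u_r, coeff_one_mul, M.invUU_zero, coeff_one_frame_r, M.φ_zero,
    map_sum, M.raise_zero, M.invUU_one, coeff_zero_frame_u, coeff_zero_frame_r,
    coeff_zero_frame_x, M.b_zero, -coeff_zero_eq_constantCoeff]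

lemma coeff_zero_Γ_rxr (A : Fin d) : coeff 0 (M.Γ ir (ix A) ir) = 0 := by
  simp [Γ, g, gi, chr_r_x_r, coeff_zero_mul', coeff_zero_frame_r, M.φ_zero, M.b_zero,
    map_sum, M.raise_zero, coeff_zero_frame_x, -coeff_zero_eq_constantCoeff]

lemma coeff_zero_Γ_rux (A : Fin d) : coeff 0 (M.Γ ir iu (ix A)) = 0 := by
  simp [Γ, g, gi, chr_r_u_x, coeff_zero_mul', M.invUU_zero, coeff_zero_frame_x, M.φ_zero,
    map_sum, M.raise_zero, -coeff_zero_eq_constantCoeff]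

lemma coeff_one_Γ_rux (A : Fin d) : coeff 1 (M.Γ ir iu (ix A))
    = 𝔥 * (2 * coeff 1 M.φ * coeff 1 (M.b A)) - (ε A) (coeff 1 M.φ)
      + 𝔥 * ∑ C, (∑ B, coeff 0 (M.hi C B) * coeff 1 (M.b B)) * δ (coeff 0 (M.h A C)) := by
  simp [Γ, g, gi, chr_r_u_x, coeff_one_mul, coeff_zero_mul', M.invUU_zero, M.φ_zero,
    map_sum, M.raise_zero, M.invUU_one, coeff_zero_frame_u, coeff_zero_frame_r, coeff_zero_half,
    coeff_one_half, coeff_one_frame_x, M.raise_one, coeff_zero_frame_x, M.b_zero,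
    -coeff_zero_eq_constantCoeff]

lemma coeff_zero_Γ_rxx (A B : Fin d) : coeff 0 (M.Γ ir (ix B) (ix A))
    = 𝔥 * ∑ C, coeff 0 (M.hi B C) * δ (coeff 0 (M.h A C)) := by
  simp [Γ, g, gi, chr_r_x_x, coeff_zero_mul', M.raise_zero, coeff_zero_frame_r,
    coeff_zero_frame_x, M.b_zero, coeff_zero_half, map_sum, -coeff_zero_eq_constantCoeff]

lemma coeff_zero_Γ_xux (A B : Fin d) : coeff 0 (M.Γ (ix A) iu (ix B))
    = 𝔥 * δ (coeff 0 (M.h A B)) := by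
  simp [Γ, g, gi, chr_x_u_x, coeff_zero_mul', M.raise_zero, M.invUU_zero, coeff_zero_frame_r,
    coeff_zero_frame_x, M.b_zero, coeff_zero_half, map_sum, -coeff_zero_eq_constantCoeff]

lemma coeff_zero_Γ_xxx (A B C : Fin d) : coeff 0 (M.Γ (ix A) (ix C) (ix B))
    = 𝔥 * ∑ E, coeff 0 (M.hi C E) * ((ε A) (coeff 0 (M.h B E)) + (ε B) (coeff 0 (M.h A E))
      - (ε E) (coeff 0 (M.h A B))) := by
  simp [Γ, g, gi, chr_x_x_x, coeff_zero_mul', M.raise_zero,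
    coeff_zero_frame_x, coeff_zero_half, map_sum, -coeff_zero_eq_constantCoeff]

lemma coeff_zero_trace_r : coeff 0 (M.Γ ir).trace
    = 𝔥 * ∑ A, ∑ B, coeff 0 (M.hi A B) * δ (coeff 0 (M.h A B)) := by
  simp [trace_Γ, coeff_zero_mul', coeff_zero_half, map_sum, coeff_zero_frame_r,
    -coeff_zero_eq_constantCoeff]

lemma coeff_zero_trace_x (C : Fin d) : coeff 0 (M.Γ (ix C)).trace
    = 𝔥 * ∑ A, ∑ B, coeff 0 (M.hi A B) * (ε C) (coeff 0 (M.h A B)) := by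
  simp [trace_Γ, coeff_zero_mul', coeff_zero_half, map_sum, coeff_zero_frame_x,
    -coeff_zero_eq_constantCoeff]

/-- The part of `R_{rA}` on the null hypersurface which does not involve `β`. -/
def sourceRX (A : Fin d) : P.K.Ring :=
  -((ε A) (coeff 1 M.φ)) + ∑ C, (ε C) (coeff 0 (M.Γ ir (ix C) (ix A)))
    - (ε A) (coeff 0 (M.Γ ir).trace)
    + ∑ C, coeff 0 (M.Γ (ix C)).trace * coeff 0 (M.Γ ir (ix C) (ix A))
    - ∑ C, ∑ E, coeff 0 (M.Γ (ix A) (ix C) (ix E)) * coeff 0 (M.Γ ir (ix E) (ix C))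

/-- The equation is of transport type because two groups of terms cancel. Those of the form `α β_A`
from `∂_u Γ^u_{rA}` and from the products of Christoffel symbols add up to zero. Those of the form
`X_A^C β_C` appear with the coefficient `½` in `∂_u Γ^u_{rA}` and `-¼` in each of `Γ^u_{AC}
Γ^C_{ru}` and `Γ^C_{Ar} Γ^r_{rC}` (the sums `e1`, `e2`). -/
lemma ric_rx (A : Fin d) : coeff 0 (M.ric ir (ix A)) = 𝔥 * δ (coeff 1 (M.b A))
    + coeff 0 (M.Γ ir).trace * (𝔥 * coeff 1 (M.b A)) + M.sourceRX A := by
  have ts := M.isLeviCivita.torsion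
  have e1 : ∑ C, coeff 0 (M.Γ (ix A) iu (ix C)) * coeff 0 (M.Γ ir (ix C) iu)
      = 𝔥 * (𝔥 * ∑ C, (∑ B, coeff 0 (M.hi C B) * coeff 1 (M.b B)) * δ (coeff 0 (M.h A C))) := by
    simp only [Finset.mul_sum]
    refine Finset.sum_congr rfl fun C _ => ?_
    rw [coeff_zero_Γ_xux, ts ir, coeff_zero_Γ_uxr]
    simp only [Finset.mul_sum, Finset.sum_mul]
    exact Finset.sum_congr rfl fun B _ => by ring
  have e2 : ∑ C, coeff 0 (M.Γ (ix A) (ix C) ir) * coeff 0 (M.Γ ir ir (ix C))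
      = 𝔥 * (𝔥 * ∑ C, (∑ B, coeff 0 (M.hi C B) * coeff 1 (M.b B)) * δ (coeff 0 (M.h A C))) := by
    simp only [ts (ix A) _ ir, coeff_zero_Γ_rxx, coeff_zero_Γ_rrx, Finset.mul_sum,
      Finset.sum_mul]
    rw [Finset.sum_comm]
    refine Finset.sum_congr rfl fun C _ => Finset.sum_congr rfl fun B _ => ?_
    rw [M.hi_symm B C]
    ring
  rw [ric, ricciOf_split _ ts]
  simp only [map_add, map_sub, map_sum, coeff_zero_mul', coeff_zero_frame_u, coeff_zero_frame_r,
    coeff_zero_frame_x, coeff_one_Γ_rux, coeff_zero_Γ_rux, coeff_zero_Γ_rrx,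
    ts (ix A) _ iu, ts (ix A) _ ir, coeff_zero_Γ_rrr, coeff_zero_Γ_rxr,
    show ∀ k, M.Γ iu ir k = 0 from fun k => by simp only [Γ, g, gi, chr_u_r], map_zero,
    Finset.sum_add_distrib, sourceRX] at e1 e2 ⊢
  simp only [ts ir _ iu, coeff_zero_Γ_uux, coeff_zero_Γ_uur,
    show ∀ k, M.Γ iu ir k = 0 from fun k => by simp only [Γ, g, gi, chr_u_r], map_zero,
    mul_zero, zero_mul, Finset.sum_const_zero, derivation_half, Derivation.leibniz, smul_eq_mul] at e1 e2 ⊢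
  rw [e1, e2]
  have hh := half_add_half (R := P.K.Ring)
  linear_combination (-(𝔥 * ∑ C, (∑ B, coeff 0 (M.hi C B) * coeff 1 (M.b B))
    * δ (coeff 0 (M.h A C)))) * hh

/-- `R_{rr}` on the null hypersurface is the Raychaudhuri expression. -/
lemma ric_rr : coeff 0 (M.ric ir ir) = -(δ (coeff 0 (M.Γ ir).trace))
    + coeff 1 M.φ * coeff 0 (M.Γ ir).trace
    - ∑ C, ∑ E, coeff 0 (M.Γ ir (ix C) (ix E)) * coeff 0 (M.Γ ir (ix E) (ix C)) := by
  have ts := M.isLeviCivita.torsion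
  rw [ric, ricciOf_split _ ts]
  simp only [map_add, map_sub, map_sum, coeff_zero_mul', coeff_zero_frame_u, coeff_zero_frame_r,
    coeff_zero_frame_x, coeff_one_Γ_rur, coeff_zero_Γ_rur, coeff_zero_Γ_rrr,
    coeff_zero_Γ_rxr, coeff_zero_Γ_rux, map_zero, mul_zero, zero_mul, Finset.sum_const_zero,
    ts ir _ iu, coeff_zero_Γ_uur,
    show ∀ k, M.Γ iu ir k = 0 from fun k => by simp only [Γ, g, gi, chr_u_r], Finset.sum_add_distrib]
  ring

end Tangential

end FormalMetric

end FormalRicci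

open PowerSeries

variable {d : ℕ}

/-- Two derivatives cost two orders. This justifies evaluating the Einstein expression on Taylor
polynomials. -/
lemma FormalMetric.eqv_ric {P : Patch d} {M M' : FormalMetric P} {n : ℕ}
    (hφ : Eqv (n + 2) M.φ M'.φ) (hb : ∀ A, Eqv (n + 2) (M.b A) (M'.b A))
    (hh : ∀ A B, Eqv (n + 2) (M.h A B) (M'.h A B)) (i j : Idx d) :
    Eqv n (M.ric i j) (M'.ric i j) := by
  have hΓ := FormalMetric.eqv_Γ hφ hb hh
  have hΓ' := fun i k j => (hΓ i k j).mono (Nat.le_succ n)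
  exact (Eqv.sum fun k _ => ((hΓ _ _ _).frame _).sub ((hΓ _ _ _).frame _)).add
    (Eqv.sum fun k _ => Eqv.sum fun l _ =>
      ((hΓ' _ _ _).mul (hΓ' _ _ _)).sub ((hΓ' _ _ _).mul (hΓ' _ _ _)))

/-! ### Expansions of matrix-valued functions -/

section MatrixTaylor

variable {P : Patch d}

open Patch

variable {κ : Type*} [Fintype κ] [DecidableEq κ] {G : (Idx d → ℝ) → Matrix κ κ ℝ}
  {a ai : Matrix κ κ P.K.Ring⟦X⟧}

lemma Patch.HasTaylor.det (h : ∀ i j, P.HasTaylor (fun p => G p i j) (a i j)) :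
    P.HasTaylor (fun p => (G p).det) a.det := by
  simp only [Matrix.det_apply']
  refine HasTaylor.sum _ fun τ _ => HasTaylor.mul ?_ (HasTaylor.prod _ fun i _ => h _ _)
  have := hasTaylor_const (P := P) (((Equiv.Perm.sign τ : ℤ) : ℝ))
  rwa [map_intCast] at this

lemma Patch.HasTaylor.eval {F : (Idx d → ℝ) → ℝ} {a : P.K.Ring⟦X⟧} (h : P.HasTaylor F a)
    {z : ℝ × Vec d} (hz : z ∈ P.K.carrier) : F (emb d z) = ev (coeff 0 a) z := by
  simpa using h.coeff_eq 0 z hz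

/-- The expansion of the inverse matrix. -/
lemma Patch.HasTaylor.matrix_inv (h : ∀ i j, P.HasTaylor (fun p => G p i j) (a i j))
    (hai : ai * a = 1) (i j : κ) : P.HasTaylor (fun p => (G p)⁻¹ i j) (ai i j) := by
  have hd := HasTaylor.det h
  have hne : ∀ z ∈ P.K.carrier, (G (emb d z)).det ≠ 0 := by
    intro z hz h0
    rw [hd.eval hz] at h0
    have h1 : ai.det * a.det = 1 := by rw [← Matrix.det_mul, hai, Matrix.det_one]
    have h2 := congrArg (fun s => ev (coeff 0 s) z) h1
    simp only [coeff_zero_mul', ev_mul, h0, mul_zero, coeff_zero_one, ev_one hz] at h2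
    exact zero_ne_one h2
  have hadj : ∀ i j, P.HasTaylor (fun p => (G p).adjugate i j) (a.adjugate i j) := by
    intro i j
    simp only [Matrix.adjugate_apply]
    refine HasTaylor.det fun k l => ?_
    simp only [Matrix.updateRow_apply]
    split_ifs
    · have := hasTaylor_const (P := P) ((Pi.single i 1 : κ → ℝ) l)
      convert this using 1
      rcases eq_or_ne l i with rfl | hli
      · simp
      · simp [hli]
    · exact h k l
  have hgood : ∀ i j, P.Good (fun p => (G p)⁻¹ i j) := by
    intro i j z hz
    have h1 := ((hd.good z hz).inv (hne z hz)).mul ((hadj i j).good z hz)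
    refine h1.congr (fun p _ => ?_) ?_ <;> simp [Matrix.inv_def, Ring.inverse_eq_inv']
  -- The inverse is smooth by Cramer's rule, hence has some expansion `b`. The identity `G⁻¹ G = 1`,
  -- valid near the hypersurface, and uniqueness of expansions give `b * a = 1`, so that `b` is the
  -- algebraic inverse `ai`.
  choose b hb using fun i j => (hgood i j).exists_hasTaylor
  have hmul : Matrix.of b * a = 1 := by
    ext1 k l
    refine HasTaylor.unique (F := fun p => ((1 : Matrix κ κ ℝ) k l)) ?_ ?_
    · rw [Matrix.mul_apply]
      refine (HasTaylor.sum Finset.univ fun m _ => (hb k m).mul (h m l)).congr fun z hz => ?_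
      have hc : ContinuousWithinAt (fun p => (G p).det) (domain P.I P.U) (emb d z) :=
        (hd.good z hz).continuousWithinAt
      filter_upwards [hc.eventually_ne (hne z hz)] with p hp
      rw [← Matrix.mul_apply, Matrix.nonsing_inv_mul _ (isUnit_iff_ne_zero.mpr hp)]
    · have := hasTaylor_const (P := P) ((1 : Matrix κ κ ℝ) k l)
      convert this using 1
      rcases eq_or_ne k l with rfl | hkl
      · simp
      · simp [hkl]
  have : Matrix.of b = ai := by
    calc Matrix.of b = Matrix.of b * (a * ai) := by
          rw [mul_eq_one_comm.mp hai, Matrix.mul_one]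
      _ = ai := by rw [← Matrix.mul_assoc, hmul, Matrix.one_mul]
  rw [← this]
  exact hb i j

lemma Patch.HasTaylor.half_mul {F : (Idx d → ℝ) → ℝ} {a : P.K.Ring⟦X⟧} (h : P.HasTaylor F a) :
    P.HasTaylor (fun p => (1 / 2) * F p) (half _ * a) := by
  have := (hasTaylor_const (P := P) (1 / 2)).mul h
  exact this

variable {Γ : Idx d → Matrix (Idx d) (Idx d) P.K.Ring⟦X⟧}
  {G : (Idx d → ℝ) → Matrix (Idx d) (Idx d) ℝ} {a ai : Matrix (Idx d) (Idx d) P.K.Ring⟦X⟧}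

lemma Patch.HasTaylor.christoffel (h : ∀ i j, P.HasTaylor (fun p => G p i j) (a i j))
    (hai : ai * a = 1) (k i j : Idx d) :
    P.HasTaylor (christoffel (domain P.I P.U) G k i j) (leviCivita P.frame a ai i k j) :=
  (HasTaylor.sum Finset.univ fun l _ => (HasTaylor.matrix_inv h hai k l).mul
    ((((h j l).partialDeriv i).add ((h i l).partialDeriv j)).sub ((h i j).partialDeriv l))).half_mul

lemma Patch.HasTaylor.ricci (h : ∀ i j, P.HasTaylor (fun p => G p i j) (a i j))
    (hai : ai * a = 1) (i j : Idx d) :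
    P.HasTaylor (ricci (domain P.I P.U) G i j) (ricciOf P.frame (leviCivita P.frame a ai) i j) := by
  have hΓ := HasTaylor.christoffel h hai
  exact (HasTaylor.sum Finset.univ fun k _ =>
    ((hΓ k i j).partialDeriv k).sub ((hΓ k i k).partialDeriv j)).add
    (HasTaylor.sum Finset.univ fun k _ => HasTaylor.sum Finset.univ fun l _ =>
      ((hΓ k k l).mul (hΓ l i j)).sub ((hΓ k j l).mul (hΓ l i k)))

end MatrixTaylor

/-! ### Formal metrics of smooth jets -/

/-- Smooth collections of components in a coordinate patch. -/
structure CoordJet.IsSmooth (P : Patch d) (J : CoordJet d) : Prop where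
  smooth_g : ∀ j A B, ContDiffOn ℝ ∞ (fun z : ℝ × Vec d => J.g j z.1 z.2 A B) P.K.carrier
  smooth_α : ∀ j, ContDiffOn ℝ ∞ (fun z : ℝ × Vec d => J.α j z.1 z.2) P.K.carrier
  smooth_β : ∀ j A, ContDiffOn ℝ ∞ (fun z : ℝ × Vec d => J.β j z.1 z.2 A) P.K.carrier
  symm : ∀ j, ∀ z ∈ P.K.carrier, ∀ A B, J.g j z.1 z.2 A B = J.g j z.1 z.2 B A
  det_ne : ∀ z ∈ P.K.carrier, (J.g 0 z.1 z.2).det ≠ 0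

/-- The truncation of a jet. -/
def CoordJet.trunc (m : ℕ) (J : CoordJet d) : CoordJet d where
  g j r y := if j ≤ m then J.g j r y else 0
  α j r y := if j ≤ m then J.α j r y else 0
  β j r y := if j ≤ m then J.β j r y else 0

/-- The expansion with given derivatives. -/
def Patch.ser (P : Patch d) (f : ℕ → ℝ × Vec d → ℝ) : P.K.Ring⟦X⟧ :=
  PowerSeries.mk fun j => (1 / (j.factorial : ℝ)) • P.K.mk' (f j)

section Series

variable {P : Patch d} {f f' : ℕ → ℝ × Vec d → ℝ}

lemma Patch.ev_coeff_ser {j : ℕ} (hf : ContDiffOn ℝ ∞ (f j) P.K.carrier) {z : ℝ × Vec d}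
    (hz : z ∈ P.K.carrier) : ev (coeff j (P.ser f)) z = 1 / (j.factorial : ℝ) * f j z := by
  rw [Patch.ser, coeff_mk, ev_smul, ev_mk hf hz]

lemma SmoothDomain.mk'_congr {E : Type*} [NormedAddCommGroup E] [NormedSpace ℝ E]
    (K : SmoothDomain E) {f g : E → ℝ} (h : ∀ z ∈ K.carrier, f z = g z) : K.mk' f = K.mk' g := by
  have hiff : ContDiffOn ℝ ∞ f K.carrier ↔ ContDiffOn ℝ ∞ g K.carrier :=
    ⟨fun hf => hf.congr fun z hz => (h z hz).symm, fun hg => hg.congr h⟩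
  by_cases hf : ContDiffOn ℝ ∞ f K.carrier
  · exact ev_ext fun z hz => by rw [ev_mk hf hz, ev_mk (hiff.mp hf) hz, h z hz]
  · have h1 : K.mk' f = 0 := dif_neg hf
    have h2 : K.mk' g = 0 := dif_neg (hiff.not.mp hf)
    rw [h1, h2]

lemma Patch.coeff_ser_congr {j : ℕ} (h : ∀ z ∈ P.K.carrier, f j z = f' j z) :
    coeff j (P.ser f) = coeff j (P.ser f') := by
  rw [Patch.ser, Patch.ser, coeff_mk, coeff_mk, P.K.mk'_congr h]

lemma Patch.hasTaylor_taylorSum (hf : ∀ j, ContDiffOn ℝ ∞ (f j) P.K.carrier) (m : ℕ) :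
    P.HasTaylor (fun p => taylorSum m (fun j => f j (Patch.proj d p)) (p iu))
      (P.ser fun j z => if j ≤ m then f j z else 0) := by
  have h := HasTaylor.sum (P := P) (Finset.range (m + 1)) (fun j _ =>
    ((hasTaylor_u.pow j).mul (hasTaylor_const (1 / (j.factorial : ℝ)))).mul (hasTaylor_proj (hf j)))
  have e : ∑ j ∈ Finset.range (m + 1), X ^ j * algebraMap ℝ P.K.Ring⟦X⟧ (1 / (j.factorial : ℝ))
      * C (P.K.mk' (f j)) = P.ser fun j z => if j ≤ m then f j z else 0 := by
    ext1 n
    have : ∀ j, X ^ j * algebraMap ℝ P.K.Ring⟦X⟧ (1 / (j.factorial : ℝ)) * C (P.K.mk' (f j))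
        = C ((1 / (j.factorial : ℝ)) • P.K.mk' (f j)) * X ^ j := by
      intro j
      rw [Algebra.smul_def, PowerSeries.algebraMap_apply, map_mul]
      ring
    simp only [this, map_sum, coeff_C_mul_X_pow, Finset.sum_ite_eq, Finset.mem_range,
      Patch.ser, coeff_mk]
    by_cases hn : n ≤ m
    · simp [hn, Nat.lt_succ_iff]
    · rw [if_neg (by omega)]
      simp only [hn, if_false]
      refine (ev_ext fun z hz => ?_).symm
      rw [ev_smul, ev_mk contDiffOn_const hz, ev_zero, mul_zero]
  rw [← e]
  simpa only [taylorSum, div_eq_mul_one_div (_ ^ _ : ℝ)] using h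

end Series

namespace CoordJet

variable {P : Patch d} {J J' : CoordJet d}

lemma IsSmooth.trunc (hJ : J.IsSmooth P) (m : ℕ) : (J.trunc m).IsSmooth P where
  smooth_g j A B := by
    by_cases h : j ≤ m
    · simpa [CoordJet.trunc, h] using hJ.smooth_g j A B
    · simpa [CoordJet.trunc, h] using contDiffOn_const
  smooth_α j := by
    by_cases h : j ≤ m
    · simpa [CoordJet.trunc, h] using hJ.smooth_α j
    · simpa [CoordJet.trunc, h] using contDiffOn_const
  smooth_β j A := by
    by_cases h : j ≤ m
    · simpa [CoordJet.trunc, h] using hJ.smooth_β j A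
    · simpa [CoordJet.trunc, h] using contDiffOn_const
  symm j z hz A B := by
    by_cases h : j ≤ m
    · simpa [CoordJet.trunc, h] using hJ.symm j z hz A B
    · simp [CoordJet.trunc, h]
  det_ne z hz := by simpa [CoordJet.trunc] using hJ.det_ne z hz

variable (P) in
/-- The expansions of the components `g_{AB}`. -/
def serG (J : CoordJet d) : Matrix (Fin d) (Fin d) P.K.Ring⟦X⟧ :=
  Matrix.of fun A B => P.ser fun j z => J.g j z.1 z.2 A B

/-- A series is invertible as soon as its constant term is, and the constant term is the nowhere
vanishing function `det g|_N`. -/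
lemma IsSmooth.isUnit_det (hJ : J.IsSmooth P) : IsUnit (J.serG P).det := by
  rw [PowerSeries.isUnit_iff_constantCoeff]
  have : ∃ k : P.K.Ring, k * constantCoeff (J.serG P).det = 1 := by
    refine exists_mul_eq_one _ fun z hz => ?_
    rw [RingHom.map_det, ← evHom_apply hz, RingHom.map_det]
    convert hJ.det_ne z hz using 2
    ext A B
    simp only [RingHom.mapMatrix_apply, Matrix.map_apply, serG, Matrix.of_apply, evHom_apply]
    rw [← coeff_zero_eq_constantCoeff_apply, Patch.ev_coeff_ser (hJ.smooth_g 0 A B) hz]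
    simp
  obtain ⟨k, hk⟩ := this
  exact IsUnit.of_mul_eq_one_right _ hk

/-- The formal metric of a smooth jet. -/
def IsSmooth.formal (hJ : J.IsSmooth P) : FormalMetric P where
  φ := X * P.ser fun j z => J.α j z.1 z.2
  b A := X * P.ser fun j z => J.β j z.1 z.2 A
  h := J.serG P
  hi := (J.serG P)⁻¹
  φ_zero := coeff_zero_X_mul _
  b_zero _ := coeff_zero_X_mul _
  symm := by
    ext1 A B
    ext1 j
    exact Patch.coeff_ser_congr (f := fun j z => J.g j z.1 z.2 B A)
      (f' := fun j z => J.g j z.1 z.2 A B) fun z hz => hJ.symm j z hz B A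
  inv := Matrix.nonsing_inv_mul _ hJ.isUnit_det

lemma IsSmooth.formal_φ (hJ : J.IsSmooth P) :
    hJ.formal.φ = X * P.ser fun j z => J.α j z.1 z.2 := rfl
lemma IsSmooth.formal_b (hJ : J.IsSmooth P) (A : Fin d) :
    hJ.formal.b A = X * P.ser fun j z => J.β j z.1 z.2 A := rfl
lemma IsSmooth.formal_h (hJ : J.IsSmooth P) (A B : Fin d) :
    hJ.formal.h A B = P.ser fun j z => J.g j z.1 z.2 A B := rfl

lemma IsSmooth.hasTaylor_g (hJ : J.IsSmooth P) (m : ℕ) (A B : Fin d) :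
    P.HasTaylor (fun p => taylorSum m (fun j => J.g j (p ir) (xPart p) A B) (p iu))
      ((hJ.trunc m).formal.h A B) := by
  have := Patch.hasTaylor_taylorSum (fun j => hJ.smooth_g j A B) m
  have e : (hJ.trunc m).formal.h A B
      = P.ser fun j z => if j ≤ m then J.g j z.1 z.2 A B else 0 := by
    rw [formal_h]
    congr 1
    funext j z
    simp only [CoordJet.trunc]
    split_ifs <;> rfl
  rw [e]
  exact this

/-- The metric of a jet is represented by its formal metric. -/
lemma IsSmooth.hasTaylor_metric (hJ : J.IsSmooth P) (m : ℕ) (i j : Idx d) :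
    P.HasTaylor (fun p => J.metric m p i j) ((hJ.trunc m).formal.g i j) := by
  have hα := Patch.hasTaylor_taylorSum hJ.smooth_α m
  have hβ := fun A => Patch.hasTaylor_taylorSum (fun j => hJ.smooth_β j A) m
  have eβ : ∀ A, (hJ.trunc m).formal.b A
      = X * P.ser fun j z => if j ≤ m then J.β j z.1 z.2 A else 0 := by
    intro A
    rw [formal_b]
    congr 2
    funext j z
    simp only [CoordJet.trunc]
    split_ifs <;> rfl
  have hb : ∀ A, P.HasTaylor (fun p => p iu * taylorSum m (fun j => J.β j (p ir) (xPart p) A)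
      (p iu)) ((hJ.trunc m).formal.b A) := fun A => by
    rw [eβ]
    exact Patch.hasTaylor_u.mul (hβ A)
  have h0 : P.HasTaylor (fun _ => 0) 0 := by simpa using Patch.hasTaylor_const (P := P) 0
  have h1 : P.HasTaylor (fun _ => -1) (-1) := by simpa using Patch.hasTaylor_const (P := P) (-1)
  have h2 : P.HasTaylor (fun p => 2 * p iu * taylorSum m (fun j => J.α j (p ir) (xPart p)) (p iu))
      (2 * (hJ.trunc m).formal.φ) := by
    have := ((Patch.hasTaylor_const (P := P) 2).mul Patch.hasTaylor_u).mul hα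
    rw [map_ofNat] at this
    rw [formal_φ, ← mul_assoc]
    exact this
  revert i j
  simp only [forall_idx, FormalMetric.g, imMetric_uu, imMetric_ur, imMetric_ru, imMetric_rr,
    imMetric_ux, imMetric_xu, imMetric_rx, imMetric_xr, imMetric_xx]
  exact ⟨⟨h0, h1, fun _ => h0⟩, ⟨h1, h2, hb⟩, fun A => ⟨h0, hb A, hJ.hasTaylor_g m A⟩⟩

lemma eqv_X_mul {C : Type*} [CommRing C] [Algebra ℝ C] {n : ℕ} {a a' : C⟦X⟧} (h : Eqv n a a') :
    Eqv (n + 1) (X * a) (X * a') := by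
  obtain ⟨e, rfl⟩ := h
  exact ⟨e, by ring⟩

lemma eqv_ser {n : ℕ} {f f' : ℕ → ℝ × Vec d → ℝ}
    (h : ∀ j < n, ∀ z ∈ P.K.carrier, f j z = f' j z) : Eqv n (P.ser f) (P.ser f') :=
  eqv_iff.mpr fun j hj => Patch.coeff_ser_congr (h j hj)

/-- Orders: truncation at `m + 1` gives `Eqv (m + 2)`, the Ricci tensor loses two, and the
coefficients below `m` remain. Thus the Taylor polynomial of order `i + 2` suffices for the `i`-th
derivative. -/
lemma IsSmooth.eqv_trunc (hJ : J.IsSmooth P) (m i : ℕ) (him : i + 1 ≤ m) (μ ν : Idx d) :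
    coeff i ((hJ.trunc (m + 1)).formal.ric μ ν) = coeff i (hJ.formal.ric μ ν) := by
  refine eqv_iff.mp (FormalMetric.eqv_ric (n := m) ?_ (fun A => ?_) (fun A B => ?_) μ ν) i (by omega)
  · refine eqv_X_mul (eqv_ser fun j hj z hz => ?_)
    simp [CoordJet.trunc, show j ≤ m + 1 by omega]
  · refine eqv_X_mul (eqv_ser fun j hj z hz => ?_)
    simp [CoordJet.trunc, show j ≤ m + 1 by omega]
  · rw [formal_h, formal_h]
    refine eqv_ser fun j hj z hz => ?_
    simp [CoordJet.trunc, show j ≤ m + 1 by omega]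

/-- The expansion of the vacuum Einstein expression. -/
def IsSmooth.ein (hJ : J.IsSmooth P) (Λ : ℝ) (μ ν : Idx d) : P.K.Ring⟦X⟧ :=
  hJ.formal.ric μ ν - algebraMap ℝ _ (2 * Λ / d) * hJ.formal.g μ ν

lemma IsSmooth.coeff_trunc_g (hJ : J.IsSmooth P) {m i : ℕ} (h : i ≤ m) (μ ν : Idx d) :
    coeff i ((hJ.trunc m).formal.g μ ν) = coeff i (hJ.formal.g μ ν) := by
  have hφ : Eqv (m + 2) (hJ.trunc m).formal.φ hJ.formal.φ :=
    eqv_X_mul (eqv_ser fun j hj z hz => by simp [CoordJet.trunc, show j ≤ m by omega])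
  have hb : ∀ A, Eqv (m + 2) ((hJ.trunc m).formal.b A) (hJ.formal.b A) := fun A =>
    eqv_X_mul (eqv_ser fun j hj z hz => by simp [CoordJet.trunc, show j ≤ m by omega])
  have hh : ∀ A B, Eqv (m + 1) ((hJ.trunc m).formal.h A B) (hJ.formal.h A B) := fun A B => by
    rw [formal_h, formal_h]
    exact eqv_ser fun j hj z hz => by simp [CoordJet.trunc, show j ≤ m by omega]
  suffices key : Eqv (m + 1) ((hJ.trunc m).formal.g μ ν) (hJ.formal.g μ ν) from
    eqv_iff.mp key i (by omega)
  revert μ ν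
  simp only [forall_idx, FormalMetric.g, imMetric_uu, imMetric_ur, imMetric_ru, imMetric_rr,
    imMetric_ux, imMetric_xu, imMetric_rx, imMetric_xr, imMetric_xx]
  exact ⟨⟨Eqv.refl _ _, Eqv.refl _ _, fun _ => Eqv.refl _ _⟩,
      ⟨Eqv.refl _ _, (hφ.mono (Nat.le_succ _)).const_mul _, fun A => (hb A).mono (Nat.le_succ _)⟩,
      fun A => ⟨Eqv.refl _ _, (hb A).mono (Nat.le_succ _), hh A⟩⟩

/-- The transverse derivatives of the Einstein expression are given by formal expansions. -/
theorem IsSmooth.einstein_eq (hJ : J.IsSmooth P) (Λ : ℝ) (i : ℕ) (μ ν : Idx d) {z : ℝ × Vec d}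
    (hz : z ∈ P.K.carrier) : J.einstein P.I P.U Λ i μ ν z.1 z.2
      = i.factorial * ev (coeff i (hJ.ein Λ μ ν)) z := by
  have hm := hJ.hasTaylor_metric (i + 2)
  have h1 : P.HasTaylor (ricci (domain P.I P.U) (J.metric (i + 2)) μ ν)
      ((hJ.trunc (i + 2)).formal.ric μ ν) :=
    Patch.HasTaylor.ricci hm (hJ.trunc (i + 2)).formal.gi_mul_g μ ν
  have h := h1.sub ((Patch.hasTaylor_const (P := P) (2 * Λ / d)).mul (hm μ ν))
  rw [CoordJet.einstein, h.iteratedDeriv_eq i hz, IsSmooth.ein, map_sub, map_sub,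
    PowerSeries.algebraMap_apply, coeff_C_mul, coeff_C_mul, hJ.coeff_trunc_g (by omega),
    hJ.eqv_trunc (i + 1) i le_rfl μ ν]

/-- The transverse derivatives of `Γ^r_{rr}`. -/
theorem IsSmooth.kappa_eq (hJ : J.IsSmooth P) (i : ℕ) {z : ℝ × Vec d} (hz : z ∈ P.K.carrier) :
    J.kappa P.I P.U i z.1 z.2 = (i + 1) * J.α i z.1 z.2 := by
  have h := Patch.HasTaylor.christoffel (hJ.hasTaylor_metric (i + 2))
    (hJ.trunc (i + 2)).formal.gi_mul_g ir ir ir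
  rw [CoordJet.kappa, h.iteratedDeriv_eq i hz]
  have e : leviCivita P.frame (hJ.trunc (i + 2)).formal.g (hJ.trunc (i + 2)).formal.gi ir ir ir
      = P.frame iu (hJ.trunc (i + 2)).formal.φ := by
    simp only [FormalMetric.g, FormalMetric.gi, chr_r_r_r]
  have hc : ev ((i : P.K.Ring) + 1) z = i + 1 := by
    rw [← evHom_apply hz, map_add, map_natCast, map_one]
  rw [e, Patch.frame_u, coeff_dX, formal_φ, coeff_succ_X_mul, ev_mul, hc,
    Patch.ev_coeff_ser ((hJ.trunc (i + 2)).smooth_α i) hz]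
  simp only [CoordJet.trunc, show i ≤ i + 2 by omega, if_true]
  field_simp

end CoordJet

open PowerSeries

variable {d : ℕ}

/-! ### The Einstein expressions of a jet in terms of its components -/

namespace CoordJet

variable {P : Patch d} {J J' : CoordJet d}

lemma derivWithin_eq_fderivWithin {f : ℝ × Vec d → ℝ} {z : ℝ × Vec d} (hz : z ∈ P.K.carrier)
    (hf : DifferentiableWithinAt ℝ f P.K.carrier z) :
    HasDerivWithinAt (fun r => f (r, z.2)) (fderivWithin ℝ f P.K.carrier z (1, 0)) P.I z.1 := by
  have h1 : HasFDerivWithinAt f (fderivWithin ℝ f P.K.carrier z) P.K.carrier (z.1, z.2) :=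
    hf.hasFDerivWithinAt
  have h2 : HasDerivWithinAt (fun r : ℝ => (r, z.2)) ((1 : ℝ), (0 : Vec d)) P.I z.1 :=
    (hasDerivWithinAt_id z.1 P.I).prodMk (hasDerivWithinAt_const z.1 P.I z.2)
  exact h1.comp_hasDerivWithinAt z.1 h2 (s := P.I) (t := P.K.carrier)
    (fun r hr => ⟨hr, hz.2⟩)

lemma uniqueDiff (P : Patch d) {r : ℝ} (hr : r ∈ P.I) : UniqueDiffWithinAt ℝ P.I r :=
  P.ord.uniqueDiffOn_real P.nontrivial r hr

lemma ev_dirDeriv_r (a : P.K.Ring) {z : ℝ × Vec d} (hz : z ∈ P.K.carrier) :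
    ev (dirDeriv ((1 : ℝ), (0 : Vec d)) a) z = derivWithin (fun r => ev a (r, z.2)) P.I z.1 := by
  rw [ev_dirDeriv _ _ hz]
  exact ((derivWithin_eq_fderivWithin hz (differentiableWithinAt_ev a hz)).derivWithin
    (uniqueDiff P hz.1)).symm

lemma ev_dirDeriv_ser {f : ℕ → ℝ × Vec d → ℝ} {j : ℕ} (hf : ContDiffOn ℝ ∞ (f j) P.K.carrier)
    {z : ℝ × Vec d} (hz : z ∈ P.K.carrier) :
    ev (dirDeriv ((1 : ℝ), (0 : Vec d)) (coeff j (P.ser f))) z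
      = 1 / (j.factorial : ℝ) * derivWithin (fun r => f j (r, z.2)) P.I z.1 := by
  rw [ev_dirDeriv_r _ hz, ← derivWithin_const_mul_field]
  exact derivWithin_congr (fun r hr => Patch.ev_coeff_ser hf ⟨hr, hz.2⟩)
    (Patch.ev_coeff_ser hf (z := (z.1, z.2)) hz)

lemma IsSmooth.ev_g_zero (hJ : J.IsSmooth P) (A B : Fin d) {z : ℝ × Vec d} (hz : z ∈ P.K.carrier) :
    ev (coeff 0 (hJ.formal.h A B)) z = J.g 0 z.1 z.2 A B := by
  rw [formal_h, Patch.ev_coeff_ser (hJ.smooth_g 0 A B) hz]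
  simp

lemma IsSmooth.ev_hi_zero (hJ : J.IsSmooth P) (A B : Fin d) {z : ℝ × Vec d}
    (hz : z ∈ P.K.carrier) : ev (coeff 0 (hJ.formal.hi A B)) z = (J.g 0 z.1 z.2)⁻¹ A B := by
  have : (J.g 0 z.1 z.2)⁻¹ = Matrix.of fun A B => ev (coeff 0 (hJ.formal.hi A B)) z := by
    refine Matrix.inv_eq_left_inv ?_
    ext A B
    have h := congrFun (congrFun hJ.formal.inv A) B
    have h2 := congrArg (fun s => ev (coeff 0 s) z) h
    simp only [Matrix.mul_apply, map_sum, coeff_zero_mul', ev_sum _ _ hz, ev_mul,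
      hJ.ev_g_zero _ _ hz] at h2
    rw [Matrix.mul_apply]
    simp only [Matrix.of_apply]
    rw [h2]
    rcases eq_or_ne A B with rfl | hAB
    · rw [Matrix.one_apply_eq, Matrix.one_apply_eq, coeff_zero_one, ev_one hz]
    · rw [Matrix.one_apply_ne hAB, Matrix.one_apply_ne hAB, map_zero, ev_zero]
  rw [this, Matrix.of_apply]

lemma IsSmooth.ev_g' (hJ : J.IsSmooth P) (A B : Fin d) {z : ℝ × Vec d} (hz : z ∈ P.K.carrier) :
    ev (dirDeriv ((1 : ℝ), (0 : Vec d)) (coeff 0 (hJ.formal.h A B))) z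
      = entryDeriv P.I (fun r => J.g 0 r z.2) z.1 A B := by
  rw [formal_h, ev_dirDeriv_ser (hJ.smooth_g 0 A B) hz]
  simp [entryDeriv]

lemma IsSmooth.ev_φ_one (hJ : J.IsSmooth P) {z : ℝ × Vec d} (hz : z ∈ P.K.carrier) :
    ev (coeff 1 hJ.formal.φ) z = J.α 0 z.1 z.2 := by
  rw [formal_φ, coeff_succ_X_mul 0, Patch.ev_coeff_ser (hJ.smooth_α 0) hz]
  simp

lemma ev_half {z : ℝ × Vec d} (hz : z ∈ P.K.carrier) : ev (half P.K.Ring) z = 1 / 2 :=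
  ev_algebraMap _ hz

lemma ev_natCast (n : ℕ) {z : ℝ × Vec d} (hz : z ∈ P.K.carrier) : ev (n : P.K.Ring) z = n := by
  rw [← evHom_apply hz, map_natCast]

lemma ev_ofNat (n : ℕ) [n.AtLeastTwo] {z : ℝ × Vec d} (hz : z ∈ P.K.carrier) :
    ev (OfNat.ofNat n : P.K.Ring) z = OfNat.ofNat n := by
  rw [← evHom_apply hz, map_ofNat]

variable (P) in
/-- Two collections of components agree on the patch up to and including transverse order `i`. -/
structure AgreeOn (i : ℕ) (J J' : CoordJet d) : Prop where
  g : ∀ j ≤ i, ∀ z ∈ P.K.carrier, J.g j z.1 z.2 = J'.g j z.1 z.2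
  α : ∀ j ≤ i, ∀ z ∈ P.K.carrier, J.α j z.1 z.2 = J'.α j z.1 z.2
  β : ∀ j ≤ i, ∀ z ∈ P.K.carrier, J.β j z.1 z.2 = J'.β j z.1 z.2

lemma IsSmooth.eqv_h (hJ : J.IsSmooth P) (hJ' : J'.IsSmooth P) {n : ℕ}
    (h : ∀ j < n, ∀ z ∈ P.K.carrier, J.g j z.1 z.2 = J'.g j z.1 z.2) (A B : Fin d) :
    Eqv n (hJ.formal.h A B) (hJ'.formal.h A B) := by
  rw [formal_h, formal_h]
  exact eqv_ser fun j hj z hz => by rw [h j hj z hz]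

/-- The transport operator along the generators. -/
def transport (I : Set ℝ) (J : CoordJet d) (i : ℕ) (η : ℝ → Vec d → Matrix (Fin d) (Fin d) ℝ)
    (r : ℝ) (y : Vec d) (A B : Fin d) : ℝ :=
  derivWithin (fun r' => η r' y A B) I r + (i + 1) * J.α 0 r y * η r y A B
    - (1 / 2) * ((η r y * ((J.g 0 r y)⁻¹ * entryDeriv I (fun r' => J.g 0 r' y) r)) A B
      + (η r y * ((J.g 0 r y)⁻¹ * entryDeriv I (fun r' => J.g 0 r' y) r)) B A)
    + (1 / 4) * (((J.g 0 r y)⁻¹ * entryDeriv I (fun r' => J.g 0 r' y) r).trace * η r y A B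
      + ((J.g 0 r y)⁻¹ * η r y).trace * entryDeriv I (fun r' => J.g 0 r' y) r A B)

/-- The products of Christoffel symbols in `lin_ric_xx` produce `h_{AC} X_B^C` and its transpose
twice each, with coefficient `¼`. -/
lemma transport_algebra {k g p : Matrix (Fin d) (Fin d) ℝ} (hk : ∀ A B, k A B = k B A)
    (hg : ∀ A B, g A B = g B A) (A B : Fin d) :
    (∑ C, (1 / 2 * g B C) * (1 / 2 * ∑ E, k C E * p A E)
      + ∑ C, (1 / 2 * p B C) * (1 / 2 * ∑ E, k C E * g A E)
      + ∑ C, ((1 / 2 * ∑ E, k C E * p B E) * (1 / 2 * g A C)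
        + (1 / 2 * ∑ E, k C E * g B E) * (1 / 2 * p A C)))
    = 1 / 2 * ((p * (k * g)) A B + (p * (k * g)) B A) := by
  have e1 : ∀ A B, ∑ C, (1 / 2 * g B C) * (1 / 2 * ∑ E, k C E * p A E)
      = 1 / 4 * (p * (k * g)) A B := by
    intro A B
    simp only [Matrix.mul_apply, Finset.mul_sum]
    rw [Finset.sum_comm]
    refine Finset.sum_congr rfl fun C _ => Finset.sum_congr rfl fun E _ => ?_
    rw [hk E C, hg B E]
    ring
  have e2 : ∀ A B, ∑ C, (1 / 2 * p A C) * (1 / 2 * ∑ E, k C E * g B E)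
      = 1 / 4 * (p * (k * g)) A B := by
    intro A B
    simp only [Matrix.mul_apply, Finset.mul_sum]
    refine Finset.sum_congr rfl fun C _ => Finset.sum_congr rfl fun E _ => ?_
    rw [hg B E]
    ring
  have e3 : ∑ C, (1 / 2 * ∑ E, k C E * p B E) * (1 / 2 * g A C)
      = 1 / 4 * (p * (k * g)) B A := by
    rw [← e1]
    exact Finset.sum_congr rfl fun C _ => mul_comm _ _
  have e4 : ∑ C, (1 / 2 * ∑ E, k C E * g B E) * (1 / 2 * p A C)
      = 1 / 4 * (p * (k * g)) A B := by
    rw [← e2]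
    exact Finset.sum_congr rfl fun C _ => mul_comm _ _
  rw [Finset.sum_add_distrib, e1, e2, e3, e4]
  ring

lemma trace_mul_of_symm {k p : Matrix (Fin d) (Fin d) ℝ} (hp : ∀ A B, p A B = p B A) :
    (k * p).trace = ∑ C, ∑ E, k C E * p C E := by
  simp only [Matrix.trace, Matrix.diag_apply, Matrix.mul_apply]
  exact Finset.sum_congr rfl fun C _ => Finset.sum_congr rfl fun E _ => by rw [hp]

lemma entryDeriv_symm {I : Set ℝ} {M : ℝ → Matrix (Fin d) (Fin d) ℝ} {r : ℝ} (hr : r ∈ I)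
    (hM : ∀ r ∈ I, ∀ A B, M r A B = M r B A) (A B : Fin d) :
    entryDeriv I M r A B = entryDeriv I M r B A :=
  derivWithin_congr (fun r' hr' => hM r' hr' A B) (hM r hr A B)

lemma inv_symm {M : Matrix (Fin d) (Fin d) ℝ} (hM : ∀ A B, M A B = M B A) (A B : Fin d) :
    M⁻¹ A B = M⁻¹ B A := by
  have : Mᵀ = M := by ext A B; exact hM B A
  have h2 : (M⁻¹)ᵀ = M⁻¹ := by rw [Matrix.transpose_nonsing_inv, this]
  conv_lhs => rw [← h2]
  rfl

/-- The terms of the `AB` equations which contain `∂_u^{i+1} g_{AB}`. -/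
theorem IsSmooth.einstein_xx_sub (hJ : J.IsSmooth P) (hJ' : J'.IsSmooth P) (Λ : ℝ) {i : ℕ}
    (h : AgreeOn P i J J') {z : ℝ × Vec d} (hz : z ∈ P.K.carrier) (A B : Fin d) :
    J.einstein P.I P.U Λ i (ix A) (ix B) z.1 z.2
        - J.transport P.I i (J.g (i + 1)) z.1 z.2 A B
      = J'.einstein P.I P.U Λ i (ix A) (ix B) z.1 z.2
        - J'.transport P.I i (J'.g (i + 1)) z.1 z.2 A B := by
  -- The source is never written out. Two jets with the same fields up to order `i` are compared,
  -- and the difference of their Einstein expressions is shown to be that of the transport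
  -- operators. Up to the factor `1 / (i + 1)!`, `q` is the difference of the `∂_u^{i+1} g`.
  set q : Fin d → Fin d → P.K.Ring := fun A B =>
    coeff (i + 1) (hJ.formal.h A B) - coeff (i + 1) (hJ'.formal.h A B) with hq
  have hφ : Eqv (i + 2) hJ.formal.φ hJ'.formal.φ :=
    eqv_X_mul (eqv_ser fun j hj => h.α j (by omega))
  have hb : ∀ A, Eqv (i + 2) (hJ.formal.b A) (hJ'.formal.b A) := fun A =>
    eqv_X_mul (eqv_ser fun j hj z hz => by rw [h.β j (by omega) z hz])
  have hh0 : ∀ A B, Eqv (i + 1) (hJ.formal.h A B) (hJ'.formal.h A B) := 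
    hJ.eqv_h hJ' fun j hj z hz => by rw [h.g j (by omega) z hz]
  have hh : ∀ A B, Lin (i + 1) (q A B) (hJ.formal.h A B) (hJ'.formal.h A B) := fun A B =>
    (hh0 A B).lin (by rw [hq]; ring)
  have key := FormalMetric.lin_ric_xx hφ hb hh A B
  have hg0 : ∀ r ∈ P.I, J.g 0 r z.2 = J'.g 0 r z.2 := fun r hr =>
    h.g 0 (Nat.zero_le _) (r, z.2) ⟨hr, hz.2⟩
  have hG : entryDeriv P.I (fun r' => J'.g 0 r' z.2) z.1
      = entryDeriv P.I (fun r' => J.g 0 r' z.2) z.1 := by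
    ext A B
    exact derivWithin_congr (fun r hr => by simp only [hg0 r hr]) (by simp only [hg0 _ hz.1])
  have hsJ := hJ.symm (i + 1) z hz
  have hsJ' := hJ'.symm (i + 1) z hz
  have hfac : ((i + 1).factorial : ℝ) = (i + 1) * i.factorial := by
    rw [Nat.factorial_succ]; push_cast; ring
  have hN : (i.factorial : ℝ) ≠ 0 := by positivity
  have evq : ∀ A B, ev (q A B) z = 1 / ((i + 1) * i.factorial)
      * (J.g (i + 1) z.1 z.2 A B - J'.g (i + 1) z.1 z.2 A B) := fun A B => by
    simp only [hq, ev_sub, formal_h]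
    rw [Patch.ev_coeff_ser (hJ.smooth_g _ A B) hz, Patch.ev_coeff_ser (hJ'.smooth_g _ A B) hz,
      ← hfac]
    ring
  have evdq : ∀ A B, ev (dirDeriv ((1 : ℝ), (0 : Vec d)) (q A B)) z = 1 / ((i + 1) * i.factorial)
      * (derivWithin (fun r => J.g (i + 1) r z.2 A B) P.I z.1
        - derivWithin (fun r => J'.g (i + 1) r z.2 A B) P.I z.1) := fun A B => by
    simp only [hq, map_sub, ev_sub, formal_h]
    rw [ev_dirDeriv_ser (hJ.smooth_g _ A B) hz, ev_dirDeriv_ser (hJ'.smooth_g _ A B) hz, ← hfac]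
    ring
  have hgcoeff : coeff i (hJ.formal.g (ix A) (ix B)) = coeff i (hJ'.formal.g (ix A) (ix B)) :=
    eqv_iff.mp (hh0 A B) i (Nat.lt_succ_self i)
  have hd : ∀ a : P.K.Ring, dirDeriv ((1 : ℝ), (0 : Vec d)) (half P.K.Ring * (a * ((i : P.K.Ring) + 1)))
      = half P.K.Ring * (dirDeriv ((1 : ℝ), (0 : Vec d)) a * ((i : P.K.Ring) + 1)) := by
    intro a
    simp [Derivation.leibniz]
    ring
  have hα0 := h.α 0 (Nat.zero_le _) z hz
  rw [hJ.einstein_eq Λ i _ _ hz, hJ'.einstein_eq Λ i _ _ hz, IsSmooth.ein, IsSmooth.ein, map_sub,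
    map_sub, PowerSeries.algebraMap_apply, coeff_C_mul, coeff_C_mul, hgcoeff, key, transport,
    transport, hG, ← hg0 _ hz.1, ← hα0]
  set k := (J.g 0 z.1 z.2)⁻¹ with hkdef
  set G := entryDeriv P.I (fun r' => J.g 0 r' z.2) z.1 with hGdef
  have hk : ∀ A B, k A B = k B A := inv_symm (hJ.symm 0 z hz)
  have hGs : ∀ A B, G A B = G B A :=
    entryDeriv_symm hz.1 fun r hr => hJ.symm 0 (r, z.2) ⟨hr, hz.2⟩
  set p : Matrix (Fin d) (Fin d) ℝ := Matrix.of fun A B => ev (q A B) z * (i + 1) with hp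
  have hpe : ∀ A B, p A B = ev (q A B) z * (i + 1) := fun A B => rfl
  have alg := transport_algebra (p := p) hk hGs A B
  have hpη : p = (1 / (i.factorial : ℝ)) • (J.g (i + 1) z.1 z.2 - J'.g (i + 1) z.1 z.2) := by
    ext A B
    rw [hpe, evq, Matrix.smul_apply, Matrix.sub_apply, smul_eq_mul]
    field_simp
  have hps : ∀ A B, p A B = p B A := fun A B => by
    rw [hpη, Matrix.smul_apply, Matrix.smul_apply, Matrix.sub_apply, Matrix.sub_apply, hsJ A B,
      hsJ' A B]
  have t1 := trace_mul_of_symm (k := k) hps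
  have t2 := trace_mul_of_symm (k := k) hGs
  have hi1 : ev ((i : P.K.Ring) + 1) z = i + 1 := by rw [ev_add, ev_natCast _ hz, ev_one hz]
  simp only [hd, ev_add, ev_sub, ev_mul, ev_neg, ev_sum _ _ hz, hJ.ev_hi_zero _ _ hz,
    hJ.ev_g' _ _ hz, hJ.ev_φ_one hz, ev_half hz, ev_natCast _ hz, ev_one hz, ev_ofNat _ hz,
    evdq, ← hpe, ← hkdef, ← hGdef]
  rw [← t1, ← t2, alg, hpη]
  simp only [Matrix.smul_mul, Matrix.sub_mul, Matrix.smul_apply, Matrix.sub_apply, smul_eq_mul,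
    Matrix.mul_smul, Matrix.mul_sub, Matrix.trace_smul, Matrix.trace_sub]
  -- What remains is a rational identity between real numbers, with only `i!` and `i + 1` in
  -- denominators.
  generalize ev (coeff i (hJ'.formal.ric (ix A) (ix B))) z = a1
  generalize ev (algebraMap ℝ P.K.Ring (2 * Λ / d)) z * ev (coeff i (hJ'.formal.g (ix A) (ix B))) z
    = a2
  generalize (J.g (i + 1) z.1 z.2 * (k * G)) A B = x1
  generalize (J'.g (i + 1) z.1 z.2 * (k * G)) A B = x2
  generalize (J.g (i + 1) z.1 z.2 * (k * G)) B A = x3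
  generalize (J'.g (i + 1) z.1 z.2 * (k * G)) B A = x4
  generalize (k * J.g (i + 1) z.1 z.2).trace = x5
  generalize (k * J'.g (i + 1) z.1 z.2).trace = x6
  generalize (k * G).trace = x7
  generalize J.g (i + 1) z.1 z.2 A B = x8
  generalize J'.g (i + 1) z.1 z.2 A B = x9
  generalize derivWithin (fun r => J.g (i + 1) r z.2 A B) P.I z.1 = y1
  generalize derivWithin (fun r => J'.g (i + 1) r z.2 A B) P.I z.1 = y2
  generalize J.α 0 z.1 z.2 = y3
  generalize G A B = y4
  have hi2 : (i : ℝ) + 1 ≠ 0 := by positivity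
  clear_value k G p q
  generalize (i.factorial : ℝ) = N at hN
  generalize (i : ℝ) = m at hi2
  clear * - hN hi2
  field_simp
  ring

/-- The terms of the `ur` equation which contain `∂_u^{i+1} α`. -/
theorem IsSmooth.einstein_ur_sub (hJ : J.IsSmooth P) (hJ' : J'.IsSmooth P) (Λ : ℝ) {i : ℕ}
    (h : AgreeOn P i J J')
    (hg : ∀ z ∈ P.K.carrier, J.g (i + 1) z.1 z.2 = J'.g (i + 1) z.1 z.2) {z : ℝ × Vec d}
    (hz : z ∈ P.K.carrier) :
    J.einstein P.I P.U Λ i iu ir z.1 z.2 + (i + 2) * J.α (i + 1) z.1 z.2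
      = J'.einstein P.I P.U Λ i iu ir z.1 z.2 + (i + 2) * J'.α (i + 1) z.1 z.2 := by
  set q : P.K.Ring := coeff (i + 2) hJ.formal.φ - coeff (i + 2) hJ'.formal.φ with hq
  have hφ0 : Eqv (i + 2) hJ.formal.φ hJ'.formal.φ :=
    eqv_X_mul (eqv_ser fun j hj => h.α j (by omega))
  have hφ : Lin (i + 2) q hJ.formal.φ hJ'.formal.φ := hφ0.lin (by rw [hq]; ring)
  have hb : ∀ A, Eqv (i + 2) (hJ.formal.b A) (hJ'.formal.b A) := fun A =>
    eqv_X_mul (eqv_ser fun j hj z hz => by rw [h.β j (by omega) z hz])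
  have hh : ∀ A B, Eqv (i + 2) (hJ.formal.h A B) (hJ'.formal.h A B) := 
    hJ.eqv_h hJ' fun j hj z hz => by
      rcases Nat.lt_succ_iff_lt_or_eq.mp hj with h1 | rfl
      · rw [h.g j (by omega) z hz]
      · rw [hg z hz]
  have key := FormalMetric.lin_ric_ur hφ hb hh
  have hfac : ((i + 1).factorial : ℝ) = (i + 1) * i.factorial := by
    rw [Nat.factorial_succ]; push_cast; ring
  have evq : ev q z = 1 / ((i + 1) * i.factorial)
      * (J.α (i + 1) z.1 z.2 - J'.α (i + 1) z.1 z.2) := by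
    simp only [hq, ev_sub, formal_φ, coeff_succ_X_mul]
    rw [Patch.ev_coeff_ser (hJ.smooth_α _) hz, Patch.ev_coeff_ser (hJ'.smooth_α _) hz, ← hfac]
    ring
  have hgc : hJ.formal.g iu ir = hJ'.formal.g iu ir := by
    simp only [FormalMetric.g, imMetric_ur]
  rw [hJ.einstein_eq Λ i _ _ hz, hJ'.einstein_eq Λ i _ _ hz, IsSmooth.ein, IsSmooth.ein, map_sub,
    map_sub, hgc, key]
  simp only [ev_sub, ev_add, ev_mul, evq, ev_natCast _ hz, ev_one hz, ev_ofNat _ hz]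
  have hN : (i.factorial : ℝ) ≠ 0 := by positivity
  generalize ev (coeff i (hJ'.formal.ric iu ir)) z = a1
  generalize ev (coeff i (algebraMap ℝ P.K.Ring⟦X⟧ (2 * Λ / d) * hJ'.formal.g iu ir)) z = a2
  generalize J.α (i + 1) z.1 z.2 = x1
  generalize J'.α (i + 1) z.1 z.2 = x2
  have hi2 : (i : ℝ) + 1 ≠ 0 := by positivity
  generalize (i.factorial : ℝ) = N at hN
  generalize (i : ℝ) = m at hi2
  clear * - hN hi2
  field_simp
  ring

/-- The terms of the `uA` equations which contain `∂_u^{i+1} β_A`. -/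
theorem IsSmooth.einstein_ux_sub (hJ : J.IsSmooth P) (hJ' : J'.IsSmooth P) (Λ : ℝ) {i : ℕ}
    (h : AgreeOn P i J J')
    (hg : ∀ z ∈ P.K.carrier, J.g (i + 1) z.1 z.2 = J'.g (i + 1) z.1 z.2) {z : ℝ × Vec d}
    (hz : z ∈ P.K.carrier) (A : Fin d) :
    J.einstein P.I P.U Λ i iu (ix A) z.1 z.2 + (i + 2) / 2 * J.β (i + 1) z.1 z.2 A
      = J'.einstein P.I P.U Λ i iu (ix A) z.1 z.2 + (i + 2) / 2 * J'.β (i + 1) z.1 z.2 A := by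
  set q : Fin d → P.K.Ring := fun A =>
    coeff (i + 2) (hJ.formal.b A) - coeff (i + 2) (hJ'.formal.b A) with hq
  have hφ : Eqv (i + 2) hJ.formal.φ hJ'.formal.φ :=
    eqv_X_mul (eqv_ser fun j hj => h.α j (by omega))
  have hb0 : ∀ A, Eqv (i + 2) (hJ.formal.b A) (hJ'.formal.b A) := fun A =>
    eqv_X_mul (eqv_ser fun j hj z hz => by rw [h.β j (by omega) z hz])
  have hb : ∀ A, Lin (i + 2) (q A) (hJ.formal.b A) (hJ'.formal.b A) := fun A =>
    (hb0 A).lin (by rw [hq]; ring)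
  have hh : ∀ A B, Eqv (i + 2) (hJ.formal.h A B) (hJ'.formal.h A B) := 
    hJ.eqv_h hJ' fun j hj z hz => by
      rcases Nat.lt_succ_iff_lt_or_eq.mp hj with h1 | rfl
      · rw [h.g j (by omega) z hz]
      · rw [hg z hz]
  have key := FormalMetric.lin_ric_ux hφ hb hh A
  have hfac : ((i + 1).factorial : ℝ) = (i + 1) * i.factorial := by
    rw [Nat.factorial_succ]; push_cast; ring
  have evq : ev (q A) z = 1 / ((i + 1) * i.factorial)
      * (J.β (i + 1) z.1 z.2 A - J'.β (i + 1) z.1 z.2 A) := by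
    simp only [hq, ev_sub, formal_b, coeff_succ_X_mul]
    rw [Patch.ev_coeff_ser (hJ.smooth_β _ A) hz, Patch.ev_coeff_ser (hJ'.smooth_β _ A) hz, ← hfac]
    ring
  have hgc : hJ.formal.g iu (ix A) = hJ'.formal.g iu (ix A) := by
    simp only [FormalMetric.g, imMetric_ux]
  rw [hJ.einstein_eq Λ i _ _ hz, hJ'.einstein_eq Λ i _ _ hz, IsSmooth.ein, IsSmooth.ein, map_sub,
    map_sub, hgc, key]
  simp only [ev_sub, ev_add, ev_mul, evq, ev_natCast _ hz, ev_one hz, ev_ofNat _ hz, ev_half hz]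
  have hN : (i.factorial : ℝ) ≠ 0 := by positivity
  generalize ev (coeff i (hJ'.formal.ric iu (ix A))) z = a1
  generalize ev (coeff i (algebraMap ℝ P.K.Ring⟦X⟧ (2 * Λ / d) * hJ'.formal.g iu (ix A))) z = a2
  generalize J.β (i + 1) z.1 z.2 A = x1
  generalize J'.β (i + 1) z.1 z.2 A = x2
  have hi2 : (i : ℝ) + 1 ≠ 0 := by positivity
  generalize (i.factorial : ℝ) = N at hN
  generalize (i : ℝ) = m at hi2
  clear * - hN hi2
  field_simp
  ring

/-- The transport operator for `β_A`. -/
def transportβ (I : Set ℝ) (J : CoordJet d) (β : ℝ → Vec d → Fin d → ℝ) (r : ℝ) (y : Vec d)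
    (A : Fin d) : ℝ :=
  (1 / 2) * derivWithin (fun r' => β r' y A) I r
    + (1 / 4) * ((J.g 0 r y)⁻¹ * entryDeriv I (fun r' => J.g 0 r' y) r).trace * β r y A

lemma IsSmooth.ev_b_one (hJ : J.IsSmooth P) (A : Fin d) {z : ℝ × Vec d} (hz : z ∈ P.K.carrier) :
    ev (coeff 1 (hJ.formal.b A)) z = J.β 0 z.1 z.2 A := by
  rw [formal_b, coeff_succ_X_mul 0, Patch.ev_coeff_ser (hJ.smooth_β 0 A) hz]
  simp

lemma _root_.IsenbergMoncrief.FormalMetric.sourceRX_congr {M M' : FormalMetric P}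
    (hφ : coeff 1 M.φ = coeff 1 M'.φ) (hh : ∀ A B, coeff 0 (M.h A B) = coeff 0 (M'.h A B))
    (A : Fin d) : M.sourceRX A = M'.sourceRX A := by
  have hhi : ∀ A B, coeff 0 (M.hi A B) = coeff 0 (M'.hi A B) := fun A B =>
    eqv_iff.mp (FormalMetric.eqv_hi (n := 1) (fun A B => eqv_iff.mpr fun j hj => by
      rw [Nat.lt_one_iff.mp hj, hh]) A B) 0 Nat.zero_lt_one
  simp only [FormalMetric.sourceRX, FormalMetric.coeff_zero_Γ_rxx, FormalMetric.coeff_zero_Γ_xxx,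
    FormalMetric.coeff_zero_trace_r, FormalMetric.coeff_zero_trace_x, hφ, hh, hhi]

/-- The trace of `X`. -/
lemma IsSmooth.ev_trace_r (hJ : J.IsSmooth P) {z : ℝ × Vec d} (hz : z ∈ P.K.carrier) :
    ev (coeff 0 (hJ.formal.Γ ir).trace) z
      = 1 / 2 * ((J.g 0 z.1 z.2)⁻¹ * entryDeriv P.I (fun r' => J.g 0 r' z.2) z.1).trace := by
  rw [FormalMetric.coeff_zero_trace_r, trace_mul_of_symm
    (entryDeriv_symm hz.1 fun r hr => hJ.symm 0 (r, z.2) ⟨hr, hz.2⟩)]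
  simp only [ev_mul, ev_half hz, ev_sum _ _ hz, hJ.ev_hi_zero _ _ hz, hJ.ev_g' _ _ hz]

/-- The terms of the equation `R_{rA} = 0` which contain `β_A`. -/
theorem IsSmooth.einstein_rx_sub (hJ : J.IsSmooth P) (hJ' : J'.IsSmooth P) (Λ : ℝ)
    (hg : ∀ z ∈ P.K.carrier, J.g 0 z.1 z.2 = J'.g 0 z.1 z.2)
    (hα : ∀ z ∈ P.K.carrier, J.α 0 z.1 z.2 = J'.α 0 z.1 z.2) {z : ℝ × Vec d}
    (hz : z ∈ P.K.carrier) (A : Fin d) :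
    J.einstein P.I P.U Λ 0 ir (ix A) z.1 z.2 - J.transportβ P.I (J.β 0) z.1 z.2 A
      = J'.einstein P.I P.U Λ 0 ir (ix A) z.1 z.2 - J'.transportβ P.I (J'.β 0) z.1 z.2 A := by
  have main : ∀ {J : CoordJet d} (hJ : J.IsSmooth P),
      J.einstein P.I P.U Λ 0 ir (ix A) z.1 z.2 - J.transportβ P.I (J.β 0) z.1 z.2 A
        = ev (hJ.formal.sourceRX A) z := by
    intro J hJ
    have e0 : coeff 0 (hJ.formal.g ir (ix A)) = 0 := hJ.formal.b_zero A
    have e1 : ev (dirDeriv ((1 : ℝ), (0 : Vec d)) (coeff 1 (hJ.formal.b A))) z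
        = derivWithin (fun r => J.β 0 r z.2 A) P.I z.1 := by
      rw [formal_b, coeff_succ_X_mul 0, ev_dirDeriv_ser (hJ.smooth_β 0 A) hz]
      simp
    rw [hJ.einstein_eq Λ 0 _ _ hz, IsSmooth.ein, map_sub, PowerSeries.algebraMap_apply,
      coeff_C_mul, e0, FormalMetric.ric_rx, transportβ]
    simp only [mul_zero, sub_zero, ev_add, ev_mul, ev_half hz, e1, hJ.ev_trace_r hz,
      hJ.ev_b_one A hz, Nat.factorial_zero, Nat.cast_one]
    ring
  rw [main hJ, main hJ']
  rw [FormalMetric.sourceRX_congr]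
  · rw [formal_φ, formal_φ, coeff_succ_X_mul 0, coeff_succ_X_mul 0]
    exact Patch.coeff_ser_congr fun z hz => hα z hz
  · intro A B
    rw [formal_h, formal_h]
    exact Patch.coeff_ser_congr fun z hz => by rw [hg z hz]

/-- `R_{rr}` on the null hypersurface is the Raychaudhuri expression. -/
theorem IsSmooth.einstein_rr (hJ : J.IsSmooth P) (Λ : ℝ) {z : ℝ × Vec d} (hz : z ∈ P.K.carrier) :
    J.einstein P.I P.U Λ 0 ir ir z.1 z.2
      = raychaudhuri P.I (fun r => J.g 0 r z.2) (J.α 0 z.1 z.2) z.1 := by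
  set M := hJ.formal with hM
  set k := (J.g 0 z.1 z.2)⁻¹ with hkdef
  set G := entryDeriv P.I (fun r' => J.g 0 r' z.2) z.1 with hGdef
  set H := entryDeriv P.I (entryDeriv P.I fun r' => J.g 0 r' z.2) z.1 with hHdef
  have hGs : ∀ r ∈ P.I, ∀ A B, entryDeriv P.I (fun r' => J.g 0 r' z.2) r A B
      = entryDeriv P.I (fun r' => J.g 0 r' z.2) r B A := fun r hr =>
    entryDeriv_symm hr fun r hr => hJ.symm 0 (r, z.2) ⟨hr, hz.2⟩
  have hHs : ∀ A B, H A B = H B A := entryDeriv_symm hz.1 hGs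
  have hk : ∀ A B, k A B = k B A := inv_symm (hJ.symm 0 z hz)
  have e0 : coeff 0 (M.g ir ir) = 0 := by
    show coeff 0 (2 * M.φ) = 0
    rw [coeff_zero_mul', M.φ_zero, mul_zero]
  have evhi : ∀ A B, ev (coeff 0 (M.hi A B)) z = k A B := fun A B => hJ.ev_hi_zero A B hz
  have evG : ∀ A B, ev (dirDeriv ((1 : ℝ), (0 : Vec d)) (coeff 0 (M.h A B))) z = G A B :=
    fun A B => hJ.ev_g' A B hz
  have evg : ∀ A B, ev (coeff 0 (M.h A B)) z = J.g 0 z.1 z.2 A B := fun A B =>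
    hJ.ev_g_zero A B hz
  have evφ : ev (coeff 1 M.φ) z = J.α 0 z.1 z.2 := hJ.ev_φ_one hz
  have eH : ∀ A B, ev (dirDeriv ((1 : ℝ), (0 : Vec d))
      (dirDeriv ((1 : ℝ), (0 : Vec d)) (coeff 0 (M.h A B)))) z = H A B := by
    intro A B
    rw [ev_dirDeriv_r _ hz]
    exact derivWithin_congr (fun r hr => hJ.ev_g' A B (z := (r, z.2)) ⟨hr, hz.2⟩) (hJ.ev_g' A B hz)
  -- derivative of the inverse matrix
  have ek : ∀ A B, ev (dirDeriv ((1 : ℝ), (0 : Vec d)) (coeff 0 (M.hi A B))) z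
      = -(k * G * k) A B := by
    intro A B
    have h1 : ∀ A B, ∑ C, coeff 0 (M.hi A C) * coeff 0 (M.h C B)
        = (if A = B then 1 else 0 : P.K.Ring) := by
      intro A B
      have := congrArg (coeff 0) (congrFun (congrFun M.inv A) B)
      rw [Matrix.mul_apply, map_sum] at this
      simp only [coeff_zero_mul'] at this
      rw [this, Matrix.one_apply]
      split_ifs <;> simp
    set kd : Matrix (Fin d) (Fin d) ℝ := Matrix.of fun A B =>
      ev (dirDeriv ((1 : ℝ), (0 : Vec d)) (coeff 0 (M.hi A B))) z with hkd
    have h2 : k * G + kd * J.g 0 z.1 z.2 = 0 := by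
      ext A B
      have h3 := congrArg (dirDeriv (K := P.K) ((1 : ℝ), (0 : Vec d))) (h1 A B)
      have h4 : dirDeriv (K := P.K) ((1 : ℝ), (0 : Vec d)) (if A = B then 1 else 0) = 0 := by
        split_ifs <;> simp
      rw [h4, map_sum] at h3
      have h5 := congrArg (fun s => ev s z) h3
      simp only [Derivation.leibniz, smul_eq_mul, ev_sum _ _ hz, ev_add, ev_mul, ev_zero,
        evhi, evG, evg, Finset.sum_add_distrib] at h5
      rw [Matrix.add_apply, Matrix.mul_apply, Matrix.mul_apply, Matrix.zero_apply, ← h5]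
      congr 1
      exact Finset.sum_congr rfl fun C _ => mul_comm _ _
    have hu : IsUnit (J.g 0 z.1 z.2).det := isUnit_iff_ne_zero.mpr (hJ.det_ne z hz)
    have h6 : kd = -(k * G * k) := by
      calc kd = kd * (J.g 0 z.1 z.2 * k) := by
            rw [hkdef, Matrix.mul_nonsing_inv _ hu, Matrix.mul_one]
        _ = -(k * G * k) := by
            rw [← Matrix.mul_assoc, eq_neg_of_add_eq_zero_right h2, Matrix.neg_mul]
    exact congrFun (congrFun h6 A) B
  rw [hJ.einstein_eq Λ 0 _ _ hz, IsSmooth.ein, map_sub, PowerSeries.algebraMap_apply,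
    coeff_C_mul, ← hM, e0, M.ric_rr]
  simp only [mul_zero, sub_zero, ev_add, ev_sub, ev_mul, ev_neg, Nat.factorial_zero, Nat.cast_one,
    one_mul, evφ, ev_sum _ _ hz, FormalMetric.coeff_zero_Γ_rxx, ev_half hz,
    evhi, evG, FormalMetric.coeff_zero_trace_r, Derivation.leibniz,
    derivation_half, smul_eq_mul, map_sum, eH, ek, ev_zero, Finset.sum_add_distrib]
  have hGs' : ∀ A B, G A B = G B A := hGs z.1 hz.1
  have t1 : ∑ A, ∑ B, k A B * H A B = (k * H).trace := (trace_mul_of_symm hHs).symm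
  have t2 : ∑ A, ∑ B, k A B * G A B = (k * G).trace := (trace_mul_of_symm hGs').symm
  -- Differentiating the inverse in `-½ ∂_r (g^{AB} ∂_r g_{AB})` gives `½ tr X²`; together with `-¼
  -- tr X²` from `t4` this is the `¼ tr X²` of the Raychaudhuri expression.
  have t3 : ∑ A, ∑ B, G A B * -(k * G * k) A B = -(k * G * (k * G)).trace := by
    simp only [Matrix.trace, Matrix.diag_apply]
    rw [← Finset.sum_neg_distrib]
    refine Finset.sum_congr rfl fun A _ => ?_
    rw [← Matrix.mul_assoc, Matrix.mul_apply, ← Finset.sum_neg_distrib]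
    refine Finset.sum_congr rfl fun B _ => ?_
    rw [hGs' A B]
    ring
  have t4 : ∑ C, ∑ E, (1 / 2 * ∑ F, k C F * G E F) * (1 / 2 * ∑ F, k E F * G C F)
      = 1 / 4 * (k * G * (k * G)).trace := by
    simp only [Matrix.trace, Matrix.diag_apply]
    rw [Finset.mul_sum]
    refine Finset.sum_congr rfl fun A _ => ?_
    rw [Matrix.mul_apply, Finset.mul_sum]
    refine Finset.sum_congr rfl fun B _ => ?_
    have : ∀ C E, ∑ F, k C F * G E F = (k * G) C E := fun C E => by
      rw [Matrix.mul_apply]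
      exact Finset.sum_congr rfl fun F _ => by rw [hGs' E F]
    rw [this, this]
    ring
  rw [t1, t2, t3, t4, raychaudhuri]
  rw [← hkdef, ← hGdef, ← hHdef]
  ring

end CoordJet

open PowerSeries

variable {d : ℕ}

/-! ### The component `R_{uu}` and the Raychaudhuri expression in the transverse direction -/

section

variable {R : Type*} [CommRing R] [Algebra ℝ R] {κ : Type*} [Fintype κ] [DecidableEq κ]

/-- `R_{uu}` for a metric of Isenberg–Moncrief form. -/
lemma ricciOf_uu_trace {D : Idx d → Derivation ℝ R R} {φ : R} {b : Fin d → R}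
    {h hi : Matrix (Fin d) (Fin d) R} (hs : hᵀ = h) (hinv : hi * h = 1) :
    ricciOf D (leviCivita D (imMetric φ b h) (imInv φ b hi)) iu iu
      = -(half R) * (hi * dMat (D iu) (dMat (D iu) h)).trace
        + half R * half R * (hi * dMat (D iu) h * (hi * dMat (D iu) h)).trace := by
  have hs' : ∀ A B, h A B = h B A := fun A B => by
    conv_lhs => rw [← hs]
    rfl
  have e1 : ∀ C E, ∑ B, hi C B * D iu (h E B) = (hi * dMat (D iu) h) C E := fun C E => by
    rw [Matrix.mul_apply]
    exact Finset.sum_congr rfl fun B _ => by rw [dMat_apply, hs' E B]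
  have e2 : ∑ A, ∑ B, hi A B * D iu (h A B) = (hi * dMat (D iu) h).trace := by
    rw [Matrix.trace]
    exact Finset.sum_congr rfl fun A _ => e1 A A
  have e3 : D iu (hi * dMat (D iu) h).trace = (hi * dMat (D iu) (dMat (D iu) h)).trace
      - (hi * dMat (D iu) h * (hi * dMat (D iu) h)).trace := by
    have : D iu (hi * dMat (D iu) h).trace = (dMat (D iu) (hi * dMat (D iu) h)).trace := by
      simp only [Matrix.trace, map_sum]
      rfl
    rw [this, dMat_mul, dMat_inv (D iu) hinv, Matrix.trace_add, Matrix.neg_mul, Matrix.trace_neg]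
    simp only [Matrix.mul_assoc]
    ring
  rw [ricciOf_uu hs hinv, e2]
  simp only [e1, Derivation.leibniz, derivation_half, smul_eq_mul, e3]
  have e4 : ∑ C, ∑ E, half R * (hi * dMat (D iu) h) C E * (half R * (hi * dMat (D iu) h) E C)
      = half R * half R * (hi * dMat (D iu) h * (hi * dMat (D iu) h)).trace := by
    rw [Matrix.trace, Finset.mul_sum]
    refine Finset.sum_congr rfl fun C _ => ?_
    rw [Matrix.diag_apply, Matrix.mul_apply, Finset.mul_sum]
    exact Finset.sum_congr rfl fun E _ => by ring
  rw [e4]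
  linear_combination (half R * (hi * dMat (D iu) h * (hi * dMat (D iu) h)).trace)
    * (1 - half_add_half (R := R)) 

end

namespace CoordJet

variable {P : Patch d} {J J' : CoordJet d}

lemma hasDerivAt_line {F : (Idx d → ℝ) → ℝ} (hF : DifferentiableOn ℝ F (domain P.I P.U))
    {z : ℝ × Vec d} (hz : z ∈ P.K.carrier) (u : ℝ) :
    HasDerivAt (fun u => F (pt u z.1 z.2)) (partialDeriv (domain P.I P.U) iu F (pt u z.1 z.2)) u := by
  have h1 : HasDerivAt (fun u => pt u z.1 z.2) (Pi.single iu 1 : Idx d → ℝ) u := by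
    rw [hasDerivAt_pi]
    rw [forall_idx]
    refine ⟨?_, ?_, fun A => ?_⟩
    · exact hasDerivAt_id' u
    · simpa [pt] using hasDerivAt_const u z.1
    · simpa [pt] using hasDerivAt_const u (z.2 A)
  rw [← hasDerivWithinAt_univ] at h1 ⊢
  exact (hF _ (P.pt_mem hz u)).hasFDerivWithinAt.comp_hasDerivWithinAt (s := Set.univ)
    (t := domain P.I P.U) u h1 (fun v _ => P.pt_mem hz v)

/-- `R_{uu}` and its transverse derivatives are given by the Raychaudhuri expression in the
transverse direction. -/
theorem IsSmooth.einstein_uu (hJ : J.IsSmooth P) (Λ : ℝ) (i : ℕ) {z : ℝ × Vec d}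
    (hz : z ∈ P.K.carrier) :
    J.einstein P.I P.U Λ i iu iu z.1 z.2 = iteratedDeriv i (raychaudhuri Set.univ
      (fun u => Matrix.of fun A B => taylorSum (i + 2) (fun j => J.g j z.1 z.2 A B) u) 0) 0 := by
  set m := i + 2 with hm
  set F : Fin d → Fin d → (Idx d → ℝ) → ℝ := fun A B p =>
    taylorSum m (fun j => J.g j (p ir) (xPart p) A B) (p iu) with hF
  set F1 : Fin d → Fin d → (Idx d → ℝ) → ℝ := fun A B => partialDeriv (domain P.I P.U) iu (F A B)
    with hF1
  set F2 : Fin d → Fin d → (Idx d → ℝ) → ℝ := fun A B => partialDeriv (domain P.I P.U) iu (F1 A B)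
    with hF2
  set M := (hJ.trunc m).formal with hM
  have t0 : ∀ A B, P.HasTaylor (F A B) (M.h A B) := hJ.hasTaylor_g m
  have t1 : ∀ A B, P.HasTaylor (F1 A B) (P.frame iu (M.h A B)) := fun A B => (t0 A B).partialDeriv iu
  have t2 : ∀ A B, P.HasTaylor (F2 A B) (P.frame iu (P.frame iu (M.h A B))) :=
    fun A B => (t1 A B).partialDeriv iu
  have tk : ∀ A B, P.HasTaylor (fun p => (Matrix.of fun A B => F A B p)⁻¹ A B) (M.hi A B) :=
    Patch.HasTaylor.matrix_inv t0 M.inv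
  have tmul : ∀ {G H : (Idx d → ℝ) → Matrix (Fin d) (Fin d) ℝ}
      {a b : Matrix (Fin d) (Fin d) P.K.Ring⟦X⟧}, (∀ A B, P.HasTaylor (fun p => G p A B) (a A B)) →
      (∀ A B, P.HasTaylor (fun p => H p A B) (b A B)) →
      ∀ A B, P.HasTaylor (fun p => (G p * H p) A B) ((a * b) A B) := by
    intro G H a b hG hH A B
    simp only [Matrix.mul_apply]
    exact Patch.HasTaylor.sum _ fun C _ => (hG A C).mul (hH C B)
  have ttr : ∀ {G : (Idx d → ℝ) → Matrix (Fin d) (Fin d) ℝ}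
      {a : Matrix (Fin d) (Fin d) P.K.Ring⟦X⟧}, (∀ A B, P.HasTaylor (fun p => G p A B) (a A B)) →
      P.HasTaylor (fun p => (G p).trace) a.trace := by
    intro G a hG
    simp only [Matrix.trace]
    exact Patch.HasTaylor.sum _ fun C _ => hG C C
  have tk1 := tmul (H := fun p => Matrix.of fun A B => F1 A B p) (b := dMat (P.frame iu) M.h) tk t1
  have tR := ((ttr (tmul (H := fun p => Matrix.of fun A B => F2 A B p)
      (b := dMat (P.frame iu) (dMat (P.frame iu) M.h)) tk t2)).half_mul.neg).add
    ((ttr (tmul tk1 tk1)).half_mul.half_mul)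
  have hR : M.ric iu iu = -(half _ * (M.hi * dMat (P.frame iu) (dMat (P.frame iu) M.h)).trace)
      + half _ * (half _ * (M.hi * dMat (P.frame iu) M.h * (M.hi * dMat (P.frame iu) M.h)).trace) := by
    have := ricciOf_uu_trace (D := P.frame) (φ := M.φ) (b := M.b) M.symm M.inv
    rw [FormalMetric.ric, FormalMetric.Γ, FormalMetric.g, FormalMetric.gi, this]
    ring
  rw [← hR] at tR
  -- The iterated derivative is applied to an expression which itself contains derivatives in `u`.
  -- The Taylor polynomials are smooth on the whole domain, so these inner derivatives can be
  -- identified with partial derivatives at every `u`, not only near `0`.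
  have hcd : ∀ A B, ContDiffOn ℝ ∞ (F A B) (domain P.I P.U) := by
    intro A B
    simp only [hF, taylorSum]
    refine ContDiffOn.sum fun j _ => ContDiffOn.mul ?_ ?_
    · exact ((contDiff_apply ℝ ℝ (iu : Idx d)).pow j).div_const _ |>.contDiffOn
    · exact (hJ.smooth_g j A B).comp (Patch.proj d).contDiff.contDiffOn (fun p hp => hp)
  have hcd1 : ∀ A B, ContDiffOn ℝ ∞ (F1 A B) (domain P.I P.U) := fun A B =>
    contDiffOn_fderivWithin_apply P.uniqueDiffOn_domain (hcd A B) _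
  have d1 : ∀ A B u, deriv (fun u => F A B (pt u z.1 z.2)) u = F1 A B (pt u z.1 z.2) := fun A B u =>
    (hasDerivAt_line ((hcd A B).differentiableOn (by simp)) hz u).deriv
  have d2 : ∀ A B u, deriv (fun u => F1 A B (pt u z.1 z.2)) u = F2 A B (pt u z.1 z.2) := fun A B u =>
    (hasDerivAt_line ((hcd1 A B).differentiableOn (by simp)) hz u).deriv
  have e0 : (fun u => Matrix.of fun A B => taylorSum m (fun j => J.g j z.1 z.2 A B) u)
      = fun u => Matrix.of fun A B => F A B (pt u z.1 z.2) := by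
    funext u
    rfl
  have e1 : entryDeriv Set.univ (fun u => Matrix.of fun A B => F A B (pt u z.1 z.2))
      = fun u => Matrix.of fun A B => F1 A B (pt u z.1 z.2) := by
    funext u
    ext A B
    simp only [entryDeriv, Matrix.of_apply, derivWithin_univ, d1]
  have e2 : entryDeriv Set.univ (fun u => Matrix.of fun A B => F1 A B (pt u z.1 z.2))
      = fun u => Matrix.of fun A B => F2 A B (pt u z.1 z.2) := by
    funext u
    ext A B
    simp only [entryDeriv, Matrix.of_apply, derivWithin_univ, d2]
  have eR : raychaudhuri Set.univ
      (fun u => Matrix.of fun A B => taylorSum m (fun j => J.g j z.1 z.2 A B) u) 0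
      = fun u => (fun p => -(1 / 2 * ((Matrix.of fun A B => F A B p)⁻¹
          * Matrix.of fun A B => F2 A B p).trace)
        + 1 / 2 * (1 / 2 * ((Matrix.of fun A B => F A B p)⁻¹ * (Matrix.of fun A B => F1 A B p)
          * ((Matrix.of fun A B => F A B p)⁻¹ * Matrix.of fun A B => F1 A B p)).trace))
        (pt u z.1 z.2) := by
    funext u
    rw [e0, raychaudhuri, e1, e2]
    ring
  rw [eR, tR.iteratedDeriv_eq i hz, hJ.einstein_eq Λ i _ _ hz, IsSmooth.ein, hM, hm,
    map_sub, hJ.eqv_trunc (i + 1) i le_rfl]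
  have h0 : hJ.formal.g iu iu = 0 := by simp only [FormalMetric.g, imMetric_uu]
  rw [h0, mul_zero, map_zero, sub_zero]

end CoordJet

/-! ### Linear ordinary differential equations depending smoothly on parameters -/

section ContinuousFunctions

variable (E : Type) [NormedAddCommGroup E] [NormedSpace ℝ E]

/-- Continuous functions on the unit interval, with the supremum norm. -/
def IntervalMap : Type := C(unitInterval, E)

instance : NormedAddCommGroup (IntervalMap E) :=
  inferInstanceAs (NormedAddCommGroup C(unitInterval, E))

instance : NormedSpace ℝ (IntervalMap E) := inferInstanceAs (NormedSpace ℝ C(unitInterval, E))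

instance [CompleteSpace E] : CompleteSpace (IntervalMap E) :=
  inferInstanceAs (CompleteSpace C(unitInterval, E))

instance : FunLike (IntervalMap E) unitInterval E :=
  inferInstanceAs (FunLike C(unitInterval, E) unitInterval E)

namespace IntervalMap

variable {E}

/-- The element given by a continuous function. -/
def of (f : C(unitInterval, E)) : IntervalMap E := f

@[simp] lemma of_apply (f : C(unitInterval, E)) (s : unitInterval) : of f s = f s := rfl

@[ext] lemma ext {w w' : IntervalMap E} (h : ∀ s, w s = w' s) : w = w' := DFunLike.ext _ _ h

lemma continuous (w : IntervalMap E) : Continuous (fun s => w s) := ContinuousMap.continuous _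

lemma norm_le (w : IntervalMap E) {c : ℝ} (hc : 0 ≤ c) : ‖w‖ ≤ c ↔ ∀ s, ‖w s‖ ≤ c :=
  ContinuousMap.norm_le (w : C(unitInterval, E)) hc

lemma norm_apply_le (w : IntervalMap E) (s : unitInterval) : ‖w s‖ ≤ ‖w‖ :=
  ContinuousMap.norm_coe_le_norm (w : C(unitInterval, E)) s

@[simp] lemma add_apply (w w' : IntervalMap E) (s : unitInterval) : (w + w') s = w s + w' s := rfl
@[simp] lemma sub_apply (w w' : IntervalMap E) (s : unitInterval) : (w - w') s = w s - w' s := rfl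
@[simp] lemma smul_apply (c : ℝ) (w : IntervalMap E) (s : unitInterval) : (c • w) s = c • w s := rfl

/-- Evaluation. -/
def eval (s : unitInterval) : IntervalMap E →L[ℝ] E :=
  LinearMap.mkContinuous
    { toFun := fun w => w s, map_add' := fun _ _ => rfl, map_smul' := fun _ _ => rfl } 1
    fun w => by rw [one_mul]; exact w.norm_apply_le s

lemma sum_apply {κ : Type*} (t : Finset κ) (w : κ → IntervalMap E) (s : unitInterval) :
    (∑ k ∈ t, w k) s = ∑ k ∈ t, w k s := map_sum (eval s) w t

end IntervalMap

end ContinuousFunctions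

/-! ### Smooth families as smooth maps into continuous functions on the unit interval -/

section Slice

open Set Filter Topology

variable {Z E : Type} [NormedAddCommGroup Z] [NormedSpace ℝ Z] [NormedAddCommGroup E]
  [NormedSpace ℝ E] {Ω : Set Z} {f : Z × ℝ → E}

open Classical in
/-- The function `s ↦ f (z, s)` on the unit interval. -/
def slice (f : Z × ℝ → E) (z : Z) : IntervalMap E :=
  if h : Continuous (fun s : unitInterval => f (z, s)) then IntervalMap.of ⟨_, h⟩ else 0

lemma slice_apply (hf : ContinuousOn f (Ω ×ˢ Icc 0 1)) {z : Z} (hz : z ∈ Ω) (s : unitInterval) :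
    slice f z s = f (z, s) := by
  have : Continuous (fun s : unitInterval => f (z, s)) :=
    hf.comp_continuous (by fun_prop) fun s => ⟨hz, s.2⟩
  simp [slice, this]

/-- Currying is continuous for the compact-open topology, which on a compact interval is that of the
supremum norm. -/
lemma continuousOn_slice (hf : ContinuousOn f (Ω ×ˢ Icc 0 1)) : ContinuousOn (slice f) Ω := by
  have hc : Continuous (fun p : Ω × unitInterval => f (p.1, p.2)) :=
    hf.comp_continuous (by fun_prop) fun p => ⟨p.1.2, p.2.2⟩
  rw [continuousOn_iff_continuous_domRestrict]
  have h : Ω.domRestrict (slice f) = fun z => IntervalMap.of (ContinuousMap.curry ⟨_, hc⟩ z) := by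
    funext z
    ext s
    exact slice_apply hf z.2 s
  rw [h]
  exact ContinuousMap.continuous _

variable [FiniteDimensional ℝ Z]

/-- The derivative of `slice f`. -/
def sliceDeriv (Ω : Set Z) (f : Z × ℝ → E) (z : Z) : Z →L[ℝ] IntervalMap E :=
  ∑ i, ((Module.finBasis ℝ Z).coord i).toContinuousLinearMap.smulRight
    (slice (fun p => fderivWithin ℝ f (Ω ×ˢ Icc 0 1) p (Module.finBasis ℝ Z i, 0)) z)

lemma sliceDeriv_apply (hf : ContinuousOn (fderivWithin ℝ f (Ω ×ˢ Icc 0 1)) (Ω ×ˢ Icc 0 1))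
    {z : Z} (hz : z ∈ Ω) (v : Z) (s : unitInterval) :
    sliceDeriv Ω f z v s = fderivWithin ℝ f (Ω ×ˢ Icc 0 1) (z, s) (v, 0) := by
  have h : ∀ w, slice (fun p => fderivWithin ℝ f (Ω ×ˢ Icc 0 1) p (w, 0)) z s
      = fderivWithin ℝ f (Ω ×ˢ Icc 0 1) (z, s) (w, 0) := fun w =>
    slice_apply (hf.clm_apply continuousOn_const) hz s
  simp only [sliceDeriv, ContinuousLinearMap.sum_apply, ContinuousLinearMap.smulRight_apply,
    IntervalMap.sum_apply, IntervalMap.smul_apply, h]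
  have e : v = ∑ i, (Module.finBasis ℝ Z).coord i v • Module.finBasis ℝ Z i := by
    simp [Module.Basis.sum_repr]
  have e2 : ((v, 0) : Z × ℝ) = ∑ i, (Module.finBasis ℝ Z).coord i v • (Module.finBasis ℝ Z i, 0) := by
    refine Prod.ext ?_ ?_
    · rw [Prod.fst_sum]
      exact e
    · rw [Prod.snd_sum]
      simp
  rw [e2, map_sum]
  exact Finset.sum_congr rfl fun i _ => (map_smul _ _ _).symm

/-- The mean value inequality for `w ↦ f (w, s)` on a convex neighbourhood, uniformly in `s`:
continuity of the curried derivative `slice D` in the supremum norm bounds the variation of the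
derivative for all `s` at once. Local convexity of `Ω` is what makes the inequality available at
boundary points. -/
lemma hasFDerivWithinAt_slice (hc : ∀ z ∈ Ω, ∃ r > 0, Convex ℝ (Ω ∩ Metric.ball z r))
    (hu : UniqueDiffOn ℝ (Ω ×ˢ Icc (0 : ℝ) 1)) (hf : ContDiffOn ℝ 1 f (Ω ×ˢ Icc 0 1)) {z : Z}
    (hz : z ∈ Ω) : HasFDerivWithinAt (slice f) (sliceDeriv Ω f z) Ω z := by
  have hfc := hf.continuousOn
  have hd : ContinuousOn (fderivWithin ℝ f (Ω ×ˢ Icc 0 1)) (Ω ×ˢ Icc 0 1) :=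
    hf.continuousOn_fderivWithin hu le_rfl
  set D : Z × ℝ → Z →L[ℝ] E := fun p =>
    (fderivWithin ℝ f (Ω ×ˢ Icc 0 1) p).comp (ContinuousLinearMap.inl ℝ Z ℝ) with hD
  have hDc : ContinuousOn D (Ω ×ˢ Icc 0 1) := hd.clm_comp continuousOn_const
  have hDs := continuousOn_slice hDc z hz
  have hder : ∀ s ∈ Icc (0 : ℝ) 1, ∀ w ∈ Ω, HasFDerivWithinAt (fun w => f (w, s)) (D (w, s)) Ω w := by
    intro s hs w hw
    have h1 := (hf.differentiableOn (by simp) (w, s) ⟨hw, hs⟩).hasFDerivWithinAt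
    exact h1.comp w ((hasFDerivWithinAt_id w Ω).prodMk (hasFDerivWithinAt_const s w Ω))
      (s := Ω) (t := Ω ×ˢ Icc 0 1) (fun w' hw' => ⟨hw', hs⟩)
  rw [hasFDerivWithinAt_iff_isLittleO, Asymptotics.isLittleO_iff]
  intro c hcpos
  obtain ⟨r, hr, hconv⟩ := hc z hz
  obtain ⟨ρ, hρ, hρD⟩ := Metric.continuousWithinAt_iff.mp hDs c hcpos
  have hconv' : Convex ℝ (Ω ∩ Metric.ball z (min r ρ)) := by
    have : Ω ∩ Metric.ball z (min r ρ) = (Ω ∩ Metric.ball z r) ∩ Metric.ball z ρ := by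
      rw [inter_assoc]
      congr 1
      ext w
      simp [lt_min_iff]
    rw [this]
    exact hconv.inter (convex_ball z ρ)
  have hev : ∀ᶠ w in 𝓝[Ω] z, w ∈ Ω ∩ Metric.ball z (min r ρ) :=
    inter_mem self_mem_nhdsWithin (mem_nhdsWithin_of_mem_nhds (Metric.ball_mem_nhds z (lt_min hr hρ)))
  filter_upwards [hev] with w hw
  rw [IntervalMap.norm_le _ (by positivity)]
  intro s
  have hz' : z ∈ Ω ∩ Metric.ball z (min r ρ) := ⟨hz, Metric.mem_ball_self (lt_min hr hρ)⟩
  have key := hconv'.norm_image_sub_le_of_norm_hasFDerivWithin_le' (f := fun w => f (w, s))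
    (f' := fun w => D (w, s)) (φ := D (z, s)) (C := c)
    (fun x hx => (hder s s.2 x hx.1).mono inter_subset_left) (fun x hx => ?_) hz' hw
  · simp only [IntervalMap.sub_apply, slice_apply hfc hw.1, slice_apply hfc hz,
      sliceDeriv_apply hd hz]
    exact key
  · have h1 := (hρD hx.1 (lt_of_lt_of_le hx.2 (min_le_right _ _))).le
    rw [dist_eq_norm] at h1
    have h2 := (IntervalMap.norm_apply_le (slice D x - slice D z) s).trans h1
    rwa [IntervalMap.sub_apply, slice_apply hDc hx.1, slice_apply hDc hz] at h2

/-- Smoothness of the curried form of a smooth function. -/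
lemma contDiffOn_slice (hc : ∀ z ∈ Ω, ∃ r > 0, Convex ℝ (Ω ∩ Metric.ball z r))
    (hΩ : UniqueDiffOn ℝ Ω) (hf : ContDiffOn ℝ ∞ f (Ω ×ˢ Icc 0 1)) :
    ContDiffOn ℝ ∞ (slice f) Ω := by
  have hu : UniqueDiffOn ℝ (Ω ×ˢ Icc (0 : ℝ) 1) := hΩ.prod (uniqueDiffOn_Icc zero_lt_one)
  rw [contDiffOn_infty]
  intro n
  induction n generalizing f with
  | zero => exact contDiffOn_zero.mpr (continuousOn_slice hf.continuousOn)
  | succ n ih =>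
    have hder : ∀ z ∈ Ω, HasFDerivWithinAt (slice f) (sliceDeriv Ω f z) Ω z := fun z hz =>
      hasFDerivWithinAt_slice hc hu (hf.of_le (by exact_mod_cast le_top)) hz
    push_cast
    rw [contDiffOn_succ_iff_fderivWithin hΩ]
    refine ⟨fun z hz => (hder z hz).differentiableWithinAt, by simp, ?_⟩
    -- Written in a basis, the derivative is a finite sum of slices of smooth functions with values
    -- in the same space, so the induction hypothesis applies.
    have h1 : ContDiffOn ℝ n (sliceDeriv Ω f) Ω := by
      refine ContDiffOn.sum fun i _ => contDiffOn_const.smulRight (ih ?_)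
      exact (hf.fderivWithin hu (m := ∞) (by simp)).clm_apply contDiffOn_const
    exact h1.congr fun z hz => (hder z hz).fderivWithin (hΩ z hz)

end Slice

/-! ### Volterra equations on the unit interval -/

section Volterra

open Set Filter Topology

variable {E : Type} [NormedAddCommGroup E] [NormedSpace ℝ E] [CompleteSpace E]

/-- A continuous function on the unit interval, extended to the real line by constants. -/
def extendI (w : IntervalMap E) (t : ℝ) : E := w (projIcc 0 1 zero_le_one t)

lemma continuous_extendI (w : IntervalMap E) : Continuous (extendI w) :=
  w.continuous.comp continuous_projIcc

lemma extendI_of_mem (w : IntervalMap E) {t : ℝ} (ht : t ∈ Icc (0 : ℝ) 1) :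
    extendI w t = w ⟨t, ht⟩ := by
  rw [extendI, projIcc_of_mem _ ht]

lemma norm_extendI_le (w : IntervalMap E) (t : ℝ) : ‖extendI w t‖ ≤ ‖w‖ :=
  w.norm_apply_le _

variable (E) in
/-- The integral from zero, as an operator on continuous functions on the unit interval. -/
def integralOp : IntervalMap E →L[ℝ] IntervalMap E :=
  LinearMap.mkContinuous
    { toFun := fun w => IntervalMap.of ⟨fun s => ∫ t in (0 : ℝ)..s, extendI w t,
        (intervalIntegral.continuous_primitive
          (fun a b => (continuous_extendI w).intervalIntegrable a b) 0).comp continuous_subtype_val⟩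
      map_add' := fun w w' => by
        ext s
        exact intervalIntegral.integral_add ((continuous_extendI w).intervalIntegrable 0 s)
          ((continuous_extendI w').intervalIntegrable 0 s)
      map_smul' := fun c w => by
        ext s
        exact intervalIntegral.integral_smul c (extendI w) }
    1 fun w => by
      rw [one_mul, IntervalMap.norm_le _ (norm_nonneg _)]
      intro s
      refine (intervalIntegral.norm_integral_le_of_norm_le_const
        fun t _ => norm_extendI_le w t).trans ?_
      rw [sub_zero, abs_of_nonneg s.2.1]
      exact mul_le_of_le_one_right (norm_nonneg _) s.2.2

lemma integralOp_apply (w : IntervalMap E) (s : unitInterval) :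
    integralOp E w s = ∫ t in (0 : ℝ)..s, extendI w t := rfl

variable (E) in
/-- Pointwise application of operator-valued functions. -/
def applyOp : IntervalMap (E →L[ℝ] E) →L[ℝ] IntervalMap E →L[ℝ] IntervalMap E :=
  LinearMap.mkContinuous₂
    (LinearMap.mk₂ ℝ (fun (a : IntervalMap (E →L[ℝ] E)) (w : IntervalMap E) =>
        IntervalMap.of ⟨fun s => a s (w s), a.continuous.clm_apply w.continuous⟩)
      (fun a a' w => by ext; simp) (fun c a w => by ext; simp)
      (fun a w w' => by ext; simp) (fun c a w => by ext; simp))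
    1 fun (a : IntervalMap (E →L[ℝ] E)) (w : IntervalMap E) => by
      rw [one_mul, LinearMap.mk₂_apply, IntervalMap.norm_le _ (by positivity)]
      intro s
      exact ((a s).le_opNorm _).trans
        (mul_le_mul (a.norm_apply_le s) (w.norm_apply_le s) (norm_nonneg _) (norm_nonneg _))

lemma applyOp_apply (a : IntervalMap (E →L[ℝ] E)) (w : IntervalMap E) (s : unitInterval) :
    applyOp E a w s = a s (w s) := rfl

variable (E) in
/-- The Volterra operator. -/
def volterra : IntervalMap (E →L[ℝ] E) →L[ℝ] IntervalMap E →L[ℝ] IntervalMap E :=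
  (ContinuousLinearMap.compL ℝ _ _ _ (integralOp E)).comp (applyOp E)

lemma volterra_apply (a : IntervalMap (E →L[ℝ] E)) (w : IntervalMap E) :
    volterra E a w = integralOp E (applyOp E a w) := rfl

/-- Keeping the factor `s ^ n` makes the induction close: each integration of `t ^ n` produces `s ^
(n + 1) / (n + 1)`, whence the factorial. -/
lemma norm_volterra_pow_le (a : IntervalMap (E →L[ℝ] E)) (n : ℕ) (w : IntervalMap E)
    (s : unitInterval) :
    ‖((volterra E a) ^ n) w s‖ ≤ ‖a‖ ^ n / n.factorial * ‖w‖ * (s : ℝ) ^ n := by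
  induction n generalizing s with
  | zero => simpa using w.norm_apply_le s
  | succ n ih =>
    rw [pow_succ', ContinuousLinearMap.mul_apply, volterra_apply, integralOp_apply]
    have h1 : ∀ t ∈ Icc (0 : ℝ) s, ‖extendI (applyOp E a ((volterra E a ^ n) w)) t‖
        ≤ ‖a‖ * (‖a‖ ^ n / n.factorial * ‖w‖) * t ^ n := by
      intro t ht
      have ht' : t ∈ Icc (0 : ℝ) 1 := ⟨ht.1, ht.2.trans s.2.2⟩
      rw [extendI_of_mem _ ht', applyOp_apply, mul_assoc]
      exact ((a _).le_opNorm _).trans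
        (mul_le_mul (a.norm_apply_le _) (ih _) (norm_nonneg _) (norm_nonneg _))
    have h2 := intervalIntegral.norm_integral_le_of_norm_le (μ := MeasureTheory.volume) s.2.1
      (Eventually.of_forall fun t ht => h1 t ⟨ht.1.le, ht.2⟩)
      (Continuous.intervalIntegrable (by fun_prop) 0 (s : ℝ))
    refine h2.trans (le_of_eq ?_)
    rw [intervalIntegral.integral_const_mul, integral_pow, Nat.factorial_succ]
    push_cast
    simp only [zero_pow (Nat.succ_ne_zero n), sub_zero]
    field_simp
    rw [pow_succ']
    ring

/-- By the factorial bound some power `V ^ n` has norm less than one, so `1 - V ^ n` is invertible.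
It is the product of the commuting factors `1 - V` and the geometric sum, hence `1 - V` is
invertible too. No smallness of `a` is needed. -/
lemma isUnit_one_sub_volterra (a : IntervalMap (E →L[ℝ] E)) :
    IsUnit (1 - volterra E a) := by
  obtain ⟨n, hn⟩ := ((FloorSemiring.tendsto_pow_div_factorial_atTop ‖a‖).eventually
    (gt_mem_nhds zero_lt_one)).exists
  have h1 : ‖(volterra E a) ^ n‖ < 1 := by
    refine lt_of_le_of_lt (ContinuousLinearMap.opNorm_le_bound _ (by positivity) fun w => ?_) hn
    rw [IntervalMap.norm_le _ (by positivity)]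
    intro s
    refine (norm_volterra_pow_le a n w s).trans ?_
    exact mul_le_of_le_one_right (by positivity) (pow_le_one₀ s.2.1 s.2.2)
  have h2 : IsUnit (1 - (volterra E a) ^ n) := isUnit_one_sub_of_norm_lt_one h1
  have hc : Commute (1 - volterra E a) (∑ i ∈ Finset.range n, (volterra E a) ^ i) := by
    rw [commute_iff_eq, mul_neg_geom_sum, geom_sum_mul_neg]
  rw [← mul_neg_geom_sum, hc.isUnit_mul_iff] at h2
  exact h2.1

/-- The solution of `w = c + ∫ a w`. -/
def volterraSol (a : IntervalMap (E →L[ℝ] E)) (c : IntervalMap E) : IntervalMap E :=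
  Ring.inverse (1 - volterra E a) c

/-- Both directions matter: one gives the integral equation, the other uniqueness, used for the
scaling property of solutions. -/
lemma volterraSol_eq_iff {a : IntervalMap (E →L[ℝ] E)} {c w : IntervalMap E} :
    w = volterraSol a c ↔ w = c + volterra E a w := by
  have hu := isUnit_one_sub_volterra a
  constructor
  · rintro rfl
    have h := congrArg (fun T : IntervalMap E →L[ℝ] IntervalMap E => T c)
      (Ring.mul_inverse_cancel _ hu)
    simp only [ContinuousLinearMap.mul_apply, ContinuousLinearMap.sub_apply,
      ContinuousLinearMap.one_apply] at h
    rw [sub_eq_iff_eq_add] at h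
    exact h
  · intro h
    have h1 : c = (1 - volterra E a) w := by
      rw [ContinuousLinearMap.sub_apply, ContinuousLinearMap.one_apply, eq_sub_iff_add_eq]
      exact h.symm
    have h2 := congrArg (fun T : IntervalMap E →L[ℝ] IntervalMap E => T w)
      (Ring.inverse_mul_cancel _ hu)
    rw [volterraSol, h1]
    exact h2.symm

/-- The operator depends linearly and continuously on the coefficient, and inversion is smooth at
units. Smooth dependence on parameters thus needs no differentiation of the ODE. -/
lemma contDiffOn_volterraSol {Z : Type} [NormedAddCommGroup Z] [NormedSpace ℝ Z] {Ω : Set Z}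
    {a : Z → IntervalMap (E →L[ℝ] E)} {c : Z → IntervalMap E}
    (ha : ContDiffOn ℝ ∞ a Ω) (hc : ContDiffOn ℝ ∞ c Ω) :
    ContDiffOn ℝ ∞ (fun z => volterraSol (a z) (c z)) Ω := by
  refine ContDiffOn.clm_apply (fun z hz => ?_) hc
  obtain ⟨u, hu⟩ := isUnit_one_sub_volterra (a z)
  have h1 : ContDiffAt ℝ ∞ Ring.inverse (1 - volterra E (a z)) := by
    rw [← hu]
    exact contDiffAt_ringInverse ℝ u
  have h2 : ContDiffOn ℝ ∞ (fun z => 1 - volterra E (a z)) Ω :=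
    contDiffOn_const.sub (ContDiff.comp_contDiffOn (volterra E).contDiff ha)
  exact h1.comp_contDiffWithinAt z (h2 z hz)

end Volterra

/-! ### Transport equations along the generators -/

section TransportODE

open Set Filter Topology

variable {d : ℕ} {P : Patch d}

/-- Intersected with a ball, the patch is a product of an interval and a ball. This provides the
local convexity for the mean value inequality, also at endpoints of the interval. -/
lemma Patch.exists_convex (P : Patch d) {z : ℝ × Vec d} (hz : z ∈ P.K.carrier) :
    ∃ r > 0, Convex ℝ (P.K.carrier ∩ Metric.ball z r) := by
  obtain ⟨r, hr, h⟩ := Metric.isOpen_iff.mp P.isOpen z.2 hz.2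
  refine ⟨r, hr, ?_⟩
  have : P.K.carrier ∩ Metric.ball z r
      = (P.I ∩ Metric.ball z.1 r) ×ˢ (Metric.ball z.2 r) := by
    rw [← Prod.mk.eta (p := z), ← ball_prod_same]
    ext w
    constructor
    · rintro ⟨hw, hw1, hw2⟩
      exact ⟨⟨hw.1, hw1⟩, hw2⟩
    · rintro ⟨⟨hw, hw1⟩, hw2⟩
      exact ⟨⟨hw, h hw2⟩, hw1, hw2⟩
  rw [this]
  exact (P.ord.convex.inter (convex_ball _ _)).prod (convex_ball _ _)

variable {E : Type} [NormedAddCommGroup E] [NormedSpace ℝ E]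

/-- The point at parameter `s` on the segment from the cross-section `r = σ` to a given point. -/
def ray (σ : Vec d → ℝ) (q : (ℝ × Vec d) × ℝ) : ℝ × Vec d :=
  (σ q.1.2 + q.2 * (q.1.1 - σ q.1.2), q.1.2)

lemma ray_mem {σ : Vec d → ℝ} (hσI : ∀ y ∈ P.U, σ y ∈ P.I) {q : (ℝ × Vec d) × ℝ}
    (hq : q ∈ P.K.carrier ×ˢ Icc (0 : ℝ) 1) : ray σ q ∈ P.K.carrier := by
  refine ⟨?_, hq.1.2⟩
  have h := P.ord.convex (hσI _ hq.1.2) hq.1.1 (a := 1 - q.2) (b := q.2) (by linarith [hq.2.2]) hq.2.1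
    (by ring)
  convert h using 1
  simp only [smul_eq_mul, ray]
  ring

lemma contDiffOn_ray {σ : Vec d → ℝ} (hσ : ContDiffOn ℝ ∞ σ P.U) :
    ContDiffOn ℝ ∞ (ray σ) (P.K.carrier ×ˢ Icc (0 : ℝ) 1) := by
  have h1 : ContDiffOn ℝ ∞ (fun q : (ℝ × Vec d) × ℝ => σ q.1.2) (P.K.carrier ×ˢ Icc (0 : ℝ) 1) :=
    hσ.comp (contDiff_snd.comp contDiff_fst).contDiffOn fun q hq => hq.1.2
  have h2 : ContDiffOn ℝ ∞ (fun q : (ℝ × Vec d) × ℝ => q.2) (P.K.carrier ×ˢ Icc (0 : ℝ) 1) :=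
    contDiff_snd.contDiffOn
  have h3 : ContDiffOn ℝ ∞ (fun q : (ℝ × Vec d) × ℝ => q.1.1) (P.K.carrier ×ˢ Icc (0 : ℝ) 1) :=
    (contDiff_fst.comp contDiff_fst).contDiffOn
  exact (h1.add (h2.mul (h3.sub h1))).prodMk (contDiff_snd.comp contDiff_fst).contDiffOn

/-- A coefficient, pulled back to the unit interval. -/
def rayCoeff (σ : Vec d → ℝ) (f : ℝ × Vec d → E) (q : (ℝ × Vec d) × ℝ) : E :=
  (q.1.1 - σ q.1.2) • f (ray σ q)

lemma contDiffOn_rayCoeff {σ : Vec d → ℝ} (hσ : ContDiffOn ℝ ∞ σ P.U)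
    (hσI : ∀ y ∈ P.U, σ y ∈ P.I) {f : ℝ × Vec d → E} (hf : ContDiffOn ℝ ∞ f P.K.carrier) :
    ContDiffOn ℝ ∞ (rayCoeff σ f) (P.K.carrier ×ˢ Icc (0 : ℝ) 1) := by
  have h1 : ContDiffOn ℝ ∞ (fun q : (ℝ × Vec d) × ℝ => σ q.1.2) (P.K.carrier ×ˢ Icc (0 : ℝ) 1) :=
    hσ.comp (contDiff_snd.comp contDiff_fst).contDiffOn fun q hq => hq.1.2
  have h3 : ContDiffOn ℝ ∞ (fun q : (ℝ × Vec d) × ℝ => q.1.1) (P.K.carrier ×ˢ Icc (0 : ℝ) 1) :=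
    (contDiff_fst.comp contDiff_fst).contDiffOn
  exact (h3.sub h1).smul (hf.comp (contDiffOn_ray hσ) fun q hq => ray_mem hσI hq)

/-- The segment to an intermediate point is a rescaling of the full one. The factor `l` is the
Jacobian of the substitution `t ↦ l t` in the integral equation. -/
lemma rayCoeff_scale (σ : Vec d → ℝ) (f : ℝ × Vec d → E) (z : ℝ × Vec d) (l s : ℝ) :
    rayCoeff σ f (ray σ (z, l), s) = l • rayCoeff σ f (z, l * s) := by
  simp only [rayCoeff, ray, smul_smul]
  congr 1
  · ring
  · congr 2
    ring

variable [CompleteSpace E]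

lemma volterraSol_apply_eq {A : IntervalMap (E →L[ℝ] E)} {b : IntervalMap E} {c w : IntervalMap E}
    {e : E} (hc : ∀ s, c s = e) :
    w = volterraSol A (c + integralOp E b) ↔
      ∀ s, w s = e + ∫ t in (0 : ℝ)..s, extendI (applyOp E A w + b) t := by
  rw [volterraSol_eq_iff, volterra_apply]
  have key : ∀ s : unitInterval, (c + integralOp E b + integralOp E (applyOp E A w)) s
      = e + ∫ t in (0 : ℝ)..s, extendI (applyOp E A w + b) t := by
    intro s
    rw [IntervalMap.add_apply, IntervalMap.add_apply, hc, add_assoc, add_comm (integralOp E b s),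
      ← IntervalMap.add_apply, ← map_add, integralOp_apply]
  constructor
  · intro h s
    rw [← key, ← h]
  · intro h
    ext s
    rw [key, ← h]

/-- Existence and smoothness of the solution of a linear transport equation. -/
theorem exists_transport {A : ℝ × Vec d → E →L[ℝ] E} {b : ℝ × Vec d → E}
    (hA : ContDiffOn ℝ ∞ A P.K.carrier) (hb : ContDiffOn ℝ ∞ b P.K.carrier)
    {σ : Vec d → ℝ} (hσ : ContDiffOn ℝ ∞ σ P.U) (hσI : ∀ y ∈ P.U, σ y ∈ P.I)
    {η₀ : Vec d → E} (hη : ContDiffOn ℝ ∞ η₀ P.U) :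
    ∃ η : ℝ × Vec d → E, ContDiffOn ℝ ∞ η P.K.carrier ∧ (∀ y ∈ P.U, η (σ y, y) = η₀ y) ∧
      ∀ z ∈ P.K.carrier, HasDerivWithinAt (fun r => η (r, z.2)) (A z (η z) + b z) P.I z.1 := by
  have hA' := contDiffOn_rayCoeff hσ hσI hA
  have hb' := contDiffOn_rayCoeff hσ hσI hb
  have hη' : ContDiffOn ℝ ∞ (fun q : (ℝ × Vec d) × ℝ => η₀ q.1.2) (P.K.carrier ×ˢ Icc (0 : ℝ) 1) :=
    hη.comp (contDiff_snd.comp contDiff_fst).contDiffOn fun q hq => hq.1.2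
  have sm : ∀ {F : Type} [NormedAddCommGroup F] [NormedSpace ℝ F] {f : (ℝ × Vec d) × ℝ → F},
      ContDiffOn ℝ ∞ f (P.K.carrier ×ˢ Icc (0 : ℝ) 1) → ContDiffOn ℝ ∞ (slice f) P.K.carrier :=
    fun hf => contDiffOn_slice (fun z hz => P.exists_convex hz) P.K.uniqueDiffOn hf
  -- For each endpoint `z` the equation is solved along the segment from the cross-section to `z`,
  -- with parameter in `[0, 1]`; the end value `W z 1` is the solution at `z`. As all endpoints
  -- share the same parameter interval, smoothness in `z` follows from smoothness of the
  -- coefficients.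
  set W : ℝ × Vec d → IntervalMap E := fun z => volterraSol (slice (rayCoeff σ A) z)
    (slice (fun q => η₀ q.1.2) z + integralOp E (slice (rayCoeff σ b) z)) with hW
  have hWs : ContDiffOn ℝ ∞ W P.K.carrier :=
    contDiffOn_volterraSol (sm hA') ((sm hη').add ((integralOp E).contDiff.comp_contDiffOn (sm hb')))
  have hc : ∀ z ∈ P.K.carrier, ∀ s, slice (fun q : (ℝ × Vec d) × ℝ => η₀ q.1.2) z s = η₀ z.2 :=
    fun z hz s => slice_apply hη'.continuousOn hz s
  set f : ℝ × Vec d → IntervalMap E := fun z =>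
    applyOp E (slice (rayCoeff σ A) z) (W z) + slice (rayCoeff σ b) z with hf
  have hWeq : ∀ z ∈ P.K.carrier, ∀ s : unitInterval,
      W z s = η₀ z.2 + ∫ t in (0 : ℝ)..s, extendI (f z) t :=
    fun z hz => (volterraSol_apply_eq (hc z hz)).mp rfl
  -- Consistency: the solution along the segment to an intermediate point is the rescaled solution,
  -- by uniqueness for the Volterra equation. Hence `W z l` is the value of the final field at the
  -- point with parameter `l`.
  have hscale : ∀ z ∈ P.K.carrier, ∀ l : unitInterval, ∀ s : unitInterval,
      W (ray σ (z, l)) s = W z ⟨l * s, unitInterval.mul_mem l.2 s.2⟩ := by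
    intro z hz l s
    have hz' : ray σ (z, l) ∈ P.K.carrier := ray_mem hσI ⟨hz, l.2⟩
    let w : IntervalMap E := IntervalMap.of ⟨fun s => W z ⟨l * s, unitInterval.mul_mem l.2 s.2⟩,
      (W z).continuous.comp (by fun_prop)⟩
    have hw : w = W (ray σ (z, l)) := by
      refine (volterraSol_apply_eq (hc _ hz')).mpr fun s => ?_
      rw [IntervalMap.of_apply]
      change W z ⟨l * s, _⟩ = _
      rw [hWeq z hz]
      congr 1
      have h1 := intervalIntegral.smul_integral_comp_mul_left (f := extendI (f z)) (a := 0)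
        (b := (s : ℝ)) (l : ℝ)
      rw [mul_zero] at h1
      change ∫ t in (0 : ℝ)..(l * s : ℝ), _ = _
      rw [← h1, ← intervalIntegral.integral_smul]
      refine intervalIntegral.integral_congr fun t ht => ?_
      rw [uIcc_of_le s.2.1] at ht
      have ht1 : t ∈ Icc (0 : ℝ) 1 := ⟨ht.1, ht.2.trans s.2.2⟩
      have ht2 : (l * t : ℝ) ∈ Icc (0 : ℝ) 1 := unitInterval.mul_mem l.2 ht1
      rw [extendI_of_mem _ ht1]
      rw [extendI_of_mem _ ht2]
      simp only [hf, IntervalMap.add_apply, applyOp_apply, slice_apply hA'.continuousOn hz,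
        slice_apply hb'.continuousOn hz, slice_apply hA'.continuousOn hz',
        slice_apply hb'.continuousOn hz', rayCoeff_scale, smul_add, ContinuousLinearMap.smul_apply]
      rfl
    rw [← hw]
    rfl
  refine ⟨fun z => W z 1, (IntervalMap.eval (1 : unitInterval)).contDiff.comp_contDiffOn hWs, ?_, ?_⟩
  · intro y hy
    have hz : ((σ y, y) : ℝ × Vec d) ∈ P.K.carrier := ⟨hσI y hy, hy⟩
    have h0 := hscale _ hz 0 1
    have e : ray σ (((σ y, y) : ℝ × Vec d), ((0 : unitInterval) : ℝ)) = (σ y, y) := by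
      simp [ray]
    rw [e] at h0
    simp only
    rw [h0, hWeq _ hz]
    simp
  · intro z hz
    -- If `z` lies on the cross-section, its own segment is degenerate and carries no derivative in
    -- `r`. The equation at `z` is therefore read along a segment ending at another point `z'` of
    -- the same generator.
    obtain ⟨z', hz', l, hl, hne⟩ : ∃ z' ∈ P.K.carrier, ∃ l : unitInterval, ray σ (z', l) = z ∧
        z'.1 - σ z'.2 ≠ 0 := by
      by_cases h : z.1 = σ z.2
      · obtain ⟨r, hr, hr'⟩ := P.nontrivial.exists_ne (σ z.2)
        exact ⟨(r, z.2), ⟨hr, hz.2⟩, 0, by simp [ray, ← h], sub_ne_zero.mpr hr'⟩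
      · exact ⟨z, hz, 1, by simp [ray], sub_ne_zero.mpr h⟩
    have hy : z'.2 = z.2 := by rw [← hl]; rfl
    set η : ℝ × Vec d → E := fun z => W z 1 with hηdef
    have hηs : ContDiffOn ℝ ∞ η P.K.carrier :=
      (IntervalMap.eval (1 : unitInterval)).contDiff.comp_contDiffOn hWs
    have hd : DifferentiableWithinAt ℝ (fun r => η (r, z.2)) P.I z.1 := by
      have h1 : DifferentiableWithinAt ℝ η P.K.carrier (z.1, z.2) :=
        hηs.differentiableOn (by simp) z hz
      exact h1.comp (f := fun r : ℝ => (r, z.2)) z.1 (t := P.K.carrier) (s := P.I) (by fun_prop)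
        fun r hr => ⟨hr, hz.2⟩
    have hpath : HasDerivWithinAt (fun s : ℝ => (ray σ (z', s)).1) (z'.1 - σ z'.2) (Icc 0 1) l := by
      have := ((hasDerivWithinAt_id (l : ℝ) (Icc 0 1)).mul_const (z'.1 - σ z'.2)).const_add (σ z'.2)
      simpa [ray] using this
    have h1 : HasDerivWithinAt (fun s : ℝ => η (ray σ (z', s)))
        ((z'.1 - σ z'.2) • derivWithin (fun r => η (r, z.2)) P.I z.1) (Icc 0 1) l := by
      have hz1 : (ray σ (z', l)).1 = z.1 := by rw [hl]
      have h2 := hd.hasDerivWithinAt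
      rw [← hz1] at h2
      have h3 := h2.scomp (l : ℝ) hpath (t' := P.I) fun s hs => (ray_mem hσI ⟨hz', hs⟩).1
      rw [hz1] at h3
      refine h3.congr (fun s hs => ?_) ?_
      · simp only [Function.comp, ← hy]; rfl
      · simp only [Function.comp, ← hy]; rfl
    have h2 : HasDerivWithinAt (fun s : ℝ => η (ray σ (z', s))) (f z' l) (Icc 0 1) l := by
      have hcont := continuous_extendI (f z')
      have h3 : HasDerivAt (fun s : ℝ => η₀ z'.2 + ∫ t in (0 : ℝ)..s, extendI (f z') t)
          (extendI (f z') l) l :=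
        (intervalIntegral.integral_hasDerivAt_right (hcont.intervalIntegrable _ _)
          (hcont.stronglyMeasurableAtFilter _ _) hcont.continuousAt).const_add _
      rw [extendI_of_mem _ l.2] at h3
      have key : ∀ s (hs : s ∈ Icc (0 : ℝ) 1),
          η (ray σ (z', s)) = η₀ z'.2 + ∫ t in (0 : ℝ)..s, extendI (f z') t := by
        intro s hs
        have := hscale z' hz' ⟨s, hs⟩ 1
        rw [hWeq z' hz'] at this
        simpa using this
      exact h3.hasDerivWithinAt.congr key (key l l.2)
    -- Two computations of the derivative in the parameter, one by the chain rule and one from the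
    -- integral equation, agree; both contain the nonzero factor `z'.1 - σ z'.2`, which is cancelled
    -- below.
    have h3 := (uniqueDiffOn_Icc zero_lt_one (l : ℝ) l.2).eq_deriv _ h1 h2
    have h4 : f z' l = (z'.1 - σ z'.2) • (A z (η z) + b z) := by
      have hWz : W z' l = η z := by
        have := hscale z' hz' l 1
        simp only [hl] at this
        rw [hηdef]
        simp only
        rw [this]
        congr 1
        ext
        simp
      simp only [hf, IntervalMap.add_apply, applyOp_apply, slice_apply hA'.continuousOn hz',
        slice_apply hb'.continuousOn hz', rayCoeff, hl, smul_add, ContinuousLinearMap.smul_apply, hWz]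
    rw [h4] at h3
    have h5 := smul_right_injective E hne h3
    rw [← h5]
    exact hd.hasDerivWithinAt

omit [CompleteSpace E] in
/-- Uniqueness for linear ordinary differential equations on an interval. -/
theorem eq_zero_of_linear_ode {I : Set ℝ} (hI : I.OrdConnected) {w : ℝ → E} {A : ℝ → E →L[ℝ] E}
    (hA : ContinuousOn A I) (hw : ∀ r ∈ I, HasDerivWithinAt w (A r (w r)) I r) {r₀ : ℝ}
    (hr₀ : r₀ ∈ I) (h0 : w r₀ = 0) : ∀ r ∈ I, w r = 0 := by
  intro r hr
  have hmem : ∀ s ∈ Icc (0 : ℝ) 1, r₀ + s * (r - r₀) ∈ I := by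
    intro s hs
    have h := hI.convex hr₀ hr (a := 1 - s) (b := s) (by linarith [hs.2]) hs.1 (by ring)
    convert h using 1
    simp only [smul_eq_mul]
    ring
  have hcont : Continuous fun s : ℝ => r₀ + s * (r - r₀) := by fun_prop
  have hAc : ContinuousOn (fun s : ℝ => A (r₀ + s * (r - r₀))) (Icc 0 1) :=
    hA.comp hcont.continuousOn hmem
  obtain ⟨C, hC⟩ := isCompact_Icc.exists_bound_of_continuousOn hAc
  have hder : ∀ s ∈ Icc (0 : ℝ) 1, HasDerivWithinAt (fun s => w (r₀ + s * (r - r₀)))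
      ((r - r₀) • A (r₀ + s * (r - r₀)) (w (r₀ + s * (r - r₀)))) (Icc 0 1) s := by
    intro s hs
    have hp : HasDerivWithinAt (fun s : ℝ => r₀ + s * (r - r₀)) (r - r₀) (Icc 0 1) s := by
      simpa using ((hasDerivWithinAt_id s (Icc 0 1)).mul_const (r - r₀)).const_add r₀
    exact (hw _ (hmem s hs)).scomp s hp hmem
  -- Grönwall on the segment from `r₀` to `r`, reparametrised by `[0, 1]` so that both orderings of
  -- the endpoints are covered and the coefficient is bounded by compactness.
  have key := eq_zero_of_abs_deriv_le_mul_abs_self_of_eq_zero_right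
    (f := fun s => w (r₀ + s * (r - r₀)))
    (f' := fun s => (r - r₀) • A (r₀ + s * (r - r₀)) (w (r₀ + s * (r - r₀)))) (K := |r - r₀| * C)
    (fun s hs => (hder s hs).continuousWithinAt)
    (fun s hs => (hder s (Ico_subset_Icc_self hs)).mono_of_mem_nhdsWithin
      (Icc_mem_nhdsGE_of_mem hs)) (by simpa using h0) (fun s hs => ?_)
  · simpa using key 1 (by simp)
  · rw [norm_smul, mul_assoc, Real.norm_eq_abs]
    gcongr
    exact ((A _).le_opNorm _).trans (by gcongr; exact hC s (Ico_subset_Icc_self hs))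

end TransportODE

open PowerSeries

variable {d : ℕ}

/-! ### Solving the transport equations in a coordinate patch -/

namespace CoordJet

variable {P : Patch d} {J J' : CoordJet d}

/-- The terms of order zero of the transport operator. -/
def transportPot (m a : ℝ) (k G : Matrix (Fin d) (Fin d) ℝ) (H : Fin d → Fin d → ℝ)
    (A B : Fin d) : ℝ :=
  m * a * H A B
    - (1 / 2) * ((∑ C, H A C * ∑ D, k C D * G D B) + ∑ C, H B C * ∑ D, k C D * G D A)
    + (1 / 4) * ((∑ C, ∑ D, k C D * G D C) * H A B + (∑ C, ∑ D, k C D * H D C) * G A B)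

lemma transport_eq (I : Set ℝ) (J : CoordJet d) (i : ℕ)
    (η : ℝ → Vec d → Matrix (Fin d) (Fin d) ℝ) (r : ℝ) (y : Vec d) (A B : Fin d) :
    J.transport I i η r y A B = derivWithin (fun r' => η r' y A B) I r
      + transportPot (i + 1) (J.α 0 r y) (J.g 0 r y)⁻¹ (entryDeriv I (fun r' => J.g 0 r' y) r)
        (η r y) A B := by
  simp only [transport, transportPot, Matrix.mul_apply, Matrix.trace, Matrix.diag]
  ring

lemma transportPot_add (m a : ℝ) (k G : Matrix (Fin d) (Fin d) ℝ) (H H' : Fin d → Fin d → ℝ)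
    (A B : Fin d) : transportPot m a k G (H + H') A B
      = transportPot m a k G H A B + transportPot m a k G H' A B := by
  simp only [transportPot, Pi.add_apply, add_mul, mul_add, Finset.sum_add_distrib]
  ring

lemma transportPot_smul (m a : ℝ) (k G : Matrix (Fin d) (Fin d) ℝ) (c : ℝ)
    (H : Fin d → Fin d → ℝ) (A B : Fin d) :
    transportPot m a k G (c • H) A B = c * transportPot m a k G H A B := by
  simp only [transportPot, Pi.smul_apply, smul_eq_mul, mul_assoc, mul_left_comm _ c,
    ← Finset.mul_sum]
  ring

lemma transportPot_sub (m a : ℝ) (k G : Matrix (Fin d) (Fin d) ℝ) (H H' : Fin d → Fin d → ℝ)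
    (A B : Fin d) : transportPot m a k G (fun A B => H A B - H' A B) A B
      = transportPot m a k G H A B - transportPot m a k G H' A B := by
  simp only [transportPot, sub_mul, mul_sub, Finset.sum_sub_distrib]
  ring

lemma transportPot_symm (m a : ℝ) {k G : Matrix (Fin d) (Fin d) ℝ} {H : Fin d → Fin d → ℝ}
    (hG : ∀ A B, G A B = G B A) (hH : ∀ A B, H A B = H B A) (A B : Fin d) :
    transportPot m a k G H A B = transportPot m a k G H B A := by
  simp only [transportPot]
  rw [hG A B, hH A B]
  ring

/-- The symmetric part. -/
def symmPart (η : Fin d → Fin d → ℝ) : Fin d → Fin d → ℝ := fun A B => (1 / 2) * (η A B + η B A)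

lemma symmPart_symm (η : Fin d → Fin d → ℝ) (A B : Fin d) : symmPart η A B = symmPart η B A := by
  simp only [symmPart]
  ring

lemma symmPart_eq {η : Fin d → Fin d → ℝ} (h : ∀ A B, η A B = η B A) : symmPart η = η := by
  ext A B
  simp only [symmPart]
  rw [h B A]
  ring

/-- The terms of order zero of the transport equation, applied to the symmetric part. -/
def transportLin (m a : ℝ) (k G : Matrix (Fin d) (Fin d) ℝ) :
    (Fin d → Fin d → ℝ) →L[ℝ] (Fin d → Fin d → ℝ) :=
  LinearMap.toContinuousLinearMap
    { toFun := fun η A B => -transportPot m a k G (symmPart η) A B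
      map_add' := fun η η' => by
        ext A B
        have : symmPart (η + η') = symmPart η + symmPart η' := by
          ext A B
          simp only [symmPart, Pi.add_apply]
          ring
        rw [this, transportPot_add]
        simp only [Pi.add_apply]
        ring
      map_smul' := fun c η => by
        ext A B
        have : symmPart (c • η) = c • symmPart η := by
          ext A B
          simp only [symmPart, Pi.smul_apply, smul_eq_mul]
          ring
        rw [this, transportPot_smul]
        simp only [Pi.smul_apply, smul_eq_mul, RingHom.id_apply]
        ring }

lemma transportLin_apply (m a : ℝ) (k G : Matrix (Fin d) (Fin d) ℝ) (η : Fin d → Fin d → ℝ)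
    (A B : Fin d) : transportLin m a k G η A B = -transportPot m a k G (symmPart η) A B := rfl

lemma IsSmooth.contDiffOn_inv (hJ : J.IsSmooth P) (A B : Fin d) :
    ContDiffOn ℝ ∞ (fun z : ℝ × Vec d => (J.g 0 z.1 z.2)⁻¹ A B) P.K.carrier :=
  (contDiffOn_ev (coeff 0 (hJ.formal.hi A B))).congr fun z hz => (hJ.ev_hi_zero A B hz).symm

lemma IsSmooth.contDiffOn_entryDeriv (hJ : J.IsSmooth P) (A B : Fin d) :
    ContDiffOn ℝ ∞ (fun z : ℝ × Vec d => entryDeriv P.I (fun r => J.g 0 r z.2) z.1 A B)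
      P.K.carrier :=
  (contDiffOn_ev _).congr fun z hz => (hJ.ev_g' A B hz).symm

lemma IsSmooth.contDiffOn_einstein (hJ : J.IsSmooth P) (Λ : ℝ) (i : ℕ) (μ ν : Idx d) :
    ContDiffOn ℝ ∞ (fun z : ℝ × Vec d => J.einstein P.I P.U Λ i μ ν z.1 z.2) P.K.carrier :=
  ((contDiffOn_ev (coeff i (hJ.ein Λ μ ν))).const_smul (i.factorial : ℝ)).congr
    fun z hz => hJ.einstein_eq Λ i μ ν hz

lemma IsSmooth.contDiffOn_transportLin (hJ : J.IsSmooth P) (m : ℝ) :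
    ContDiffOn ℝ ∞ (fun z : ℝ × Vec d => transportLin m (J.α 0 z.1 z.2) (J.g 0 z.1 z.2)⁻¹
      (entryDeriv P.I (fun r => J.g 0 r z.2) z.1)) P.K.carrier := by
  rw [contDiffOn_clm_apply]
  intro η
  have hα := hJ.smooth_α 0
  have hk := hJ.contDiffOn_inv
  have hG := hJ.contDiffOn_entryDeriv
  refine contDiffOn_pi.mpr fun A => contDiffOn_pi.mpr fun B => ?_
  simp only [transportLin_apply, transportPot]
  have hX : ∀ C B, ContDiffOn ℝ ∞ (fun z : ℝ × Vec d => ∑ D, (J.g 0 z.1 z.2)⁻¹ C D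
      * entryDeriv P.I (fun r => J.g 0 r z.2) z.1 D B) P.K.carrier := fun C B =>
    ContDiffOn.sum fun D _ => (hk C D).mul (hG D B)
  have hkH : ContDiffOn ℝ ∞ (fun z : ℝ × Vec d => ∑ C, ∑ D, (J.g 0 z.1 z.2)⁻¹ C D
      * symmPart η D C) P.K.carrier :=
    ContDiffOn.sum fun C _ => ContDiffOn.sum fun D _ => (hk C D).mul contDiffOn_const
  refine ContDiffOn.neg (ContDiffOn.add (ContDiffOn.sub ?_ ?_) ?_)
  · exact (contDiffOn_const.mul hα).mul contDiffOn_const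
  · exact contDiffOn_const.mul ((ContDiffOn.sum fun C _ => contDiffOn_const.mul (hX C B)).add
      (ContDiffOn.sum fun C _ => contDiffOn_const.mul (hX C A)))
  · exact contDiffOn_const.mul (((ContDiffOn.sum fun C _ => hX C C).mul contDiffOn_const).add
      (hkH.mul (hG A B)))

variable {σ : Vec d → ℝ}

/-- Solutions of the transport equation for symmetric tensors. -/
theorem IsSmooth.exists_transport (hJ : J.IsSmooth P) (i : ℕ) (hσ : ContDiffOn ℝ ∞ σ P.U)
    (hσI : ∀ y ∈ P.U, σ y ∈ P.I) {f : ℝ × Vec d → Fin d → Fin d → ℝ}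
    (hf : ∀ A B, ContDiffOn ℝ ∞ (fun z => f z A B) P.K.carrier)
    (hfs : ∀ z ∈ P.K.carrier, ∀ A B, f z A B = f z B A) {η₀ : Vec d → Matrix (Fin d) (Fin d) ℝ}
    (hη : ∀ A B, ContDiffOn ℝ ∞ (fun y => η₀ y A B) P.U)
    (hηs : ∀ y ∈ P.U, ∀ A B, η₀ y A B = η₀ y B A) :
    ∃ η : ℝ → Vec d → Matrix (Fin d) (Fin d) ℝ,
      (∀ A B, ContDiffOn ℝ ∞ (fun z : ℝ × Vec d => η z.1 z.2 A B) P.K.carrier) ∧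
      (∀ z ∈ P.K.carrier, ∀ A B, η z.1 z.2 A B = η z.1 z.2 B A) ∧
      (∀ y ∈ P.U, η (σ y) y = η₀ y) ∧
      ∀ z ∈ P.K.carrier, ∀ A B, J.transport P.I i η z.1 z.2 A B = f z A B := by
  obtain ⟨w, hw, hw0, hwd⟩ := IsenbergMoncrief.exists_transport (P := P)
    (E := Fin d → Fin d → ℝ) (hJ.contDiffOn_transportLin (i + 1)) (b := f)
    (contDiffOn_pi.mpr fun A => contDiffOn_pi.mpr fun B => hf A B) hσ hσI
    (η₀ := fun y A B => η₀ y A B)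
    (contDiffOn_pi.mpr fun A => contDiffOn_pi.mpr fun B => hη A B)
  have hwc : ∀ A B, ContDiffOn ℝ ∞ (fun z => w z A B) P.K.carrier := fun A B =>
    contDiffOn_pi.mp (contDiffOn_pi.mp hw A) B
  -- The ODE was posed for arbitrary matrices, with the zero-order terms acting on the symmetric
  -- part. As these terms and the source are symmetric, the symmetric part of the solution solves
  -- the transport equation.
  refine ⟨fun r y => Matrix.of (symmPart (w (r, y))), fun A B => ?_, fun z _ A B => symmPart_symm _ A B,
    fun y hy => ?_, fun z hz A B => ?_⟩
  · exact contDiffOn_const.mul ((hwc A B).add (hwc B A))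
  · simp only [hw0 y hy]
    exact symmPart_eq (hηs y hy)
  · have hd : ∀ A B, HasDerivWithinAt (fun r => w (r, z.2) A B)
        (-transportPot (i + 1) (J.α 0 z.1 z.2) (J.g 0 z.1 z.2)⁻¹
          (entryDeriv P.I (fun r => J.g 0 r z.2) z.1) (symmPart (w z)) A B + f z A B) P.I z.1 :=
      fun A B => hasDerivWithinAt_pi.mp (hasDerivWithinAt_pi.mp (hwd z hz) A) B
    have h2 := (((hd A B).add (hd B A)).const_mul (1 / 2)).derivWithin (uniqueDiff P hz.1)
    have hGs : ∀ A B, entryDeriv P.I (fun r => J.g 0 r z.2) z.1 A B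
        = entryDeriv P.I (fun r => J.g 0 r z.2) z.1 B A :=
      entryDeriv_symm hz.1 fun r hr => hJ.symm 0 (r, z.2) ⟨hr, hz.2⟩
    rw [transport_eq]
    have e : derivWithin (fun r' => Matrix.of (symmPart (w (r', z.2))) A B) P.I z.1
        = f z A B - transportPot (i + 1) (J.α 0 z.1 z.2) (J.g 0 z.1 z.2)⁻¹
          (entryDeriv P.I (fun r => J.g 0 r z.2) z.1) (symmPart (w z)) A B := by
      refine h2.trans ?_
      rw [transportPot_symm _ _ hGs (symmPart_symm _) B A, hfs z hz B A]
      ring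
    rw [e]
    exact sub_add_cancel _ _

/-- Uniqueness for the transport equation. -/
theorem IsSmooth.transport_unique (hJ : J.IsSmooth P) (i : ℕ) (hσI : ∀ y ∈ P.U, σ y ∈ P.I)
    {η η' : ℝ → Vec d → Matrix (Fin d) (Fin d) ℝ}
    (hη : ∀ A B, ContDiffOn ℝ ∞ (fun z : ℝ × Vec d => η z.1 z.2 A B) P.K.carrier)
    (hη' : ∀ A B, ContDiffOn ℝ ∞ (fun z : ℝ × Vec d => η' z.1 z.2 A B) P.K.carrier)
    (hηs : ∀ z ∈ P.K.carrier, ∀ A B, η z.1 z.2 A B = η z.1 z.2 B A)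
    (hηs' : ∀ z ∈ P.K.carrier, ∀ A B, η' z.1 z.2 A B = η' z.1 z.2 B A)
    (h0 : ∀ y ∈ P.U, η (σ y) y = η' (σ y) y)
    (h : ∀ z ∈ P.K.carrier, ∀ A B, J.transport P.I i η z.1 z.2 A B
      = J.transport P.I i η' z.1 z.2 A B) :
    ∀ z ∈ P.K.carrier, η z.1 z.2 = η' z.1 z.2 := by
  intro z hz
  have hline : ∀ r ∈ P.I, (r, z.2) ∈ P.K.carrier := fun r hr => ⟨hr, hz.2⟩
  have hcont : ContinuousOn (fun r => transportLin (i + 1) (J.α 0 r z.2) (J.g 0 r z.2)⁻¹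
      (entryDeriv P.I (fun r => J.g 0 r z.2) r)) P.I :=
    (hJ.contDiffOn_transportLin (i + 1)).continuousOn.comp (f := fun r : ℝ => (r, z.2))
      (by fun_prop) hline
  have key := eq_zero_of_linear_ode (E := Fin d → Fin d → ℝ) P.ord
    (w := fun r => (fun A B => η r z.2 A B - η' r z.2 A B)) hcont ?_ (hσI z.2 hz.2) ?_ z.1 hz.1
  · ext A B
    exact sub_eq_zero.mp (congrFun (congrFun key A) B)
  · intro r hr
    refine hasDerivWithinAt_pi.mpr fun A => hasDerivWithinAt_pi.mpr fun B => ?_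
    have d1 := derivWithin_eq_fderivWithin (hline r hr) ((hη A B).differentiableOn (by simp) _ (hline r hr))
    have d2 := derivWithin_eq_fderivWithin (hline r hr) ((hη' A B).differentiableOn (by simp) _ (hline r hr))
    have d1' := d1.derivWithin (uniqueDiff P hr)
    have d2' := d2.derivWithin (uniqueDiff P hr)
    have hh := h _ (hline r hr) A B
    rw [transport_eq, transport_eq] at hh
    simp only at hh d1' d2'
    rw [d1', d2'] at hh
    refine (d1.sub d2).congr_deriv ?_
    rw [transportLin_apply, symmPart_eq fun A B =>
      congrArg₂ (· - ·) (hηs _ (hline r hr) A B) (hηs' _ (hline r hr) A B)]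
    refine Eq.trans ?_ (congrArg Neg.neg (transportPot_sub _ _ _ _ (η r z.2) (η' r z.2) A B).symm)
    linarith
  · ext A B
    simp [h0 z.2 hz.2]

/-- The expansion of a generator. -/
def expansion (I : Set ℝ) (J : CoordJet d) (r : ℝ) (y : Vec d) : ℝ :=
  ((J.g 0 r y)⁻¹ * entryDeriv I (fun r' => J.g 0 r' y) r).trace

lemma IsSmooth.contDiffOn_expansion (hJ : J.IsSmooth P) :
    ContDiffOn ℝ ∞ (fun z : ℝ × Vec d => J.expansion P.I z.1 z.2) P.K.carrier := by
  simp only [expansion, Matrix.trace, Matrix.diag, Matrix.mul_apply]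
  exact ContDiffOn.sum fun C _ => ContDiffOn.sum fun D _ =>
    (hJ.contDiffOn_inv C D).mul (hJ.contDiffOn_entryDeriv D C)

/-- Solutions of the transport equation for covectors. -/
theorem IsSmooth.exists_transportβ (hJ : J.IsSmooth P) (hσ : ContDiffOn ℝ ∞ σ P.U)
    (hσI : ∀ y ∈ P.U, σ y ∈ P.I) {f : ℝ × Vec d → Fin d → ℝ}
    (hf : ∀ A, ContDiffOn ℝ ∞ (fun z => f z A) P.K.carrier) {β₀ : Vec d → Fin d → ℝ}
    (hβ : ∀ A, ContDiffOn ℝ ∞ (fun y => β₀ y A) P.U) :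
    ∃ β : ℝ → Vec d → Fin d → ℝ,
      (∀ A, ContDiffOn ℝ ∞ (fun z : ℝ × Vec d => β z.1 z.2 A) P.K.carrier) ∧
      (∀ y ∈ P.U, β (σ y) y = β₀ y) ∧
      ∀ z ∈ P.K.carrier, ∀ A, J.transportβ P.I β z.1 z.2 A = f z A := by
  -- The equation `½ β' + ¼ (tr X) β = f` in the form `β' = -½ (tr X) β + 2 f`.
  have hA : ContDiffOn ℝ ∞ (fun z : ℝ × Vec d => (-(1 / 2) * J.expansion P.I z.1 z.2) •
      ContinuousLinearMap.id ℝ (Fin d → ℝ)) P.K.carrier := by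
    have h1 : ContDiffOn ℝ ∞ (fun z : ℝ × Vec d => -(1 / 2) * J.expansion P.I z.1 z.2) P.K.carrier :=
      contDiffOn_const.mul hJ.contDiffOn_expansion
    exact h1.smul contDiffOn_const
  have hb : ContDiffOn ℝ ∞ (fun z => (2 : ℝ) • f z) P.K.carrier :=
    (contDiffOn_pi.mpr fun A => hf A).const_smul (2 : ℝ)
  have hβ' : ContDiffOn ℝ ∞ β₀ P.U := contDiffOn_pi.mpr fun A => hβ A
  obtain ⟨w, hw, hw0, hwd⟩ := IsenbergMoncrief.exists_transport hA hb hσ hσI hβ'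
  refine ⟨fun r y => w (r, y), fun A => contDiffOn_pi.mp hw A, hw0, fun z hz A => ?_⟩
  have hd := (hasDerivWithinAt_pi.mp (hwd z hz) A).derivWithin (uniqueDiff P hz.1)
  simp only [transportβ]
  rw [hd]
  simp only [expansion, Pi.add_apply, ContinuousLinearMap.smul_apply, ContinuousLinearMap.id_apply,
    Pi.smul_apply, smul_eq_mul]
  ring

/-- Uniqueness for the transport equation for covectors. -/
theorem IsSmooth.transportβ_unique (hJ : J.IsSmooth P) (hσI : ∀ y ∈ P.U, σ y ∈ P.I)
    {β β' : ℝ → Vec d → Fin d → ℝ}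
    (hβ : ∀ A, ContDiffOn ℝ ∞ (fun z : ℝ × Vec d => β z.1 z.2 A) P.K.carrier)
    (hβ' : ∀ A, ContDiffOn ℝ ∞ (fun z : ℝ × Vec d => β' z.1 z.2 A) P.K.carrier)
    (h0 : ∀ y ∈ P.U, β (σ y) y = β' (σ y) y)
    (h : ∀ z ∈ P.K.carrier, ∀ A, J.transportβ P.I β z.1 z.2 A = J.transportβ P.I β' z.1 z.2 A) :
    ∀ z ∈ P.K.carrier, β z.1 z.2 = β' z.1 z.2 := by
  intro z hz
  ext A
  have hline : ∀ r ∈ P.I, (r, z.2) ∈ P.K.carrier := fun r hr => ⟨hr, hz.2⟩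
  have hcont : ContinuousOn (fun r => (-(1 / 2) * J.expansion P.I r z.2) •
      ContinuousLinearMap.id ℝ ℝ) P.I :=
    (continuousOn_const.mul (hJ.contDiffOn_expansion.continuousOn.comp
      (f := fun r : ℝ => (r, z.2)) (by fun_prop) hline)).smul continuousOn_const
  have key := eq_zero_of_linear_ode P.ord
    (w := fun r => β r z.2 A - β' r z.2 A) hcont ?_ (hσI z.2 hz.2) ?_ z.1 hz.1
  · exact sub_eq_zero.mp key
  · intro r hr
    have d1 := derivWithin_eq_fderivWithin (hline r hr) ((hβ A).differentiableOn (by simp) _ (hline r hr))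
    have d2 := derivWithin_eq_fderivWithin (hline r hr) ((hβ' A).differentiableOn (by simp) _ (hline r hr))
    have d1' := d1.derivWithin (uniqueDiff P hr)
    have d2' := d2.derivWithin (uniqueDiff P hr)
    have hh := h _ (hline r hr) A
    simp only [transportβ] at hh d1' d2'
    rw [d1', d2'] at hh
    refine (d1.sub d2).congr_deriv ?_
    simp only [expansion, ContinuousLinearMap.smul_apply, ContinuousLinearMap.id_apply, smul_eq_mul]
    linarith
  · simp [h0 z.2 hz.2]

end CoordJet

open PowerSeries

variable {d : ℕ}

/-! ### The hierarchy in a coordinate patch -/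

namespace CoordJet

variable {P : Patch d} {J J' : CoordJet d} {Λ : ℝ}

variable (P Λ) in
/-- The transport and algebraic equations up to transverse order `n`. -/
structure Solves (n : ℕ) (J : CoordJet d) : Prop where
  rx : ∀ z ∈ P.K.carrier, ∀ A, J.einstein P.I P.U Λ 0 ir (ix A) z.1 z.2 = 0
  xx : ∀ i < n, ∀ z ∈ P.K.carrier, ∀ A B, J.einstein P.I P.U Λ i (ix A) (ix B) z.1 z.2 = 0
  ur : ∀ i < n, ∀ z ∈ P.K.carrier, J.einstein P.I P.U Λ i iu ir z.1 z.2 = 0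
  ux : ∀ i < n, ∀ z ∈ P.K.carrier, ∀ A, J.einstein P.I P.U Λ i iu (ix A) z.1 z.2 = 0

lemma IsSmooth.einstein_symm (hJ : J.IsSmooth P) (Λ : ℝ) (i : ℕ) (μ ν : Idx d) {z : ℝ × Vec d}
    (hz : z ∈ P.K.carrier) :
    J.einstein P.I P.U Λ i μ ν z.1 z.2 = J.einstein P.I P.U Λ i ν μ z.1 z.2 := by
  have hg : hJ.formal.g μ ν = hJ.formal.g ν μ := by
    rw [← Matrix.transpose_apply hJ.formal.g μ ν, FormalMetric.g, imMetric_transpose hJ.formal.symm]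
  rw [hJ.einstein_eq Λ i μ ν hz, hJ.einstein_eq Λ i ν μ hz, IsSmooth.ein, IsSmooth.ein,
    hJ.formal.ric_comm μ ν, hg]

lemma AgreeOn.mono {i j : ℕ} (h : AgreeOn P j J J') (hij : i ≤ j) : AgreeOn P i J J' :=
  ⟨fun k hk => h.g k (hk.trans hij), fun k hk => h.α k (hk.trans hij),
    fun k hk => h.β k (hk.trans hij)⟩

lemma AgreeOn.symm {i : ℕ} (h : AgreeOn P i J J') : AgreeOn P i J' J :=
  ⟨fun k hk z hz => (h.g k hk z hz).symm, fun k hk z hz => (h.α k hk z hz).symm,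
    fun k hk z hz => (h.β k hk z hz).symm⟩

lemma AgreeOn.trans {i : ℕ} {J'' : CoordJet d} (h : AgreeOn P i J J') (h' : AgreeOn P i J' J'') :
    AgreeOn P i J J'' :=
  ⟨fun k hk z hz => (h.g k hk z hz).trans (h'.g k hk z hz),
    fun k hk z hz => (h.α k hk z hz).trans (h'.α k hk z hz),
    fun k hk z hz => (h.β k hk z hz).trans (h'.β k hk z hz)⟩

lemma entryDeriv_congr {I : Set ℝ} {M M' : ℝ → Matrix (Fin d) (Fin d) ℝ} (h : ∀ r ∈ I, M r = M' r)
    {r : ℝ} (hr : r ∈ I) : entryDeriv I M r = entryDeriv I M' r := by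
  ext A B
  exact derivWithin_congr (fun r' hr' => by rw [h r' hr']) (by rw [h r hr])

lemma transport_congr {i : ℕ} {η η' : ℝ → Vec d → Matrix (Fin d) (Fin d) ℝ}
    (hg : ∀ z ∈ P.K.carrier, J.g 0 z.1 z.2 = J'.g 0 z.1 z.2)
    (hα : ∀ z ∈ P.K.carrier, J.α 0 z.1 z.2 = J'.α 0 z.1 z.2)
    (hη : ∀ z ∈ P.K.carrier, η z.1 z.2 = η' z.1 z.2) {z : ℝ × Vec d} (hz : z ∈ P.K.carrier)
    (A B : Fin d) : J.transport P.I i η z.1 z.2 A B = J'.transport P.I i η' z.1 z.2 A B := by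
  have hline : ∀ r ∈ P.I, (r, z.2) ∈ P.K.carrier := fun r hr => ⟨hr, hz.2⟩
  have h1 : derivWithin (fun r' => η r' z.2 A B) P.I z.1
      = derivWithin (fun r' => η' r' z.2 A B) P.I z.1 :=
    derivWithin_congr (fun r' hr' => by rw [hη _ (hline r' hr')]) (by rw [hη z hz])
  rw [transport_eq, transport_eq, h1, hη z hz, hg z hz, hα z hz,
    entryDeriv_congr (M' := fun r => J'.g 0 r z.2) (fun r hr => hg _ (hline r hr)) hz.1]

lemma transportβ_congr {β β' : ℝ → Vec d → Fin d → ℝ}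
    (hg : ∀ z ∈ P.K.carrier, J.g 0 z.1 z.2 = J'.g 0 z.1 z.2)
    (hβ : ∀ z ∈ P.K.carrier, β z.1 z.2 = β' z.1 z.2) {z : ℝ × Vec d} (hz : z ∈ P.K.carrier)
    (A : Fin d) : J.transportβ P.I β z.1 z.2 A = J'.transportβ P.I β' z.1 z.2 A := by
  have hline : ∀ r ∈ P.I, (r, z.2) ∈ P.K.carrier := fun r hr => ⟨hr, hz.2⟩
  have h1 : derivWithin (fun r' => β r' z.2 A) P.I z.1
      = derivWithin (fun r' => β' r' z.2 A) P.I z.1 :=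
    derivWithin_congr (fun r' hr' => by rw [hβ _ (hline r' hr')]) (by rw [hβ z hz])
  rw [transportβ, transportβ, h1, hβ z hz, hg z hz,
    entryDeriv_congr (M' := fun r => J'.g 0 r z.2) (fun r hr => hg _ (hline r hr)) hz.1]

/-- The equations up to order `n` only involve the fields up to order `n`. -/
lemma AgreeOn.solves {n : ℕ} (h : AgreeOn P n J J') (hJ : J.IsSmooth P) (hJ' : J'.IsSmooth P)
    (hs : Solves P Λ n J) : Solves P Λ n J' where
  rx z hz A := by
    have h1 := hJ.einstein_rx_sub hJ' Λ (h.g 0 (Nat.zero_le n)) (h.α 0 (Nat.zero_le n)) hz A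
    rw [transportβ_congr (h.g 0 (Nat.zero_le n)) (h.β 0 (Nat.zero_le n)) hz, hs.rx z hz A] at h1
    linarith
  xx i hi z hz A B := by
    have h1 := hJ.einstein_xx_sub hJ' Λ (h.mono hi.le) hz A B
    rw [transport_congr (h.g 0 (Nat.zero_le n)) (h.α 0 (Nat.zero_le n)) (h.g (i + 1) hi) hz,
      hs.xx i hi z hz A B] at h1
    linarith
  ur i hi z hz := by
    have h1 := hJ.einstein_ur_sub hJ' Λ (h.mono hi.le) (h.g (i + 1) hi) hz
    rw [h.α (i + 1) hi z hz, hs.ur i hi z hz] at h1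
    linarith
  ux i hi z hz A := by
    have h1 := hJ.einstein_ux_sub hJ' Λ (h.mono hi.le) (h.g (i + 1) hi) hz A
    rw [h.β (i + 1) hi z hz, hs.ux i hi z hz A] at h1
    linarith

variable {σ : Vec d → ℝ}

/-- The data determine the fields up to order `n`. -/
theorem Solves.unique {n : ℕ} (hJ : J.IsSmooth P) (hJ' : J'.IsSmooth P) (hs : Solves P Λ n J)
    (hs' : Solves P Λ n J') (hσI : ∀ y ∈ P.U, σ y ∈ P.I)
    (hg : ∀ z ∈ P.K.carrier, J.g 0 z.1 z.2 = J'.g 0 z.1 z.2)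
    (hα : ∀ z ∈ P.K.carrier, J.α 0 z.1 z.2 = J'.α 0 z.1 z.2)
    (hβ : ∀ y ∈ P.U, J.β 0 (σ y) y = J'.β 0 (σ y) y)
    (hgS : ∀ j ≤ n, ∀ y ∈ P.U, J.g j (σ y) y = J'.g j (σ y) y) : AgreeOn P n J J' := by
  -- `β` on `N` comes first: `R_rA` involves only `g`, `α` and `β` of order zero, and the later
  -- sources contain `β`.
  have hβ0 : ∀ z ∈ P.K.carrier, J.β 0 z.1 z.2 = J'.β 0 z.1 z.2 := by
    refine hJ.transportβ_unique hσI (hJ.smooth_β 0) (hJ'.smooth_β 0) hβ fun z hz A => ?_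
    have h1 := hJ.einstein_rx_sub hJ' Λ hg hα hz A
    rw [hs.rx z hz A, hs'.rx z hz A, ← transportβ_congr hg (fun _ _ => rfl) hz] at h1
    linarith
  have key : ∀ m ≤ n, AgreeOn P m J J' := by
    intro m
    induction m with
    | zero =>
      intro _
      refine ⟨fun j hj => ?_, fun j hj => ?_, fun j hj => ?_⟩
      all_goals obtain rfl := Nat.le_zero.mp hj; assumption
    | succ m ih =>
      intro hm
      have h := ih (by omega)
      -- At each order `∂_u^{m+1} g` has to be treated before `∂_u^{m+1} α` and `∂_u^{m+1} β`, whose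
      -- sources contain it.
      have hgm : ∀ z ∈ P.K.carrier, J.g (m + 1) z.1 z.2 = J'.g (m + 1) z.1 z.2 := by
        refine hJ.transport_unique m hσI (hJ.smooth_g _) (hJ'.smooth_g _) (hJ.symm _) (hJ'.symm _)
          (hgS _ hm) fun z hz A B => ?_
        have h1 := hJ.einstein_xx_sub hJ' Λ h hz A B
        rw [hs.xx m (by omega) z hz A B, hs'.xx m (by omega) z hz A B,
          ← transport_congr hg hα (fun _ _ => rfl) hz] at h1
        linarith
      refine ⟨fun j hj z hz => ?_, fun j hj z hz => ?_, fun j hj z hz => ?_⟩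
      all_goals rcases Nat.le_succ_iff.mp hj with hj | rfl
      · exact h.g j hj z hz
      · exact hgm z hz
      · exact h.α j hj z hz
      · have h1 := hJ.einstein_ur_sub hJ' Λ h hgm hz
        rw [hs.ur m (by omega) z hz, hs'.ur m (by omega) z hz, zero_add, zero_add] at h1
        exact mul_left_cancel₀ (by positivity) h1
      · exact h.β j hj z hz
      · ext A
        have h1 := hJ.einstein_ux_sub hJ' Λ h hgm hz A
        rw [hs.ux m (by omega) z hz, hs'.ux m (by omega) z hz, zero_add, zero_add] at h1
        exact mul_left_cancel₀ (by positivity) h1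
  exact key n le_rfl

/-- Replacement of the fields of order `m`. -/
def update (J : CoordJet d) (m : ℕ) (η : ℝ → Vec d → Matrix (Fin d) (Fin d) ℝ) (a : ℝ → Vec d → ℝ)
    (b : ℝ → Vec d → Fin d → ℝ) : CoordJet d where
  g := Function.update J.g m η
  α := Function.update J.α m a
  β := Function.update J.β m b

section Update

variable {m : ℕ} {η : ℝ → Vec d → Matrix (Fin d) (Fin d) ℝ} {a : ℝ → Vec d → ℝ}
  {b : ℝ → Vec d → Fin d → ℝ}

@[simp] lemma update_g_self : (J.update m η a b).g m = η := Function.update_self ..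
@[simp] lemma update_α_self : (J.update m η a b).α m = a := Function.update_self ..
@[simp] lemma update_β_self : (J.update m η a b).β m = b := Function.update_self ..
lemma update_g_ne {j : ℕ} (h : j ≠ m) : (J.update m η a b).g j = J.g j := Function.update_of_ne h ..
lemma update_α_ne {j : ℕ} (h : j ≠ m) : (J.update m η a b).α j = J.α j := Function.update_of_ne h ..
lemma update_β_ne {j : ℕ} (h : j ≠ m) : (J.update m η a b).β j = J.β j := Function.update_of_ne h ..

lemma IsSmooth.update (hJ : J.IsSmooth P) (hm : m ≠ 0)
    (hη : ∀ A B, ContDiffOn ℝ ∞ (fun z : ℝ × Vec d => η z.1 z.2 A B) P.K.carrier)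
    (hηs : ∀ z ∈ P.K.carrier, ∀ A B, η z.1 z.2 A B = η z.1 z.2 B A)
    (ha : ContDiffOn ℝ ∞ (fun z : ℝ × Vec d => a z.1 z.2) P.K.carrier)
    (hb : ∀ A, ContDiffOn ℝ ∞ (fun z : ℝ × Vec d => b z.1 z.2 A) P.K.carrier) :
    (J.update m η a b).IsSmooth P where
  smooth_g j A B := by
    rcases eq_or_ne j m with rfl | h
    · rw [update_g_self]; exact hη A B
    · rw [update_g_ne h]; exact hJ.smooth_g j A B
  smooth_α j := by
    rcases eq_or_ne j m with rfl | h
    · rw [update_α_self]; exact ha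
    · rw [update_α_ne h]; exact hJ.smooth_α j
  smooth_β j A := by
    rcases eq_or_ne j m with rfl | h
    · rw [update_β_self]; exact hb A
    · rw [update_β_ne h]; exact hJ.smooth_β j A
  symm j := by
    rcases eq_or_ne j m with rfl | h
    · rw [update_g_self]; exact hηs
    · rw [update_g_ne h]; exact hJ.symm j
  det_ne := by
    rw [update_g_ne hm.symm]
    exact hJ.det_ne

lemma agreeOn_update {n : ℕ} (h : n < m) : AgreeOn P n J (J.update m η a b) where
  g j hj z _ := by rw [update_g_ne (by omega)]
  α j hj z _ := by rw [update_α_ne (by omega)]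
  β j hj z _ := by rw [update_β_ne (by omega)]

end Update

/-- The fields of the next order. -/
theorem Solves.exists_succ {n : ℕ} (hJ : J.IsSmooth P) (hs : Solves P Λ n J)
    (hσ : ContDiffOn ℝ ∞ σ P.U) (hσI : ∀ y ∈ P.U, σ y ∈ P.I)
    {η₀ : Vec d → Matrix (Fin d) (Fin d) ℝ} (hη : ∀ A B, ContDiffOn ℝ ∞ (fun y => η₀ y A B) P.U)
    (hηs : ∀ y ∈ P.U, ∀ A B, η₀ y A B = η₀ y B A) :
    ∃ η a b, (J.update (n + 1) η a b).IsSmooth P ∧ Solves P Λ (n + 1) (J.update (n + 1) η a b) ∧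
      ∀ y ∈ P.U, η (σ y) y = η₀ y := by
  -- With zero fields at order `n + 1` the transport operator contributes nothing, so that the
  -- Einstein expression of `J₀` is exactly the source for `η`. In the same way `J₁`, which already
  -- contains `η`, provides the sources for `a` and `b`.
  set J₀ := J.update (n + 1) 0 0 0 with hJ₀
  have hJ₀s : J₀.IsSmooth P := hJ.update (Nat.succ_ne_zero n) (fun _ _ => contDiffOn_const)
    (fun _ _ _ _ => rfl) contDiffOn_const fun _ => contDiffOn_const
  obtain ⟨η, hη1, hη2, hη3, hη4⟩ := hJ₀s.exists_transport n hσ hσI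
    (f := fun z A B => -J₀.einstein P.I P.U Λ n (ix A) (ix B) z.1 z.2)
    (fun A B => (hJ₀s.contDiffOn_einstein Λ n _ _).neg)
    (fun z hz A B => by rw [hJ₀s.einstein_symm Λ n _ _ hz]) hη hηs
  set J₁ := J.update (n + 1) η 0 0 with hJ₁
  have hJ₁s : J₁.IsSmooth P := hJ.update (Nat.succ_ne_zero n) hη1 hη2 contDiffOn_const
    fun _ => contDiffOn_const
  -- The factors `1 / (n + 2)` and `2 / (n + 2)` invert the coefficients of `∂_u^{n+1} α` and
  -- `∂_u^{n+1} β` in the `ur` and `uA` equations.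
  set a : ℝ → Vec d → ℝ := fun r y => (1 / ((n : ℝ) + 2)) * J₁.einstein P.I P.U Λ n iu ir r y with ha
  set b : ℝ → Vec d → Fin d → ℝ := fun r y A =>
    (2 / ((n : ℝ) + 2)) * J₁.einstein P.I P.U Λ n iu (ix A) r y with hb
  set J₂ := J.update (n + 1) η a b with hJ₂
  have hJ₂s : J₂.IsSmooth P := hJ.update (Nat.succ_ne_zero n) hη1 hη2
    (contDiffOn_const.mul (hJ₁s.contDiffOn_einstein Λ n _ _))
    fun _ => contDiffOn_const.mul (hJ₁s.contDiffOn_einstein Λ n _ _)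
  have hA : AgreeOn P n J J₂ := agreeOn_update (Nat.lt_succ_self n)
  have hA0 : AgreeOn P n J₂ J₀ := hA.symm.trans (agreeOn_update (Nat.lt_succ_self n))
  have hA1 : AgreeOn P n J₂ J₁ := hA.symm.trans (agreeOn_update (Nat.lt_succ_self n))
  have hs2 := hA.solves hJ hJ₂s hs
  have hn : (n : ℝ) + 2 ≠ 0 := by positivity
  refine ⟨η, a, b, hJ₂s, ⟨hs2.rx, fun i hi => ?_, fun i hi => ?_, fun i hi => ?_⟩, hη3⟩
  all_goals rcases Nat.lt_succ_iff_lt_or_eq.mp hi with hi | rfl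
  · exact hs2.xx i hi
  · intro z hz A B
    have h1 := hJ₂s.einstein_xx_sub hJ₀s Λ hA0 hz A B
    rw [transport_congr (hA0.g 0 (Nat.zero_le i)) (hA0.α 0 (Nat.zero_le i))
      (η' := η) (fun z _ => by rw [hJ₂, update_g_self]) hz, hη4 z hz A B, hJ₀, update_g_self, ← hJ₀] at h1
    have h2 : J₀.transport P.I i 0 z.1 z.2 A B = 0 := by
      simp [transport]
    rw [h2] at h1
    linarith
  · exact hs2.ur i hi
  · intro z hz
    have h1 := hJ₂s.einstein_ur_sub hJ₁s Λ hA1 (fun z _ => by rw [hJ₂, hJ₁, update_g_self, update_g_self]) hz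
    rw [hJ₂, update_α_self, ← hJ₂] at h1
    have h2 : J₁.α (i + 1) z.1 z.2 = 0 := by rw [hJ₁, update_α_self]; rfl
    rw [h2, ha] at h1
    simp only at h1
    rw [← mul_assoc, mul_one_div_cancel hn] at h1
    linarith
  · exact hs2.ux i hi
  · intro z hz A
    have h1 := hJ₂s.einstein_ux_sub hJ₁s Λ hA1 (fun z _ => by rw [hJ₂, hJ₁, update_g_self, update_g_self]) hz A
    rw [hJ₂, update_β_self, ← hJ₂] at h1
    have h2 : J₁.β (i + 1) z.1 z.2 A = 0 := by rw [hJ₁, update_β_self]; rfl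
    rw [h2, hb] at h1
    simp only at h1
    have h3 : ((i : ℝ) + 2) / 2 * (2 / ((i : ℝ) + 2) * J₁.einstein P.I P.U Λ i iu (ix A) z.1 z.2)
        = J₁.einstein P.I P.U Λ i iu (ix A) z.1 z.2 := by
      field_simp
    rw [h3] at h1
    linarith

/-- Used to pass from the finite-order approximations to their limit: each Einstein expression sees
only finitely many fields. -/
lemma einstein_congr {i : ℕ} (I : Set ℝ) (U : Set (Vec d)) (hg : ∀ j ≤ i + 2, J.g j = J'.g j)
    (hα : ∀ j ≤ i + 2, J.α j = J'.α j) (hβ : ∀ j ≤ i + 2, J.β j = J'.β j) (μ ν : Idx d) (r : ℝ)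
    (y : Vec d) : J.einstein I U Λ i μ ν r y = J'.einstein I U Λ i μ ν r y := by
  have hm : J.metric (i + 2) = J'.metric (i + 2) := by
    funext p
    have h1 : ∀ (f f' : ℕ → ℝ), (∀ j ≤ i + 2, f j = f' j) → ∀ u,
        taylorSum (i + 2) f u = taylorSum (i + 2) f' u := by
      intro f f' h u
      refine Finset.sum_congr rfl fun j hj => ?_
      rw [h j (Nat.lt_succ_iff.mp (Finset.mem_range.mp hj))]
    have ha : taylorSum (i + 2) (fun j => J.α j (p ir) (xPart p)) (p iu)
        = taylorSum (i + 2) (fun j => J'.α j (p ir) (xPart p)) (p iu) :=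
      h1 _ _ (fun j hj => by rw [hα j hj]) _
    have hb : (fun A => taylorSum (i + 2) (fun j => J.β j (p ir) (xPart p) A) (p iu))
        = fun A => taylorSum (i + 2) (fun j => J'.β j (p ir) (xPart p) A) (p iu) :=
      funext fun A => h1 _ _ (fun j hj => by rw [hβ j hj]) _
    have hh : (fun A B => taylorSum (i + 2) (fun j => J.g j (p ir) (xPart p) A B) (p iu))
        = fun A B => taylorSum (i + 2) (fun j => J'.g j (p ir) (xPart p) A B) (p iu) :=
      funext fun A => funext fun B => h1 _ _ (fun j hj => by rw [hg j hj]) _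
    simp only [CoordJet.metric]
    rw [ha, hh]
    simp only [congrFun hb]
  rw [einstein, einstein, hm]

/-- Existence of solutions of the hierarchy. -/
theorem exists_solves (P : Patch d) (Λ : ℝ) (hσ : ContDiffOn ℝ ∞ σ P.U) (hσI : ∀ y ∈ P.U, σ y ∈ P.I)
    {gN : ℝ → Vec d → Matrix (Fin d) (Fin d) ℝ} {αN : ℝ → Vec d → ℝ}
    {gS : ℕ → Vec d → Matrix (Fin d) (Fin d) ℝ} {βS : Vec d → Fin d → ℝ}
    (hgN : ∀ A B, ContDiffOn ℝ ∞ (fun z : ℝ × Vec d => gN z.1 z.2 A B) P.K.carrier)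
    (hαN : ContDiffOn ℝ ∞ (fun z : ℝ × Vec d => αN z.1 z.2) P.K.carrier)
    (hgS : ∀ j A B, ContDiffOn ℝ ∞ (fun y => gS j y A B) P.U)
    (hβS : ∀ A, ContDiffOn ℝ ∞ (fun y => βS y A) P.U)
    (hsN : ∀ z ∈ P.K.carrier, ∀ A B, gN z.1 z.2 A B = gN z.1 z.2 B A)
    (hdN : ∀ z ∈ P.K.carrier, (gN z.1 z.2).det ≠ 0)
    (hsS : ∀ j, ∀ y ∈ P.U, ∀ A B, gS j y A B = gS j y B A)
    (h0 : ∀ y ∈ P.U, gN (σ y) y = gS 0 y) :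
    ∃ J : CoordJet d, J.IsSmooth P ∧ (∀ n, Solves P Λ n J) ∧ J.g 0 = gN ∧ J.α 0 = αN ∧
      (∀ j, ∀ y ∈ P.U, J.g j (σ y) y = gS j y) ∧ ∀ y ∈ P.U, J.β 0 (σ y) y = βS y := by
  -- The jet with `β = 0` provides the source of the transport equation for `β`; inserting the
  -- solution gives the start `B` of the induction.
  let B₀ : CoordJet d := ⟨fun j => if j = 0 then gN else 0, fun j => if j = 0 then αN else 0, 0⟩
  have hB₀ : B₀.IsSmooth P :=
    { smooth_g := fun j A B => by
        rcases eq_or_ne j 0 with rfl | h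
        · simpa [B₀] using hgN A B
        · simpa [B₀, h] using contDiffOn_const
      smooth_α := fun j => by
        rcases eq_or_ne j 0 with rfl | h
        · simpa [B₀] using hαN
        · simpa [B₀, h] using contDiffOn_const
      smooth_β := fun j A => contDiffOn_const
      symm := fun j z hz A B => by
        rcases eq_or_ne j 0 with rfl | h
        · simpa [B₀] using hsN z hz A B
        · simp [B₀, h]
      det_ne := by simpa [B₀] using hdN }
  obtain ⟨b, hb1, hb2, hb3⟩ := hB₀.exists_transportβ hσ hσI
    (f := fun z A => -B₀.einstein P.I P.U Λ 0 ir (ix A) z.1 z.2)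
    (fun A => (hB₀.contDiffOn_einstein Λ 0 _ _).neg) hβS
  let B : CoordJet d := ⟨B₀.g, B₀.α, fun j => if j = 0 then b else 0⟩
  have hB : B.IsSmooth P :=
    { smooth_g := hB₀.smooth_g
      smooth_α := hB₀.smooth_α
      smooth_β := fun j A => by
        rcases eq_or_ne j 0 with rfl | h
        · simpa [B] using hb1 A
        · simpa [B, h] using contDiffOn_const
      symm := hB₀.symm
      det_ne := hB₀.det_ne }
  have hBs : Solves P Λ 0 B :=
    { rx := fun z hz A => by
        have h1 := hB.einstein_rx_sub hB₀ Λ (fun _ _ => rfl) (fun _ _ => rfl) hz A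
        have h2 : B₀.transportβ P.I (B₀.β 0) z.1 z.2 A = 0 := by
          simp [transportβ, B₀]
        have h3 : B.transportβ P.I (B.β 0) z.1 z.2 A = B₀.transportβ P.I b z.1 z.2 A :=
          transportβ_congr (fun _ _ => rfl) (fun z _ => by simp [B]) hz A
        rw [h2, h3, hb3 z hz A] at h1
        linarith
      xx := fun i hi => absurd hi (Nat.not_lt_zero i)
      ur := fun i hi => absurd hi (Nat.not_lt_zero i)
      ux := fun i hi => absurd hi (Nat.not_lt_zero i) }
  let Q : ℕ → CoordJet d → Prop := fun n C => C.IsSmooth P ∧ Solves P Λ n C ∧ C.g 0 = gN ∧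
    C.α 0 = αN ∧ (∀ j ≤ n, ∀ y ∈ P.U, C.g j (σ y) y = gS j y) ∧ ∀ y ∈ P.U, C.β 0 (σ y) y = βS y
  have hQ0 : Q 0 B := ⟨hB, hBs, by simp [B, B₀], by simp [B, B₀], fun j hj y hy => by
    obtain rfl := Nat.le_zero.mp hj
    simpa [B, B₀] using h0 y hy, fun y hy => by simpa [B] using hb2 y hy⟩
  have hstep : ∀ n C, Q n C → ∃ C', Q (n + 1) C' ∧
      ∀ j ≤ n, C'.g j = C.g j ∧ C'.α j = C.α j ∧ C'.β j = C.β j := by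
    rintro n C ⟨hC, hCs, hCg, hCα, hCS, hCβ⟩
    obtain ⟨η, a, b, h1, h2, h3⟩ := hCs.exists_succ hC hσ hσI (hgS (n + 1)) (hsS (n + 1))
    refine ⟨C.update (n + 1) η a b, ⟨h1, h2, ?_, ?_, fun j hj y hy => ?_, fun y hy => ?_⟩,
      fun j hj => ⟨update_g_ne (by omega), update_α_ne (by omega), update_β_ne (by omega)⟩⟩
    · rw [update_g_ne (Nat.succ_ne_zero n).symm, hCg]
    · rw [update_α_ne (Nat.succ_ne_zero n).symm, hCα]
    · rcases Nat.le_succ_iff.mp hj with hj | rfl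
      · rw [update_g_ne (by omega)]
        exact hCS j hj y hy
      · rw [update_g_self]
        exact h3 y hy
    · rw [update_β_ne (Nat.succ_ne_zero n).symm]
      exact hCβ y hy
  choose! next hnext hagree using hstep
  let seq : ℕ → CoordJet d := fun n => Nat.rec B (fun n C => next n C) n
  have hseq : ∀ n, Q n (seq n) := by
    intro n
    induction n with
    | zero => exact hQ0
    | succ n ih => exact hnext n _ ih
  have hmono : ∀ n m, n ≤ m → ∀ j ≤ n,
      (seq m).g j = (seq n).g j ∧ (seq m).α j = (seq n).α j ∧ (seq m).β j = (seq n).β j := by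
    intro n m hnm j hj
    induction m, hnm using Nat.le_induction with
    | base => exact ⟨rfl, rfl, rfl⟩
    | succ m hm ih =>
      have h := hagree m (seq m) (hseq m) j (hj.trans hm)
      exact ⟨h.1.trans ih.1, h.2.1.trans ih.2.1, h.2.2.trans ih.2.2⟩
  -- Diagonal limit: the step to order `n + 1` leaves the fields up to order `n` unchanged, so the
  -- field of order `n` is that of the `n`-th approximation and of all later ones.
  let L : CoordJet d := ⟨fun n => (seq n).g n, fun n => (seq n).α n, fun n => (seq n).β n⟩
  have hL : ∀ n, ∀ j ≤ n, L.g j = (seq n).g j ∧ L.α j = (seq n).α j ∧ L.β j = (seq n).β j := by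
    intro n j hj
    have h := hmono j n hj j le_rfl
    exact ⟨h.1.symm, h.2.1.symm, h.2.2.symm⟩
  have hein : ∀ i μ ν r y, L.einstein P.I P.U Λ i μ ν r y
      = (seq (i + 2)).einstein P.I P.U Λ i μ ν r y := fun i μ ν r y =>
    einstein_congr _ _ (fun j hj => (hL _ j hj).1) (fun j hj => (hL _ j hj).2.1)
      (fun j hj => (hL _ j hj).2.2) μ ν r y
  refine ⟨L, ⟨fun j => (hseq j).1.smooth_g j, fun j => (hseq j).1.smooth_α j,
    fun j => (hseq j).1.smooth_β j, fun j => (hseq j).1.symm j, (hseq 0).1.det_ne⟩, fun n =>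
    ⟨fun z hz A => ?_, fun i _ z hz A B => ?_, fun i _ z hz => ?_, fun i _ z hz A => ?_⟩,
    (hseq 0).2.2.1, (hseq 0).2.2.2.1, fun j => (hseq j).2.2.2.2.1 j le_rfl, (hseq 0).2.2.2.2.2⟩
  · rw [hein]; exact (hseq 2).2.1.rx z hz A
  · rw [hein]; exact (hseq (i + 2)).2.1.xx i (by omega) z hz A B
  · rw [hein]; exact (hseq (i + 2)).2.1.ur i (by omega) z hz
  · rw [hein]; exact (hseq (i + 2)).2.1.ux i (by omega) z hz A

end CoordJet

open PowerSeries

variable {d : ℕ}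

/-! ### Propagation of the constraints -/

section Propagation

variable {C : Type*} [CommRing C] [Algebra ℝ C]

/-- Uniqueness for homogeneous linear equations in the transverse direction. -/
lemma eq_zero_of_dX {κ : Type*} {f : κ → C⟦X⟧}
    (h : ∀ n, (∀ k, X ^ n ∣ f k) → ∀ k, X ^ n ∣ dX C (f k)) (h0 : ∀ k, coeff 0 (f k) = 0) (k : κ) :
    f k = 0 := by
  have key : ∀ n, ∀ k, X ^ n ∣ f k := by
    intro n
    induction n with
    | zero => exact fun k => by rw [pow_zero]; exact one_dvd _
    | succ n ih =>
      intro k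
      rw [X_pow_dvd_iff]
      intro m hm
      rcases m with _ | m
      · exact h0 k
      · have h1 := X_pow_dvd_iff.mp (h n ih k) m (by omega)
        rw [coeff_dX] at h1
        have h2 : ((m : C) + 1) = algebraMap ℝ C ((m : ℝ) + 1) := by simp
        -- Division by `m + 1`, possible since the coefficient ring is an algebra over the reals.
        have h3 : coeff (m + 1) (f k) = (coeff (m + 1) (f k) * (m + 1)) * algebraMap ℝ C (1 / ((m : ℝ) + 1)) := by
          rw [h2, mul_assoc, ← map_mul, mul_one_div_cancel (by positivity), map_one, mul_one]
        rw [h3, h1, zero_mul]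
  ext n
  rw [map_zero]
  exact X_pow_dvd_iff.mp (key (n + 1) k) n (Nat.lt_succ_self n)

lemma coeff_mul_of_dvd {n : ℕ} (a : C⟦X⟧) {f : C⟦X⟧} (h : X ^ n ∣ f) :
    coeff n (a * f) = coeff 0 a * coeff n f := by
  obtain ⟨e, rfl⟩ := h
  rw [mul_left_comm, coeff_X_pow_mul', coeff_X_pow_mul']
  simp

lemma coeff_succ_mul_of_dvd {n : ℕ} {a f : C⟦X⟧} (ha : coeff 0 a = 0) (h : X ^ n ∣ f) :
    coeff (n + 1) (a * f) = coeff 1 a * coeff n f := by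
  obtain ⟨e, rfl⟩ := h
  obtain ⟨a', rfl⟩ : X ∣ a := X_dvd_iff.mpr (by rw [← coeff_zero_eq_constantCoeff_apply, ha])
  rw [show X * a' * (X ^ n * e) = X ^ (n + 1) * (a' * e) by ring, coeff_X_pow_mul',
    coeff_X_pow_mul', coeff_succ_X_mul]
  simp

end Propagation

namespace CoordJet

variable {P : Patch d} {J : CoordJet d} {Λ : ℝ} {σ : Vec d → ℝ}

lemma IsSmooth.ein_eq_zero_iff (hJ : J.IsSmooth P) (Λ : ℝ) (μ ν : Idx d) :
    hJ.ein Λ μ ν = 0 ↔ ∀ i, ∀ z ∈ P.K.carrier, J.einstein P.I P.U Λ i μ ν z.1 z.2 = 0 := by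
  constructor
  · intro h i z hz
    rw [hJ.einstein_eq Λ i μ ν hz, h, map_zero, ev_zero, mul_zero]
  · intro h
    ext1 i
    rw [map_zero]
    refine ev_ext fun z hz => ?_
    have h1 := h i z hz
    rw [hJ.einstein_eq Λ i μ ν hz] at h1
    rw [ev_zero]
    exact (mul_eq_zero.mp h1).resolve_left (by positivity)

/-- Along each generator this is a homogeneous scalar linear ODE, with zero initial value where the
generator meets the cross-section. -/
lemma eq_zero_of_transport {w c : P.K.Ring} (hw : dirDeriv ((1 : ℝ), (0 : Vec d)) w = c * w)
    (hσI : ∀ y ∈ P.U, σ y ∈ P.I) (h0 : ∀ y ∈ P.U, ev w (σ y, y) = 0) : w = 0 := by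
  refine ev_ext fun z hz => ?_
  rw [ev_zero]
  have hline : ∀ r ∈ P.I, (r, z.2) ∈ P.K.carrier := fun r hr => ⟨hr, hz.2⟩
  refine eq_zero_of_linear_ode (E := ℝ) P.ord (w := fun r => ev w (r, z.2))
    (A := fun r => ev c (r, z.2) • ContinuousLinearMap.id ℝ ℝ) ?_ (fun r hr => ?_) (hσI _ hz.2)
    (h0 _ hz.2) z.1 hz.1
  · exact ((contDiffOn_ev c).continuousOn.comp (f := fun r : ℝ => (r, z.2)) (by fun_prop)
      hline).smul continuousOn_const
  · have h1 := derivWithin_eq_fderivWithin (hline r hr) (differentiableWithinAt_ev w (hline r hr))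
    refine h1.congr_deriv ?_
    rw [← ev_dirDeriv _ _ (hline r hr), hw, ev_mul]
    rfl

/-- Uniqueness for the `u` component of the contracted Bianchi identity. -/
lemma eq_zero_of_transverse_bianchi {w p τ : P.K.Ring⟦X⟧} {q : Fin d → P.K.Ring⟦X⟧}
    (hp : coeff 0 p = 0) (hq : ∀ A, coeff 0 (q A) = 0)
    (h : 2 * (P.frame iu (p * w) - P.frame ir w + ∑ A, P.frame (ix A) (q A * w) + τ * w)
      = P.frame iu (p * w))
    (hσI : ∀ y ∈ P.U, σ y ∈ P.I) (h0 : ∀ i, ∀ y ∈ P.U, ev (coeff i w) (σ y, y) = 0) : w = 0 := by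
  have h1 : P.frame ir w
      = half _ * P.frame iu (p * w) + ∑ A, P.frame (ix A) (q A * w) + τ * w := by
    refine eq_of_two_mul_eq ?_
    linear_combination -h - two_mul_half (P.frame iu (p * w))
  have key : ∀ n, X ^ n ∣ w := by
    intro n
    induction n with
    | zero => rw [pow_zero]; exact one_dvd _
    | succ n ih =>
      have h2 := congrArg (coeff n) h1
      rw [P.frame_r, P.frame_u, coeff_mapDer, map_add, map_add, map_sum, coeff_mul_of_dvd τ ih,
        half, PowerSeries.algebraMap_apply, coeff_C_mul, coeff_dX, coeff_succ_mul_of_dvd hp ih,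
        Finset.sum_eq_zero fun A _ => by
          rw [P.frame_x, coeff_mapDer, coeff_mul_of_dvd _ ih, hq, zero_mul, map_zero]] at h2
      -- If `w` starts at order `n`, then `∂_u (p w)` at order `n` is `(n + 1) p₁ w_n`, as `p`
      -- vanishes at `u = 0`; the tangential terms drop out because `q A` vanishes there as well.
      -- What is left is a homogeneous ODE for `w_n`, in which `w_{n+1}` does not occur.
      have h3 := eq_zero_of_transport (w := coeff n w)
        (c := algebraMap ℝ P.K.Ring (1 / 2) * coeff 1 p * (n + 1) + coeff 0 τ)
        (by rw [h2]; ring) hσI (h0 n)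
      rw [X_pow_dvd_iff]
      intro m hm
      rcases Nat.lt_succ_iff_lt_or_eq.mp hm with hm | rfl
      · exact X_pow_dvd_iff.mp ih m hm
      · exact h3
  ext1 n
  rw [map_zero]
  exact X_pow_dvd_iff.mp (key (n + 1)) n (Nat.lt_succ_self n)

/-- The remaining Einstein equations follow from the Bianchi identities. -/
theorem IsSmooth.einstein_eq_zero (hJ : J.IsSmooth P) (hs : ∀ n, Solves P Λ n J)
    (hσI : ∀ y ∈ P.U, σ y ∈ P.I)
    (hrr : ∀ z ∈ P.K.carrier, J.einstein P.I P.U Λ 0 ir ir z.1 z.2 = 0)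
    (huu : ∀ i, ∀ y ∈ P.U, J.einstein P.I P.U Λ i iu iu (σ y) y = 0) (i : ℕ) (μ ν : Idx d)
    {z : ℝ × Vec d} (hz : z ∈ P.K.carrier) : J.einstein P.I P.U Λ i μ ν z.1 z.2 = 0 := by
  have hxx : ∀ A B, hJ.ein Λ (ix A) (ix B) = 0 := fun A B =>
    (hJ.ein_eq_zero_iff Λ _ _).mpr fun i z hz => (hs (i + 1)).xx i (Nat.lt_succ_self i) z hz A B
  have hur : hJ.ein Λ iu ir = 0 :=
    (hJ.ein_eq_zero_iff Λ _ _).mpr fun i z hz => (hs (i + 1)).ur i (Nat.lt_succ_self i) z hz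
  have hux : ∀ A, hJ.ein Λ iu (ix A) = 0 := fun A =>
    (hJ.ein_eq_zero_iff Λ _ _).mpr fun i z hz => (hs (i + 1)).ux i (Nat.lt_succ_self i) z hz A
  have c0 : ∀ {μ ν}, (∀ z ∈ P.K.carrier, J.einstein P.I P.U Λ 0 μ ν z.1 z.2 = 0) →
      coeff 0 (hJ.ein Λ μ ν) = 0 := by
    intro μ ν h
    refine ev_ext fun z hz => ?_
    have h1 := h z hz
    rw [hJ.einstein_eq Λ 0 μ ν hz, Nat.factorial_zero, Nat.cast_one, one_mul] at h1
    rw [h1, ev_zero]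
  obtain ⟨B1, B2⟩ := bianchi_im P.frame_comm hJ.formal.symm hJ.formal.inv (2 * Λ / d) (hJ.ein Λ)
    (fun i j => rfl) hxx hur hux
  -- Propagation along the generators, separately at each order in `u`, starting from the transverse
  -- constraint on the cross-section.
  have huu0 : hJ.ein Λ iu iu = 0 := by
    have hσz : ∀ y ∈ P.U, (σ y, y) ∈ P.K.carrier := fun y hy => ⟨hσI y hy, hy⟩
    have h0 : ∀ i, ∀ y ∈ P.U, ev (coeff i (hJ.ein Λ iu iu)) (σ y, y) = 0 := by
      intro i y hy
      have h1 := huu i y hy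
      rw [hJ.einstein_eq Λ i iu iu (hσz y hy)] at h1
      exact (mul_eq_zero.mp h1).resolve_left (by positivity)
    have hp := hJ.formal.invUU_zero
    have hq := hJ.formal.raise_zero
    exact eq_zero_of_transverse_bianchi hp hq B1 hσI h0
  obtain ⟨B2, B3⟩ := B2 huu0
  -- Propagation in the transverse direction: the `u`-derivative of `R_rA` is a linear combination
  -- of the `R_rB`, and these vanish at `u = 0` by the transport equation for `β`.
  have hrx0 : ∀ A, hJ.ein Λ ir (ix A) = 0 := by
    refine eq_zero_of_dX (fun n hn A => ?_) fun A => c0 fun z hz => (hs 0).rx z hz A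
    have h := B2 A
    rw [P.frame_u] at h
    rw [h]
    refine dvd_add (dvd_sub (dvd_neg.mpr ((hn A).mul_left _)) ?_) ?_
    · exact Finset.dvd_sum fun C _ => (Finset.dvd_sum fun B _ => (hn B).mul_left _).mul_left _
    · exact Finset.dvd_sum fun C _ => (hn C).mul_left _
  -- The same argument for the last component, with the Raychaudhuri equation as initial condition
  -- at `u = 0`.
  have hrr0 : hJ.ein Λ ir ir = 0 := by
    refine eq_zero_of_dX (κ := Unit) (f := fun _ => hJ.ein Λ ir ir) (fun n hn k => ?_)
      (fun k => c0 hrr) ()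
    have h := B3 hrx0
    rw [P.frame_u] at h
    rw [h]
    exact dvd_neg.mpr ((hn ()).mul_left _)
  have main : ∀ μ ν, hJ.ein Λ μ ν = 0 := by
    have hsy : ∀ {μ ν}, hJ.ein Λ μ ν = 0 → hJ.ein Λ ν μ = 0 := fun {μ ν} h =>
      (hJ.ein_eq_zero_iff Λ _ _).mpr fun i z hz => by
        rw [hJ.einstein_symm Λ i _ _ hz]
        exact (hJ.ein_eq_zero_iff Λ _ _).mp h i z hz
    simp only [forall_idx]
    exact ⟨⟨huu0, hur, hux⟩, ⟨hsy hur, hrr0, hrx0⟩, fun A => ⟨hsy (hux A), hsy (hrx0 A), hxx A⟩⟩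
  exact (hJ.ein_eq_zero_iff Λ μ ν).mp (main μ ν) i z hz

end CoordJet

open PowerSeries

variable {d : ℕ}

/-! ### Changes of coordinates on the cross-section -/

/-- The Jacobi matrix. -/
def jac (ψ : Vec d → Vec d) (y : Vec d) : Matrix (Fin d) (Fin d) ℝ :=
  Matrix.of fun A B => (fderiv ℝ ψ y (EuclideanSpace.single B (1 : ℝ) : Vec d)) A

/-- The Jacobi matrix of the change of coordinates `(u, r, x) ↦ (u, r, ψ(x))`. -/
def spaceJac {R : Type*} [CommRing R] (T : Matrix (Fin d) (Fin d) R) : Matrix (Idx d) (Idx d) R :=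
  Matrix.fromBlocks 1 0 0 T

/-- The coordinates of a map, in the ring of functions. -/
def Patch.coord (P : Patch d) (ψ : Vec d → Vec d) (A : Fin d) : P.K.Ring := P.K.mk' fun z => ψ z.2 A

/-- The Jacobi matrix, with entries in the ring of functions. -/
def Patch.ringJac (P : Patch d) (ψ : Vec d → Vec d) : Matrix (Fin d) (Fin d) P.K.Ring :=
  Matrix.of fun A B => dirDeriv ((0 : ℝ), (EuclideanSpace.single B (1 : ℝ) : Vec d)) (P.coord ψ A)

/-- A smooth map between patches over the same interval. -/
structure Patch.Map (P P' : Patch d) (ψ : Vec d → Vec d) : Prop where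
  hI : P.I = P'.I
  mapsTo : ∀ y ∈ P.U, ψ y ∈ P'.U
  smooth : ContDiffOn ℝ ∞ ψ P.U

namespace Patch.Map

variable {P P' : Patch d} {ψ : Vec d → Vec d} (H : P.Map P' ψ)
include H

lemma mem {z : ℝ × Vec d} (hz : z ∈ P.K.carrier) : (z.1, ψ z.2) ∈ P'.K.carrier :=
  ⟨H.hI ▸ hz.1, H.mapsTo _ hz.2⟩

lemma smooth_prod : ContDiffOn ℝ ∞ (fun z : ℝ × Vec d => (z.1, ψ z.2)) P.K.carrier :=
  contDiff_fst.contDiffOn.prodMk (H.smooth.comp contDiff_snd.contDiffOn fun z hz => hz.2)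

lemma contDiffOn_comp {f : ℝ × Vec d → ℝ} (hf : ContDiffOn ℝ ∞ f P'.K.carrier) :
    ContDiffOn ℝ ∞ (fun z : ℝ × Vec d => f (z.1, ψ z.2)) P.K.carrier :=
  hf.comp H.smooth_prod fun _ hz => H.mem hz

lemma hasFDerivAt {y : Vec d} (hy : y ∈ P.U) : HasFDerivAt ψ (fderiv ℝ ψ y) y :=
  ((H.smooth.contDiffAt (P.isOpen.mem_nhds hy)).differentiableAt (by simp)).hasFDerivAt

lemma contDiffOn_jac (A B : Fin d) :
    ContDiffOn ℝ ∞ (fun z : ℝ × Vec d => jac ψ z.2 A B) P.K.carrier := by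
  have h1 : ContDiffOn ℝ ∞ (fderiv ℝ ψ) P.U := H.smooth.fderiv_of_isOpen P.isOpen (by simp)
  have h2 : ContDiffOn ℝ ∞ (fun y => fderiv ℝ ψ y (EuclideanSpace.single B (1 : ℝ) : Vec d)) P.U :=
    h1.clm_apply contDiffOn_const
  have h3 : ContDiffOn ℝ ∞
      (fun y => (fderiv ℝ ψ y (EuclideanSpace.single B (1 : ℝ) : Vec d)) A) P.U :=
    (EuclideanSpace.proj (𝕜 := ℝ) A).contDiff.comp_contDiffOn h2
  exact h3.comp contDiff_snd.contDiffOn fun z hz => hz.2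

/-- The pullback of functions. -/
def hom : P'.K.Ring →+* P.K.Ring where
  toFun a := P.K.mk' fun z => ev a (z.1, ψ z.2)
  map_one' := ev_ext fun z hz => by
    rw [ev_mk (H.contDiffOn_comp (contDiffOn_ev _)) hz, ev_one hz, ev_one (H.mem hz)]
  map_zero' := ev_ext fun z hz => by
    rw [ev_mk (H.contDiffOn_comp (contDiffOn_ev _)) hz, ev_zero, ev_zero]
  map_mul' a b := ev_ext fun z hz => by
    rw [ev_mul, ev_mk (H.contDiffOn_comp (contDiffOn_ev _)) hz,
      ev_mk (H.contDiffOn_comp (contDiffOn_ev _)) hz, ev_mk (H.contDiffOn_comp (contDiffOn_ev _)) hz,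
      ev_mul]
  map_add' a b := ev_ext fun z hz => by
    rw [ev_add, ev_mk (H.contDiffOn_comp (contDiffOn_ev _)) hz,
      ev_mk (H.contDiffOn_comp (contDiffOn_ev _)) hz, ev_mk (H.contDiffOn_comp (contDiffOn_ev _)) hz,
      ev_add]

lemma ev_hom (a : P'.K.Ring) {z : ℝ × Vec d} (hz : z ∈ P.K.carrier) :
    ev (H.hom a) z = ev a (z.1, ψ z.2) :=
  ev_mk (H.contDiffOn_comp (contDiffOn_ev a)) hz

lemma fderivWithin_hom (a : P'.K.Ring) {z : ℝ × Vec d} (hz : z ∈ P.K.carrier) (v : ℝ × Vec d) :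
    fderivWithin ℝ (ev (H.hom a)) P.K.carrier z v
      = fderivWithin ℝ (ev a) P'.K.carrier (z.1, ψ z.2) (v.1, fderiv ℝ ψ z.2 v.2) := by
  have h1 : HasFDerivWithinAt (fun w : ℝ × Vec d => (w.1, ψ w.2))
      ((ContinuousLinearMap.fst ℝ ℝ (Vec d)).prod
        ((fderiv ℝ ψ z.2).comp (ContinuousLinearMap.snd ℝ ℝ (Vec d)))) P.K.carrier z :=
    (hasFDerivAt_fst.prodMk ((H.hasFDerivAt hz.2).comp z hasFDerivAt_snd)).hasFDerivWithinAt
  have h2 : HasFDerivWithinAt (fun w : ℝ × Vec d => ev a (w.1, ψ w.2)) _ P.K.carrier z :=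
    ((differentiableWithinAt_ev a (H.mem hz)).hasFDerivWithinAt).comp z h1 fun w hw => H.mem hw
  rw [fderivWithin_congr (fun w hw => H.ev_hom a hw) (H.ev_hom a hz),
    h2.fderivWithin (P.K.uniqueDiffOn z hz)]
  rfl

lemma dirDeriv_r_hom (a : P'.K.Ring) : dirDeriv ((1 : ℝ), (0 : Vec d)) (H.hom a)
    = H.hom (dirDeriv ((1 : ℝ), (0 : Vec d)) a) := by
  refine ev_ext fun z hz => ?_
  rw [H.ev_hom _ hz, ev_dirDeriv _ _ hz, ev_dirDeriv _ _ (H.mem hz), H.fderivWithin_hom a hz, map_zero]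

lemma ev_coord (A : Fin d) {z : ℝ × Vec d} (hz : z ∈ P.K.carrier) : ev (P.coord ψ A) z = ψ z.2 A :=
  ev_mk ((EuclideanSpace.proj (𝕜 := ℝ) A).contDiff.comp_contDiffOn
    (f := fun z : ℝ × Vec d => ψ z.2)
    (H.smooth.comp contDiff_snd.contDiffOn fun z (hz : z ∈ P.K.carrier) => hz.2)) hz

lemma fderivWithin_coord (A : Fin d) {z : ℝ × Vec d} (hz : z ∈ P.K.carrier) (v : ℝ × Vec d) :
    fderivWithin ℝ (ev (P.coord ψ A)) P.K.carrier z v = (fderiv ℝ ψ z.2 v.2) A := by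
  have h2 : HasFDerivWithinAt (fun w : ℝ × Vec d => ψ w.2 A)
      ((EuclideanSpace.proj A).comp
        ((fderiv ℝ ψ z.2).comp (ContinuousLinearMap.snd ℝ ℝ (Vec d)))) P.K.carrier z :=
    ((EuclideanSpace.proj (𝕜 := ℝ) A).hasFDerivAt.comp z
      ((H.hasFDerivAt hz.2).comp z hasFDerivAt_snd)).hasFDerivWithinAt
  rw [fderivWithin_congr (fun w hw => H.ev_coord A hw) (H.ev_coord A hz),
    h2.fderivWithin (P.K.uniqueDiffOn z hz)]
  rfl

lemma ev_ringJac (A B : Fin d) {z : ℝ × Vec d} (hz : z ∈ P.K.carrier) :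
    ev (P.ringJac ψ A B) z = jac ψ z.2 A B := by
  rw [Patch.ringJac, Matrix.of_apply, ev_dirDeriv _ _ hz, H.fderivWithin_coord A hz]
  rfl

lemma dirDeriv_r_ringJac (A B : Fin d) : dirDeriv ((1 : ℝ), (0 : Vec d)) (P.ringJac ψ A B) = 0 := by
  have h : dirDeriv ((1 : ℝ), (0 : Vec d)) (P.coord ψ A) = 0 := by
    refine ev_ext fun z hz => ?_
    rw [ev_dirDeriv _ _ hz, H.fderivWithin_coord A hz, ev_zero, map_zero]
    rfl
  rw [Patch.ringJac, Matrix.of_apply, dirDeriv_comm, h, map_zero]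

lemma dirDeriv_x_hom (a : P'.K.Ring) (B : Fin d) :
    dirDeriv ((0 : ℝ), (EuclideanSpace.single B (1 : ℝ) : Vec d)) (H.hom a)
      = ∑ A, P.ringJac ψ A B *
        H.hom (dirDeriv ((0 : ℝ), (EuclideanSpace.single A (1 : ℝ) : Vec d)) a) := by
  refine ev_ext fun z hz => ?_
  rw [ev_dirDeriv _ _ hz, H.fderivWithin_hom a hz, ev_sum _ _ hz]
  simp only [ev_mul, H.ev_ringJac _ _ hz, H.ev_hom _ hz, ev_dirDeriv _ _ (H.mem hz)]
  have e : (((0 : ℝ), fderiv ℝ ψ z.2 (EuclideanSpace.single B (1 : ℝ) : Vec d)) : ℝ × Vec d)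
      = ∑ A, jac ψ z.2 A B • ((0 : ℝ), (EuclideanSpace.single A (1 : ℝ) : Vec d)) := by
    refine Prod.ext (by simp [Prod.fst_sum]) ?_
    rw [Prod.snd_sum]
    ext C
    simp [jac, Pi.single_apply]
  rw [e, map_sum]
  exact Finset.sum_congr rfl fun A _ => by rw [map_smul, smul_eq_mul]

/-- The chain rule for the formal derivations, in the shape required by
`IsLeviCivita.ricciOf_pullback`; `u` and `r` are unaffected by the change of coordinates. -/
lemma frame_map (i : Idx d) (a : P'.K.Ring⟦X⟧) :
    P.frame i (PowerSeries.map H.hom a)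
      = ∑ b, spaceJac ((P.ringJac ψ).map (C (R := P.K.Ring))) b i
        * PowerSeries.map H.hom (P'.frame b a) := by
  rw [sum_idx]
  revert i
  rw [forall_idx]
  refine ⟨?_, ?_, fun A => ?_⟩ <;> simp only [spaceJac, Matrix.fromBlocks_apply₁₁,
    Matrix.fromBlocks_apply₂₁, Matrix.fromBlocks_apply₁₂, Matrix.fromBlocks_apply₂₂,
    Matrix.one_apply, Matrix.zero_apply, zero_mul, Finset.sum_const_zero, add_zero, Fin.isValue,
    zero_ne_one, one_ne_zero, if_true, if_false, zero_add, one_mul]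
  · ext n
    rw [P.frame_u, P'.frame_u, coeff_dX, coeff_map, coeff_map, coeff_dX, map_mul, map_add,
      map_natCast, map_one]
  · ext1 n
    rw [P.frame_r, P'.frame_r, coeff_mapDer, coeff_map, coeff_map, coeff_mapDer, H.dirDeriv_r_hom]
  · ext1 n
    rw [P.frame_x, coeff_mapDer, coeff_map, H.dirDeriv_x_hom, map_sum]
    exact Finset.sum_congr rfl fun B _ => by
      rw [P'.frame_x, Matrix.map_apply, coeff_C_mul, coeff_map, coeff_mapDer]

/-- Symmetry of the second derivatives of `ψ`, the integrability condition which keeps the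
transformed connection torsion-free. -/
lemma frame_spaceJac (i j a : Idx d) :
    P.frame j (spaceJac ((P.ringJac ψ).map (C (R := P.K.Ring))) a i)
      = P.frame i (spaceJac ((P.ringJac ψ).map (C (R := P.K.Ring))) a j) := by
  have c0 : ∀ i (k l : Fin 2), P.frame i ((1 : Matrix (Fin 2) (Fin 2) P.K.Ring⟦X⟧) k l) = 0 := by
    intro i k l
    rw [Matrix.one_apply]
    split_ifs <;> simp
  have cu : ∀ a : P.K.Ring, P.frame iu (C a) = 0 := fun a => by
    ext1 n
    rw [P.frame_u, coeff_dX, coeff_C, if_neg (Nat.succ_ne_zero n), zero_mul, map_zero]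
  have cr : ∀ A B, P.frame ir (C (P.ringJac ψ A B)) = 0 := fun A B => by
    ext1 n
    rw [P.frame_r, coeff_mapDer, coeff_C, map_zero]
    split_ifs
    · exact H.dirDeriv_r_ringJac A B
    · exact map_zero _
  have cx : ∀ A B D, P.frame (ix D) (C (P.ringJac ψ A B)) = P.frame (ix B) (C (P.ringJac ψ A D)) := by
    intro A B D
    ext1 n
    rw [P.frame_x, P.frame_x, coeff_mapDer, coeff_mapDer, coeff_C, coeff_C]
    split_ifs
    · exact dirDeriv_comm _ _ _
    · rw [map_zero, map_zero]
  rcases a with a | A <;> rcases i with i | B <;> rcases j with j | D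
  all_goals simp only [spaceJac, Matrix.fromBlocks_apply₁₁,
    Matrix.fromBlocks_apply₂₁, Matrix.fromBlocks_apply₁₂, Matrix.fromBlocks_apply₂₂,
    Matrix.zero_apply, Matrix.map_apply, c0, map_zero]
  · fin_cases i
    · exact (cu _).symm
    · exact (cr _ _).symm
  · fin_cases j
    · exact cu _
    · exact cr _ _
  · exact cx _ _ _

lemma ser_eq {κ : Type*} (s : Finset κ) {t : κ → P.K.Ring} {f : ℕ → ℝ × Vec d → ℝ}
    {f' : κ → ℕ → ℝ × Vec d → ℝ} (hf : ∀ j, ContDiffOn ℝ ∞ (f j) P.K.carrier)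
    (hf' : ∀ k j, ContDiffOn ℝ ∞ (f' k j) P'.K.carrier)
    (h : ∀ j, ∀ z ∈ P.K.carrier, f j z = ∑ k ∈ s, ev (t k) z * f' k j (z.1, ψ z.2)) :
    P.ser f = ∑ k ∈ s, C (t k) * PowerSeries.map H.hom (P'.ser (f' k)) := by
  ext1 j
  refine ev_ext fun z hz => ?_
  rw [Patch.ev_coeff_ser (hf j) hz, map_sum, ev_sum _ _ hz, h j z hz, Finset.mul_sum]
  refine Finset.sum_congr rfl fun k _ => ?_
  rw [coeff_C_mul, coeff_map, ev_mul, H.ev_hom _ hz, Patch.ev_coeff_ser (hf' k j) (H.mem hz)]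
  ring

end Patch.Map

namespace CoordJet

variable {P P' : Patch d} {ψ : Vec d → Vec d} {J J' : CoordJet d}

variable (P ψ) in
/-- The components `J` are those of `J'` in other coordinates. -/
structure IsPullback (J J' : CoordJet d) : Prop where
  g : ∀ j, ∀ z ∈ P.K.carrier,
    J.g j z.1 z.2 = (jac ψ z.2)ᵀ * J'.g j z.1 (ψ z.2) * jac ψ z.2
  α : ∀ j, ∀ z ∈ P.K.carrier, J.α j z.1 z.2 = J'.α j z.1 (ψ z.2)
  β : ∀ j, ∀ z ∈ P.K.carrier, ∀ A, J.β j z.1 z.2 A = ∑ B, jac ψ z.2 B A * J'.β j z.1 (ψ z.2) B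

variable (H : P.Map P' ψ) (hJ : J.IsSmooth P) (hJ' : J'.IsSmooth P') (h : IsPullback P ψ J J')
include h

lemma IsPullback.det_ne {z : ℝ × Vec d} (hz : z ∈ P.K.carrier) (hd : (J.g 0 z.1 z.2).det ≠ 0) :
    (jac ψ z.2).det ≠ 0 := by
  intro h0
  rw [h.g 0 z hz, Matrix.det_mul, h0, mul_zero] at hd
  exact hd rfl

/-- The Isenberg–Moncrief form is preserved: `α` is a scalar, `β` a covector and `g_{AB}` a tensor
on the cross-section, at every order in `u`. -/
lemma IsPullback.formal_g : hJ.formal.g = (spaceJac ((P.ringJac ψ).map (C (R := P.K.Ring))))ᵀ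
    * hJ'.formal.g.map (PowerSeries.map H.hom) * spaceJac ((P.ringJac ψ).map (C (R := P.K.Ring))) := by
  have e1 : hJ.formal.φ = PowerSeries.map H.hom hJ'.formal.φ := by
    rw [hJ.formal_φ, hJ'.formal_φ, map_mul, map_X, H.ser_eq {()} (t := fun _ => 1)
      (f' := fun _ j z => J'.α j z.1 z.2) hJ.smooth_α (fun _ => hJ'.smooth_α) fun j z hz => by
        rw [Finset.sum_singleton, ev_one hz, one_mul, h.α j z hz]]
    rw [Finset.sum_singleton, map_one, one_mul]
  have e2 : ∀ A, hJ.formal.b A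
      = ∑ B, C (P.ringJac ψ B A) * PowerSeries.map H.hom (hJ'.formal.b B) := by
    intro A
    rw [hJ.formal_b, H.ser_eq Finset.univ (t := fun B => P.ringJac ψ B A)
      (f' := fun B j z => J'.β j z.1 z.2 B) (fun j => hJ.smooth_β j A)
      (fun B j => hJ'.smooth_β j B) fun j z hz => by
        rw [h.β j z hz]
        exact Finset.sum_congr rfl fun B _ => by rw [H.ev_ringJac _ _ hz], Finset.mul_sum]
    refine Finset.sum_congr rfl fun B _ => ?_
    rw [hJ'.formal_b, map_mul, map_X]
    ring
  have e3 : ∀ A B, hJ.formal.h A B = ∑ D, ∑ E, C (P.ringJac ψ D A)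
      * PowerSeries.map H.hom (hJ'.formal.h D E) * C (P.ringJac ψ E B) := by
    intro A B
    rw [hJ.formal_h, H.ser_eq (Finset.univ ×ˢ Finset.univ)
      (t := fun k : Fin d × Fin d => P.ringJac ψ k.1 A * P.ringJac ψ k.2 B)
      (f' := fun k j z => J'.g j z.1 z.2 k.1 k.2) (fun j => hJ.smooth_g j A B)
      (fun k j => hJ'.smooth_g j k.1 k.2) fun j z hz => by
        rw [h.g j z hz, Finset.sum_product, Matrix.mul_apply, Finset.sum_comm]
        refine Finset.sum_congr rfl fun E _ => ?_
        rw [Matrix.mul_apply, Finset.sum_mul]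
        refine Finset.sum_congr rfl fun D _ => ?_
        rw [ev_mul, H.ev_ringJac _ _ hz, H.ev_ringJac _ _ hz, Matrix.transpose_apply]
        ring, Finset.sum_product]
    refine Finset.sum_congr rfl fun D _ => Finset.sum_congr rfl fun E _ => ?_
    rw [hJ'.formal_h, map_mul]
    ring
  have e2' : (Matrix.of ![fun _ => 0, hJ.formal.b] : Matrix (Fin 2) (Fin d) _)
      = (Matrix.of ![fun _ => 0, hJ'.formal.b]).map (PowerSeries.map H.hom)
        * (P.ringJac ψ).map (C (R := P.K.Ring)) := by
    ext1 i A
    rw [Matrix.mul_apply]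
    fin_cases i
    · simp
    · simp [e2, mul_comm]
  have e3' : hJ.formal.h = ((P.ringJac ψ).map (C (R := P.K.Ring)))ᵀ
      * hJ'.formal.h.map (PowerSeries.map H.hom) * (P.ringJac ψ).map (C (R := P.K.Ring)) := by
    ext1 A B
    rw [e3, Matrix.mul_apply, Finset.sum_comm]
    refine Finset.sum_congr rfl fun E _ => ?_
    rw [Matrix.mul_apply, Finset.sum_mul]
    rfl
  rw [FormalMetric.g, FormalMetric.g, imMetric, imMetric, Matrix.fromBlocks_map, spaceJac,
    Matrix.fromBlocks_transpose, Matrix.fromBlocks_multiply, Matrix.fromBlocks_multiply]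
  simp only [Matrix.transpose_one, Matrix.transpose_zero, Matrix.one_mul, Matrix.zero_mul,
    Matrix.mul_one, Matrix.mul_zero, add_zero, zero_add]
  rw [Matrix.fromBlocks_inj]
  refine ⟨?_, e2', ?_, e3'⟩
  · ext1 i j
    fin_cases i <;> fin_cases j <;> simp [e1]
    exact congrArg (· * _) (map_ofNat (PowerSeries.map H.hom) 2).symm
  · rw [e2', Matrix.transpose_mul, Matrix.transpose_map]

include H hJ hJ' in
/-- The Einstein expressions are covariant under changes of coordinates. -/
theorem IsPullback.einstein (Λ : ℝ) (i : ℕ) {z : ℝ × Vec d} (hz : z ∈ P.K.carrier) :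
    Matrix.of (fun μ ν => J.einstein P.I P.U Λ i μ ν z.1 z.2)
      = (spaceJac (jac ψ z.2))ᵀ
        * Matrix.of (fun μ ν => J'.einstein P'.I P'.U Λ i μ ν z.1 (ψ z.2))
        * spaceJac (jac ψ z.2) := by
  set T := (P.ringJac ψ).map (C (R := P.K.Ring)) with hT
  have hdet : IsUnit (P.ringJac ψ).det := by
    obtain ⟨k, hk⟩ := exists_mul_eq_one (P.ringJac ψ).det fun z hz => by
      rw [← evHom_apply hz, RingHom.map_det]
      convert h.det_ne hz (hJ.det_ne z hz) using 2
      ext A B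
      exact H.ev_ringJac A B hz
    exact IsUnit.of_mul_eq_one_right _ hk
  have hQ : spaceJac (((P.ringJac ψ)⁻¹).map (C (R := P.K.Ring))) * spaceJac T = 1 := by
    rw [spaceJac, spaceJac, Matrix.fromBlocks_multiply, hT, ← Matrix.map_mul,
      Matrix.nonsing_inv_mul _ hdet, Matrix.map_one _ (map_zero _) (map_one _)]
    simp
  have hg := h.formal_g H hJ hJ'
  have hgs : (hJ.formal.g)ᵀ = hJ.formal.g := imMetric_transpose hJ.formal.symm
  have key := IsLeviCivita.ricciOf_pullback P.frame_comm (D' := P'.frame) (PowerSeries.map H.hom)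
    (spaceJac T) _ hQ H.frame_map H.frame_spaceJac hg hgs hJ.formal.gi_mul_g
    hJ.formal.isLeviCivita hJ'.formal.isLeviCivita
  have hE : Matrix.of (hJ.ein Λ) = (spaceJac T)ᵀ
      * (Matrix.of (hJ'.ein Λ)).map (PowerSeries.map H.hom) * spaceJac T := by
    have e1 : Matrix.of (hJ.ein Λ) = Matrix.of (hJ.formal.ric)
        - algebraMap ℝ P.K.Ring⟦X⟧ (2 * Λ / d) • hJ.formal.g := rfl
    have e2 : (Matrix.of (hJ'.ein Λ)).map (PowerSeries.map H.hom)
        = (Matrix.of (hJ'.formal.ric)).map (PowerSeries.map H.hom)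
          - algebraMap ℝ P.K.Ring⟦X⟧ (2 * Λ / d) • hJ'.formal.g.map (PowerSeries.map H.hom) := by
      ext1 a b
      have e3 : PowerSeries.map H.hom (algebraMap ℝ P'.K.Ring⟦X⟧ (2 * Λ / d))
          = algebraMap ℝ P.K.Ring⟦X⟧ (2 * Λ / d) := by
        rw [PowerSeries.algebraMap_apply, PowerSeries.algebraMap_apply, map_C]
        congr 1
        refine ev_ext fun z hz => ?_
        rw [H.ev_hom _ hz, ev_algebraMap _ hz, ev_algebraMap _ (H.mem hz)]
      simp only [Matrix.map_apply, Matrix.of_apply, Matrix.sub_apply, Matrix.smul_apply, smul_eq_mul,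
        IsSmooth.ein, map_sub, map_mul, e3]
    rw [e1, e2, Matrix.mul_sub, Matrix.sub_mul, Matrix.mul_smul, Matrix.smul_mul, ← hg]
    congr 1
  have hc : spaceJac T = (spaceJac (P.ringJac ψ)).map (C (R := P.K.Ring)) := by
    rw [spaceJac, spaceJac, Matrix.fromBlocks_map, Matrix.map_one _ (map_zero _) (map_one _),
      Matrix.map_zero _ (map_zero _), Matrix.map_zero _ (map_zero _)]
  have hev : ∀ a b, ev (spaceJac (P.ringJac ψ) a b) z = spaceJac (jac ψ z.2) a b := by
    intro a b
    rcases a with a | A <;> rcases b with b | B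
    · simp only [spaceJac, Matrix.fromBlocks_apply₁₁, Matrix.one_apply]
      split_ifs
      · exact ev_one hz
      · exact ev_zero z
    · exact ev_zero z
    · exact ev_zero z
    · exact H.ev_ringJac A B hz
  ext1 μ ν
  have h1 := congrArg (fun M => ev (coeff i (M μ ν)) z) hE
  simp only [hc, Matrix.mul_apply, Matrix.transpose_apply, Matrix.map_apply, Matrix.of_apply,
    map_sum, coeff_mul_C, coeff_C_mul, Finset.sum_mul, ev_sum _ _ hz, ev_mul, hev, coeff_map,
    H.ev_hom _ hz] at h1
  rw [Matrix.of_apply, hJ.einstein_eq Λ i μ ν hz, h1, Finset.mul_sum, Matrix.mul_apply]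
  refine Finset.sum_congr rfl fun b _ => ?_
  rw [Matrix.mul_apply, Finset.sum_mul, Finset.mul_sum]
  refine Finset.sum_congr rfl fun a _ => ?_
  have h2 := hJ'.einstein_eq Λ i a b (H.mem hz)
  simp only at h2
  rw [Matrix.transpose_apply, Matrix.of_apply, h2]
  ring

-- The Jacobian is the identity in the `(u, r)` block, so components with both indices there
-- transform as scalars.
include H hJ hJ' in
lemma IsPullback.einstein_inl (Λ : ℝ) (i : ℕ) {z : ℝ × Vec d} (hz : z ∈ P.K.carrier)
    (k l : Fin 2) : J.einstein P.I P.U Λ i (Sum.inl k) (Sum.inl l) z.1 z.2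
      = J'.einstein P'.I P'.U Λ i (Sum.inl k) (Sum.inl l) z.1 (ψ z.2) := by
  have h1 := congrFun (congrFun (h.einstein H hJ hJ' Λ i hz) (Sum.inl k)) (Sum.inl l)
  simpa [Matrix.mul_apply, spaceJac, Matrix.one_apply] using h1

include H hJ hJ' in
lemma IsPullback.einstein_inl_x (Λ : ℝ) (i : ℕ) {z : ℝ × Vec d} (hz : z ∈ P.K.carrier)
    (k : Fin 2) (A : Fin d) : J.einstein P.I P.U Λ i (Sum.inl k) (ix A) z.1 z.2
      = ∑ B, J'.einstein P'.I P'.U Λ i (Sum.inl k) (ix B) z.1 (ψ z.2) * jac ψ z.2 B A := by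
  have h1 := congrFun (congrFun (h.einstein H hJ hJ' Λ i hz) (Sum.inl k)) (ix A)
  simpa [Matrix.mul_apply, spaceJac, Matrix.one_apply] using h1

include H hJ hJ' in
lemma IsPullback.einstein_xx (Λ : ℝ) (i : ℕ) {z : ℝ × Vec d} (hz : z ∈ P.K.carrier)
    (A B : Fin d) : J.einstein P.I P.U Λ i (ix A) (ix B) z.1 z.2
      = ∑ D, (∑ E, jac ψ z.2 E A * J'.einstein P'.I P'.U Λ i (ix E) (ix D) z.1 (ψ z.2))
        * jac ψ z.2 D B := by
  have h1 := congrFun (congrFun (h.einstein H hJ hJ' Λ i hz) (ix A)) (ix B)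
  simpa [Matrix.mul_apply, spaceJac, Matrix.one_apply] using h1

include H hJ hJ' in
lemma IsPullback.solves {Λ : ℝ} {n : ℕ} (hs : Solves P' Λ n J') : Solves P Λ n J where
  rx z hz A := by
    rw [h.einstein_inl_x H hJ hJ' Λ 0 hz]
    exact Finset.sum_eq_zero fun B _ => by rw [hs.rx (z.1, ψ z.2) (H.mem hz), zero_mul]
  xx i hi z hz A B := by
    rw [h.einstein_xx H hJ hJ' Λ i hz]
    refine Finset.sum_eq_zero fun D _ => ?_
    rw [Finset.sum_eq_zero fun E _ => by rw [hs.xx i hi (z.1, ψ z.2) (H.mem hz), mul_zero], zero_mul]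
  ur i hi z hz := by
    rw [h.einstein_inl H hJ hJ' Λ i hz, hs.ur i hi (z.1, ψ z.2) (H.mem hz)]
  ux i hi z hz A := by
    rw [h.einstein_inl_x H hJ hJ' Λ i hz]
    exact Finset.sum_eq_zero fun B _ => by rw [hs.ux i hi (z.1, ψ z.2) (H.mem hz), zero_mul]

end CoordJet

/-! ### Components in different charts -/

section Charts

open Set

variable {d : ℕ} {S : Type*} [TopologicalSpace S] [ChartedSpace (Vec d) S]

/-- The coordinate change between two charts. -/
def chartChange (e e' : OpenPartialHomeomorph S (Vec d)) (y : Vec d) : Vec d := e' (e.symm y)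

/-- The domain of a coordinate change. -/
def overlap (e e' : OpenPartialHomeomorph S (Vec d)) : Set (Vec d) := e.target ∩ e.symm ⁻¹' e'.source

lemma isOpen_overlap (e e' : OpenPartialHomeomorph S (Vec d)) : IsOpen (overlap e e') :=
  e.symm.isOpen_inter_preimage e'.open_source

lemma chartChange_mem {e e' : OpenPartialHomeomorph S (Vec d)} {y : Vec d} (hy : y ∈ overlap e e') :
    chartChange e e' y ∈ e'.target := e'.map_source hy.2

lemma symm_chartChange {e e' : OpenPartialHomeomorph S (Vec d)} {y : Vec d} (hy : y ∈ overlap e e') :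
    e'.symm (chartChange e e' y) = e.symm y := e'.left_inv hy.2

lemma chartChange_mem_overlap {e e' : OpenPartialHomeomorph S (Vec d)} {y : Vec d}
    (hy : y ∈ overlap e e') : chartChange e e' y ∈ overlap e' e :=
  ⟨chartChange_mem hy, by
    rw [mem_preimage, symm_chartChange hy]
    exact e.map_target hy.1⟩

lemma mem_overlap_chartAt {e : OpenPartialHomeomorph S (Vec d)} {y : Vec d} (hy : y ∈ e.target) :
    y ∈ overlap e (chartAt (Vec d) (e.symm y)) := ⟨hy, mem_chart_source (Vec d) (e.symm y)⟩

variable [IsManifold 𝓘(ℝ, Vec d) ∞ S]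

lemma contDiffOn_chartChange {e e' : OpenPartialHomeomorph S (Vec d)} (he : e ∈ atlas (Vec d) S)
    (he' : e' ∈ atlas (Vec d) S) : ContDiffOn ℝ ∞ (chartChange e e') (overlap e e') := by
  have h := (contDiffGroupoid ∞ 𝓘(ℝ, Vec d)).compatible he he'
  rw [contDiffGroupoid, mem_groupoid_of_pregroupoid] at h
  have h1 := h.1
  simp only [contDiffPregroupoid, modelWithCornersSelf_coe, modelWithCornersSelf_coe_symm,
    Function.comp_id, Function.id_comp, preimage_id, range_id, inter_univ] at h1
  exact h1

lemma hasFDerivAt_chartChange {e e' : OpenPartialHomeomorph S (Vec d)} (he : e ∈ atlas (Vec d) S)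
    (he' : e' ∈ atlas (Vec d) S) {y : Vec d} (hy : y ∈ overlap e e') :
    HasFDerivAt (chartChange e e') (fderiv ℝ (chartChange e e') y) y :=
  (((contDiffOn_chartChange he he').contDiffAt ((isOpen_overlap e e').mem_nhds hy)).differentiableAt
    (by simp)).hasFDerivAt

/-- The tangent space at `x` is modelled on `Vec d` through the preferred chart at `x`. Coordinate
vectors of `e` are therefore columns of the Jacobian of the change from `e` to that chart. -/
lemma coordVec_eq {e : OpenPartialHomeomorph S (Vec d)} (he : e ∈ atlas (Vec d) S) {y : Vec d}
    (hy : y ∈ e.target) (A : Fin d) : (coordVec e y A : Vec d)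
      = fderiv ℝ (chartChange e (chartAt (Vec d) (e.symm y))) y
        (EuclideanSpace.single A (1 : ℝ) : Vec d) := by
  have : IsManifold 𝓘(ℝ, Vec d) 1 S := IsManifold.of_le (n := ∞) (by simp)
  have h : MDifferentiableAt 𝓘(ℝ, Vec d) 𝓘(ℝ, Vec d) e.symm y := mdifferentiableAt_atlas_symm he hy
  have h2 := congrArg (fun L : Vec d →L[ℝ] Vec d => L (EuclideanSpace.single A (1 : ℝ) : Vec d))
    h.mfderiv
  simp only [modelWithCornersSelf_coe, range_id, fderivWithin_univ] at h2
  exact h2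

/-- Change of coordinates for the coordinate vectors. -/
lemma coordVec_change {e e' : OpenPartialHomeomorph S (Vec d)} (he : e ∈ atlas (Vec d) S)
    (he' : e' ∈ atlas (Vec d) S) {y : Vec d} (hy : y ∈ overlap e e') (A : Fin d) :
    (coordVec e y A : Vec d) = ∑ B, jac (chartChange e e') y B A •
      (coordVec e' (chartChange e e' y) B : Vec d) := by
  set c := chartAt (Vec d) (e.symm y) with hc
  have hcm : c ∈ atlas (Vec d) S := chart_mem_atlas _ _
  have hy' := chartChange_mem hy
  have hs := symm_chartChange hy
  have h1 : ∀ B, (coordVec e' (chartChange e e' y) B : Vec d)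
      = fderiv ℝ (chartChange e' c) (chartChange e e' y) (EuclideanSpace.single B (1 : ℝ) : Vec d) := by
    intro B
    rw [coordVec_eq he' hy', hs]
  have hy2 : chartChange e e' y ∈ overlap e' c := by
    refine ⟨hy', ?_⟩
    rw [mem_preimage, hs]
    exact mem_chart_source _ _
  have h2 := (hasFDerivAt_chartChange he' hcm hy2).comp y (hasFDerivAt_chartChange he he' hy)
  have h3 : chartChange e' c ∘ chartChange e e' =ᶠ[nhds y] chartChange e c := by
    filter_upwards [(isOpen_overlap e e').mem_nhds hy] with w hw
    simp only [Function.comp, chartChange]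
    rw [e'.left_inv hw.2]
  have h4 := (h2.congr_of_eventuallyEq h3.symm).fderiv
  rw [coordVec_eq he hy.1, ← hc, h4]
  simp only [h1]
  have e1 : fderiv ℝ (chartChange e e') y (EuclideanSpace.single A (1 : ℝ) : Vec d)
      = ∑ B, jac (chartChange e e') y B A • (EuclideanSpace.single B (1 : ℝ) : Vec d) := by
    ext C
    simp [jac, Pi.single_apply]
  rw [ContinuousLinearMap.comp_apply, e1, map_sum]
  exact Finset.sum_congr rfl fun B _ => map_smul _ _ _

/-- In the preferred chart the coordinate vectors are the standard basis. -/
lemma coordVec_chartAt (x : S) (A : Fin d) :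
    (coordVec (chartAt (Vec d) x) (chartAt (Vec d) x x) A : Vec d)
      = (EuclideanSpace.single A (1 : ℝ) : Vec d) := by
  set c := chartAt (Vec d) x with hc
  have hx : x ∈ c.source := mem_chart_source _ _
  rw [coordVec_eq (chart_mem_atlas _ _) (c.map_source hx), c.left_inv hx, ← hc]
  have h : chartChange c c =ᶠ[nhds (c x)] id := by
    filter_upwards [c.open_target.mem_nhds (c.map_source hx)] with w hw
    exact c.right_inv hw
  rw [h.fderiv_eq, fderiv_id]
  rfl

lemma jac_chartChange_mul {e e' : OpenPartialHomeomorph S (Vec d)} (he : e ∈ atlas (Vec d) S)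
    (he' : e' ∈ atlas (Vec d) S) {y : Vec d} (hy : y ∈ overlap e e') :
    jac (chartChange e' e) (chartChange e e' y) * jac (chartChange e e') y = 1 := by
  have h2 := (hasFDerivAt_chartChange he' he (chartChange_mem_overlap hy)).comp y
    (hasFDerivAt_chartChange he he' hy)
  have h3 : chartChange e' e ∘ chartChange e e' =ᶠ[nhds y] id := by
    filter_upwards [(isOpen_overlap e e').mem_nhds hy] with w hw
    simp only [Function.comp, chartChange]
    rw [e'.left_inv hw.2, e.right_inv hw.1]
    rfl
  have h4 := (h2.congr_of_eventuallyEq h3.symm).unique (hasFDerivAt_id y)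
  ext A B
  have h5 := congrArg (fun L : Vec d →L[ℝ] Vec d => (L (EuclideanSpace.single B (1 : ℝ) : Vec d)) A) h4
  have e1 : fderiv ℝ (chartChange e e') y (EuclideanSpace.single B (1 : ℝ) : Vec d)
      = ∑ C, jac (chartChange e e') y C B • (EuclideanSpace.single C (1 : ℝ) : Vec d) := by
    ext C
    simp [jac, Pi.single_apply]
  simp only [ContinuousLinearMap.comp_apply, e1, map_sum, map_smul] at h5
  rw [Matrix.mul_apply, Matrix.one_apply]
  simp only [ContinuousLinearMap.id_apply, PiLp.single_apply] at h5
  rw [← h5]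
  simp [jac, mul_comm]

-- All tangent spaces are definitionally `Vec d`, so the same vectors can be inserted at
-- propositionally equal base points.
omit [IsManifold 𝓘(ℝ, Vec d) ∞ S] in
lemma bilin_congr (f : (x : S) → Bilin d x) {x x' : S} (h : x = x') (v w : Vec d) :
    f x v w = f x' v w := by
  subst h
  rfl

omit [IsManifold 𝓘(ℝ, Vec d) ∞ S] in
lemma covec_congr (f : (x : S) → Covec d x) {x x' : S} (h : x = x') (v : Vec d) :
    f x v = f x' v := by
  subst h
  rfl

lemma bilin_sum (L : Vec d →L[ℝ] Vec d →L[ℝ] ℝ) (T : Matrix (Fin d) (Fin d) ℝ) (v : Fin d → Vec d)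
    (A B : Fin d) : L (∑ C, T C A • v C) (∑ D, T D B • v D)
      = (Tᵀ * Matrix.of (fun C D => L (v C) (v D)) * T) A B := by
  simp only [map_sum, map_smul, ContinuousLinearMap.sum_apply, ContinuousLinearMap.smul_apply,
    Matrix.mul_apply, Matrix.transpose_apply, Matrix.of_apply, Finset.sum_mul, smul_eq_mul]
  refine Finset.sum_congr rfl fun D _ => ?_
  rw [Finset.mul_sum]
  exact Finset.sum_congr rfl fun C _ => by ring

/-- The components of a bilinear form in a chart. -/
def bilinComp (e : OpenPartialHomeomorph S (Vec d)) (f : (x : S) → Bilin d x) (y : Vec d) :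
    Matrix (Fin d) (Fin d) ℝ :=
  Matrix.of fun A B => f (e.symm y) (coordVec e y A) (coordVec e y B)

/-- The components of a covector in a chart. -/
def covecComp (e : OpenPartialHomeomorph S (Vec d)) (f : (x : S) → Covec d x) (y : Vec d)
    (A : Fin d) : ℝ := f (e.symm y) (coordVec e y A)

lemma bilinComp_change {e e' : OpenPartialHomeomorph S (Vec d)} (he : e ∈ atlas (Vec d) S)
    (he' : e' ∈ atlas (Vec d) S) (f : (x : S) → Bilin d x) {y : Vec d} (hy : y ∈ overlap e e') :
    bilinComp e f y = (jac (chartChange e e') y)ᵀ * bilinComp e' f (chartChange e e' y)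
      * jac (chartChange e e') y := by
  ext A B
  have h2 : bilinComp e f y A B
      = f (e'.symm (chartChange e e' y)) (coordVec e y A : Vec d) (coordVec e y B : Vec d) :=
    (bilin_congr f (symm_chartChange hy) _ _).symm
  rw [h2, coordVec_change he he' hy A, coordVec_change he he' hy B]
  exact bilin_sum (f (e'.symm (chartChange e e' y))) _ _ A B

lemma covecComp_change {e e' : OpenPartialHomeomorph S (Vec d)} (he : e ∈ atlas (Vec d) S)
    (he' : e' ∈ atlas (Vec d) S) (f : (x : S) → Covec d x) {y : Vec d} (hy : y ∈ overlap e e')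
    (A : Fin d) : covecComp e f y A
      = ∑ B, jac (chartChange e e') y B A * covecComp e' f (chartChange e e' y) B := by
  have h2 : covecComp e f y A = f (e'.symm (chartChange e e' y)) (coordVec e y A : Vec d) :=
    (covec_congr f (symm_chartChange hy) _).symm
  rw [h2, coordVec_change he he' hy A]
  refine (map_sum (show Vec d →L[ℝ] ℝ from f (e'.symm (chartChange e e' y))) _ _).trans ?_
  exact Finset.sum_congr rfl fun B _ =>
    map_smul (show Vec d →L[ℝ] ℝ from f (e'.symm (chartChange e e' y))) _ _

/-- The bilinear form with given components in the standard basis. -/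
def bilinOf (M : Matrix (Fin d) (Fin d) ℝ) : Vec d →L[ℝ] Vec d →L[ℝ] ℝ :=
  ∑ A, ∑ B, M A B • (EuclideanSpace.proj (𝕜 := ℝ) A : Vec d →L[ℝ] ℝ).smulRight
    (EuclideanSpace.proj (𝕜 := ℝ) B : Vec d →L[ℝ] ℝ)

omit [IsManifold 𝓘(ℝ, Vec d) ∞ S] in
lemma bilinOf_apply (M : Matrix (Fin d) (Fin d) ℝ) (v w : Vec d) :
    bilinOf M v w = ∑ A, ∑ B, M A B * (v A * w B) := by
  simp [bilinOf, ContinuousLinearMap.sum_apply]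

/-- The covector with given components in the standard basis. -/
def covecOf (b : Fin d → ℝ) : Vec d →L[ℝ] ℝ :=
  ∑ A, b A • (EuclideanSpace.proj (𝕜 := ℝ) A : Vec d →L[ℝ] ℝ)

omit [IsManifold 𝓘(ℝ, Vec d) ∞ S] in
lemma covecOf_apply (b : Fin d → ℝ) (v : Vec d) : covecOf b v = ∑ A, b A * v A := by
  simp [covecOf, ContinuousLinearMap.sum_apply]

lemma vec_eq_sum (v : Vec d) : v = ∑ A, v A • (EuclideanSpace.single A (1 : ℝ) : Vec d) := by
  ext C
  simp [Pi.single_apply]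

lemma bilin_ext {L L' : Vec d →L[ℝ] Vec d →L[ℝ] ℝ}
    (h : ∀ A B, L (EuclideanSpace.single A (1 : ℝ)) (EuclideanSpace.single B (1 : ℝ))
      = L' (EuclideanSpace.single A (1 : ℝ)) (EuclideanSpace.single B (1 : ℝ))) : L = L' := by
  ext v w
  rw [vec_eq_sum v, vec_eq_sum w]
  simp only [map_sum, map_smul, ContinuousLinearMap.sum_apply, ContinuousLinearMap.smul_apply, h]

lemma covec_ext {L L' : Vec d →L[ℝ] ℝ}
    (h : ∀ A, L (EuclideanSpace.single A (1 : ℝ)) = L' (EuclideanSpace.single A (1 : ℝ))) :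
    L = L' := by
  ext v
  rw [vec_eq_sum v]
  simp only [map_sum, map_smul, h]

/-- Components in the preferred chart, at the point itself, are those in the standard basis. -/
lemma bilinComp_chartAt (f : (x : S) → Bilin d x) (x : S) :
    bilinComp (chartAt (Vec d) x) f (chartAt (Vec d) x x) = gram (f x) := by
  ext A B
  have h : bilinComp (chartAt (Vec d) x) f (chartAt (Vec d) x x) A B
      = f x (coordVec (chartAt (Vec d) x) (chartAt (Vec d) x x) A : Vec d)
        (coordVec (chartAt (Vec d) x) (chartAt (Vec d) x x) B : Vec d) :=
    bilin_congr f ((chartAt (Vec d) x).left_inv (mem_chart_source _ _)) _ _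
  rw [h, coordVec_chartAt, coordVec_chartAt]
  rfl

lemma covecComp_chartAt (f : (x : S) → Covec d x) (x : S) (A : Fin d) :
    covecComp (chartAt (Vec d) x) f (chartAt (Vec d) x x) A
      = f x (EuclideanSpace.single A (1 : ℝ) : Vec d) := by
  have h : covecComp (chartAt (Vec d) x) f (chartAt (Vec d) x x) A
      = f x (coordVec (chartAt (Vec d) x) (chartAt (Vec d) x x) A : Vec d) :=
    covec_congr f ((chartAt (Vec d) x).left_inv (mem_chart_source _ _)) _
  rw [h, coordVec_chartAt]

end Charts

/-! ### Fields on the manifold from fields in charts -/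

section Global

open Set

variable {d : ℕ} {S : Type*} [TopologicalSpace S] [ChartedSpace (Vec d) S] {I : Set ℝ}

/-- The part of the null hypersurface covered by a chart. -/
def chartPatch (hI : I.OrdConnected) (hI' : I.Nontrivial) (e : OpenPartialHomeomorph S (Vec d)) :
    Patch d := ⟨I, e.target, hI, hI', e.open_target⟩

/-- The part of the null hypersurface covered by two charts, in the coordinates of the first one. -/
def overlapPatch (hI : I.OrdConnected) (hI' : I.Nontrivial)
    (e e' : OpenPartialHomeomorph S (Vec d)) : Patch d :=
  ⟨I, overlap e e', hI, hI', isOpen_overlap e e'⟩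

lemma CoordJet.IsSmooth.mono {P P' : Patch d} {J : CoordJet d} (hJ : J.IsSmooth P)
    (h : P'.K.carrier ⊆ P.K.carrier) : J.IsSmooth P' where
  smooth_g j A B := (hJ.smooth_g j A B).mono h
  smooth_α j := (hJ.smooth_α j).mono h
  smooth_β j A := (hJ.smooth_β j A).mono h
  symm j z hz := hJ.symm j z (h hz)
  det_ne z hz := hJ.det_ne z (h hz)

lemma jac_id (y : Vec d) : jac id y = 1 := by
  ext A B
  rw [jac, Matrix.of_apply, fderiv_id, Matrix.one_apply]
  simp [Pi.single_apply]

lemma CoordJet.isPullback_id (P : Patch d) (J : CoordJet d) : J.IsPullback P id J where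
  g j z _ := by rw [jac_id]; simp
  α j z _ := rfl
  β j z _ A := by rw [jac_id]; simp [Matrix.one_apply]

/-- The Einstein expression is defined with derivatives within the patch. Restriction to a smaller
patch is treated as pullback by the identity, for which covariance is already available. -/
lemma CoordJet.Solves.mono {P P' : Patch d} {J : CoordJet d} {Λ : ℝ} {n : ℕ}
    (hs : CoordJet.Solves P Λ n J) (hJ : J.IsSmooth P) (hI : P'.I = P.I) (hU : P'.U ⊆ P.U) :
    CoordJet.Solves P' Λ n J := by
  have H : P'.Map P id := ⟨hI, fun y hy => hU hy, contDiffOn_id⟩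
  exact (CoordJet.isPullback_id P' J).solves H (hJ.mono fun z hz => ⟨hI ▸ hz.1, hU hz.2⟩) hJ hs

variable [IsManifold 𝓘(ℝ, Vec d) ∞ S] (hI : I.OrdConnected) (hI' : I.Nontrivial)

include hI hI' in
lemma map_chartChange {e e' : OpenPartialHomeomorph S (Vec d)} (he : e ∈ atlas (Vec d) S)
    (he' : e' ∈ atlas (Vec d) S) :
    (overlapPatch hI hI' e e').Map (chartPatch hI hI' e') (chartChange e e') where
  hI := rfl
  mapsTo _ hy := chartChange_mem hy
  smooth := contDiffOn_chartChange he he'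

lemma bilinComp_eq {e : OpenPartialHomeomorph S (Vec d)} (he : e ∈ atlas (Vec d) S) {y : Vec d}
    (hy : y ∈ e.target) (f : (x : S) → Bilin d x) :
    bilinComp e f y = (jac (chartChange e (chartAt (Vec d) (e.symm y))) y)ᵀ * gram (f (e.symm y))
      * jac (chartChange e (chartAt (Vec d) (e.symm y))) y := by
  rw [bilinComp_change he (chart_mem_atlas _ (e.symm y)) f (mem_overlap_chartAt hy)]
  congr 2
  exact bilinComp_chartAt f (e.symm y)

lemma covecComp_eq {e : OpenPartialHomeomorph S (Vec d)} (he : e ∈ atlas (Vec d) S) {y : Vec d}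
    (hy : y ∈ e.target) (f : (x : S) → Covec d x) (A : Fin d) :
    covecComp e f y A = ∑ B, jac (chartChange e (chartAt (Vec d) (e.symm y))) y B A
      * f (e.symm y) (EuclideanSpace.single B (1 : ℝ) : Vec d) := by
  rw [covecComp_change he (chart_mem_atlas _ (e.symm y)) f (mem_overlap_chartAt hy)]
  exact Finset.sum_congr rfl fun B _ => congrArg _ (covecComp_chartAt f (e.symm y) B)

omit [IsManifold 𝓘(ℝ, Vec d) ∞ S] in
lemma gram_mulVec {x : S} (b : Bilin d x) (v : Fin d → ℝ) :
    v ⬝ᵥ (gram b *ᵥ v) = b (WithLp.toLp 2 v : Vec d) (WithLp.toLp 2 v : Vec d) := by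
  have h := vec_eq_sum (WithLp.toLp 2 v : Vec d)
  have key : ∀ L : Vec d →L[ℝ] Vec d →L[ℝ] ℝ, L (WithLp.toLp 2 v) (WithLp.toLp 2 v)
      = ∑ A, ∑ B, v A * (v B * L (EuclideanSpace.single A (1 : ℝ)) (EuclideanSpace.single B (1 : ℝ))) := by
    intro L
    rw [h]
    simp only [map_sum, map_smul, ContinuousLinearMap.sum_apply, ContinuousLinearMap.smul_apply,
      smul_eq_mul]
    simp only [Finset.mul_sum]
    rw [Finset.sum_comm]
    exact Finset.sum_congr rfl fun A _ => Finset.sum_congr rfl fun B _ => mul_left_comm _ _ _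
  refine Eq.trans ?_ (key b).symm
  simp only [dotProduct, Matrix.mulVec, Finset.mul_sum]
  exact Finset.sum_congr rfl fun A _ => Finset.sum_congr rfl fun B _ => by
    rw [mul_comm (v B)]
    rfl

omit [IsManifold 𝓘(ℝ, Vec d) ∞ S] in
lemma det_gram_ne_zero {x : S} {b : Bilin d x}
    (hb : ∀ v : TangentSpace 𝓘(ℝ, Vec d) x, v ≠ 0 → 0 < b v v) : (gram b).det ≠ 0 := by
  intro h0
  obtain ⟨v, hv, hv0⟩ := Matrix.exists_mulVec_eq_zero_iff.mpr h0
  have h1 := gram_mulVec b v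
  rw [hv0, dotProduct_zero] at h1
  refine (hb (WithLp.toLp 2 v : Vec d) fun h2 => hv ?_).ne h1
  exact (WithLp.toLp_injective 2) h2

lemma det_jac_chartChange {e e' : OpenPartialHomeomorph S (Vec d)} (he : e ∈ atlas (Vec d) S)
    (he' : e' ∈ atlas (Vec d) S) {y : Vec d} (hy : y ∈ overlap e e') :
    (jac (chartChange e e') y).det ≠ 0 := by
  intro h0
  have h := congrArg Matrix.det (jac_chartChange_mul he he' hy)
  rw [Matrix.det_mul, h0, mul_zero, Matrix.det_one] at h
  exact zero_ne_one h

lemma det_bilinComp_ne_zero {e : OpenPartialHomeomorph S (Vec d)} (he : e ∈ atlas (Vec d) S)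
    {y : Vec d} (hy : y ∈ e.target) {f : (x : S) → Bilin d x}
    (hf : ∀ v : TangentSpace 𝓘(ℝ, Vec d) (e.symm y), v ≠ 0 → 0 < f (e.symm y) v v) :
    (bilinComp e f y).det ≠ 0 := by
  have h := det_jac_chartChange he (chart_mem_atlas _ (e.symm y)) (mem_overlap_chartAt hy)
  rw [bilinComp_eq he hy, Matrix.det_mul, Matrix.det_mul, Matrix.det_transpose]
  exact mul_ne_zero (mul_ne_zero h (det_gram_ne_zero hf)) h

/-- The components of smooth fields. -/
lemma IsJet.isSmooth {J : IMJet d S} (hJ : IsJet I J) {e : OpenPartialHomeomorph S (Vec d)}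
    (he : e ∈ atlas (Vec d) S) : (J.inChart e).IsSmooth (chartPatch hI hI' e) where
  smooth_g j A B := hJ.smooth_g j e he A B
  smooth_α j := hJ.smooth_α j e he
  smooth_β j A := hJ.smooth_β j e he A
  symm j z hz A B := hJ.symm j z.1 hz.1 _ _ _
  det_ne z hz := det_bilinComp_ne_zero he hz.2 (f := J.g 0 z.1) fun v => hJ.pos z.1 hz.1 _ v

/-- Components in different charts are related by a change of coordinates. -/
lemma isPullback_inChart (J : IMJet d S) {e e' : OpenPartialHomeomorph S (Vec d)}
    (he : e ∈ atlas (Vec d) S) (he' : e' ∈ atlas (Vec d) S) :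
    (J.inChart e).IsPullback (overlapPatch hI hI' e e') (chartChange e e') (J.inChart e') where
  g j z hz := bilinComp_change he he' (J.g j z.1) hz.2
  α j z hz := by
    change J.α j z.1 (e.symm z.2) = J.α j z.1 (e'.symm (chartChange e e' z.2))
    rw [symm_chartChange hz.2]
  β j z hz A := covecComp_change he he' (J.β j z.1) hz.2 A

lemma contDiffOn_symm_of_contMDiff {σ : S → ℝ} (hσ : ContMDiff 𝓘(ℝ, Vec d) 𝓘(ℝ, ℝ) ∞ σ)
    {e : OpenPartialHomeomorph S (Vec d)} (he : e ∈ atlas (Vec d) S) :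
    ContDiffOn ℝ ∞ (fun y => σ (e.symm y)) e.target := by
  have h1 : ContMDiffOn 𝓘(ℝ, Vec d) 𝓘(ℝ, Vec d) ∞ e.symm e.target :=
    contMDiffOn_symm_of_mem_maximalAtlas (IsManifold.subset_maximalAtlas he)
  exact contMDiffOn_iff_contDiffOn.mp (hσ.comp_contMDiffOn h1)

lemma contDiffOn_of_prod {U : Set (Vec d)} {f : Vec d → ℝ}
    (hf : ContDiffOn ℝ ∞ (fun p : ℝ × Vec d => f p.2) (univ ×ˢ U)) : ContDiffOn ℝ ∞ f U :=
  hf.comp (f := fun y => ((0 : ℝ), y)) (contDiff_const.prodMk contDiff_id).contDiffOn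
    fun y hy => ⟨mem_univ _, hy⟩

variable {Λ : ℝ} {σ : S → ℝ}

/-- Fields in all charts with compatible components. -/
lemma exists_jet_of_compatible {C : OpenPartialHomeomorph S (Vec d) → CoordJet d}
    (hC : ∀ e ∈ atlas (Vec d) S, ∀ e' ∈ atlas (Vec d) S,
      (C e).IsPullback (overlapPatch hI hI' e e') (chartChange e e') (C e')) :
    ∃ J : IMJet d S, ∀ e ∈ atlas (Vec d) S, ∀ j, ∀ z ∈ (chartPatch hI hI' e).K.carrier,
      (J.inChart e).g j z.1 z.2 = (C e).g j z.1 z.2 ∧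
      (J.inChart e).α j z.1 z.2 = (C e).α j z.1 z.2 ∧
      (J.inChart e).β j z.1 z.2 = (C e).β j z.1 z.2 := by
  -- At `x` the field is read off in the preferred chart of `x`, where coordinate vectors are the
  -- standard basis. Compatibility then gives the components in any other chart.
  refine ⟨⟨fun j r x => bilinOf ((C (chartAt (Vec d) x)).g j r (chartAt (Vec d) x x)),
    fun j r x => (C (chartAt (Vec d) x)).α j r (chartAt (Vec d) x x),
    fun j r x => covecOf ((C (chartAt (Vec d) x)).β j r (chartAt (Vec d) x x))⟩,
    fun e he j z hz => ?_⟩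
  have hy : z.2 ∈ e.target := hz.2
  have h := hC e he _ (chart_mem_atlas (Vec d) (e.symm z.2))
  have hz' : z ∈ (overlapPatch hI hI' e (chartAt (Vec d) (e.symm z.2))).K.carrier :=
    ⟨hz.1, mem_overlap_chartAt hy⟩
  refine ⟨?_, (h.α j z hz').symm, ?_⟩
  · rw [h.g j z hz']
    refine (bilinComp_eq he hy _).trans ?_
    congr 2
    ext A B
    refine (bilinOf_apply _ _ _).trans ?_
    simp [Pi.single_apply]
    rfl
  · ext A
    rw [h.β j z hz']
    refine (covecComp_eq he hy _ A).trans ?_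
    refine Finset.sum_congr rfl fun B _ => congrArg _ ?_
    refine (covecOf_apply _ _).trans ?_
    simp [Pi.single_apply]
    rfl

/-- All data on the cross-section and on the null hypersurface arise from solutions of the
hierarchy. -/
theorem exists_jet (hσ : ContMDiff 𝓘(ℝ, Vec d) 𝓘(ℝ, ℝ) ∞ σ) (hσI : ∀ x, σ x ∈ I) (Λ : ℝ)
    {D : IMData d S} (hD : IsIMData I σ ⊤ D) :
    ∃ J : IMJet d S, IsJet I J ∧ SameIMData I ⊤ (J.restrict σ) D ∧
      ∀ e ∈ atlas (Vec d) S, ∀ n, CoordJet.Solves (chartPatch hI hI' e) Λ n (J.inChart e) := by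
  have hC : ∀ e : OpenPartialHomeomorph S (Vec d), ∃ C : CoordJet d, e ∈ atlas (Vec d) S →
      C.IsSmooth (chartPatch hI hI' e) ∧
      (∀ n, CoordJet.Solves (chartPatch hI hI' e) Λ n C) ∧
      C.g 0 = (fun r => bilinComp e (D.gN r)) ∧ C.α 0 = (fun r y => D.αN r (e.symm y)) ∧
      (∀ j, ∀ y ∈ e.target, C.g j (σ (e.symm y)) y = bilinComp e (D.gS j) y) ∧
      ∀ y ∈ e.target, C.β 0 (σ (e.symm y)) y = covecComp e D.βS y := by
    intro e
    by_cases he : e ∈ atlas (Vec d) S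
    · obtain ⟨C, hC⟩ := CoordJet.exists_solves (chartPatch hI hI' e) Λ
        (contDiffOn_symm_of_contMDiff hσ he) (fun y _ => hσI (e.symm y))
        (gN := fun r => bilinComp e (D.gN r)) (αN := fun r y => D.αN r (e.symm y))
        (gS := fun j => bilinComp e (D.gS j)) (βS := covecComp e D.βS)
        (fun A B => hD.smooth_gN e he A B) (hD.smooth_αN e he)
        (fun j A B => contDiffOn_of_prod (hD.smooth_gS j le_top e he A B))
        (fun A => contDiffOn_of_prod (hD.smooth_βS le_top e he A))
        (fun z hz A B => hD.symm_gN z.1 hz.1 _ _ _)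
        (fun z hz => det_bilinComp_ne_zero he hz.2 (f := D.gN z.1) fun v => hD.pos_gN z.1 hz.1 _ v)
        (fun j y hy A B => hD.symm_gS j le_top _ _ _)
        (fun y hy => by
          ext A B
          simp only [bilinComp, Matrix.of_apply, hD.gS_zero])
      exact ⟨C, fun _ => hC⟩
    · exact ⟨⟨0, 0, 0⟩, fun h => absurd h he⟩
  choose C hC using hC
  have hpull : ∀ e ∈ atlas (Vec d) S, ∀ e' ∈ atlas (Vec d) S,
      (C e).IsPullback (overlapPatch hI hI' e e') (chartChange e e') (C e') := by
    intro e he e' he'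
    obtain ⟨h1, h2, h3, h4, h5, h6⟩ := hC e he
    obtain ⟨h1', h2', h3', h4', h5', h6'⟩ := hC e' he'
    have H := map_chartChange hI hI' he he'
    -- The solution of the second chart expressed in the coordinates of the first. By covariance it
    -- solves the same hierarchy on the overlap.
    set Q : CoordJet d := ⟨fun j r y => (jac (chartChange e e') y)ᵀ
      * (C e').g j r (chartChange e e' y) * jac (chartChange e e') y,
      fun j r y => (C e').α j r (chartChange e e' y),
      fun j r y A => ∑ B, jac (chartChange e e') y B A * (C e').β j r (chartChange e e' y) B⟩ with hQ
    have hQp : Q.IsPullback (overlapPatch hI hI' e e') (chartChange e e') (C e') :=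
      ⟨fun _ _ _ => rfl, fun _ _ _ => rfl, fun _ _ _ _ => rfl⟩
    have hQs : Q.IsSmooth (overlapPatch hI hI' e e') :=
      { smooth_g := fun j A B => by
          simp only [hQ, Matrix.mul_apply, Matrix.transpose_apply]
          exact ContDiffOn.sum fun E _ => (ContDiffOn.sum fun F _ =>
            (H.contDiffOn_jac F A).mul (H.contDiffOn_comp (h1'.smooth_g j F E))).mul
            (H.contDiffOn_jac E B)
        smooth_α := fun j => H.contDiffOn_comp (h1'.smooth_α j)
        smooth_β := fun j A => by
          simp only [hQ]
          exact ContDiffOn.sum fun E _ =>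
            (H.contDiffOn_jac E A).mul (H.contDiffOn_comp (h1'.smooth_β j E))
        symm := fun j z hz A B => by
          have hs : ((C e').g j z.1 (chartChange e e' z.2))ᵀ = (C e').g j z.1 (chartChange e e' z.2) := by
            ext A B
            exact h1'.symm j _ (H.mem hz) B A
          have : (Q.g j z.1 z.2)ᵀ = Q.g j z.1 z.2 := by
            simp only [hQ, Matrix.transpose_mul, Matrix.transpose_transpose, hs, Matrix.mul_assoc]
          conv_lhs => rw [← this]
          rfl
        det_ne := fun z hz => by
          have h := det_jac_chartChange he he' hz.2
          simp only [hQ, Matrix.det_mul, Matrix.det_transpose]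
          exact mul_ne_zero (mul_ne_zero h (h1'.det_ne _ (H.mem hz))) h }
    have hCs : (C e).IsSmooth (overlapPatch hI hI' e e') := h1.mono fun z hz => ⟨hz.1, hz.2.1⟩
    -- Both solutions have the same data, since these come from global fields; uniqueness makes them
    -- agree. The cross-section is met by every generator, so uniqueness holds on any open piece of
    -- `S`.
    have hA : ∀ n, CoordJet.AgreeOn (overlapPatch hI hI' e e') n (C e) Q := by
      intro n
      refine CoordJet.Solves.unique (Λ := Λ) (σ := fun y => σ (e.symm y)) hCs hQs
        ((h2 n).mono h1 rfl fun y hy => hy.1) (hQp.solves H hQs h1' (h2' n))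
        (fun y _ => hσI _) (fun z hz => ?_) (fun z hz => ?_) (fun y hy => ?_) (fun j _ y hy => ?_)
      · simp only [hQ, h3, h3']
        exact bilinComp_change he he' _ hz.2
      · simp only [hQ, h4, h4', symm_chartChange hz.2]
      · ext A
        simp only [hQ]
        rw [h6 y hy.1, covecComp_change he he' _ hy, ← symm_chartChange hy,
          h6' _ (chartChange_mem hy)]
      · simp only [hQ]
        rw [h5 j y hy.1, bilinComp_change he he' _ hy, ← symm_chartChange hy,
          h5' j _ (chartChange_mem hy)]
    exact ⟨fun j z hz => (hA j).g j le_rfl z hz, fun j z hz => (hA j).α j le_rfl z hz,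
      fun j z hz A => congrFun ((hA j).β j le_rfl z hz) A⟩
  obtain ⟨J, hJ⟩ := exists_jet_of_compatible hI hI' hpull
  have hgN : ∀ r ∈ I, ∀ x, J.g 0 r x = D.gN r x := by
    intro r hr x
    have hx := mem_chart_source (Vec d) x
    have h := (hJ _ (chart_mem_atlas (Vec d) x) 0 (r, chartAt (Vec d) x x)
      ⟨hr, (chartAt (Vec d) x).map_source hx⟩).1
    rw [(hC _ (chart_mem_atlas (Vec d) x)).2.2.1] at h
    have h2 : gram (J.g 0 r x) = gram (D.gN r x) := by
      rw [← bilinComp_chartAt, ← bilinComp_chartAt]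
      exact h
    exact bilin_ext fun A B => congrFun (congrFun h2 A) B
  have hgram : ∀ j, ∀ r ∈ I, ∀ x, gram (J.g j r x)
      = (C (chartAt (Vec d) x)).g j r (chartAt (Vec d) x x) := by
    intro j r hr x
    rw [← bilinComp_chartAt]
    exact (hJ _ (chart_mem_atlas (Vec d) x) j (r, chartAt (Vec d) x x)
      ⟨hr, (chartAt (Vec d) x).map_source (mem_chart_source (Vec d) x)⟩).1
  have hαN : ∀ r ∈ I, ∀ x, J.α 0 r x = D.αN r x := by
    intro r hr x
    have hx := mem_chart_source (Vec d) x
    have h := (hJ _ (chart_mem_atlas (Vec d) x) 0 (r, chartAt (Vec d) x x)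
      ⟨hr, (chartAt (Vec d) x).map_source hx⟩).2.1
    rw [(hC _ (chart_mem_atlas (Vec d) x)).2.2.2.1] at h
    simp only [IMJet.inChart, (chartAt (Vec d) x).left_inv hx] at h
    exact h
  have hjet : IsJet I J :=
    { smooth_g := fun j e he A B => ((hC e he).1.smooth_g j A B).congr fun z hz =>
        congrFun (congrFun (hJ e he j z hz).1 A) B
      smooth_α := fun j e he => ((hC e he).1.smooth_α j).congr fun z hz => (hJ e he j z hz).2.1
      smooth_β := fun j e he A => ((hC e he).1.smooth_β j A).congr fun z hz =>
        congrFun (hJ e he j z hz).2.2 A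
      symm := fun j r hr x v w => by
        have hs : ∀ A B, gram (J.g j r x) A B = gram (J.g j r x) B A := fun A B => by
          rw [hgram j r hr x]
          exact (hC _ (chart_mem_atlas (Vec d) x)).1.symm j (r, chartAt (Vec d) x x)
            ⟨hr, (chartAt (Vec d) x).map_source (mem_chart_source (Vec d) x)⟩ A B
        have h2 : (show Vec d →L[ℝ] Vec d →L[ℝ] ℝ from J.g j r x)
            = (show Vec d →L[ℝ] Vec d →L[ℝ] ℝ from J.g j r x).flip :=
          bilin_ext fun A B => hs A B
        exact congrArg (fun L : Vec d →L[ℝ] Vec d →L[ℝ] ℝ => L v w) h2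
      pos := fun r hr x v hv => by
        rw [hgN r hr x]
        exact hD.pos_gN r hr x v hv }
  refine ⟨J, hjet, ⟨fun j _ x => ?_, fun _ x => ⟨?_, ?_⟩, fun r hr x => ⟨hgN r hr x, ?_⟩⟩,
    fun e he n => ?_⟩
  · have hx := mem_chart_source (Vec d) x
    have h := (hC _ (chart_mem_atlas (Vec d) x)).2.2.2.2.1 j (chartAt (Vec d) x x)
      ((chartAt (Vec d) x).map_source hx)
    rw [(chartAt (Vec d) x).left_inv hx, ← hgram j _ (hσI x), bilinComp_chartAt] at h
    exact bilin_ext fun A B => congrFun (congrFun h A) B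
  · exact (hαN _ (hσI x) x).trans (hD.αS_eq le_top x).symm
  · have hx := mem_chart_source (Vec d) x
    have hy := (chartAt (Vec d) x).map_source hx
    have h := (hC _ (chart_mem_atlas (Vec d) x)).2.2.2.2.2 (chartAt (Vec d) x x) hy
    rw [(chartAt (Vec d) x).left_inv hx] at h
    have h2 := (hJ _ (chart_mem_atlas (Vec d) x) 0 (σ x, chartAt (Vec d) x x) ⟨hσI x, hy⟩).2.2
    have h3 := h2.trans h
    refine covec_ext fun A => ?_
    have h4 := congrFun h3 A
    rw [covecComp_chartAt] at h4
    exact (covecComp_chartAt (J.β 0 (σ x)) x A).symm.trans h4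
  · exact hαN r hr x
  · refine CoordJet.AgreeOn.solves (J := C e) ?_ (hC e he).1 (hjet.isSmooth hI hI' he) ((hC e he).2.1 n)
    exact ⟨fun j _ z hz => (hJ e he j z hz).1.symm, fun j _ z hz => (hJ e he j z hz).2.1.symm,
      fun j _ z hz => (hJ e he j z hz).2.2.symm⟩

end Global

open PowerSeries in
/-- The term of `R_{uu}` which contains `∂_u^{i+2} g_{AB}`. -/
theorem CoordJet.IsSmooth.einstein_uu_add {d : ℕ} {P : Patch d} {J J' : CoordJet d}
    (hJ : J.IsSmooth P) (hJ' : J'.IsSmooth P) (Λ : ℝ) {i : ℕ}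
    (h : ∀ j < i + 2, ∀ z ∈ P.K.carrier, J.g j z.1 z.2 = J'.g j z.1 z.2) {z : ℝ × Vec d}
    (hz : z ∈ P.K.carrier) :
    J.einstein P.I P.U Λ i iu iu z.1 z.2
        + 1 / 2 * ((J.g 0 z.1 z.2)⁻¹ * J.g (i + 2) z.1 z.2).trace
      = J'.einstein P.I P.U Λ i iu iu z.1 z.2
        + 1 / 2 * ((J'.g 0 z.1 z.2)⁻¹ * J'.g (i + 2) z.1 z.2).trace := by
  set q : Fin d → Fin d → P.K.Ring := fun A B =>
    coeff (i + 2) (hJ.formal.h A B) - coeff (i + 2) (hJ'.formal.h A B) with hq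
  have hh0 : ∀ A B, Eqv (i + 2) (hJ.formal.h A B) (hJ'.formal.h A B) := hJ.eqv_h hJ' h
  have hh : ∀ A B, Lin (i + 1 + 1) (q A B) (hJ.formal.h A B) (hJ'.formal.h A B) := fun A B =>
    (hh0 A B).lin (by rw [hq]; ring)
  have hi : ∀ A B, Eqv (i + 1) (hJ.formal.hi A B) (hJ'.formal.hi A B) := fun A B =>
    (FormalMetric.eqv_hi hh0 A B).mono (by omega)
  have h1 : ∀ A B, Lin (i + 1) (q A B * (((i + 1 : ℕ) : P.K.Ring) + 1))
      (P.frame iu (hJ.formal.h A B)) (P.frame iu (hJ'.formal.h A B)) := fun A B => (hh A B).dX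
  have h2 : ∀ A B, Lin i (q A B * (((i + 1 : ℕ) : P.K.Ring) + 1) * (i + 1))
      (P.frame iu (P.frame iu (hJ.formal.h A B))) (P.frame iu (P.frame iu (hJ'.formal.h A B))) :=
    fun A B => (h1 A B).dX
  have hm1 : ∀ A B, Eqv (i + 1) ((hJ.formal.hi * dMat (P.frame iu) hJ.formal.h) A B)
      ((hJ'.formal.hi * dMat (P.frame iu) hJ'.formal.h) A B) := fun A B => by
    simp only [Matrix.mul_apply, dMat_apply]
    exact Eqv.sum fun C _ => (hi A C).mul (h1 C B).eqv
  -- The quadratic term contains only first derivatives in `u` and thus cannot see `∂_u^{i+2} g` at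
  -- order `i`.
  have t1 : Eqv (i + 1) (hJ.formal.hi * dMat (P.frame iu) hJ.formal.h
        * (hJ.formal.hi * dMat (P.frame iu) hJ.formal.h)).trace
      (hJ'.formal.hi * dMat (P.frame iu) hJ'.formal.h
        * (hJ'.formal.hi * dMat (P.frame iu) hJ'.formal.h)).trace :=
    Eqv.sum fun A _ => by
      simp only [Matrix.diag_apply, Matrix.mul_apply (M := hJ.formal.hi * _),
        Matrix.mul_apply (M := hJ'.formal.hi * _)]
      exact Eqv.sum fun C _ => (hm1 A C).mul (hm1 C A)
  have t2 : Lin i (∑ A, ∑ C, coeff 0 (hJ.formal.hi A C)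
        * (q C A * (((i + 1 : ℕ) : P.K.Ring) + 1) * ((i : P.K.Ring) + 1)))
      (hJ.formal.hi * dMat (P.frame iu) (dMat (P.frame iu) hJ.formal.h)).trace
      (hJ'.formal.hi * dMat (P.frame iu) (dMat (P.frame iu) hJ'.formal.h)).trace :=
    Lin.sum fun A _ => by
      simp only [Matrix.diag_apply, Matrix.mul_apply, dMat_apply]
      exact Lin.sum fun C _ => Lin.mul_left (hi A C) (h2 C A)
  have key := ((Lin.const_mul (half P.K.Ring⟦X⟧) t2).neg.add
    (Eqv.const_mul (half P.K.Ring⟦X⟧ * half P.K.Ring⟦X⟧) t1).lin_zero).coeff_eq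
  have hr : ∀ {J : CoordJet d} (hJ : J.IsSmooth P), J.einstein P.I P.U Λ i iu iu z.1 z.2
      = i.factorial * ev (coeff i (-(half _
          * (hJ.formal.hi * dMat (P.frame iu) (dMat (P.frame iu) hJ.formal.h)).trace)
        + half _ * half _ * (hJ.formal.hi * dMat (P.frame iu) hJ.formal.h
          * (hJ.formal.hi * dMat (P.frame iu) hJ.formal.h)).trace)) z := by
    intro J hJ
    have hg : hJ.formal.g iu iu = 0 := by simp only [FormalMetric.g, imMetric_uu]
    have := ricciOf_uu_trace (D := P.frame) (φ := hJ.formal.φ) (b := hJ.formal.b) hJ.formal.symm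
      hJ.formal.inv
    rw [hJ.einstein_eq Λ i _ _ hz, IsSmooth.ein, hg, mul_zero, sub_zero, FormalMetric.ric,
      FormalMetric.Γ, FormalMetric.g, FormalMetric.gi, this, neg_mul]
  have hfac : ((i + 2).factorial : ℝ) = (i + 2) * (i + 1) * i.factorial := by
    rw [Nat.factorial_succ, Nat.factorial_succ]; push_cast; ring
  have hN : (i.factorial : ℝ) ≠ 0 := by positivity
  have evq : ∀ A B, ev (q A B) z = 1 / ((i + 2) * (i + 1) * i.factorial)
      * (J.g (i + 2) z.1 z.2 A B - J'.g (i + 2) z.1 z.2 A B) := fun A B => by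
    simp only [hq, ev_sub, formal_h]
    rw [Patch.ev_coeff_ser (hJ.smooth_g _ A B) hz, Patch.ev_coeff_ser (hJ'.smooth_g _ A B) hz,
      ← hfac]
    ring
  rw [hr hJ, hr hJ', key, coeff_zero_half, add_zero]
  have e2 : ((J.g 0 z.1 z.2)⁻¹ * J.g (i + 2) z.1 z.2).trace
      - ((J'.g 0 z.1 z.2)⁻¹ * J'.g (i + 2) z.1 z.2).trace
      = ∑ A, ∑ C, (J.g 0 z.1 z.2)⁻¹ A C * (J.g (i + 2) z.1 z.2 C A - J'.g (i + 2) z.1 z.2 C A) := by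
    rw [← h 0 (by omega) z hz, ← Matrix.trace_sub, ← Matrix.mul_sub]
    rfl
  have e3 : ev (∑ A, ∑ C, coeff 0 (hJ.formal.hi A C)
        * (q C A * (((i + 1 : ℕ) : P.K.Ring) + 1) * ((i : P.K.Ring) + 1))) z
      = 1 / i.factorial * ∑ A, ∑ C, (J.g 0 z.1 z.2)⁻¹ A C
        * (J.g (i + 2) z.1 z.2 C A - J'.g (i + 2) z.1 z.2 C A) := by
    simp only [ev_sum _ _ hz, ev_mul, ev_add, hJ.ev_hi_zero _ _ hz, evq, ev_natCast _ hz, ev_one hz,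
      Finset.mul_sum]
    refine Finset.sum_congr rfl fun A _ => Finset.sum_congr rfl fun C _ => ?_
    push_cast
    have h1 : (i : ℝ) + 1 ≠ 0 := by positivity
    have h2 : (i : ℝ) + 2 ≠ 0 := by positivity
    field_simp
    ring
  rw [ev_add, ev_neg, ev_mul, ev_half hz, e3, ← e2]
  field_simp
  ring

/-! ### The transverse Raychaudhuri equation -/

section Transverse

variable {d : ℕ}

/-- The transverse derivative of order `i` of the Raychaudhuri expression, for a metric with given
transverse derivatives. -/
def transverse (G : ℕ → Matrix (Fin d) (Fin d) ℝ) (i : ℕ) : ℝ :=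
  iteratedDeriv i (raychaudhuri Set.univ
    (fun u => Matrix.of fun A B => taylorSum (i + 2) (fun j => G j A B) u) 0) 0

lemma transverse_congr {G G' : ℕ → Matrix (Fin d) (Fin d) ℝ} {i : ℕ}
    (h : ∀ j ≤ i + 2, G j = G' j) : transverse G i = transverse G' i := by
  have : (fun u => Matrix.of fun A B => taylorSum (i + 2) (fun j => G j A B) u)
      = fun u => Matrix.of fun A B => taylorSum (i + 2) (fun j => G' j A B) u := by
    funext u
    ext A B
    simp only [Matrix.of_apply, taylorSum]
    refine Finset.sum_congr rfl fun j hj => ?_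
    rw [h j (Nat.lt_succ_iff.mp (Finset.mem_range.mp hj))]
  rw [transverse, transverse, this]

/-- Pointwise statement about matrices, obtained from that on jets by taking `G j` as constant
fields on `ℝ × ℝ^d` with `α = β = 0`. -/
lemma transverse_add {G G' : ℕ → Matrix (Fin d) (Fin d) ℝ} {i : ℕ}
    (hs : ∀ j A B, G j A B = G j B A) (hs' : ∀ j A B, G' j A B = G' j B A) (h0 : (G 0).det ≠ 0)
    (h : ∀ j < i + 2, G j = G' j) :
    transverse G i + 1 / 2 * ((G 0)⁻¹ * G (i + 2)).trace
      = transverse G' i + 1 / 2 * ((G' 0)⁻¹ * G' (i + 2)).trace := by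
  have hI : (Set.univ : Set ℝ).Nontrivial := Set.nontrivial_univ
  set P : Patch d := ⟨Set.univ, Set.univ, Set.ordConnected_univ, hI, isOpen_univ⟩
  have hsm : ∀ {G : ℕ → Matrix (Fin d) (Fin d) ℝ}, (∀ j A B, G j A B = G j B A) → (G 0).det ≠ 0 →
      CoordJet.IsSmooth P ⟨fun j _ _ => G j, fun _ _ _ => 0, fun _ _ _ _ => 0⟩ := fun hs h0 =>
    ⟨fun _ _ _ => contDiffOn_const, fun _ => contDiffOn_const, fun _ _ => contDiffOn_const,
      fun j _ _ => hs j, fun _ _ => h0⟩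
  have h0' : (G' 0).det ≠ 0 := h 0 (by omega) ▸ h0
  have hz : ((0, 0) : ℝ × Vec d) ∈ P.K.carrier := ⟨Set.mem_univ _, Set.mem_univ _⟩
  have key := (hsm hs h0).einstein_uu_add (hsm hs' h0') 0 (i := i) (fun j hj _ _ => h j hj) hz
  rw [(hsm hs h0).einstein_uu 0 i hz, (hsm hs' h0').einstein_uu 0 i hz] at key
  exact key

end Transverse

section

open Set

variable {d : ℕ} {S : Type*} [TopologicalSpace S] [ChartedSpace (Vec d) S]
  [IsManifold 𝓘(ℝ, Vec d) ∞ S] {I : Set ℝ} (hI : I.OrdConnected) (hI' : I.Nontrivial)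
  {J J' : IMJet d S} {Λ : ℝ} {k : ℕ∞} {σ : S → ℝ} {e : OpenPartialHomeomorph S (Vec d)}

/-! ### Scalar components of the Einstein equations -/

-- Components with both indices among `u`, `r` do not depend on the chart. Evaluating them in the
-- preferred chart replaces components by `gram`, in terms of which the constraints are formulated.
include hI hI' in
lemma IsJet.einstein_inl_chartAt (hJ : IsJet I J) (he : e ∈ atlas (Vec d) S) (Λ : ℝ) (i : ℕ)
    {r : ℝ} (hr : r ∈ I) {y : Vec d} (hy : y ∈ e.target) (k l : Fin 2) :
    (J.inChart e).einstein I e.target Λ i (Sum.inl k) (Sum.inl l) r y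
      = (J.inChart (chartAt (Vec d) (e.symm y))).einstein I (chartAt (Vec d) (e.symm y)).target Λ i
        (Sum.inl k) (Sum.inl l) r (chartAt (Vec d) (e.symm y) (e.symm y)) := by
  have hc := chart_mem_atlas (Vec d) (e.symm y)
  have hs : (J.inChart e).IsSmooth (overlapPatch hI hI' e (chartAt (Vec d) (e.symm y))) :=
    (hJ.isSmooth hI hI' he).mono fun z hz => ⟨hz.1, hz.2.1⟩
  have hz : (r, y) ∈ (overlapPatch hI hI' e (chartAt (Vec d) (e.symm y))).K.carrier :=
    ⟨hr, mem_overlap_chartAt hy⟩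
  have H : (overlapPatch hI hI' e (chartAt (Vec d) (e.symm y))).Map (chartPatch hI hI' e) id :=
    ⟨rfl, fun y hy => hy.1, contDiffOn_id⟩
  have h1 := (CoordJet.isPullback_id _ (J.inChart e)).einstein_inl H hs (hJ.isSmooth hI hI' he) Λ i
    hz k l
  have h2 := (isPullback_inChart hI hI' J he hc).einstein_inl (map_chartChange hI hI' he hc) hs
    (hJ.isSmooth hI hI' hc) Λ i hz k l
  exact h1.symm.trans h2

include hI hI' in
lemma IsJet.einstein_uu_eq (hJ : IsJet I J) (he : e ∈ atlas (Vec d) S) (Λ : ℝ) (i : ℕ)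
    {r : ℝ} (hr : r ∈ I) {y : Vec d} (hy : y ∈ e.target) :
    (J.inChart e).einstein I e.target Λ i iu iu r y
      = transverse (fun j => gram (J.g j r (e.symm y))) i := by
  have hc := chart_mem_atlas (Vec d) (e.symm y)
  refine (hJ.einstein_inl_chartAt hI hI' he Λ i hr hy 0 0).trans ?_
  refine ((hJ.isSmooth hI hI' hc).einstein_uu Λ i (z := (r, chartAt (Vec d) (e.symm y) (e.symm y)))
    ⟨hr, OpenPartialHomeomorph.map_source _ (mem_chart_source _ _)⟩).trans ?_
  exact transverse_congr fun j _ => bilinComp_chartAt (J.g j r) (e.symm y)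

include hI hI' in
lemma IsJet.einstein_rr_eq (hJ : IsJet I J) (he : e ∈ atlas (Vec d) S) (Λ : ℝ)
    {r : ℝ} (hr : r ∈ I) {y : Vec d} (hy : y ∈ e.target) :
    (J.inChart e).einstein I e.target Λ 0 ir ir r y
      = raychaudhuri I (fun r' => gram (J.g 0 r' (e.symm y))) (J.α 0 r (e.symm y)) r := by
  have hc := chart_mem_atlas (Vec d) (e.symm y)
  refine (hJ.einstein_inl_chartAt hI hI' he Λ 0 hr hy 1 1).trans ?_
  refine ((hJ.isSmooth hI hI' hc).einstein_rr Λ (z := (r, chartAt (Vec d) (e.symm y) (e.symm y)))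
    ⟨hr, OpenPartialHomeomorph.map_source _ (mem_chart_source _ _)⟩).trans ?_
  have h1 : (fun r' => (J.inChart (chartAt (Vec d) (e.symm y))).g 0 r'
      (chartAt (Vec d) (e.symm y) (e.symm y))) = fun r' => gram (J.g 0 r' (e.symm y)) :=
    funext fun r' => bilinComp_chartAt (J.g 0 r') (e.symm y)
  have h2 : (J.inChart (chartAt (Vec d) (e.symm y))).α 0 r (chartAt (Vec d) (e.symm y) (e.symm y))
      = J.α 0 r (e.symm y) := by
    simp only [IMJet.inChart]
    rw [(chartAt (Vec d) (e.symm y)).left_inv (mem_chart_source _ _)]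
  rw [← h2]
  exact congrArg (fun M => raychaudhuri I M _ r) h1

omit [IsManifold 𝓘(ℝ, Vec d) ∞ S] in
lemma raychaudhuri_congr {M M' : ℝ → Matrix (Fin d) (Fin d) ℝ} {a : ℝ} (h : ∀ r ∈ I, M r = M' r)
    {r : ℝ} (hr : r ∈ I) : raychaudhuri I M a r = raychaudhuri I M' a r := by
  have h1 : ∀ r ∈ I, entryDeriv I M r = entryDeriv I M' r := fun r hr =>
    CoordJet.entryDeriv_congr h hr
  rw [raychaudhuri, raychaudhuri, h r hr, h1 r hr, CoordJet.entryDeriv_congr h1 hr]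

/-! ### Comparison of fields on the manifold and in charts -/

lemma IMJet.eq_of_agreeOn {n : ℕ}
    (h : ∀ e ∈ atlas (Vec d) S, CoordJet.AgreeOn (chartPatch hI hI' e) n (J.inChart e) (J'.inChart e))
    {r : ℝ} (hr : r ∈ I) (x : S) :
    J.g n r x = J'.g n r x ∧ J.α n r x = J'.α n r x ∧ J.β n r x = J'.β n r x := by
  have hx := mem_chart_source (Vec d) x
  have hz : (r, chartAt (Vec d) x x) ∈ (chartPatch hI hI' (chartAt (Vec d) x)).K.carrier :=
    ⟨hr, (chartAt (Vec d) x).map_source hx⟩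
  have H := h _ (chart_mem_atlas (Vec d) x)
  refine ⟨?_, ?_, ?_⟩
  · have h1 : gram (J.g n r x) = gram (J'.g n r x) := by
      rw [← bilinComp_chartAt, ← bilinComp_chartAt]
      exact H.g n le_rfl _ hz
    exact bilin_ext fun A B => congrFun (congrFun h1 A) B
  · have h1 := H.α n le_rfl _ hz
    simp only [IMJet.inChart, (chartAt (Vec d) x).left_inv hx] at h1
    exact h1
  · refine covec_ext fun A => ?_
    have h1 := congrFun (H.β n le_rfl _ hz) A
    exact (covecComp_chartAt (J.β n r) x A).symm.trans (h1.trans (covecComp_chartAt (J'.β n r) x A))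

omit [IsManifold 𝓘(ℝ, Vec d) ∞ S] in
lemma AgreeUpTo.agreeOn {n : ℕ} (h : AgreeUpTo I n J J') (e : OpenPartialHomeomorph S (Vec d)) :
    CoordJet.AgreeOn (chartPatch hI hI' e) n (J.inChart e) (J'.inChart e) where
  g j hj z hz := by simp only [IMJet.inChart, (h j hj z.1 hz.1 _).1]
  α j hj z hz := by simp only [IMJet.inChart, (h j hj z.1 hz.1 _).2.1]
  β j hj z hz := by simp only [IMJet.inChart, (h j hj z.1 hz.1 _).2.2]

omit [IsManifold 𝓘(ℝ, Vec d) ∞ S] in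
lemma SameData.agreeUpTo (h : SameData I k J J') (hk : 1 ≤ k) {n : ℕ} (hn : (n : ℕ∞) ≤ k) :
    AgreeUpTo I n J J' := fun j hj r hr x =>
  have h1 := h j ((Nat.cast_le.mpr hj).trans hn) r hr x
  ⟨h1.1, h1.2.1, h1.2.2 hk⟩

-- For `k = 0` both sides are void. For `k ≥ 1` the hierarchy, possibly of infinite order, is split
-- into the finite systems used in the patches.
omit [IsManifold 𝓘(ℝ, Vec d) ∞ S] in
lemma solvesHierarchy_iff : SolvesHierarchy I Λ k J ↔ (1 ≤ k → ∀ e ∈ atlas (Vec d) S, ∀ n : ℕ,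
    (n : ℕ∞) ≤ k → CoordJet.Solves (chartPatch hI hI' e) Λ n (J.inChart e)) := by
  constructor
  · intro h hk e he n hn
    have hlt : ∀ i < n, ((i + 1 : ℕ) : ℕ∞) ≤ k := fun i hi => by
      refine le_trans ?_ hn
      exact_mod_cast hi
    exact ⟨fun z hz => (h e he z.1 hz.1 z.2 hz.2).1 hk,
      fun i hi z hz => ((h e he z.1 hz.1 z.2 hz.2).2 i (hlt i hi)).1,
      fun i hi z hz => ((h e he z.1 hz.1 z.2 hz.2).2 i (hlt i hi)).2.1,
      fun i hi z hz => ((h e he z.1 hz.1 z.2 hz.2).2 i (hlt i hi)).2.2⟩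
  · intro h e he r hr y hy
    refine ⟨fun hk => (h hk e he 0 (by simp)).rx (r, y) ⟨hr, hy⟩, fun i hi => ?_⟩
    have hk : 1 ≤ k := le_trans (by norm_cast; omega) hi
    have hs := h hk e he (i + 1) hi
    have hz : (r, y) ∈ (chartPatch hI hI' e).K.carrier := ⟨hr, hy⟩
    exact ⟨fun A B => hs.xx i i.lt_succ_self (r, y) hz A B, hs.ur i i.lt_succ_self (r, y) hz,
      fun A => hs.ux i i.lt_succ_self (r, y) hz A⟩

/-! ### Vacuum data -/

-- The equations hold for the completion of the data to a formal solution. Those of the hierarchy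
-- involve fields of order at most `k` only, hence hold for the data themselves.
include hI hI' in
lemma IsVacuumData.solvesHierarchy (h : IsVacuumData I Λ k J) : SolvesHierarchy I Λ k J := by
  obtain ⟨hJ, J', ⟨hJ', hE⟩, hsame⟩ := h
  refine (solvesHierarchy_iff hI hI').mpr fun hk e he n hn => ?_
  have hs : CoordJet.Solves (chartPatch hI hI' e) Λ n (J'.inChart e) :=
    ⟨fun z hz A => hE e he 0 ir (ix A) z.1 hz.1 z.2 hz.2,
      fun i _ z hz A B => hE e he i (ix A) (ix B) z.1 hz.1 z.2 hz.2,
      fun i _ z hz => hE e he i iu ir z.1 hz.1 z.2 hz.2,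
      fun i _ z hz A => hE e he i iu (ix A) z.1 hz.1 z.2 hz.2⟩
  exact CoordJet.AgreeOn.solves ((hsame.agreeUpTo hk hn).agreeOn hI hI' e).symm
    (hJ'.isSmooth hI hI' he) (hJ.isSmooth hI hI' he) hs

include hI hI' in
lemma IsVacuumData.transverseConstraint (hσI : ∀ x, σ x ∈ I) (h : IsVacuumData I Λ k J) :
    TransverseConstraint k (J.restrict σ) := by
  obtain ⟨hJ, J', ⟨hJ', hE⟩, hsame⟩ := h
  intro i hi x
  have hx := mem_chart_source (Vec d) x
  have hc := chart_mem_atlas (Vec d) x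
  have h1 := hE _ hc i iu iu (σ x) (hσI x) _ ((chartAt (Vec d) x).map_source hx)
  rw [hJ'.einstein_uu_eq hI hI' hc Λ i (hσI x) ((chartAt (Vec d) x).map_source hx),
    (chartAt (Vec d) x).left_inv hx] at h1
  refine (transverse_congr fun j hj => ?_).trans h1
  have h2 := (hsame j ((Nat.cast_le.mpr hj).trans hi) (σ x) (hσI x) x).1
  simp only [IMJet.restrict, h2]

include hI hI' in
lemma IsVacuumData.isIMData (hσ : ContMDiff 𝓘(ℝ, Vec d) 𝓘(ℝ, ℝ) ∞ σ) (hσI : ∀ x, σ x ∈ I)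
    (h : IsVacuumData I Λ k J) : IsIMData I σ k (J.restrict σ) := by
  obtain ⟨hJ, J', ⟨hJ', hE⟩, hsame⟩ := h
  have hcomp : ∀ e ∈ atlas (Vec d) S, ContDiffOn ℝ ∞ (fun p : ℝ × Vec d => (σ (e.symm p.2), p.2))
      (univ ×ˢ e.target) := fun e he =>
    ((contDiffOn_symm_of_contMDiff hσ he).comp contDiff_snd.contDiffOn fun p hp => hp.2).prodMk
      contDiff_snd.contDiffOn
  exact
    { smooth_gN := hJ.smooth_g 0
      smooth_αN := hJ.smooth_α 0
      symm_gN := hJ.symm 0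
      pos_gN := hJ.pos
      smooth_gS := fun j _ e he A B => (hJ.smooth_g j e he A B).comp (hcomp e he)
        fun p hp => ⟨hσI _, hp.2⟩
      symm_gS := fun j _ x => hJ.symm j (σ x) (hσI x) x
      smooth_βS := fun _ e he A => (hJ.smooth_β 0 e he A).comp (hcomp e he)
        fun p hp => ⟨hσI _, hp.2⟩
      gS_zero := fun _ => rfl
      αS_eq := fun _ _ => rfl
      raychaudhuri_eq := fun r hr x => by
        have hx := mem_chart_source (Vec d) x
        have hc := chart_mem_atlas (Vec d) x
        have h1 := hE _ hc 0 ir ir r hr _ ((chartAt (Vec d) x).map_source hx)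
        rw [hJ'.einstein_rr_eq hI hI' hc Λ hr ((chartAt (Vec d) x).map_source hx),
          (chartAt (Vec d) x).left_inv hx] at h1
        have h2 := fun r hr => hsame 0 (by simp) r hr x
        simp only [IMJet.restrict]
        rw [(h2 r hr).2.1, ← h1]
        exact raychaudhuri_congr (fun r' hr' => by rw [(h2 r' hr').1]) hr }

/-! ### Uniqueness -/

include hI hI' in
lemma sameData_of_sameIMData (hσI : ∀ x, σ x ∈ I) (hJ : IsJet I J) (hJ' : IsJet I J')
    (hs : SolvesHierarchy I Λ k J) (hs' : SolvesHierarchy I Λ k J')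
    (h : SameIMData I k (J.restrict σ) (J'.restrict σ)) : SameData I k J J' := by
  obtain ⟨hgS, hS, hN⟩ := h
  intro j hj r hr x
  by_cases hk : 1 ≤ k
  · have H := fun e he => CoordJet.Solves.unique (σ := fun y => σ (e.symm y))
      (hJ.isSmooth hI hI' he) (hJ'.isSmooth hI hI' he)
      ((solvesHierarchy_iff hI hI').mp hs hk e he j hj)
      ((solvesHierarchy_iff hI hI').mp hs' hk e he j hj) (fun y _ => hσI _)
      (fun z hz => congrArg (fun b => bilinComp e b z.2) (?_ : J.g 0 z.1 = J'.g 0 z.1))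
      (fun z hz => (hN z.1 hz.1 _).2) (fun y hy => funext fun A => ?_) (fun i hi y hy => ?_)
    · have h1 := IMJet.eq_of_agreeOn hI hI' H hr x
      exact ⟨h1.1, h1.2.1, fun _ => h1.2.2⟩
    · funext x
      exact (hN z.1 hz.1 x).1
    · exact DFunLike.congr_fun ((hS hk (e.symm y)).2) _
    · ext A B
      exact DFunLike.congr_fun (DFunLike.congr_fun (hgS i ((Nat.cast_le.mpr hi).trans hj) (e.symm y)) _) _
  · have hj0 : j = 0 := by
      by_contra hne
      exact hk (le_trans (by norm_cast; omega) hj)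
    subst hj0
    exact ⟨(hN r hr x).1, (hN r hr x).2, fun h => absurd h hk⟩

end

section

open Set

/-! ### Extension of data of finite order -/

/-- Recursively defined sequences; the step `F n` sees the first `n` terms, continued by `a`. -/
lemma exists_seq {α : Type*} (F : ℕ → (ℕ → α) → α) (a : α) :
    ∃ g : ℕ → α, ∀ n, g n = F n (fun j => if j < n then g j else a) := by
  let G : ℕ → ℕ → α := fun n => Nat.rec (fun _ => a) (fun n f => Function.update f n (F n f)) n
  have hs : ∀ n, G (n + 1) = Function.update (G n) n (F n (G n)) := fun _ => rfl
  have hlt : ∀ n j, G n j = if j < n then G (j + 1) j else a := by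
    intro n
    induction n with
    | zero => intro j; rfl
    | succ n ih =>
      intro j
      rcases lt_trichotomy j n with h | rfl | h
      · rw [hs, Function.update_of_ne h.ne, ih, if_pos h, if_pos (by omega)]
      · rw [if_pos (Nat.lt_succ_self j)]
      · rw [hs, Function.update_of_ne h.ne', ih, if_neg (by omega), if_neg (by omega)]
  refine ⟨fun n => G (n + 1) n, fun n => ?_⟩
  have : (fun j => if j < n then G (j + 1) j else a) = G n := funext fun j => (hlt n j).symm
  simp only [this]
  rw [hs, Function.update_self]

variable {d : ℕ} {S : Type*} [TopologicalSpace S] [ChartedSpace (Vec d) S]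
  [IsManifold 𝓘(ℝ, Vec d) ∞ S] {I : Set ℝ} {Λ : ℝ} {k : ℕ∞} {σ : S → ℝ}

/-- The expression is `∂_u^i R_uu` of the jet with these `g`, independent of `r`, and `α = β = 0`;
smoothness is that of the Einstein expression. -/
lemma contDiffOn_transverse {G : ℕ → (x : S) → Bilin d x}
    (hG : ∀ j, SmoothBilin univ (fun _ => G j))
    (hs : ∀ j (x : S) (v w : TangentSpace 𝓘(ℝ, Vec d) x), G j x v w = G j x w v)
    (hpos : ∀ (x : S) (v : TangentSpace 𝓘(ℝ, Vec d) x), v ≠ 0 → 0 < G 0 x v v) (i : ℕ)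
    {e : OpenPartialHomeomorph S (Vec d)} (he : e ∈ atlas (Vec d) S) :
    ContDiffOn ℝ ∞ (fun y => transverse (fun j => gram (G j (e.symm y))) i) e.target := by
  set J : IMJet d S := ⟨fun j _ => G j, fun _ _ _ => 0, fun _ _ _ => 0⟩ with hJdef
  have hJ : IsJet univ J :=
    { smooth_g := hG
      smooth_α := fun j e he => contDiffOn_const
      smooth_β := fun j e he A => contDiffOn_const
      symm := fun j _ _ => hs j
      pos := fun _ _ => hpos }
  have h := (hJ.isSmooth ordConnected_univ nontrivial_univ he).contDiffOn_einstein 0 i iu iu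
  refine (h.comp (f := fun y => ((0 : ℝ), y)) (contDiff_const.prodMk contDiff_id).contDiffOn
    fun y hy => ⟨mem_univ _, hy⟩).congr fun y hy => ?_
  exact (hJ.einstein_uu_eq ordConnected_univ nontrivial_univ he 0 i (mem_univ _) hy).symm

omit [IsManifold 𝓘(ℝ, Vec d) ∞ S] in
lemma gram_smul {x : S} (c : ℝ) (b : Bilin d x) : gram (c • b) = c • gram b := rfl

omit [IsManifold 𝓘(ℝ, Vec d) ∞ S] in
lemma gram_symm {x : S} {b : Bilin d x}
    (h : ∀ v w : TangentSpace 𝓘(ℝ, Vec d) x, b v w = b w v) (A B : Fin d) :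
    gram b A B = gram b B A := h _ _

/-- Data of order `k` extend to data of infinite order which satisfy the part of the transverse
constraint not involving the given fields only. -/
theorem IsIMData.exists_extension (hd : d ≠ 0) (hσI : ∀ x, σ x ∈ I) {D : IMData d S} (hD : IsIMData I σ k D) :
    ∃ D' : IMData d S, IsIMData I σ ⊤ D' ∧ SameIMData I k D' D ∧
      (TransverseConstraint k D → TransverseConstraint ⊤ D') := by
  classical
  have hk0 : ((0 : ℕ) : ℕ∞) ≤ k := by simp
  have hpos0 : ∀ (x : S) (v : TangentSpace 𝓘(ℝ, Vec d) x), v ≠ 0 → 0 < D.gS 0 x v v :=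
    fun x v hv => by rw [hD.gS_zero]; exact hD.pos_gN _ (hσI x) x v hv
  -- Missing orders are filled recursively by multiples of `g`. The factor `2 / d` solves `½ tr (g⁻¹
  -- (c g)) = t`, that is `½ c d = t`, where `t` is the value of the constraint with the top field
  -- set to zero. Order one occurs in no constraint as top order and is set to zero if it is not
  -- given.
  obtain ⟨g, hg⟩ := exists_seq (α := (x : S) → Bilin d x) (fun n f =>
    if (n : ℕ∞) ≤ k then D.gS n else if n < 2 then fun _ => 0 else
      fun x => (2 / d * transverse (fun j => gram (f j x)) (n - 2)) • D.gS 0 x) (fun _ => 0)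
  set f : ℕ → ℕ → (x : S) → Bilin d x := fun n j => if j < n then g j else fun _ => 0 with hf
  have hgk : ∀ n : ℕ, (n : ℕ∞) ≤ k → g n = D.gS n := fun n hn => by rw [hg, if_pos hn]
  have hfin : ∀ n, (∀ j < n, SmoothBilin univ (fun _ => g j) ∧
      ∀ (x : S) (v w : TangentSpace 𝓘(ℝ, Vec d) x), g j x v w = g j x w v) → ∀ j,
      SmoothBilin univ (fun _ => f n j) ∧
        ∀ (x : S) (v w : TangentSpace 𝓘(ℝ, Vec d) x), f n j x v w = f n j x w v := by
    intro n h j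
    by_cases hj : j < n
    · have : f n j = g j := by simp only [hf, if_pos hj]
      rw [this]
      exact h j hj
    · have : f n j = fun _ => 0 := by simp only [hf, if_neg hj]
      rw [this]
      exact ⟨fun e he A B => contDiffOn_const, fun x v w => rfl⟩
  have hf0 : ∀ n, 0 < n → f n 0 = D.gS 0 := fun n hn => by
    simp only [hf, if_pos hn]
    exact hgk 0 hk0
  have hsm : ∀ n, SmoothBilin univ (fun _ => g n) ∧
      ∀ (x : S) (v w : TangentSpace 𝓘(ℝ, Vec d) x), g n x v w = g n x w v := by
    intro n
    induction n using Nat.strong_induction_on with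
    | _ n ih =>
      by_cases hn : (n : ℕ∞) ≤ k
      · rw [hgk n hn]
        exact ⟨hD.smooth_gS n hn, hD.symm_gS n hn⟩
      rw [hg, if_neg hn]
      by_cases hn2 : n < 2
      · rw [if_pos hn2]
        exact ⟨fun e he A B => contDiffOn_const, fun x v w => rfl⟩
      rw [if_neg hn2]
      have h1 := hfin n ih
      refine ⟨fun e he A B => ?_, fun x v w => ?_⟩
      · have h2 := contDiffOn_transverse (fun j => (h1 j).1) (fun j => (h1 j).2)
          (fun x v hv => by rw [hf0 n (by omega)]; exact hpos0 x v hv) (n - 2) he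
        exact (contDiffOn_const.mul (h2.comp contDiff_snd.contDiffOn fun p hp => hp.2)).mul
          (hD.smooth_gS 0 hk0 e he A B)
      · exact congrArg (_ * ·) (hD.symm_gS 0 hk0 x v w)
  -- Comparison with the sequence whose term of order `i + 2` is zero: the chosen trace cancels
  -- exactly the value of the constraint there.
  have hcon : ∀ i : ℕ, ¬ ((i + 2 : ℕ) : ℕ∞) ≤ k → ∀ x, transverse (fun j => gram (g j x)) i = 0 := by
    intro i hi x
    have hdet : (gram (D.gS 0 x)).det ≠ 0 := det_gram_ne_zero (hpos0 x)
    have h1 := transverse_add (G := fun j => gram (g j x)) (G' := fun j => gram (f (i + 2) j x))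
      (i := i) (fun j => gram_symm ((hsm j).2 x))
      (fun j => gram_symm ((hfin (i + 2) (fun j _ => hsm j) j).2 x))
      (by simp only [hgk 0 hk0]; exact hdet) (fun j hj => by simp only [hf, if_pos hj])
    have h2 : gram (f (i + 2) (i + 2) x) = 0 := by
      simp only [hf, lt_irrefl, if_false]
      rfl
    have h3 : g (i + 2) x = (2 / d * transverse (fun j => gram (f (i + 2) j x)) i) • D.gS 0 x := by
      have := congrFun (hg (i + 2)) x
      rw [if_neg hi, if_neg (by omega)] at this
      exact this
    simp only [h2, h3, hgk 0 hk0, gram_smul, Matrix.mul_smul, Matrix.mul_zero, Matrix.trace_zero,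
      Matrix.nonsing_inv_mul _ (isUnit_iff_ne_zero.mpr hdet), Matrix.trace_smul, Matrix.trace_one,
      Fintype.card_fin, smul_eq_mul] at h1
    have hd' : (d : ℝ) ≠ 0 := Nat.cast_ne_zero.mpr hd
    generalize transverse (fun j => gram (f (i + 2) j x)) i = t at h1
    field_simp at h1
    linarith
  refine ⟨⟨g, fun x => D.αN (σ x) x, if 1 ≤ k then D.βS else fun _ => 0, D.gN, D.αN⟩,
    { smooth_gN := hD.smooth_gN
      smooth_αN := hD.smooth_αN
      symm_gN := hD.symm_gN
      pos_gN := hD.pos_gN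
      smooth_gS := fun j _ => (hsm j).1
      symm_gS := fun j _ => (hsm j).2
      smooth_βS := fun _ => ?_
      gS_zero := fun x => (congrFun (hgk 0 hk0) x).trans (hD.gS_zero x)
      αS_eq := fun _ _ => rfl
      raychaudhuri_eq := hD.raychaudhuri_eq }, ⟨fun j hj x => congrFun (hgk j hj) x, fun hk x =>
      ⟨(hD.αS_eq hk x).symm, by simp only [if_pos hk]⟩, fun r _ x => ⟨rfl, rfl⟩⟩, fun hc i _ x => ?_⟩
  · by_cases hk : 1 ≤ k
    · simp only [if_pos hk]
      exact hD.smooth_βS hk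
    · simp only [if_neg hk]
      exact fun e he A => contDiffOn_const
  · by_cases hi : ((i + 2 : ℕ) : ℕ∞) ≤ k
    · refine (transverse_congr fun j hj => ?_).trans (hc i hi x)
      exact congrArg gram (congrFun (hgk j ((Nat.cast_le.mpr hj).trans hi)) x)
    · exact hcon i hi x

omit [IsManifold 𝓘(ℝ, Vec d) ∞ S] in
lemma TransverseConstraint.congr {D D' : IMData d S} (h : TransverseConstraint k D)
    (hD : ∀ j : ℕ, (j : ℕ∞) ≤ k → ∀ x, D.gS j x = D'.gS j x) : TransverseConstraint k D' :=
  fun i hi x => (transverse_congr fun j hj => by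
    rw [hD j ((Nat.cast_le.mpr hj).trans hi) x]).trans (h i hi x)

/-! ### Existence -/

variable (hI : I.OrdConnected) (hI' : I.Nontrivial)

-- Raychaudhuri and the transverse constraint provide the initial conditions for the propagation by
-- the Bianchi identities.
include hI hI' in
lemma isFormalVacuum_of_solves (hσI : ∀ x, σ x ∈ I) {J : IMJet d S} (hJ : IsJet I J)
    (hs : ∀ e ∈ atlas (Vec d) S, ∀ n, CoordJet.Solves (chartPatch hI hI' e) Λ n (J.inChart e))
    (hrr : ∀ r ∈ I, ∀ x, raychaudhuri I (fun r' => gram (J.g 0 r' x)) (J.α 0 r x) r = 0)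
    (huu : TransverseConstraint ⊤ (J.restrict σ)) : IsFormalVacuum I Λ J := by
  refine ⟨hJ, fun e he i μ ν r hr y hy => ?_⟩
  refine (hJ.isSmooth hI hI' he).einstein_eq_zero (hs e he) (σ := fun y => σ (e.symm y))
    (fun y _ => hσI _) (fun z hz => ?_) (fun i y hy => ?_) i μ ν (z := (r, y)) ⟨hr, hy⟩
  · exact (hJ.einstein_rr_eq hI hI' he Λ hz.1 hz.2).trans (hrr z.1 hz.1 _)
  · exact (hJ.einstein_uu_eq hI hI' he Λ i (hσI _) hy).trans (huu i le_top _)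

-- Reduction to infinite order. In one direction, the extension satisfies the constraint to all
-- orders if the data do, so the jet constructed is a full formal solution. In the other, vacuum
-- data restrict to constrained data, whatever the extension.
include hI hI' in
theorem exists_jet_of_isIMData (hd : d ≠ 0) (hσ : ContMDiff 𝓘(ℝ, Vec d) 𝓘(ℝ, ℝ) ∞ σ)
    (hσI : ∀ x, σ x ∈ I) (Λ : ℝ) {D : IMData d S} (hD : IsIMData I σ k D) :
    ∃ J : IMJet d S, IsJet I J ∧ SameIMData I k (J.restrict σ) D ∧ SolvesHierarchy I Λ k J ∧
      (IsVacuumData I Λ k J ↔ TransverseConstraint k D) := by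
  obtain ⟨D', hD', hsame, hc⟩ := hD.exists_extension hd hσI
  obtain ⟨J, hJ, hJD, hs⟩ := exists_jet hI hI' hσ hσI Λ hD'
  have hgS : ∀ j : ℕ, (j : ℕ∞) ≤ k → ∀ x, (J.restrict σ).gS j x = D.gS j x := fun j hj x =>
    (hJD.1 j le_top x).trans (hsame.1 j hj x)
  refine ⟨J, hJ, ⟨hgS, fun hk x => ⟨((hJD.2.1 le_top x).1).trans (hsame.2.1 hk x).1,
    ((hJD.2.1 le_top x).2).trans (hsame.2.1 hk x).2⟩, fun r hr x =>
    ⟨((hJD.2.2 r hr x).1).trans (hsame.2.2 r hr x).1, ((hJD.2.2 r hr x).2).trans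
      (hsame.2.2 r hr x).2⟩⟩, (solvesHierarchy_iff hI hI').mpr fun _ e he n _ => hs e he n,
    fun hv => (hv.transverseConstraint hI hI' hσI).congr hgS, fun h => ?_⟩
  refine ⟨hJ, J, isFormalVacuum_of_solves hI hI' hσI hJ hs (fun r hr x => ?_)
    ((hc h).congr fun j _ x => (hJD.1 j le_top x).symm), fun j _ r _ x => ⟨rfl, rfl, fun _ => rfl⟩⟩
  rw [← hD'.raychaudhuri_eq r hr x, ← (hJD.2.2 r hr x).2]
  refine raychaudhuri_congr (fun r' hr' => ?_) hr
  rw [← (hJD.2.2 r' hr' x).1]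
  rfl

end

end IsenbergMoncrief
end

/-! ### The proposition -/

open IsenbergMoncrief in
theorem proposition4p1 (d : ℕ) (hd : 2 ≤ d)
    (S : Type*) [TopologicalSpace S] [ChartedSpace (Vec d) S] [IsManifold 𝓘(ℝ, Vec d) ∞ S]
    (I : Set ℝ) (hI : I.OrdConnected) (hI' : I.Nontrivial)
    (σ : S → ℝ) (hσ : ContMDiff 𝓘(ℝ, Vec d) 𝓘(ℝ, ℝ) ∞ σ) (hσI : ∀ x, σ x ∈ I)
    (Λ : ℝ) (k : ℕ∞) :
    -- the transverse derivatives of `κ = Γ^r_{rr}` are those of `α`, up to the factors displayed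
    (∀ J : IMJet d S, IsJet I J → ∀ e ∈ atlas (Vec d) S, ∀ i : ℕ, ∀ r ∈ I, ∀ y ∈ e.target,
      (J.inChart e).kappa I e.target i r y = (i + 1) * J.α i r (e.symm y)) ∧
    -- vacuum data induce Isenberg–Moncrief data, and solve the transport and algebraic equations
    (∀ J : IMJet d S, IsVacuumData I Λ k J →
      IsIMData I σ k (J.restrict σ) ∧ TransverseConstraint k (J.restrict σ) ∧
      SolvesHierarchy I Λ k J) ∧
    -- the Isenberg–Moncrief data determine all transverse derivatives up to order `k` uniquely
    (∀ J J' : IMJet d S, IsJet I J → IsJet I J' →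
      SolvesHierarchy I Λ k J → SolvesHierarchy I Λ k J' →
      SameIMData I k (J.restrict σ) (J'.restrict σ) → SameData I k J J') ∧
    -- all Isenberg–Moncrief data arise in this way, from vacuum data precisely when the transverse
    -- constraint holds at the cross-section
    (∀ D : IMData d S, IsIMData I σ k D →
      ∃ J : IMJet d S, IsJet I J ∧ SameIMData I k (J.restrict σ) D ∧ SolvesHierarchy I Λ k J ∧
        (IsVacuumData I Λ k J ↔ TransverseConstraint k D)) ∧
    -- the equations used are linear transport equations along the generators for `β_A` and
    -- `∂_u^{i+1} g_{AB}`, and linear algebraic equations for `∂_u^{i+1} α` and `∂_u^{i+1} β_A`, with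
    -- sources determined by the fields already known
    ∀ e ∈ atlas (Vec d) S,
      (∃ F : IMJet d S → ℝ → Vec d → Fin d → ℝ,
        (∀ J J', IsJet I J → IsJet I J' →
          (∀ r ∈ I, ∀ x, J.g 0 r x = J'.g 0 r x ∧ J.α 0 r x = J'.α 0 r x) →
          ∀ r ∈ I, ∀ y ∈ e.target, F J r y = F J' r y) ∧
        ∀ J, IsJet I J → ∀ r ∈ I, ∀ y ∈ e.target, ∀ A,
          let C := J.inChart e
          let X := (C.g 0 r y)⁻¹ * entryDeriv I (fun r' => C.g 0 r' y) r
          C.einstein I e.target Λ 0 ir (ix A) r y =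
            (1 / 2) * derivWithin (fun r' => C.β 0 r' y A) I r
              + (1 / 4) * X.trace * C.β 0 r y A + F J r y A) ∧
      ∀ i : ℕ,
        (∃ F : IMJet d S → ℝ → Vec d → Matrix (Fin d) (Fin d) ℝ,
          (∀ J J', IsJet I J → IsJet I J' → AgreeUpTo I i J J' →
            ∀ r ∈ I, ∀ y ∈ e.target, F J r y = F J' r y) ∧
          ∀ J, IsJet I J → ∀ r ∈ I, ∀ y ∈ e.target, ∀ A B,
            let C := J.inChart e
            let G' := entryDeriv I (fun r' => C.g 0 r' y) r
            let X := (C.g 0 r y)⁻¹ * G'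
            let H := C.g (i + 1) r y
            C.einstein I e.target Λ i (ix A) (ix B) r y =
              derivWithin (fun r' => C.g (i + 1) r' y A B) I r
                + (i + 1) * C.α 0 r y * H A B
                - (1 / 2) * ((H * X) A B + (H * X) B A)
                + (1 / 4) * (X.trace * H A B + ((C.g 0 r y)⁻¹ * H).trace * G' A B)
                + F J r y A B) ∧
        (∃ F : IMJet d S → ℝ → Vec d → ℝ,
          (∀ J J', IsJet I J → IsJet I J' → AgreeUpTo I i J J' →
            (∀ r ∈ I, ∀ x, J.g (i + 1) r x = J'.g (i + 1) r x) →
            ∀ r ∈ I, ∀ y ∈ e.target, F J r y = F J' r y) ∧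
          ∀ J, IsJet I J → ∀ r ∈ I, ∀ y ∈ e.target,
            (J.inChart e).einstein I e.target Λ i iu ir r y =
              -(i + 2) * (J.inChart e).α (i + 1) r y + F J r y) ∧
        (∃ F : IMJet d S → ℝ → Vec d → Fin d → ℝ,
          (∀ J J', IsJet I J → IsJet I J' → AgreeUpTo I i J J' →
            (∀ r ∈ I, ∀ x, J.g (i + 1) r x = J'.g (i + 1) r x) →
            ∀ r ∈ I, ∀ y ∈ e.target, F J r y = F J' r y) ∧
          ∀ J, IsJet I J → ∀ r ∈ I, ∀ y ∈ e.target, ∀ A,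
            (J.inChart e).einstein I e.target Λ i iu (ix A) r y =
              -((i + 2) / 2) * (J.inChart e).β (i + 1) r y A + F J r y A) := by
  refine ⟨fun J hJ e he i r hr y hy => (hJ.isSmooth hI hI' he).kappa_eq i (z := (r, y)) ⟨hr, hy⟩,
    fun J hJ => ⟨hJ.isIMData hI hI' hσ hσI, hJ.transverseConstraint hI hI' hσI,
      hJ.solvesHierarchy hI hI'⟩,
    fun J J' hJ hJ' hs hs' h => sameData_of_sameIMData hI hI' hσI hJ hJ' hs hs' h,
    fun D hD => exists_jet_of_isIMData hI hI' (by omega) hσ hσI Λ hD, fun e he => ⟨?_, fun i =>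
    ⟨?_, ?_, ?_⟩⟩⟩
  -- In all four equations the source is defined as the Einstein expression minus its principal
  -- part. The content is that it depends only on the fields already known, which is the comparison
  -- of two jets.
  · refine ⟨fun J r y A => (J.inChart e).einstein I e.target Λ 0 ir (ix A) r y
      - (J.inChart e).transportβ I ((J.inChart e).β 0) r y A, fun J J' hJ hJ' h r hr y hy => ?_,
      fun J hJ r hr y hy A => ?_⟩
    · funext A
      exact (hJ.isSmooth hI hI' he).einstein_rx_sub (hJ'.isSmooth hI hI' he) Λ (z := (r, y))
        (fun z hz => by simp only [IMJet.inChart, (h z.1 hz.1 _).1])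
        (fun z hz => by simp only [IMJet.inChart, (h z.1 hz.1 _).2]) ⟨hr, hy⟩ A
    · simp only [CoordJet.transportβ]
      ring
  · refine ⟨fun J r y => Matrix.of fun A B => (J.inChart e).einstein I e.target Λ i (ix A) (ix B) r y
      - (J.inChart e).transport I i ((J.inChart e).g (i + 1)) r y A B,
      fun J J' hJ hJ' h r hr y hy => ?_, fun J hJ r hr y hy A B => ?_⟩
    · ext A B
      exact (hJ.isSmooth hI hI' he).einstein_xx_sub (hJ'.isSmooth hI hI' he) Λ (z := (r, y))
        (h.agreeOn hI hI' e) ⟨hr, hy⟩ A B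
    · simp only [CoordJet.transport, Matrix.of_apply]
      ring
  · refine ⟨fun J r y => (J.inChart e).einstein I e.target Λ i iu ir r y
      + (i + 2) * (J.inChart e).α (i + 1) r y, fun J J' hJ hJ' h hg r hr y hy => ?_,
      fun J hJ r hr y hy => by ring⟩
    exact (hJ.isSmooth hI hI' he).einstein_ur_sub (hJ'.isSmooth hI hI' he) Λ (z := (r, y))
      (h.agreeOn hI hI' e) (fun z hz => by simp only [IMJet.inChart, hg z.1 hz.1]) ⟨hr, hy⟩
  · refine ⟨fun J r y A => (J.inChart e).einstein I e.target Λ i iu (ix A) r y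
      + (i + 2) / 2 * (J.inChart e).β (i + 1) r y A, fun J J' hJ hJ' h hg r hr y hy => ?_,
      fun J hJ r hr y hy A => by ring⟩
    funext A
    exact (hJ.isSmooth hI hI' he).einstein_ux_sub (hJ'.isSmooth hI hI' he) Λ (z := (r, y))
      (h.agreeOn hI hI' e) (fun z hz => by simp only [IMJet.inChart, hg z.1 hz.1]) ⟨hr, hy⟩ A
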